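/- **Conventions.** A DG category $\mathcal C$ has Hom-complexes of abelian groups and finite direct sums (a zero object and closed degree-$0$ binary direct sums). A *$\mathcal C$-module* is a DG functor from $\mathcal C$ to complexes of abelian groups; $D(\mathcal C^{op})$ denotes the localization of the category of $\mathcal C$-modules (with closed degree-$0$ transformations) at the quasi-isomorphisms. A *pseudo-tensor structure* on $\mathcal C$ gives for every finite nonempty (enumerated) family $\{X_i\}_{i\in I}$ and every $Y$ a complex $P_I(\{X_i\},Y)^*$ and for every surjection $\pi:J\to I$ of finite nonempty sets, with fibres $J_i=\pi^{-1}(i)$, a composition map of complexes $$P_I(\{Y_i\},Z)^*\otimes\bigotimes_{i\in I}P_{J_i}(\{X_j\}_{j\in J_i},Y_i)^*\to P_J(\{X_j\},Z)^*,\qquad f\otimes(g_i)\mapsto f(g_i),$$ which is associative (with the Koszul sign of the permutation of the factors), with $P_{\{1\}}(\{X\},Y)^*=\mathrm{Hom}_{\mathcal C}(X,Y)^*$ compatibly with composition, and with the identities as units. It is *representable* if for every family there are an object $\bigotimes_{i\in I}X_i$ and an isomorphism $\lambda:P_I(\{X_i\},-)^*\cong\mathrm{Hom}_{\mathcal C}(\bigotimes_iX_i,-)^*$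 in $D(\mathcal C^{op})$ (for one-element families, the object itself and the identity). For $\pi:J\twoheadrightarrow I$ the composition of the elements $\lambda^{-1}(\mathrm{id})$ defines $\epsilon_\pi:\bigotimes_{j\in J}X_j\to\bigotimes_{i\in I}\bigotimes_{j\in J_i}X_j$ in $H^0\mathcal C$, and similarly one has $f\otimes f'$ for morphisms $f,f'$ of $H^0\mathcal C$ and the commutativity map $\tau:X\otimes Y\to Y\otimes X$. A representable pseudo-tensor structure *gives a tensor structure on $H^0\mathcal C$* if all $\epsilon_\pi$ are isomorphisms. The DG category $\text{Pre-Tr}(\mathcal C)$ has as objects $\mathcal E=\{E_i,e_{ij}\}$ with finitely many objects $E_i$ ($N\le i\le M$; put $E_i=0$ otherwise) and $e_{ij}:E_j\to E_i$ of degree $j-i+1$ with $(-1)^ide_{ij}+\sum_ke_{ik}e_{kj}=0$; morphisms of degree $n$ are families $\phi_{ij}:E_j\to F_i$ of degree $n+j-i$, composed as matrices, with $$(\partial\phi)_{ij}=(-1)^id\phi_{ij}+\sum_kf_{ik}\phi_{kj}-(-1)^n\sum_k\phi_{ik}e_{kj}.$$ Put $\mathcal E[n]_i=E_{n+i}$,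 $e[n]_{ij}=(-1)^ne_{n+i,n+j}$, and for a closed $\psi:\mathcal E\to\mathcal F$ of degree $0$ let $\mathrm{Cone}(\psi)_i=F_i\oplus E_{i+1}$ with the matrix $\begin{pmatrix}f_{ij}&\psi_{i,j+1}\\0&e[1]_{ij}\end{pmatrix}$. Let $\mathcal C^{\mathrm{pretr}}\subset\text{Pre-Tr}(\mathcal C)$ be the smallest full subcategory containing the objects $\{E_0=X,\ e_{00}=0\}$, $X\in\mathcal C$, and closed under translations and cones, and $K^b_{dg}(\mathcal C)=H^0\mathcal C^{\mathrm{pretr}}$, with translation $[1]$ and with distinguished triangles those isomorphic to the image of a cone sequence $\mathcal E\xrightarrow{\psi}\mathcal F\to\mathrm{Cone}(\psi)\to\mathcal E[1]$. Let $P$ be a pseudo-tensor structure on $\mathcal C$. For $\mathcal E^1,\dots,\mathcal E^m,\mathcal F$ in $\mathcal C^{\mathrm{pretr}}$ put $$P^{\mathrm{pretr}}(\{\mathcal E^i\},\mathcal F)^n=\bigoplus_{k,j_1,\dots,j_m}P(\{E^i_{j_i}\},F_k)^{n-k+\sum_ij_i},$$ $$(\partial\phi)_{k,\{j_i\}}=(-1)^kd\phi_{k,\{j_i\}}+\sum_lf_{kl}(\phi_{l,\{j_i\}})-(-1)^n\sum_{i}\sum_l(-1)^{s(i,j,l)}\phi_{k,(j_1,\dots,l,\dots,j_m)}(\mathrm{id},\dots,e^i_{l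 j_i},\dots,\mathrm{id}),$$ with $l$ and $e^i_{lj_i}$ in the $i$-th place and $s(i,j,l)=\sum_{a<i}j_a+(j_i-l+1)\sum_{a>i}j_a$; and for a surjection $\pi:J\to I$ of enumerated sets, $\phi$ and $\psi^i$ of degrees $n$ and $n_i$, $$(\phi(\psi^i))_{k,\{t_b\}_{b\in J}}=\sum_{\{j_i\}}(-1)^{S}\phi_{k,\{j_i\}}\bigl(\psi^i_{j_i,\{t_b\}_{b\in J_i}}\bigr),$$ $$S=\sum_p\sum_{i<p}\bigl(j_p(n_i-j_i+K_i)+K_in_p\bigr)+\sum_{a<b,\ \pi(b)<\pi(a)}t_at_b,\qquad K_i=\sum_{b\in J_i}t_b .$$ **Theorem.** Let $\mathcal C$ be a DG category and $P$ a pseudo-tensor structure on $\mathcal C$ which is representable and gives a tensor structure on $H^0\mathcal C$. Then: 1. $P^{\mathrm{pretr}}$ is a pseudo-tensor structure on $\mathcal C^{\mathrm{pretr}}$, and it is representable. 2. For every choice of representing objects and isomorphisms, $P^{\mathrm{pretr}}$ gives a tensor structure on $K^b_{dg}(\mathcal C)$: all $\epsilon_\pi$ are isomorphisms, and the induced $f\otimes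 f'$, together with the associativity constraint $X\otimes(Y\otimes Z)\xleftarrow{\epsilon}X\otimes Y\otimes Z\xrightarrow{\epsilon}(X\otimes Y)\otimes Z$ and the commutativity constraint $\tau$, form a biadditive bifunctor with natural constraints satisfying $\tau^2=\mathrm{id}$ and the pentagon and hexagon axioms. 3. This tensor structure makes $K^b_{dg}(\mathcal C)$ tensor triangulated: there are natural isomorphisms $X[1]\otimes Y\cong(X\otimes Y)[1]$ and $X\otimes Y[1]\cong(X\otimes Y)[1]$, exchanged by the commutativity constraints, such that for every distinguished triangle $A\to B\to C\to A[1]$ and every $X$ the triangles $A\otimes X\to B\otimes X\to C\otimes X\to(A\otimes X)[1]$ and $X\otimes A\to X\otimes B\to X\otimes C\to(X\otimes A)[1]$ are distinguished. -/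

import Mathlib

open CategoryTheory

universe u v

set_option linter.checkUnivs false

namespace DGTensor

/-! ### Complexes of abelian groups and their cohomology -/

/-- A `ℤ`-graded abelian group with an operator `d` of degree one.
The target degree is a separate argument, to avoid transports along equalities of degrees. -/
structure PreCx where
  X : ℤ → Type v
  [grp : ∀ n, AddCommGroup (X n)]
  d : ∀ a b : ℤ, a + 1 = b → X a →+ X b

attribute [instance] PreCx.grp

/-- A (cochain) complex of abelian groups. -/
structure Cx extends PreCx.{v} where
  d_d : ∀ (a b c : ℤ) (h : a + 1 = b) (h' : b + 1 = c) (x : X a), d b c h' (d a b h x) = 0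

/-- Transport along an equality of degrees. -/
def PreCx.cast (K : PreCx.{v}) {a b : ℤ} (h : a = b) : K.X a →+ K.X b :=
  h ▸ AddMonoidHom.id (K.X a)

@[simp] lemma PreCx.cast_rfl (K : PreCx.{v}) {a : ℤ} (h : a = a) (x : K.X a) :
    K.cast h x = x := rfl

lemma PreCx.d_cast (K : PreCx.{v}) {a a' b : ℤ} (h : a = a') (h' : a' + 1 = b) (x : K.X a) :
    K.d a' b h' (K.cast h x) = K.d a b (by omega) x := by
  subst h; rfl

lemma PreCx.cast_d (K : PreCx.{v}) {a b b' : ℤ} (h : b = b') (h' : a + 1 = b) (x : K.X a) :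
    K.cast h (K.d a b h' x) = K.d a b' (by omega) x := by
  subst h; rfl

/-- Cocycles of degree `n`. -/
def Cx.Z (K : Cx.{v}) (n : ℤ) : AddSubgroup (K.X n) := (K.d n (n + 1) rfl).ker

/-- Coboundaries of degree `n`. -/
def Cx.B (K : Cx.{v}) (n : ℤ) : AddSubgroup (K.X n) := (K.d (n - 1) n (by omega)).range

/-- The cohomology group `Hⁿ K = Zⁿ K / Bⁿ K`. -/
abbrev Cx.H (K : Cx.{v}) (n : ℤ) : Type v := K.Z n ⧸ (K.B n).addSubgroupOf (K.Z n)

/-- The class of a cocycle. -/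
def Cx.cls (K : Cx.{v}) {n : ℤ} (x : K.X n) (hx : K.d n (n + 1) rfl x = 0) : K.H n :=
  QuotientAddGroup.mk ⟨x, hx⟩

/-- A chosen cocycle representing a cohomology class. -/
noncomputable def Cx.rep (K : Cx.{v}) {n : ℤ} (x : K.H n) : K.X n := (Quotient.out x).1

lemma Cx.d_rep (K : Cx.{v}) {n m : ℤ} (h : n + 1 = m) (x : K.H n) : K.d n m h (K.rep x) = 0 := by
  subst h; exact (Quotient.out x).2

lemma Cx.cls_rep (K : Cx.{v}) {n : ℤ} (x : K.H n) : K.cls (K.rep x) (K.d_rep _ x) = x :=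
  Quotient.out_eq x

lemma Cx.cls_eq (K : Cx.{v}) {n m : ℤ} (x y : K.X n) (hx : K.d n (n + 1) rfl x = 0)
    (hy : K.d n (n + 1) rfl y = 0) (h : m + 1 = n) (z : K.X m) (hz : K.d m n h z = x - y) :
    K.cls x hx = K.cls y hy := by
  obtain rfl : m = n - 1 := by omega
  refine (QuotientAddGroup.eq).2 ⟨-z, ?_⟩
  rw [map_neg, hz]
  change -(x - y) = -x + y
  abel

lemma Cx.exists_of_cls_eq (K : Cx.{v}) {n m : ℤ} {x y : K.X n} {hx : K.d n (n + 1) rfl x = 0}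
    {hy : K.d n (n + 1) rfl y = 0} (h : m + 1 = n) (e : K.cls x hx = K.cls y hy) :
    ∃ z : K.X m, K.d m n h z = x - y := by
  obtain rfl : m = n - 1 := by omega
  obtain ⟨z, hz⟩ := (QuotientAddGroup.eq).1 e
  refine ⟨-z, ?_⟩
  have hz' : K.d (n - 1) n h z = -x + y := hz
  rw [map_neg, hz']
  abel

lemma Cx.cls_add (K : Cx.{v}) {n : ℤ} (x y : K.X n) (hx : K.d n (n + 1) rfl x = 0)
    (hy : K.d n (n + 1) rfl y = 0) :
    K.cls (x + y) (by rw [map_add, hx, hy, add_zero]) = K.cls x hx + K.cls y hy := rfl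

/-- A degree zero map of complexes. -/
@[ext]
structure CxHom (K L : Cx.{v}) where
  f : ∀ n, K.X n →+ L.X n
  comm : ∀ (a b : ℤ) (h : a + 1 = b) (x : K.X a), f b (K.d a b h x) = L.d a b h (f a x)

/-- The map on cohomology induced by a map of complexes. -/
def CxHom.H {K L : Cx.{v}} (φ : CxHom K L) (n : ℤ) : K.H n →+ L.H n :=
  QuotientAddGroup.map _ _
    (((φ.f n).comp (K.Z n).subtype).codRestrict (L.Z n) fun x => by
      change L.d n (n + 1) rfl (φ.f n x.1) = 0
      rw [← φ.comm]
      have : K.d n (n + 1) rfl x.1 = 0 := x.2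
      rw [this, map_zero])
    (by
      rintro x ⟨y, hy⟩
      exact ⟨φ.f _ y, by rw [← φ.comm, hy]; rfl⟩)

lemma CxHom.H_cls {K L : Cx.{v}} (φ : CxHom K L) {n : ℤ} (x : K.X n)
    (hx : K.d n (n + 1) rfl x = 0) :
    φ.H n (K.cls x hx) = L.cls (φ.f n x) (by rw [← φ.comm, hx, map_zero]) := rfl

lemma CxHom.H_bijective {K L : Cx.{v}} (φ : CxHom K L) (h : ∀ n, Function.Bijective (φ.f n))
    (n : ℤ) : Function.Bijective (φ.H n) := by
  constructor
  · rw [injective_iff_map_eq_zero]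
    rintro ⟨x, hx⟩ hx'
    obtain ⟨z, hz⟩ := L.exists_of_cls_eq (hx := by rw [← φ.comm, hx, map_zero])
      (hy := map_zero _) (m := n - 1) (by omega) (show L.cls (φ.f n x) _ = L.cls 0 _ from hx')
    obtain ⟨w, rfl⟩ := (h (n - 1)).2 z
    refine K.cls_eq x 0 hx (map_zero _) (m := n - 1) (by omega) w ((h n).1 ?_)
    rw [φ.comm, hz]; simp
  · rintro ⟨y, hy⟩
    obtain ⟨x, rfl⟩ := (h n).2 y
    refine ⟨K.cls x ((h (n + 1)).1 ?_), rfl⟩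
    rw [φ.comm, map_zero]; exact hy

/-! ### DG categories -/

/-- A pre-DG category: Hom-complexes, with an associative and unital composition satisfying the
Leibniz rule. -/
structure PreDG where
  Obj : Type u
  hom : Obj → Obj → Cx.{v}
  id : ∀ X, (hom X X).X 0
  comp : ∀ {X Y Z : Obj} {a b c : ℤ}, a + b = c →
    (hom Y Z).X a →+ (hom X Y).X b →+ (hom X Z).X c
  d_id : ∀ X, (hom X X).d 0 1 rfl (id X) = 0
  leibniz : ∀ {X Y Z : Obj} {a b c a' b' c' : ℤ} (h : a + b = c) (ha : a + 1 = a')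
    (hb : b + 1 = b') (hc : c + 1 = c') (f : (hom Y Z).X a) (g : (hom X Y).X b),
    (hom X Z).d c c' hc (comp h f g) =
      comp (by omega) ((hom Y Z).d a a' ha f) g +
        a.negOnePow • comp (by omega) f ((hom X Y).d b b' hb g)
  assoc : ∀ {W X Y Z : Obj} {a b c ab bc abc : ℤ} (h₁ : a + b = ab) (h₂ : ab + c = abc)
    (h₃ : b + c = bc) (h₄ : a + bc = abc)
    (f : (hom Y Z).X a) (g : (hom X Y).X b) (k : (hom W X).X c),
    comp h₂ (comp h₁ f g) k = comp h₄ f (comp h₃ g k)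
  id_comp : ∀ {X Y : Obj} {a : ℤ} (h : 0 + a = a) (f : (hom X Y).X a), comp h (id Y) f = f
  comp_id : ∀ {X Y : Obj} {a : ℤ} (h : a + 0 = a) (f : (hom X Y).X a), comp h f (id X) = f

/-- A DG category: a pre-DG category with finite direct sums, i.e. with a zero object and binary
direct sums (whose inclusions and projections are closed of degree zero). -/
structure DGCat extends PreDG.{u, v} where
  zero : Obj
  id_zero : id zero = 0
  sum : Obj → Obj → Obj
  inl : ∀ X Y, (hom X (sum X Y)).X 0
  inr : ∀ X Y, (hom Y (sum X Y)).X 0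
  fst : ∀ X Y, (hom (sum X Y) X).X 0
  snd : ∀ X Y, (hom (sum X Y) Y).X 0
  d_inl : ∀ X Y, (hom X (sum X Y)).d 0 1 rfl (inl X Y) = 0
  d_inr : ∀ X Y, (hom Y (sum X Y)).d 0 1 rfl (inr X Y) = 0
  d_fst : ∀ X Y, (hom (sum X Y) X).d 0 1 rfl (fst X Y) = 0
  d_snd : ∀ X Y, (hom (sum X Y) Y).d 0 1 rfl (snd X Y) = 0
  fst_inl : ∀ X Y, comp (add_zero 0) (fst X Y) (inl X Y) = id X
  snd_inr : ∀ X Y, comp (add_zero 0) (snd X Y) (inr X Y) = id Y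
  snd_inl : ∀ X Y, comp (add_zero 0) (snd X Y) (inl X Y) = 0
  fst_inr : ∀ X Y, comp (add_zero 0) (fst X Y) (inr X Y) = 0
  total : ∀ X Y, comp (add_zero 0) (inl X Y) (fst X Y) + comp (add_zero 0) (inr X Y) (snd X Y) =
    id (sum X Y)

/-- The full DG subcategory on the objects satisfying `p`. -/
def PreDG.full (C : PreDG.{u, v}) (p : C.Obj → Prop) : PreDG.{u, v} where
  Obj := { X : C.Obj // p X }
  hom X Y := C.hom X.1 Y.1
  id X := C.id X.1
  comp h := C.comp h
  d_id X := C.d_id X.1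
  leibniz := C.leibniz
  assoc := C.assoc
  id_comp := C.id_comp
  comp_id := C.comp_id

section

variable (C : PreDG.{u, v})

/-- The objects of the homotopy category `H⁰ C`. -/
structure Ho (C : PreDG.{u, v}) where
  as : C.Obj

variable {C}

lemma PreDG.d_comp_zero {X Y Z : C.Obj} {a b c : ℤ} (h : a + b = c) (f : (C.hom Y Z).X a)
    (g : (C.hom X Y).X b) (hf : (C.hom Y Z).d a (a + 1) rfl f = 0)
    (hg : (C.hom X Y).d b (b + 1) rfl g = 0) :
    (C.hom X Z).d c (c + 1) rfl (C.comp h f g) = 0 := by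
  rw [C.leibniz h rfl rfl, hf, hg]; simp

/-- Composition in `H⁰ C`: composition of representing closed morphisms of degree zero. -/
def Ho.compHom {X Y Z : C.Obj} : (C.hom Y Z).H 0 →+ (C.hom X Y).H 0 →+ (C.hom X Z).H 0 :=
  QuotientAddGroup.lift _
    (AddMonoidHom.mk' (fun f => QuotientAddGroup.lift _
        (AddMonoidHom.mk' (fun g => (C.hom X Z).cls (C.comp (add_zero 0) f.1 g.1)
            (PreDG.d_comp_zero _ _ _ f.2 g.2))
          (fun g g' => by
            rw [← Cx.cls_add]; congr 1; exact map_add _ _ _))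
        (by
          rintro g ⟨z, hz⟩
          refine (C.hom X Z).cls_eq (m := -1) _ 0 _ (map_zero _) rfl
            (C.comp (by omega) f.1 (z : (C.hom X Y).X (-1))) ?_
          have hf : (C.hom Y Z).d 0 1 rfl f.1 = 0 := f.2
          have hz' : (C.hom X Y).d (-1) 0 rfl z = g.1 := hz
          rw [C.leibniz _ (show (0 : ℤ) + 1 = 1 by rfl) (show (-1 : ℤ) + 1 = 0 by rfl), hf, hz']
          simp))
      (fun f f' => by
        ext g
        change Cx.cls _ _ _ = Cx.cls _ _ _ + Cx.cls _ _ _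
        rw [← Cx.cls_add]; congr 1; simp))
    (by
      rintro f ⟨z, hz⟩
      ext g
      refine (C.hom X Z).cls_eq (m := -1) _ 0 _ (map_zero _) rfl
            (C.comp (by omega) (z : (C.hom Y Z).X (-1)) g.1) ?_
      have hg : (C.hom X Y).d 0 1 rfl g.1 = 0 := g.2
      have hz' : (C.hom Y Z).d (-1) 0 rfl z = f.1 := hz
      rw [C.leibniz _ (show (-1 : ℤ) + 1 = 0 by rfl) (show (0 : ℤ) + 1 = 1 by rfl), hg, hz']
      simp)

lemma Ho.compHom_cls {X Y Z : C.Obj} (f : (C.hom Y Z).X 0) (g : (C.hom X Y).X 0)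
    (hf : (C.hom Y Z).d 0 1 rfl f = 0) (hg : (C.hom X Y).d 0 1 rfl g = 0) :
    Ho.compHom ((C.hom Y Z).cls f hf) ((C.hom X Y).cls g hg) =
      (C.hom X Z).cls (C.comp (add_zero 0) f g) (PreDG.d_comp_zero _ _ _ hf hg) := rfl

instance : Category (Ho C) where
  Hom X Y := (C.hom X.as Y.as).H 0
  id X := (C.hom X.as X.as).cls (C.id X.as) (C.d_id _)
  comp f g := Ho.compHom g f
  id_comp := by
    rintro X Y ⟨f⟩
    exact congrArg _ (Subtype.ext (C.comp_id _ _))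
  comp_id := by
    rintro X Y ⟨f⟩
    exact congrArg _ (Subtype.ext (C.id_comp _ _))
  assoc := by
    rintro W X Y Z ⟨f⟩ ⟨g⟩ ⟨k⟩
    exact congrArg _ (Subtype.ext (C.assoc (add_zero 0) (add_zero 0) (add_zero 0) (add_zero 0)
      k.1 g.1 f.1).symm)

instance (X Y : Ho C) : AddCommGroup (X ⟶ Y) :=
  inferInstanceAs (AddCommGroup ((C.hom X.as Y.as).H 0))

instance : Preadditive (Ho C) where
  add_comp X Y Z f f' g := map_add (Ho.compHom g) f f'
  comp_add X Y Z f g g' := by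
    change Ho.compHom (g + g') f = Ho.compHom g f + Ho.compHom g' f
    rw [map_add]; rfl

/-- The morphism in `H⁰ C` given by a closed morphism of degree zero. -/
def Ho.ofClosed {X Y : C.Obj} (f : (C.hom X Y).X 0) (hf : (C.hom X Y).d 0 1 rfl f = 0) :
    (⟨X⟩ : Ho C) ⟶ ⟨Y⟩ :=
  (C.hom X Y).cls f hf

end

/-! ### DG modules and the derived category -/

/-- A `C`-module: a DG functor from `C` to complexes of abelian groups. -/
structure DGMod (C : PreDG.{u, v}) where
  obj : C.Obj → Cx.{v}
  act : ∀ {X Y : C.Obj} {a b c : ℤ}, a + b = c → (C.hom X Y).X a →+ (obj X).X b →+ (obj Y).X c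
  leibniz : ∀ {X Y : C.Obj} {a b c a' b' c' : ℤ} (h : a + b = c) (ha : a + 1 = a')
    (hb : b + 1 = b') (hc : c + 1 = c') (f : (C.hom X Y).X a) (x : (obj X).X b),
    (obj Y).d c c' hc (act h f x) =
      act (by omega) ((C.hom X Y).d a a' ha f) x +
        a.negOnePow • act (by omega) f ((obj X).d b b' hb x)
  comp_act : ∀ {X Y Z : C.Obj} {a b c ab bc abc : ℤ} (h₁ : a + b = ab) (h₂ : ab + c = abc)
    (h₃ : b + c = bc) (h₄ : a + bc = abc)
    (f : (C.hom Y Z).X a) (g : (C.hom X Y).X b) (x : (obj X).X c),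
    act h₂ (C.comp h₁ f g) x = act h₄ f (act h₃ g x)
  id_act : ∀ {X : C.Obj} {a : ℤ} (h : 0 + a = a) (x : (obj X).X a), act h (C.id X) x = x

/-- A closed natural transformation of degree zero between `C`-modules. -/
@[ext]
structure DGMod.Hom {C : PreDG.{u, v}} (M N : DGMod C) where
  app : ∀ X, CxHom (M.obj X) (N.obj X)
  natural : ∀ {X Y : C.Obj} {a b c : ℤ} (h : a + b = c) (f : (C.hom X Y).X a) (x : (M.obj X).X b),
    (app Y).f c (M.act h f x) = N.act h f ((app X).f b x)

instance (C : PreDG.{u, v}) : Category (DGMod C) where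
  Hom := DGMod.Hom
  id M := ⟨fun _ => ⟨fun _ => AddMonoidHom.id _, fun _ _ _ _ => rfl⟩, fun _ _ _ => rfl⟩
  comp φ ψ := ⟨fun X => ⟨fun n => ((ψ.app X).f n).comp ((φ.app X).f n), fun a b h x => by
      simp only [AddMonoidHom.comp_apply, CxHom.comm]⟩, fun h f x => by
      simp only [AddMonoidHom.comp_apply, DGMod.Hom.natural]⟩

/-- Quasi-isomorphisms of `C`-modules. -/
def DGMod.quasiIso (C : PreDG.{u, v}) : MorphismProperty (DGMod C) := fun _ _ φ =>
  ∀ X n, Function.Bijective ((φ.app X).H n)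

/-- The derived category of `C`-modules (that is, `D(Cᵒᵖ)` if modules over a DG category are
taken to be contravariant): the localization of the category of `C`-modules and closed degree zero
natural transformations at the quasi-isomorphisms.  Homotopy equivalences are inverted by this
localization, hence it is also the localization of the homotopy category. -/
abbrev DerCat (C : PreDG.{u, v}) := (DGMod.quasiIso C).Localization

/-- The functor `M ↦ H⁰(M(Y))` on `C`-modules. -/
def DGMod.H0 (C : PreDG.{u, v}) (Y : C.Obj) : DGMod C ⥤ AddCommGrpCat.{v} where
  obj M := AddCommGrpCat.of ((M.obj Y).H 0)
  map φ := AddCommGrpCat.ofHom ((φ.app Y).H 0)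
  map_id M := by
    ext ⟨x⟩; rfl
  map_comp φ ψ := by
    ext ⟨x⟩; rfl

/-- The functor `M ↦ H⁰(M(Y))` on the derived category. -/
noncomputable def DerCat.H0 (C : PreDG.{u, v}) (Y : C.Obj) : DerCat C ⥤ AddCommGrpCat.{v} :=
  Localization.Construction.lift (DGMod.H0 C Y) (fun _ _ φ hφ => by
    rw [ConcreteCategory.isIso_iff_bijective]
    exact hφ Y 0)

/-- The corepresentable module `Hom(T, _)`. -/
def DGMod.corep {C : PreDG.{u, v}} (T : C.Obj) : DGMod C where
  obj Y := C.hom T Y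
  act h := C.comp h
  leibniz := C.leibniz
  comp_act := C.assoc
  id_act := C.id_comp

/-! ### Pseudo-tensor structures -/

/-- A surjection `{0, …, m} → {0, …, n}`, together with the order preserving enumeration
`emb i : {0, …, k i} → {0, …, m}` of its fibre over each `i`. -/
structure FinSurj (m n : ℕ) (k : Fin (n + 1) → ℕ) where
  map : Fin (m + 1) → Fin (n + 1)
  emb : ∀ i, Fin (k i + 1) → Fin (m + 1)
  strictMono : ∀ i, StrictMono (emb i)
  range_emb : ∀ i, Set.range (emb i) = map ⁻¹' {i}

/-- The surjection onto a point. -/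
abbrev FinSurj.toOne (m : ℕ) : FinSurj m 0 (fun _ => m) where
  map _ := 0
  emb _ a := a
  strictMono _ := strictMono_id
  range_emb i := by
    ext x
    have : i = 0 := Fin.ext (by omega)
    simp [this]

/-- The identity map. -/
abbrev FinSurj.refl (n : ℕ) : FinSurj n n (fun _ => 0) where
  map i := i
  emb i _ := i
  strictMono _ a b h := absurd h (by simp only [Fin.lt_def]; omega)
  range_emb i := by
    ext x; simp [eq_comm]

lemma FinSurj.sum_fibres {m n : ℕ} {k : Fin (n + 1) → ℕ} (π : FinSurj m n k)
    {A : Type*} [AddCommMonoid A] (t : Fin (m + 1) → A) :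
    ∑ i, ∑ a, t (π.emb i a) = ∑ b, t b := by
  rw [← Fintype.sum_sigma' (fun i a => t (π.emb i a))]
  have key : ∀ i a, π.map (π.emb i a) = i := fun i a => by
    have : π.emb i a ∈ π.map ⁻¹' {i} := π.range_emb i ▸ ⟨a, rfl⟩
    exact this
  refine Fintype.sum_bijective (fun x : Σ i, Fin (k i + 1) => π.emb x.1 x.2) ⟨?_, ?_⟩ _ _
    (fun _ => rfl)
  · rintro ⟨i, a⟩ ⟨j, b⟩ h
    have hij : i = j := by rw [← key i a, ← key j b]; exact congrArg π.map h
    subst hij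
    have hab : a = b := (π.strictMono i).injective h
    rw [hab]
  · intro b
    have : b ∈ Set.range (π.emb (π.map b)) := by rw [π.range_emb]; rfl
    obtain ⟨a, ha⟩ := this
    exact ⟨⟨_, a⟩, ha⟩

/-- The data of a pseudo-tensor structure on `C`.  Finite non-empty index sets are always enumerated
as `{0, …, n}`, so `P n X Y` stands for the complex `P_I({X_i}, Y)` with `|I| = n + 1`.
The map `comp π f g` is the composition `f(g_i)` along a surjection `π : J → I`; the families `X' i`
are the restrictions of the family `X` to the fibres of `π`.
The map `one` identifies `Hom(X, Y)` with `P({X}, Y)`. -/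
structure PTData (C : PreDG.{u, v}) where
  P : ∀ n : ℕ, (Fin (n + 1) → C.Obj) → C.Obj → PreCx.{v}
  one : ∀ {X : Fin 1 → C.Obj} {Y : C.Obj} {a : ℤ}, (C.hom (X 0) Y).X a →+ (P 0 X Y).X a
  comp : ∀ {m n : ℕ} {k : Fin (n + 1) → ℕ} (π : FinSurj m n k) {X : Fin (m + 1) → C.Obj}
    {X' : ∀ i, Fin (k i + 1) → C.Obj} (_ : ∀ i a, X' i a = X (π.emb i a))
    {Y : Fin (n + 1) → C.Obj} {Z : C.Obj} {p r : ℤ} {q : Fin (n + 1) → ℤ} (_ : p + ∑ i, q i = r),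
    (P n Y Z).X p → (∀ i, (P (k i) (X' i) (Y i)).X (q i)) → (P m X Z).X r

/-- The exponent of the Koszul sign of the permutation
`f, g₀, (h_j)_{π j = 0}, g₁, (h_j)_{π j = 1}, … ↦ f, g₀, g₁, …, h₀, h₁, …`,
where `g_i` has degree `q i` and `h_j` has degree `t j`. If `π` is monotone, the second sum is
zero. -/
def koszul {m n : ℕ} (π : Fin (m + 1) → Fin (n + 1)) (q : Fin (n + 1) → ℤ) (t : Fin (m + 1) → ℤ) :
    ℤ :=
  (∑ i, ∑ j with π j < i, t j * q i) + ∑ b, ∑ a with a < b ∧ π b < π a, t a * t b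

namespace PTData

variable {C : PreDG.{u, v}} (D : PTData C)

/-- The differential in the `i`-th slot: `g_j` is replaced by `∂ g_j` if `j = i` and is unchanged
otherwise. -/
def dAt {n : ℕ} {k : Fin (n + 1) → ℕ} {X : ∀ i, Fin (k i + 1) → C.Obj} {Y : Fin (n + 1) → C.Obj}
    {q : Fin (n + 1) → ℤ} (g : ∀ i, (D.P (k i) (X i) (Y i)).X (q i)) (i j : Fin (n + 1)) :
    (D.P (k j) (X j) (Y j)).X (q j + if j = i then 1 else 0) :=
  if h : j = i then (D.P (k j) (X j) (Y j)).d _ _ (by simp [h]) (g j)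
  else (D.P (k j) (X j) (Y j)).cast (by simp [h]) (g j)

lemma comp_cast {m n : ℕ} {k : Fin (n + 1) → ℕ} (π : FinSurj m n k) {X : Fin (m + 1) → C.Obj}
    {X' : ∀ i, Fin (k i + 1) → C.Obj} (hX : ∀ i a, X' i a = X (π.emb i a))
    {Y : Fin (n + 1) → C.Obj} {Z : C.Obj} {p r : ℤ} {q q' : Fin (n + 1) → ℤ} (h : p + ∑ i, q i = r)
    (hq : ∀ i, q i = q' i) (h' : p + ∑ i, q' i = r)
    (f : (D.P n Y Z).X p) (g : ∀ i, (D.P (k i) (X' i) (Y i)).X (q i)) :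
    D.comp π hX h' f (fun i => (D.P (k i) (X' i) (Y i)).cast (hq i) (g i)) = D.comp π hX h f g := by
  obtain rfl : q = q' := funext hq
  rfl

/-- The axioms of a pseudo-tensor structure. -/
structure Lawful : Prop where
  d_d : ∀ {n : ℕ} {X : Fin (n + 1) → C.Obj} {Y : C.Obj} (a b c : ℤ) (h : a + 1 = b)
    (h' : b + 1 = c) (x : (D.P n X Y).X a), (D.P n X Y).d b c h' ((D.P n X Y).d a b h x) = 0
  /- `Hom(X, Y)` and `P({X}, Y)` are isomorphic complexes, compatibly with compositions -/
  one_bijective : ∀ {X : Fin 1 → C.Obj} {Y : C.Obj} {a : ℤ},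
    Function.Bijective (D.one : (C.hom (X 0) Y).X a → (D.P 0 X Y).X a)
  one_d : ∀ {X : Fin 1 → C.Obj} {Y : C.Obj} {a b : ℤ} (h : a + 1 = b) (f : (C.hom (X 0) Y).X a),
    D.one ((C.hom (X 0) Y).d a b h f) = (D.P 0 X Y).d a b h (D.one f)
  one_comp : ∀ {X : Fin 1 → C.Obj} {Y : Fin 1 → C.Obj} {Z : C.Obj} {a b c : ℤ} (h : a + b = c)
    (f : (C.hom (Y 0) Z).X a) (g : ∀ i : Fin 1, (C.hom (X 0) (Y i)).X b),
    D.one (X := X) (C.comp h f (g 0)) =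
      D.comp (FinSurj.toOne 0) (X' := fun _ => X) (fun _ _ => rfl) (q := fun _ => b) (by simpa)
        (D.one f) (fun i => D.one (g i))
  /- composition is multi-additive -/
  comp_add_left : ∀ {m n : ℕ} {k : Fin (n + 1) → ℕ} (π : FinSurj m n k) {X : Fin (m + 1) → C.Obj}
    {X' : ∀ i, Fin (k i + 1) → C.Obj} (hX : ∀ i a, X' i a = X (π.emb i a))
    {Y : Fin (n + 1) → C.Obj} {Z : C.Obj} {p r : ℤ} {q : Fin (n + 1) → ℤ} (h : p + ∑ i, q i = r)
    (f f' : (D.P n Y Z).X p) (g : ∀ i, (D.P (k i) (X' i) (Y i)).X (q i)),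
    D.comp π hX h (f + f') g = D.comp π hX h f g + D.comp π hX h f' g
  comp_add_right : ∀ {m n : ℕ} {k : Fin (n + 1) → ℕ} (π : FinSurj m n k) {X : Fin (m + 1) → C.Obj}
    {X' : ∀ i, Fin (k i + 1) → C.Obj} (hX : ∀ i a, X' i a = X (π.emb i a))
    {Y : Fin (n + 1) → C.Obj} {Z : C.Obj} {p r : ℤ} {q : Fin (n + 1) → ℤ} (h : p + ∑ i, q i = r)
    (f : (D.P n Y Z).X p) (g : ∀ i, (D.P (k i) (X' i) (Y i)).X (q i)) (i : Fin (n + 1))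
    (x y : (D.P (k i) (X' i) (Y i)).X (q i)),
    D.comp π hX h f (Function.update g i (x + y)) =
      D.comp π hX h f (Function.update g i x) + D.comp π hX h f (Function.update g i y)
  /- composition is a map of complexes -/
  leibniz : ∀ {m n : ℕ} {k : Fin (n + 1) → ℕ} (π : FinSurj m n k) {X : Fin (m + 1) → C.Obj}
    {X' : ∀ i, Fin (k i + 1) → C.Obj} (hX : ∀ i a, X' i a = X (π.emb i a))
    {Y : Fin (n + 1) → C.Obj} {Z : C.Obj} {p r p' r' : ℤ} {q : Fin (n + 1) → ℤ}
    (h : p + ∑ i, q i = r) (hp : p + 1 = p') (hr : r + 1 = r')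
    (f : (D.P n Y Z).X p) (g : ∀ i, (D.P (k i) (X' i) (Y i)).X (q i)),
    (D.P m X Z).d r r' hr (D.comp π hX h f g) =
      D.comp π hX (by omega) ((D.P n Y Z).d p p' hp f) g +
        ∑ i, (p + ∑ j with j < i, q j).negOnePow •
          D.comp π hX (by rw [Finset.sum_add_distrib]; simp; omega) f (D.dAt g i)
  /- composition is associative -/
  assoc : ∀ {l m n : ℕ} {k : Fin (n + 1) → ℕ} {k' : Fin (m + 1) → ℕ} {s : Fin (n + 1) → ℕ}
    (π : FinSurj m n k) (ρ : FinSurj l m k') (σ : FinSurj l n s)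
    (τ : ∀ i, FinSurj (s i) (k i) (fun a => k' (π.emb i a)))
    (hτ : ∀ i a b, σ.emb i ((τ i).emb a b) = ρ.emb (π.emb i a) b)
    {W : Fin (l + 1) → C.Obj} {X : Fin (m + 1) → C.Obj} {Y : Fin (n + 1) → C.Obj} {Z : C.Obj}
    {p r N : ℤ} {q u : Fin (n + 1) → ℤ} {t : Fin (m + 1) → ℤ}
    (h₁ : p + ∑ i, q i = r) (h₂ : r + ∑ j, t j = N)
    (h₃ : ∀ i, q i + ∑ a, t (π.emb i a) = u i) (h₄ : p + ∑ i, u i = N)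
    (f : (D.P n Y Z).X p) (g : ∀ i, (D.P (k i) (fun a => X (π.emb i a)) (Y i)).X (q i))
    (h : ∀ j, (D.P (k' j) (fun b => W (ρ.emb j b)) (X j)).X (t j)),
    D.comp σ (X := W) (X' := fun i c => W (σ.emb i c)) (fun _ _ => rfl) h₄ f
        (fun i => D.comp (τ i) (fun a b => by rw [hτ]) (h₃ i) (g i) (fun a => h (π.emb i a))) =
      (koszul π.map q t).negOnePow •
        D.comp ρ (fun _ _ => rfl) h₂ (D.comp π (fun _ _ => rfl) h₁ f g) h
  /- the identities are units -/
  id_comp : ∀ {n : ℕ} {X : Fin (n + 1) → C.Obj} {Y : C.Obj} {a : ℤ} (f : (D.P n X Y).X a),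
    D.comp (FinSurj.toOne n) (X' := fun _ => X) (Y := fun _ => Y) (fun _ _ => rfl)
      (q := fun _ => a) (by simp) (D.one (C.id Y)) (fun _ => f) = f
  comp_id : ∀ {n : ℕ} {X : Fin (n + 1) → C.Obj} {Y : C.Obj} {a : ℤ} (f : (D.P n X Y).X a),
    D.comp (FinSurj.refl n) (X' := fun i _ => X i) (fun _ _ => rfl) (q := fun _ => 0) (by simp) f
      (fun i => D.one (C.id (X i))) = f

/-- The composition of a morphism `f : Y → Z` with an element of `P({X_i}, Y)`. -/
def act {n : ℕ} {X : Fin (n + 1) → C.Obj} {Y Z : C.Obj} {a b c : ℤ} (h : a + b = c)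
    (f : (C.hom Y Z).X a) (x : (D.P n X Y).X b) : (D.P n X Z).X c :=
  D.comp (FinSurj.toOne n) (X' := fun _ => X) (Y := fun _ => Y) (fun _ _ => rfl)
    (q := fun _ => b) (by simpa) (D.one f) (fun _ => x)

end PTData

/-- A pseudo-tensor structure on `C`. -/
structure PT (C : PreDG.{u, v}) extends PTData C where
  lawful : toPTData.Lawful

namespace PT

variable {C : PreDG.{u, v}} (D : PT C)

/-- The complex `P({X_i}, Y)`. -/
def cx (n : ℕ) (X : Fin (n + 1) → C.Obj) (Y : C.Obj) : Cx.{v} where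
  toPreCx := D.P n X Y
  d_d := D.lawful.d_d

lemma act_add_left {n : ℕ} {X : Fin (n + 1) → C.Obj} {Y Z : C.Obj} {a b c : ℤ} (h : a + b = c)
    (f f' : (C.hom Y Z).X a) (x : (D.P n X Y).X b) :
    D.act h (f + f') x = D.act h f x + D.act h f' x := by
  unfold PTData.act; rw [map_add, D.lawful.comp_add_left]

lemma act_add_right {n : ℕ} {X : Fin (n + 1) → C.Obj} {Y Z : C.Obj} {a b c : ℤ} (h : a + b = c)
    (f : (C.hom Y Z).X a) (x x' : (D.P n X Y).X b) :
    D.act h f (x + x') = D.act h f x + D.act h f x' := by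
  have := D.lawful.comp_add_right (FinSurj.toOne n) (X' := fun _ => X) (X := X) (Y := fun _ => Y)
    (fun _ _ => rfl) (p := a) (r := c) (q := fun _ => b) (by simpa) (D.one f) (fun _ => 0) 0 x x'
  have e : ∀ y : (D.P n X Y).X b, Function.update (fun _ : Fin 1 => (0 : (D.P n X Y).X b)) 0 y =
      fun _ => y := fun y => by
    funext i; rw [Subsingleton.elim i 0, Function.update_self]
  erw [e, e, e] at this
  exact this

lemma d_act {n : ℕ} {X : Fin (n + 1) → C.Obj} {Y Z : C.Obj} {a b c a' b' c' : ℤ} (h : a + b = c)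
    (ha : a + 1 = a') (hb : b + 1 = b') (hc : c + 1 = c') (f : (C.hom Y Z).X a)
    (x : (D.P n X Y).X b) :
    (D.P n X Z).d c c' hc (D.act h f x) =
      D.act (by omega) ((C.hom Y Z).d a a' ha f) x +
        a.negOnePow • D.act (by omega) f ((D.P n X Y).d b b' hb x) := by
  unfold PTData.act
  rw [D.lawful.leibniz _ _ _ ha, D.lawful.one_d]
  subst hb
  congr 1
  refine (Fin.sum_univ_one _).trans ?_
  have key := D.comp_cast (FinSurj.toOne n) (X := X) (X' := fun _ => X) (fun _ _ => rfl)
    (Y := fun _ => Y) (p := a) (r := c') (q' := fun _ => b + 1) (by simp; omega)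
    (fun i => by simp [Fin.ext_iff]) (by simp; omega) (D.one f)
    (D.dAt (q := fun _ => b) (X := fun _ => X) (Y := fun _ => Y) (fun _ => x) 0)
  refine (congrArg _ key.symm).trans ?_
  have e : (a + ∑ j : Fin (0 + 1) with j < 0, b) = a := by simp
  rw [e]
  congr 2
  funext i
  have : i = 0 := Fin.ext (by omega)
  subst this
  simp only [PTData.dAt, dif_pos]
  rw [PreCx.cast_d]

lemma comp_act {n : ℕ} {W : Fin (n + 1) → C.Obj} {X Y Z : C.Obj} {a b c ab bc abc : ℤ}
    (h₁ : a + b = ab) (h₂ : ab + c = abc) (h₃ : b + c = bc) (h₄ : a + bc = abc)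
    (f : (C.hom Y Z).X a) (g : (C.hom X Y).X b) (x : (D.P n W X).X c) :
    D.act h₂ (C.comp h₁ f g) x = D.act h₄ f (D.act h₃ g x) := by
  have := D.lawful.assoc (FinSurj.toOne 0) (FinSurj.toOne n) (FinSurj.toOne n)
    (fun _ => FinSurj.toOne n) (fun _ _ _ => rfl) (W := W) (X := fun _ => X) (Y := fun _ => Y)
    (q := fun _ => b) (t := fun _ => c) (u := fun _ => bc) (p := a) (r := ab) (N := abc)
    (by simpa) (by simpa) (by simpa) (by simpa) (D.one f) (fun _ => D.one g) (fun _ => x)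
  unfold PTData.act
  have e := D.lawful.one_comp (X := fun _ => X) (Y := fun _ => Y) h₁ f (fun _ => g)
  rw [e]
  rw [show koszul (FinSurj.toOne 0).map (fun _ => b) (fun _ => c) = 0 by simp [koszul]] at this
  simp only [Int.negOnePow_zero, one_smul] at this
  exact this.symm

/-- The `C`-module `P({X_i}, _)`. -/
def mod (n : ℕ) (X : Fin (n + 1) → C.Obj) : DGMod C where
  obj Y := D.cx n X Y
  act h := AddMonoidHom.mk' (fun f => AddMonoidHom.mk' (fun x => D.act h f x)
    (D.act_add_right h f)) (fun f f' => by ext x; exact D.act_add_left h f f' x)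
  leibniz := D.d_act
  comp_act := D.comp_act
  id_act := fun h x => D.lawful.id_comp x

/-- The morphism of modules `Hom(X, _) → P({X}, _)`. -/
def oneHom (X : Fin 1 → C.Obj) : DGMod.corep (X 0) ⟶ D.mod 0 X where
  app _ := ⟨fun _ => D.one, fun _ _ h f => D.lawful.one_d h f⟩
  natural h f x := D.lawful.one_comp (Y := fun _ => _) h f (fun _ => x)

lemma oneHom_quasiIso (X : Fin 1 → C.Obj) : DGMod.quasiIso C (D.oneHom X) :=
  fun _ _ => CxHom.H_bijective _ (fun _ => D.lawful.one_bijective) _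

end PT

/-! ### Representability and the induced tensor structure -/

namespace PT

variable {C : PreDG.{u, v}} (D : PT C)

lemma comp_zero_left {m n : ℕ} {k : Fin (n + 1) → ℕ} (π : FinSurj m n k)
    {X : Fin (m + 1) → C.Obj} {X' : ∀ i, Fin (k i + 1) → C.Obj}
    (hX : ∀ i a, X' i a = X (π.emb i a)) {Y : Fin (n + 1) → C.Obj} {Z : C.Obj} {p r : ℤ}
    {q : Fin (n + 1) → ℤ} (h : p + ∑ i, q i = r) (g : ∀ i, (D.P (k i) (X' i) (Y i)).X (q i)) :
    D.comp π hX h (0 : (D.P n Y Z).X p) g = 0 := by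
  simpa using D.lawful.comp_add_left π hX h (0 : (D.P n Y Z).X p) 0 g

lemma comp_zero_right {m n : ℕ} {k : Fin (n + 1) → ℕ} (π : FinSurj m n k)
    {X : Fin (m + 1) → C.Obj} {X' : ∀ i, Fin (k i + 1) → C.Obj}
    (hX : ∀ i a, X' i a = X (π.emb i a)) {Y : Fin (n + 1) → C.Obj} {Z : C.Obj} {p r : ℤ}
    {q : Fin (n + 1) → ℤ} (h : p + ∑ i, q i = r) (f : (D.P n Y Z).X p)
    (g : ∀ i, (D.P (k i) (X' i) (Y i)).X (q i)) (i : Fin (n + 1)) (hi : g i = 0) :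
    D.comp π hX h f g = 0 := by
  have := D.lawful.comp_add_right π hX h f g i 0 0
  rw [add_zero, ← hi, Function.update_eq_self] at this
  simpa using this

lemma d_comp_zero {m n : ℕ} {k : Fin (n + 1) → ℕ} (π : FinSurj m n k)
    {X : Fin (m + 1) → C.Obj} {X' : ∀ i, Fin (k i + 1) → C.Obj}
    (hX : ∀ i a, X' i a = X (π.emb i a)) {Y : Fin (n + 1) → C.Obj} {Z : C.Obj} {p r : ℤ}
    {q : Fin (n + 1) → ℤ} (h : p + ∑ i, q i = r) (f : (D.P n Y Z).X p)
    (g : ∀ i, (D.P (k i) (X' i) (Y i)).X (q i))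
    (hf : (D.P n Y Z).d p (p + 1) rfl f = 0)
    (hg : ∀ i, (D.P (k i) (X' i) (Y i)).d (q i) (q i + 1) rfl (g i) = 0) :
    (D.P m X Z).d r (r + 1) rfl (D.comp π hX h f g) = 0 := by
  rw [D.lawful.leibniz π hX h rfl rfl, hf, D.comp_zero_left, zero_add]
  refine Finset.sum_eq_zero fun i _ => ?_
  rw [D.comp_zero_right _ _ _ _ _ i, smul_zero]
  have := congrArg ((D.P (k i) (X' i) (Y i)).cast
    (show q i + 1 = q i + if i = i then 1 else 0 by simp)) (hg i)
  rw [PreCx.cast_d, map_zero] at this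
  rw [PTData.dAt, dif_pos rfl]
  exact this

/-- The composition of the pseudo-tensor structure `H⁰ P` on `H⁰ C`: composition of
representing cocycles.  By the Leibniz rule and multi-additivity, the class does not depend on the
choice of the representing cocycles. -/
noncomputable def compH0 {m n : ℕ} {k : Fin (n + 1) → ℕ} (π : FinSurj m n k)
    {X : Fin (m + 1) → C.Obj} {X' : ∀ i, Fin (k i + 1) → C.Obj}
    (hX : ∀ i a, X' i a = X (π.emb i a)) {Y : Fin (n + 1) → C.Obj} {Z : C.Obj}
    (f : (D.cx n Y Z).H 0) (g : ∀ i, (D.cx (k i) (X' i) (Y i)).H 0) : (D.cx m X Z).H 0 :=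
  (D.cx m X Z).cls
    (D.comp π hX (q := fun _ => 0) (by simp) ((D.cx n Y Z).rep f)
      (fun i => (D.cx (k i) (X' i) (Y i)).rep (g i)))
    (D.d_comp_zero π hX _ _ _ ((D.cx n Y Z).d_rep _ f)
      (fun i => (D.cx (k i) (X' i) (Y i)).d_rep _ (g i)))

/-- The element of `H⁰ P({X}, Y)` given by a morphism `X ⟶ Y` of `H⁰ C`. -/
def oneH0 (X : Fin 1 → C.Obj) (Y : C.Obj) :
    ((⟨X 0⟩ : Ho C) ⟶ ⟨Y⟩) →+ (D.cx 0 X Y).H 0 :=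
  ((D.oneHom X).app Y).H 0

/-- A representation of a pseudo-tensor structure: for every finite non-empty family `X` an object
`⨂ X_i` and an isomorphism `λ_X : P(X, _) ≅ Hom(⨂ X_i, _)` in the derived category.  For families
with one member, the object is that member, and `λ` is the canonical isomorphism. -/
structure Rep where
  obj : ∀ n : ℕ, (Fin (n + 2) → C.Obj) → C.Obj
  iso : ∀ (n : ℕ) (X : Fin (n + 2) → C.Obj),
    (DGMod.quasiIso C).Q.obj (D.mod (n + 1) X) ≅ (DGMod.quasiIso C).Q.obj (DGMod.corep (obj n X))

namespace Rep

variable {D} (R : D.Rep)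

/-- The object `⨂ X_i`. -/
def T : ∀ n : ℕ, (Fin (n + 1) → C.Obj) → C.Obj
  | 0, X => X 0
  | n + 1, X => R.obj n X

/-- The isomorphism `λ_X : P(X, _) ≅ Hom(⨂ X_i, _)` in the derived category. -/
noncomputable def lambda : ∀ (n : ℕ) (X : Fin (n + 1) → C.Obj),
    (DGMod.quasiIso C).Q.obj (D.mod n X) ≅ (DGMod.quasiIso C).Q.obj (DGMod.corep (R.T n X))
  | 0, X => (Localization.Construction.wIso (D.oneHom X) (D.oneHom_quasiIso X)).symm
  | n + 1, X => R.iso n X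

/-- The isomorphism `H⁰ P(X, Y) ≃ Hom_{H⁰ C}(⨂ X_i, Y)` induced by `λ_X`. -/
noncomputable def lambdaH0 (n : ℕ) (X : Fin (n + 1) → C.Obj) (Y : C.Obj) :
    (D.cx n X Y).H 0 ≃+ ((⟨R.T n X⟩ : Ho C) ⟶ ⟨Y⟩) :=
  ((DerCat.H0 C Y).mapIso (R.lambda n X)).addCommGroupIsoToAddEquiv

/-- The universal element of `H⁰ P(X, ⨂ X_i)`, corresponding to the identity of `⨂ X_i`. -/
noncomputable def univ (n : ℕ) (X : Fin (n + 1) → C.Obj) : (D.cx n X (R.T n X)).H 0 :=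
  (R.lambdaH0 n X (R.T n X)).symm (𝟙 _)

/-- The morphism `⨂_J X_j ⟶ ⨂_I Y_i` induced by a surjection `π : J → I` and elements
`g_i ∈ H⁰ P({X_j}_{π j = i}, Y_i)`. -/
noncomputable def lift {m n : ℕ} {k : Fin (n + 1) → ℕ} (π : FinSurj m n k)
    {X : Fin (m + 1) → C.Obj} {X' : ∀ i, Fin (k i + 1) → C.Obj}
    (hX : ∀ i a, X' i a = X (π.emb i a)) {Y : Fin (n + 1) → C.Obj}
    (g : ∀ i, (D.cx (k i) (X' i) (Y i)).H 0) : (⟨R.T m X⟩ : Ho C) ⟶ ⟨R.T n Y⟩ :=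
  R.lambdaH0 m X (R.T n Y) (D.compH0 π hX (R.univ n Y) g)

/-- The morphism `ε_π : ⨂_J X_j ⟶ ⨂_I (⨂_{π j = i} X_j)` of `H⁰ C`. -/
noncomputable def eps {m n : ℕ} {k : Fin (n + 1) → ℕ} (π : FinSurj m n k)
    (X : Fin (m + 1) → C.Obj) :
    (⟨R.T m X⟩ : Ho C) ⟶ ⟨R.T n (fun i => R.T (k i) (fun a => X (π.emb i a)))⟩ :=
  R.lift π (X' := fun i a => X (π.emb i a)) (fun _ _ => rfl) (fun _ => R.univ _ _)

/-- A representable pseudo-tensor structure is a tensor structure on `H⁰ C` if all the `ε_π` are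
isomorphisms. -/
def IsTensor : Prop :=
  ∀ {m n : ℕ} {k : Fin (n + 1) → ℕ} (π : FinSurj m n k) (X : Fin (m + 1) → C.Obj), IsIso (R.eps π X)

/-- The tensor product of two objects of `H⁰ C`. -/
def tensor (X Y : Ho C) : Ho C := ⟨R.T 1 ![X.as, Y.as]⟩

/-- The tensor product of two morphisms of `H⁰ C`. -/
noncomputable def tensorHom {X Y X' Y' : Ho C} (f : X ⟶ Y) (f' : X' ⟶ Y') :
    R.tensor X X' ⟶ R.tensor Y Y' :=
  R.lift (FinSurj.refl 1) (X := ![X.as, X'.as]) (X' := fun i _ => ![X.as, X'.as] i)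
    (Y := ![Y.as, Y'.as]) (fun _ _ => rfl) (fun
      | 0 => D.oneH0 (fun _ => X.as) Y.as f
      | 1 => D.oneH0 (fun _ => X'.as) Y'.as f')

/-- The transposition of a two element set. -/
abbrev swap : FinSurj 1 1 (fun _ => 0) where
  map := ![1, 0]
  emb i _ := ![1, 0] i
  strictMono _ a b h := absurd h (by simp only [Fin.lt_def]; omega)
  range_emb i := by ext x; fin_cases i <;> fin_cases x <;> simp

/-- The commutativity constraint. -/
noncomputable def tau (X Y : Ho C) : R.tensor X Y ⟶ R.tensor Y X :=
  R.lift swap (X := ![X.as, Y.as]) (X' := fun i _ => ![Y.as, X.as] i) (Y := ![Y.as, X.as])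
    (fun i _ => by fin_cases i <;> rfl) (fun
      | 0 => D.oneH0 (fun _ => Y.as) Y.as (𝟙 _)
      | 1 => D.oneH0 (fun _ => X.as) X.as (𝟙 _))

/-- The surjection `0 ↦ 0, 1 ↦ 1, 2 ↦ 1`. -/
abbrev surj₀₁₁ : FinSurj 2 1 ![0, 1] where
  map := ![0, 1, 1]
  emb
    | 0 => fun _ => 0
    | 1 => fun (a : Fin 2) => a.succ
  strictMono
    | 0 => fun (a b : Fin 1) h => absurd (Subsingleton.elim a b) (ne_of_lt h)
    | 1 => fun (_ _ : Fin 2) h => Fin.succ_lt_succ_iff.2 h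
  range_emb i := by
    ext x; fin_cases i <;> fin_cases x <;> simp

/-- The surjection `0 ↦ 0, 1 ↦ 0, 2 ↦ 1`. -/
abbrev surj₀₀₁ : FinSurj 2 1 ![1, 0] where
  map := ![0, 0, 1]
  emb
    | 0 => fun (a : Fin 2) => a.castSucc
    | 1 => fun _ => 2
  strictMono
    | 0 => fun (_ _ : Fin 2) h => Fin.castSucc_lt_castSucc_iff.2 h
    | 1 => fun (a b : Fin 1) h => absurd (Subsingleton.elim a b) (ne_of_lt h)
  range_emb i := by
    ext x; fin_cases i <;> fin_cases x <;> simp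

/-- The morphism `ε : X ⊗ Y ⊗ Z ⟶ X ⊗ (Y ⊗ Z)`. -/
noncomputable def eps₀₁₁ (X Y Z : Ho C) :
    (⟨R.T 2 ![X.as, Y.as, Z.as]⟩ : Ho C) ⟶ R.tensor X (R.tensor Y Z) :=
  R.lift surj₀₁₁ (X := ![X.as, Y.as, Z.as]) (Y := ![X.as, (R.tensor Y Z).as])
    (X' := fun
      | 0 => fun (_ : Fin 1) => X.as
      | 1 => (![Y.as, Z.as] : Fin 2 → C.Obj))
    (fun
      | 0 => fun (_ : Fin 1) => rfl
      | 1 => fun (a : Fin 2) => by fin_cases a <;> rfl)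
    (fun
      | 0 => R.univ 0 (fun _ => X.as)
      | 1 => R.univ 1 ![Y.as, Z.as])

/-- The morphism `ε : X ⊗ Y ⊗ Z ⟶ (X ⊗ Y) ⊗ Z`. -/
noncomputable def eps₀₀₁ (X Y Z : Ho C) :
    (⟨R.T 2 ![X.as, Y.as, Z.as]⟩ : Ho C) ⟶ R.tensor (R.tensor X Y) Z :=
  R.lift surj₀₀₁ (X := ![X.as, Y.as, Z.as]) (Y := ![(R.tensor X Y).as, Z.as])
    (X' := fun
      | 0 => (![X.as, Y.as] : Fin 2 → C.Obj)
      | 1 => fun (_ : Fin 1) => Z.as)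
    (fun
      | 0 => fun (a : Fin 2) => by fin_cases a <;> rfl
      | 1 => fun (_ : Fin 1) => rfl)
    (fun
      | 0 => R.univ 1 ![X.as, Y.as]
      | 1 => R.univ 0 (fun _ => Z.as))

end Rep

end PT

/-- A tensor structure (without unit) on an additive category, with tensor product `t` on objects:
a biadditive bifunctor with associativity and commutativity constraints. -/
structure TensorStr (A : Type*) [Category A] [Preadditive A] (t : A → A → A) where
  hom : ∀ {X Y X' Y' : A}, (X ⟶ Y) → (X' ⟶ Y') → (t X X' ⟶ t Y Y')
  hom_id : ∀ X Y : A, hom (𝟙 X) (𝟙 Y) = 𝟙 (t X Y)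
  hom_comp : ∀ {X Y Z X' Y' Z' : A} (f : X ⟶ Y) (g : Y ⟶ Z) (f' : X' ⟶ Y') (g' : Y' ⟶ Z'),
    hom (f ≫ g) (f' ≫ g') = hom f f' ≫ hom g g'
  add_hom : ∀ {X Y X' Y' : A} (f g : X ⟶ Y) (f' : X' ⟶ Y'), hom (f + g) f' = hom f f' + hom g f'
  hom_add : ∀ {X Y X' Y' : A} (f : X ⟶ Y) (f' g' : X' ⟶ Y'), hom f (f' + g') = hom f f' + hom f g'
  assoc : ∀ X Y Z : A, t X (t Y Z) ≅ t (t X Y) Z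
  assoc_natural : ∀ {X Y Z X' Y' Z' : A} (f : X ⟶ X') (g : Y ⟶ Y') (h : Z ⟶ Z'),
    hom f (hom g h) ≫ (assoc X' Y' Z').hom = (assoc X Y Z).hom ≫ hom (hom f g) h
  symm : ∀ X Y : A, t X Y ≅ t Y X
  symm_natural : ∀ {X Y X' Y' : A} (f : X ⟶ X') (g : Y ⟶ Y'),
    hom f g ≫ (symm X' Y').hom = (symm X Y).hom ≫ hom g f
  symm_symm : ∀ X Y : A, (symm X Y).hom ≫ (symm Y X).hom = 𝟙 _
  pentagon : ∀ X Y Z W : A,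
    (assoc X Y (t Z W)).hom ≫ (assoc (t X Y) Z W).hom =
      hom (𝟙 X) (assoc Y Z W).hom ≫ (assoc X (t Y Z) W).hom ≫ hom (assoc X Y Z).hom (𝟙 W)
  hexagon : ∀ X Y Z : A,
    (assoc X Y Z).hom ≫ (symm (t X Y) Z).hom ≫ (assoc Z X Y).hom =
      hom (𝟙 X) (symm Y Z).hom ≫ (assoc X Z Y).hom ≫ hom (symm X Z).hom (𝟙 Y)

/-- The tensor structure `S` on `H⁰ C` is the one given by the representable pseudo-tensor
structure: the tensor product of morphisms, the associativity constraint `ε ∘ ε⁻¹` and the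
commutativity constraint are induced by compositions of the pseudo-tensor structure. -/
structure PT.Rep.Gives {C : PreDG.{u, v}} {D : PT C} (R : D.Rep) (S : TensorStr (Ho C) R.tensor) :
    Prop where
  hom_eq : ∀ {X Y X' Y' : Ho C} (f : X ⟶ Y) (f' : X' ⟶ Y'), S.hom f f' = R.tensorHom f f'
  assoc_eq : ∀ X Y Z : Ho C, R.eps₀₁₁ X Y Z ≫ (S.assoc X Y Z).hom = R.eps₀₀₁ X Y Z
  symm_eq : ∀ X Y : Ho C, (S.symm X Y).hom = R.tau X Y

/-- Compatibility of a tensor structure with a translation functor `T` and a class `dist` of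
distinguished triangles: translation in one of the variables is translation of the tensor
product, up to natural isomorphisms exchanged by the commutativity constraint, and the tensor
product with an object, on either side, preserves distinguished triangles. -/
def TensorStr.IsTriangulated {A : Type*} [Category A] [Preadditive A] {t : A → A → A}
    (S : TensorStr A t) (T : A ⥤ A)
    (dist : ∀ {X Y Z : A}, (X ⟶ Y) → (Y ⟶ Z) → (Z ⟶ T.obj X) → Prop) : Prop :=
  ∃ (l : ∀ X Y : A, t (T.obj X) Y ≅ T.obj (t X Y)) (r : ∀ X Y : A, t X (T.obj Y) ≅ T.obj (t X Y)),
    (∀ {X Y X' Y' : A} (f : X ⟶ X') (g : Y ⟶ Y'),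
      S.hom (T.map f) g ≫ (l X' Y').hom = (l X Y).hom ≫ T.map (S.hom f g)) ∧
    (∀ {X Y X' Y' : A} (f : X ⟶ X') (g : Y ⟶ Y'),
      S.hom f (T.map g) ≫ (r X' Y').hom = (r X Y).hom ≫ T.map (S.hom f g)) ∧
    (∀ X Y : A, (S.symm (T.obj X) Y).hom ≫ (r Y X).hom =
      (l X Y).hom ≫ T.map (S.symm X Y).hom) ∧
    ∀ {X Y Z : A} (f : X ⟶ Y) (g : Y ⟶ Z) (h : Z ⟶ T.obj X), dist f g h → ∀ W : A,
      dist (S.hom f (𝟙 W)) (S.hom g (𝟙 W)) (S.hom h (𝟙 W) ≫ (l X W).hom) ∧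
      dist (S.hom (𝟙 W) f) (S.hom (𝟙 W) g) (S.hom (𝟙 W) h ≫ (r W X).hom)

/-! ### The DG category of twisted complexes -/

section

variable {C : PreDG.{u, v}}

lemma PreDG.eq_zero_of_source {X Y : C.Obj} (h : C.id X = 0) {a : ℤ} (f : (C.hom X Y).X a) :
    f = 0 := by
  rw [← C.comp_id (add_zero a) f, h, map_zero]

lemma PreDG.eq_zero_of_target {X Y : C.Obj} (h : C.id Y = 0) {a : ℤ} (f : (C.hom X Y).X a) :
    f = 0 := by
  rw [← C.id_comp (zero_add a) f, h, map_zero, AddMonoidHom.zero_apply]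

lemma PreDG.comp_cast_left {X Y Z : C.Obj} {a a' b c : ℤ} (h : a = a') (h' : a' + b = c)
    (f : (C.hom Y Z).X a) (g : (C.hom X Y).X b) :
    C.comp h' ((C.hom Y Z).cast h f) g = C.comp (by omega) f g := by
  subst h; rfl

lemma PreDG.comp_cast_right {X Y Z : C.Obj} {a b b' c : ℤ} (h : b = b') (h' : a + b' = c)
    (f : (C.hom Y Z).X a) (g : (C.hom X Y).X b) :
    C.comp h' f ((C.hom X Y).cast h g) = C.comp (by omega) f g := by
  subst h; rfl

lemma PreDG.cast_comp {X Y Z : C.Obj} {a b c c' : ℤ} (h : c = c') (h' : a + b = c)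
    (f : (C.hom Y Z).X a) (g : (C.hom X Y).X b) :
    (C.hom X Z).cast h (C.comp h' f g) = C.comp (by omega) f g := by
  subst h; rfl

lemma map_negOnePow {A B : Type*} [AddCommGroup A] [AddCommGroup B] (f : A →+ B) (n : ℤ) (x : A) :
    f (n.negOnePow • x) = n.negOnePow • f x := by
  rw [Units.smul_def, map_zsmul, Units.smul_def]

lemma comp_negOnePow {X Y Z : C.Obj} {a b c : ℤ} (h : a + b = c) (n : ℤ)
    (f : (C.hom Y Z).X a) (g : (C.hom X Y).X b) :
    C.comp h (n.negOnePow • f) g = n.negOnePow • C.comp h f g := by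
  rw [map_negOnePow]; rfl

end

/-- A finite collection of objects `E_i`, `N ≤ i ≤ M`, of a DG category.  It is extended to all
`i ∈ ℤ` by zero objects. -/
structure FinFam (C : PreDG.{u, v}) where
  N : ℤ
  M : ℤ
  E : ℤ → C.Obj
  id_eq_zero : ∀ i, i < N ∨ M < i → C.id (E i) = 0

namespace FinFam

variable {C : PreDG.{u, v}}

/-- The range of indices of a finite collection of objects. -/
noncomputable abbrev rng (E : FinFam C) : Finset ℤ := Finset.Icc E.N E.M

lemma id_eq_zero_of_notMem (E : FinFam C) {i : ℤ} (h : i ∉ E.rng) : C.id (E.E i) = 0 :=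
  E.id_eq_zero i (by rw [Finset.mem_Icc] at h; omega)

/-- Families of morphisms `φ i j : E_j → F_i` of degree `n + j - i`. -/
abbrev Fam (E F : FinFam C) (n : ℤ) : Type v := ∀ i j, (C.hom (E.E j) (F.E i)).X (n + j - i)

/-- The operator `φ ↦ ((-1)^i d φ_{ij})`. -/
noncomputable def dFam (E F : FinFam C) (a b : ℤ) (h : a + 1 = b) : Fam E F a →+ Fam E F b :=
  AddMonoidHom.mk' (fun φ i j => i.negOnePow • (C.hom _ _).d _ _ (by omega) (φ i j))
    (fun φ ψ => by funext i j; simp)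

/-- The composition `(ψ φ)_{ij} = ∑ k, ψ_{ik} φ_{kj}`. -/
noncomputable def mul {E F G : FinFam C} {a b c : ℤ} (h : a + b = c) : Fam F G a →+ Fam E F b →+ Fam E G c :=
  AddMonoidHom.mk' (fun ψ => AddMonoidHom.mk'
      (fun φ i j => ∑ k ∈ F.rng, C.comp (by omega) (ψ i k) (φ k j))
      (fun φ φ' => by funext i j; simp [Finset.sum_add_distrib]))
    (fun ψ ψ' => by ext φ i j; simp [Finset.sum_add_distrib])

/-- The family with entries `m_i : E_i → F_i` on the diagonal and zero elsewhere. -/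
noncomputable def diag {E F : FinFam C} (m : ∀ i, (C.hom (E.E i) (F.E i)).X 0) : Fam E F 0 := fun i j =>
  if h : i = j then
    (C.hom (E.E j) (F.E i)).cast (by omega)
      (Eq.rec (motive := fun j _ => (C.hom (E.E j) (F.E i)).X 0) (m i) h)
  else 0

lemma diag_self {E F : FinFam C} (m : ∀ i, (C.hom (E.E i) (F.E i)).X 0) (i : ℤ) :
    diag m i i = (C.hom (E.E i) (F.E i)).cast (by omega) (m i) := by
  simp [diag]

lemma diag_ne {E F : FinFam C} (m : ∀ i, (C.hom (E.E i) (F.E i)).X 0) {i j : ℤ} (h : i ≠ j) :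
    diag m i j = 0 := by
  simp [diag, h]

lemma diag_mul {E F G : FinFam C} (m : ∀ i, (C.hom (F.E i) (G.E i)).X 0) {a : ℤ} (φ : Fam E F a)
    (h : 0 + a = a) (i j : ℤ) : mul h (diag m) φ i j = C.comp (by omega) (m i) (φ i j) := by
  change ∑ k ∈ F.rng, C.comp _ (diag m i k) (φ k j) = _
  rw [Finset.sum_eq_single i]
  · rw [diag_self, PreDG.comp_cast_left]
  · intro k _ hk
    rw [diag_ne _ hk.symm, map_zero, AddMonoidHom.zero_apply]
  · intro hi
    rw [PreDG.eq_zero_of_target (F.id_eq_zero_of_notMem hi) (φ i j), map_zero]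

lemma mul_diag {E F G : FinFam C} (m : ∀ i, (C.hom (E.E i) (F.E i)).X 0) {a : ℤ} (φ : Fam F G a)
    (h : a + 0 = a) (i j : ℤ) : mul h φ (diag m) i j = C.comp (by omega) (φ i j) (m j) := by
  change ∑ k ∈ F.rng, C.comp _ (φ i k) (diag m k j) = _
  rw [Finset.sum_eq_single j]
  · rw [diag_self, PreDG.comp_cast_right]
  · intro k _ hk
    rw [diag_ne _ hk, map_zero]
  · intro hj
    rw [PreDG.eq_zero_of_source (F.id_eq_zero_of_notMem hj) (φ i j), map_zero,
      AddMonoidHom.zero_apply]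

lemma dFam_diag {E F : FinFam C} (m : ∀ i, (C.hom (E.E i) (F.E i)).X 0)
    (hm : ∀ i, (C.hom (E.E i) (F.E i)).d 0 1 rfl (m i) = 0) : dFam E F 0 1 rfl (diag m) = 0 := by
  funext i j
  change i.negOnePow • (C.hom _ _).d _ _ _ (diag m i j) = 0
  by_cases h : i = j
  · subst h
    rw [diag_self, PreCx.d_cast]
    have := congrArg ((C.hom (E.E i) (F.E i)).cast (show (1 : ℤ) = 1 + i - i by omega)) (hm i)
    rw [PreCx.cast_d, map_zero] at this
    rw [this, smul_zero]
  · rw [diag_ne _ h, map_zero, smul_zero]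

/-- The pre-DG category of finite collections of objects of `C` and families of morphisms. -/
noncomputable def cat (C : PreDG.{u, v}) : PreDG.{u, v} where
  Obj := FinFam C
  hom E F :=
    { X := Fam E F
      d := dFam E F
      d_d := fun a b c h h' φ => by
        funext i j
        change i.negOnePow • (C.hom _ _).d _ _ _ (i.negOnePow • (C.hom _ _).d _ _ _ (φ i j)) = 0
        rw [map_negOnePow, Cx.d_d, smul_zero, smul_zero] }
  id E := diag fun i => C.id (E.E i)
  comp := mul
  d_id E := dFam_diag _ fun i => C.d_id _
  leibniz := by
    intro E F G a b c a' b' c' h ha hb hc ψ φ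
    funext i j
    change i.negOnePow • (C.hom _ _).d _ _ _ (∑ k ∈ F.rng, C.comp _ (ψ i k) (φ k j)) =
      ∑ k ∈ F.rng, C.comp _ (i.negOnePow • (C.hom _ _).d _ _ _ (ψ i k)) (φ k j) +
      a.negOnePow • ∑ k ∈ F.rng, C.comp _ (ψ i k) (k.negOnePow • (C.hom _ _).d _ _ _ (φ k j))
    rw [map_sum, Finset.smul_sum, Finset.smul_sum, ← Finset.sum_add_distrib]
    refine Finset.sum_congr rfl fun k _ => ?_
    rw [C.leibniz _ (show a + k - i + 1 = a' + k - i by omega)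
      (show b + j - k + 1 = b' + j - k by omega), smul_add, comp_negOnePow, map_negOnePow,
      smul_smul, smul_smul]
    congr 2
    rw [← Int.negOnePow_add, ← Int.negOnePow_add]
    exact (Int.negOnePow_eq_iff _ _).2 ⟨0, by omega⟩
  assoc := by
    intro D E F G a b c ab bc abc h₁ h₂ h₃ h₄ f g k
    funext i j
    change ∑ s ∈ E.rng, C.comp _ (∑ t ∈ F.rng, C.comp _ (f i t) (g t s)) (k s j) =
      ∑ t ∈ F.rng, C.comp _ (f i t) (∑ s ∈ E.rng, C.comp _ (g t s) (k s j))
    simp_rw [map_sum, AddMonoidHom.finsetSum_apply]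
    rw [Finset.sum_comm]
    refine Finset.sum_congr rfl fun t _ => Finset.sum_congr rfl fun s _ => ?_
    exact C.assoc _ _ _ _ _ _ _
  id_comp := by
    intro E F a h f
    funext i j
    exact (diag_mul _ _ _ _ _).trans (C.id_comp _ _)
  comp_id := by
    intro E F a h f
    funext i j
    exact (mul_diag _ _ _ _ _).trans (C.comp_id _ _)

end FinFam


section

variable (A : PreDG.{u, v})

/-- An object of `A` with a Maurer-Cartan element, i.e. an endomorphism `e` of degree one such that
`d e + e e = 0`. -/
structure MC where
  obj : A.Obj
  e : (A.hom obj obj).X 1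
  maurer_cartan : (A.hom obj obj).d 1 2 rfl e + A.comp (by rfl) e e = 0

variable {A}

/-- The twisted differential `∂ φ = d φ + f φ - (-1)^n φ e` on morphisms of degree `n`. -/
noncomputable def MC.del (E F : MC A) (a b : ℤ) (h : a + 1 = b) :
    (A.hom E.obj F.obj).X a →+ (A.hom E.obj F.obj).X b :=
  AddMonoidHom.mk' (fun φ => (A.hom E.obj F.obj).d a b h φ + A.comp (by omega) F.e φ -
    a.negOnePow • A.comp h φ E.e) (fun φ ψ => by simp; abel)

lemma MC.del_apply (E F : MC A) (a b : ℤ) (h : a + 1 = b) (φ : (A.hom E.obj F.obj).X a) :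
    MC.del E F a b h φ = (A.hom E.obj F.obj).d a b h φ + A.comp (by omega) F.e φ -
      a.negOnePow • A.comp h φ E.e := rfl

lemma MC.d_e (E : MC A) : (A.hom E.obj E.obj).d 1 2 rfl E.e = - A.comp (by rfl) E.e E.e :=
  eq_neg_of_add_eq_zero_left E.maurer_cartan

lemma negOnePow_smul_apply {G H : Type*} [AddCommGroup G] [AddCommGroup H] (n : ℤ) (f : G →+ H)
    (x : G) : (n.negOnePow • f) x = n.negOnePow • f x := rfl

lemma MC.del_del (E F : MC A) (a b c : ℤ) (h : a + 1 = b) (h' : b + 1 = c)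
    (φ : (A.hom E.obj F.obj).X a) : MC.del E F b c h' (MC.del E F a b h φ) = 0 := by
  subst h
  simp only [MC.del_apply, map_add, map_sub, map_negOnePow, Cx.d_d]
  rw [A.leibniz (a := 1) (b := a) (a' := 2) _ rfl rfl,
    A.leibniz (a := a) (b := 1) (b' := 2) _ rfl rfl, F.d_e, E.d_e, Int.negOnePow_succ]
  rw [← A.assoc (a := 1) (b := 1) (c := a) rfl (by omega) (by omega) (by omega),
    A.assoc (a := 1) (b := a) (c := 1) (by omega) (by omega) rfl (by omega),
    A.assoc (a := a) (b := 1) (c := 1) rfl (by omega) rfl (by omega)]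
  simp only [map_neg, AddMonoidHom.neg_apply, Int.negOnePow_one, Units.neg_smul, one_smul,
    smul_add, smul_sub, smul_neg, smul_smul, Int.units_mul_self]
  abel

lemma MC.del_comp {E F G : MC A} {a b c a' b' c' : ℤ} (h : a + b = c) (ha : a + 1 = a')
    (hb : b + 1 = b') (hc : c + 1 = c') (ψ : (A.hom F.obj G.obj).X a)
    (φ : (A.hom E.obj F.obj).X b) :
    MC.del E G c c' hc (A.comp h ψ φ) = A.comp (by omega) (MC.del F G a a' ha ψ) φ +
      a.negOnePow • A.comp (by omega) ψ (MC.del E F b b' hb φ) := by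
  simp only [MC.del_apply, map_add, map_sub, map_negOnePow,
    AddMonoidHom.add_apply, AddMonoidHom.sub_apply, negOnePow_smul_apply]
  rw [A.leibniz h ha hb,
    ← A.assoc (a := 1) (b := a) (c := b) (ab := a') (abc := c') (by omega) (by omega) h (by omega),
    A.assoc (a := a) (b := b) (c := 1) (abc := c') h (by omega) hb (by omega),
    A.assoc (a := a) (b := 1) (c := b) (bc := b') (abc := c') ha (by omega) (by omega)
      (by omega)]
  simp only [smul_add, smul_sub, smul_smul, ← h, Int.negOnePow_add]
  abel

variable (A) in
/-- The category of objects with a Maurer-Cartan element, with the twisted differential on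
morphisms. -/
noncomputable def MC.cat : PreDG.{max u v, v} where
  Obj := MC A
  hom E F :=
    { X := (A.hom E.obj F.obj).X
      d := MC.del E F
      d_d := MC.del_del E F }
  id E := A.id E.obj
  comp := A.comp
  d_id E := by
    rw [MC.del_apply, A.d_id, A.comp_id, A.id_comp]
    simp
  leibniz := MC.del_comp
  assoc := A.assoc
  id_comp := A.id_comp
  comp_id := A.comp_id

end

/-- The objects of `Pre-Tr(C)`: finite collections of objects `E_i` with morphisms
`e i j : E_j → E_i` of degree `1 + j - i` such that `(-1)^i d e_{ij} + ∑ k, e_{ik} e_{kj} = 0`. -/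
abbrev PreTr (C : PreDG.{u, v}) := MC (FinFam.cat C)

/-- The DG category `Pre-Tr(C)`: morphisms of degree `n` are families `φ i j : E_j → F_i` of
morphisms of degree `n + j - i`, with the differential
`(∂ φ)_{ij} = (-1)^i d φ_{ij} + ∑ k, f_{ik} φ_{kj} - (-1)^n ∑ k, φ_{ik} e_{kj}`. -/
noncomputable abbrev PreTr.cat (C : PreDG.{u, v}) : PreDG.{max u v, v} := MC.cat (FinFam.cat C)

/-! ### Direct sums and extensions of Maurer-Cartan elements -/

section

/-- A direct sum of two objects. -/
structure PreDG.Biprod (A : PreDG.{u, v}) (X Y : A.Obj) where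
  sum : A.Obj
  inl : (A.hom X sum).X 0
  inr : (A.hom Y sum).X 0
  fst : (A.hom sum X).X 0
  snd : (A.hom sum Y).X 0
  d_inl : (A.hom X sum).d 0 1 rfl inl = 0
  d_inr : (A.hom Y sum).d 0 1 rfl inr = 0
  d_fst : (A.hom sum X).d 0 1 rfl fst = 0
  d_snd : (A.hom sum Y).d 0 1 rfl snd = 0
  fst_inl : A.comp (add_zero 0) fst inl = A.id X
  snd_inr : A.comp (add_zero 0) snd inr = A.id Y
  snd_inl : A.comp (add_zero 0) snd inl = 0
  fst_inr : A.comp (add_zero 0) fst inr = 0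

variable {A : PreDG.{u, v}}

/-- The map `x ↦ i x q` for morphisms `i`, `q` of degree zero. -/
def PreDG.sand {S T X Y : A.Obj} (i : (A.hom X T).X 0) (q : (A.hom S Y).X 0) (a : ℤ)
    (x : (A.hom Y X).X a) : (A.hom S T).X a :=
  A.comp (zero_add a) i (A.comp (add_zero a) x q)

lemma PreDG.sand_add {S T X Y : A.Obj} (i : (A.hom X T).X 0) (q : (A.hom S Y).X 0) (a : ℤ)
    (x y : (A.hom Y X).X a) : A.sand i q a (x + y) = A.sand i q a x + A.sand i q a y := by
  simp [PreDG.sand]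

lemma PreDG.sand_zero {S T X Y : A.Obj} (i : (A.hom X T).X 0) (q : (A.hom S Y).X 0) (a : ℤ) :
    A.sand i q a 0 = 0 := by
  simp [PreDG.sand]

lemma PreDG.d_sand {S T X Y : A.Obj} (i : (A.hom X T).X 0) (q : (A.hom S Y).X 0)
    (hi : (A.hom X T).d 0 1 rfl i = 0) (hq : (A.hom S Y).d 0 1 rfl q = 0) {a b : ℤ}
    (h : a + 1 = b) (x : (A.hom Y X).X a) :
    (A.hom S T).d a b h (A.sand i q a x) = A.sand i q b ((A.hom Y X).d a b h x) := by
  rw [PreDG.sand, A.leibniz _ (a' := 1) rfl h, A.leibniz _ h (b' := 1) rfl, hi, hq]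
  simp [PreDG.sand]

lemma PreDG.sand_sand {S T U X Y Y' Z : A.Obj} (i : (A.hom X T).X 0) (q : (A.hom S Y).X 0)
    (i' : (A.hom Y' S).X 0) (p : (A.hom U Z).X 0) {a b c : ℤ} (h : a + b = c)
    (x : (A.hom Y X).X a) (y : (A.hom Z Y').X b) :
    A.comp h (A.sand i q a x) (A.sand i' p b y) =
      A.sand i p c (A.comp h x (A.comp (zero_add b) (A.comp (add_zero 0) q i') y)) := by
  unfold PreDG.sand
  rw [A.assoc (bc := c) (abc := c) _ h (by omega) (by omega),
    A.assoc (bc := b) (abc := c) _ h (by omega) (by omega),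
    A.assoc (a := 0) (b := 0) (c := b) (bc := b) (abc := b) _ _ (by omega) (by omega),
    A.assoc (a := a) (b := b) (c := 0) (bc := b) (abc := c) _ _ (by omega) (by omega),
    A.assoc (a := 0) (b := b) (c := 0) (bc := b) (abc := b) _ _ (by omega) (by omega),
    A.assoc (a := 0) (b := b) (c := 0) (bc := b) (abc := b) _ _ (by omega) (by omega)]

lemma PreDG.sand_comp {S T X Y Z : A.Obj} (i : (A.hom X T).X 0) (q : (A.hom S Y).X 0) {a : ℤ}
    (h : a + 0 = a) (x : (A.hom Y X).X a) (f : (A.hom Z S).X 0) :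
    A.comp h (A.sand i q a x) f =
      A.comp (zero_add a) i (A.comp h x (A.comp (add_zero 0) q f)) := by
  unfold PreDG.sand
  rw [A.assoc (bc := a) (abc := a) _ h (by omega) (by omega),
    A.assoc (bc := 0) (abc := a) _ h (by omega) (by omega)]

lemma PreDG.comp_sand {S T X Y Z : A.Obj} (i : (A.hom X T).X 0) (q : (A.hom S Y).X 0) {a : ℤ}
    (h : 0 + a = a) (x : (A.hom Y X).X a) (f : (A.hom T Z).X 0) :
    A.comp h f (A.sand i q a x) =
      A.comp h (A.comp (add_zero 0) f i) (A.comp (add_zero a) x q) := by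
  unfold PreDG.sand
  rw [← A.assoc (ab := 0) (abc := a) _ h (by omega) (by omega)]

/-- The extension of a pair of Maurer-Cartan elements by a morphism `x` of degree one: the
direct sum with the Maurer-Cartan element given by the matrix with rows `(X.e, x)` and
`(0, Y.e)`. -/
def MC.extend (X Y : MC A) (S : A.Biprod X.obj Y.obj) (x : (A.hom Y.obj X.obj).X 1)
    (hx : (A.hom Y.obj X.obj).d 1 2 rfl x + A.comp (by rfl) X.e x + A.comp (by rfl) x Y.e = 0) :
    MC A where
  obj := S.sum
  e := A.sand S.inl S.fst 1 X.e + A.sand S.inl S.snd 1 x + A.sand S.inr S.snd 1 Y.e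
  maurer_cartan := by
    have hX := X.maurer_cartan
    have hY := Y.maurer_cartan
    simp only [map_add, AddMonoidHom.add_apply, PreDG.sand_sand, S.fst_inl, S.snd_inr, S.snd_inl,
      S.fst_inr, A.id_comp, map_zero, AddMonoidHom.zero_apply, PreDG.sand_zero,
      A.d_sand _ _ S.d_inl S.d_fst, A.d_sand _ _ S.d_inl S.d_snd, A.d_sand _ _ S.d_inr S.d_snd,
      add_zero, zero_add]
    have h1 := congrArg (A.sand S.inl S.fst 2) hX
    have h2 := congrArg (A.sand S.inl S.snd 2) hx
    have h3 := congrArg (A.sand S.inr S.snd 2) hY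
    simp only [PreDG.sand_add, PreDG.sand_zero] at h1 h2 h3
    rw [← add_zero (0 : (A.hom S.sum S.sum).X 2)]
    nth_rewrite 1 [← h1]
    rw [← add_zero (0 : (A.hom S.sum S.sum).X 2)]
    nth_rewrite 1 [← h2]
    rw [← h3]
    abel

lemma MC.extend_inl (X Y : MC A) (S : A.Biprod X.obj Y.obj) (x : (A.hom Y.obj X.obj).X 1) (hx) :
    ((MC.cat A).hom X (MC.extend X Y S x hx)).d 0 1 rfl S.inl = 0 := by
  have : (A.hom X.obj S.sum).d 0 1 rfl S.inl +
      A.comp (by rfl) (A.sand S.inl S.fst 1 X.e + A.sand S.inl S.snd 1 x +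
        A.sand S.inr S.snd 1 Y.e) S.inl -
      Int.negOnePow 0 • A.comp (c := 1) (by rfl) S.inl X.e = 0 := by
    simp only [S.d_inl, map_add, AddMonoidHom.add_apply]
    rw [PreDG.sand_comp _ _ rfl, PreDG.sand_comp _ _ rfl, PreDG.sand_comp _ _ rfl, S.fst_inl,
      S.snd_inl, A.comp_id]
    simp
  exact this

lemma MC.extend_snd (X Y : MC A) (S : A.Biprod X.obj Y.obj) (x : (A.hom Y.obj X.obj).X 1) (hx) :
    ((MC.cat A).hom (MC.extend X Y S x hx) Y).d 0 1 rfl S.snd = 0 := by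
  have : (A.hom S.sum Y.obj).d 0 1 rfl S.snd + A.comp (by rfl) Y.e S.snd -
      Int.negOnePow 0 • A.comp (by rfl) S.snd (A.sand S.inl S.fst 1 X.e + A.sand S.inl S.snd 1 x +
        A.sand S.inr S.snd 1 Y.e) = 0 := by
    simp only [S.d_snd, map_add]
    rw [PreDG.comp_sand _ _ rfl, PreDG.comp_sand _ _ rfl,
      PreDG.comp_sand _ _ rfl, S.snd_inr, S.snd_inl, A.id_comp]
    simp
  exact this

end

/-! ### DG functors -/

/-- A DG functor. -/
structure DGFun (C : PreDG.{u, v}) (D : PreDG.{u, v}) where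
  obj : C.Obj → D.Obj
  map : ∀ X Y, CxHom (C.hom X Y) (D.hom (obj X) (obj Y))
  map_id : ∀ X, (map X X).f 0 (C.id X) = D.id (obj X)
  map_comp : ∀ {X Y Z : C.Obj} {a b c : ℤ} (h : a + b = c) (f : (C.hom Y Z).X a)
    (g : (C.hom X Y).X b), (map X Z).f c (C.comp h f g) = D.comp h ((map Y Z).f a f)
      ((map X Y).f b g)

/-- The functor `H⁰ C ⥤ H⁰ D` induced by a DG functor. -/
def DGFun.ho {C D : PreDG.{u, v}} (F : DGFun C D) : Ho C ⥤ Ho D where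
  obj X := ⟨F.obj X.as⟩
  map f := (F.map _ _).H 0 f
  map_id X := congrArg _ (Subtype.ext (F.map_id X.as))
  map_comp := by
    rintro X Y Z ⟨f⟩ ⟨g⟩
    exact congrArg _ (Subtype.ext (F.map_comp (add_zero 0) g.1 f.1))

/-! ### Translations of finite families -/

lemma PreCx.cast_cast (K : PreCx.{v}) {a b c : ℤ} (h : a = b) (h' : b = c) (x : K.X a) :
    K.cast h' (K.cast h x) = K.cast (h.trans h') x := by
  subst h h'; rfl

namespace FinFam

variable {C : PreDG.{u, v}}

/-- The translation `E[n]_i = E_{n+i}`. -/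
def shift (n : ℤ) (E : FinFam C) : FinFam C where
  N := E.N - n
  M := E.M - n
  E i := E.E (n + i)
  id_eq_zero i hi := E.id_eq_zero _ (by omega)

/-- The family `φ_{n+i,n+j}`. -/
noncomputable def shiftFam (n : ℤ) {E F : FinFam C} (a : ℤ) :
    Fam E F a →+ Fam (E.shift n) (F.shift n) a :=
  AddMonoidHom.mk' (fun φ i j => (C.hom (E.E (n + j)) (F.E (n + i))).cast (by omega)
    (φ (n + i) (n + j))) (fun φ ψ => by funext i j; simp; rfl)

lemma sum_shift (n : ℤ) (E : FinFam C) {G : Type*} [AddCommMonoid G] (g : ℤ → G) :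
    ∑ k ∈ (E.shift n).rng, g (n + k) = ∑ k ∈ E.rng, g k := by
  refine Finset.sum_bij (fun k _ => n + k) ?_ ?_ ?_ ?_
  · intro k hk
    rw [Finset.mem_Icc] at hk ⊢
    change E.N - n ≤ k ∧ k ≤ E.M - n at hk
    omega
  · intro k _ l _ h
    omega
  · intro k hk
    refine ⟨k - n, ?_, by omega⟩
    rw [Finset.mem_Icc] at hk ⊢
    change E.N - n ≤ k - n ∧ k - n ≤ E.M - n
    omega
  · intros; rfl

lemma shiftFam_mul (n : ℤ) {E F G : FinFam C} {a b c : ℤ} (h : a + b = c) (ψ : Fam F G a)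
    (φ : Fam E F b) :
    shiftFam n c (mul h ψ φ) = mul h (shiftFam n a ψ) (shiftFam n b φ) := by
  funext i j
  change (C.hom _ _).cast _ (∑ k ∈ F.rng, C.comp _ (ψ (n + i) k) (φ k (n + j))) =
    ∑ k ∈ (F.shift n).rng, C.comp _ ((C.hom _ _).cast _ (ψ (n + i) (n + k)))
      ((C.hom _ _).cast _ (φ (n + k) (n + j)))
  simp only [PreDG.comp_cast_left, PreDG.comp_cast_right, map_sum, PreDG.cast_comp]
  exact (sum_shift n F (fun k => C.comp (c := c + j - i) (by omega) (ψ (n + i) k)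
    (φ k (n + j)))).symm

lemma dFam_shiftFam (n : ℤ) {E F : FinFam C} {a b : ℤ} (h : a + 1 = b) (φ : Fam E F a) :
    dFam _ _ a b h (shiftFam n a φ) = n.negOnePow • shiftFam n b (dFam _ _ a b h φ) := by
  funext i j
  change i.negOnePow • (C.hom _ _).d _ _ _ ((C.hom _ _).cast _ (φ (n + i) (n + j))) =
    n.negOnePow • (C.hom _ _).cast _ ((n + i).negOnePow • (C.hom _ _).d _ _ _ (φ (n + i) (n + j)))
  rw [PreCx.d_cast, map_negOnePow, PreCx.cast_d, smul_smul, Int.negOnePow_add, ← mul_assoc,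
    Int.units_mul_self, one_mul]

lemma shiftFam_id (n : ℤ) (E : FinFam C) :
    shiftFam n 0 ((cat C).id E) = (cat C).id (E.shift n) := by
  funext i j
  change (C.hom _ _).cast _ (diag (fun i => C.id (E.E i)) (n + i) (n + j)) =
    diag (E := E.shift n) (F := E.shift n) (fun i => C.id (E.E (n + i))) i j
  by_cases h : i = j
  · subst h
    refine (congrArg _ (diag_self _ (n + i))).trans ?_
    refine (PreCx.cast_cast _ _ _ _).trans ?_
    exact (diag_self (E := E.shift n) (F := E.shift n)
      (fun i => C.id (E.E (n + i))) i).symm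
  · refine (congrArg _ (diag_ne _ (by omega))).trans ?_
    exact (map_zero _).trans (diag_ne (E := E.shift n) (F := E.shift n) _ h).symm

/-- The family `φ_{i,j+1}`, of degree one more than `φ`. -/
noncomputable def barFam {E F : FinFam C} (a b : ℤ) (h : a + 1 = b) :
    Fam E F a →+ Fam (E.shift 1) F b :=
  AddMonoidHom.mk' (fun φ i j => (C.hom (E.E (1 + j)) (F.E i)).cast (by omega) (φ i (1 + j)))
    (fun φ ψ => by funext i j; simp; rfl)

lemma mul_barFam {E F G : FinFam C} {a b c b' c' : ℤ} (h : a + b = c) (hb : b + 1 = b')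
    (hc : c + 1 = c') (ψ : Fam F G a) (φ : Fam E F b) :
    barFam c c' hc (mul h ψ φ) = mul (by omega) ψ (barFam b b' hb φ) := by
  funext i j
  change (C.hom _ _).cast _ (∑ k ∈ F.rng, C.comp _ (ψ i k) (φ k (1 + j))) =
    ∑ k ∈ F.rng, C.comp _ (ψ i k) ((C.hom _ _).cast _ (φ k (1 + j)))
  simp only [PreDG.comp_cast_right, map_sum, PreDG.cast_comp]

lemma barFam_mul {E F G : FinFam C} {a b c a' c' : ℤ} (h : a + b = c) (ha : a + 1 = a')
    (hc : c + 1 = c') (ψ : Fam F G a) (φ : Fam E F b) :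
    barFam c c' hc (mul h ψ φ) = mul (by omega) (barFam a a' ha ψ) (shiftFam 1 b φ) := by
  funext i j
  change (C.hom _ _).cast _ (∑ k ∈ F.rng, C.comp _ (ψ i k) (φ k (1 + j))) =
    ∑ k ∈ (F.shift 1).rng, C.comp _ ((C.hom _ _).cast _ (ψ i (1 + k)))
      ((C.hom _ _).cast _ (φ (1 + k) (1 + j)))
  simp only [PreDG.comp_cast_left, PreDG.comp_cast_right, map_sum, PreDG.cast_comp]
  exact (sum_shift 1 F (fun k => C.comp (c := c' + j - i) (by omega) (ψ i k)
    (φ k (1 + j)))).symm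

lemma dFam_barFam {E F : FinFam C} {a b c : ℤ} (h : a + 1 = b) (h' : b + 1 = c) (φ : Fam E F a) :
    dFam _ _ b c h' (barFam a b h φ) = barFam b c h' (dFam _ _ a b h φ) := by
  funext i j
  change i.negOnePow • (C.hom _ _).d _ _ _ ((C.hom _ _).cast _ (φ i (1 + j))) =
    (C.hom _ _).cast _ (i.negOnePow • (C.hom _ _).d _ _ _ (φ i (1 + j)))
  rw [PreCx.d_cast, map_negOnePow, PreCx.cast_d]

/-- The translation of an object of `FinFam.cat C`. -/
def cshift (n : ℤ) (E : (cat C).Obj) : (cat C).Obj := FinFam.shift n E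

/-- The map `φ ↦ φ_{n+i,n+j}` on morphisms. -/
noncomputable def cmap (n : ℤ) {E F : (cat C).Obj} (a : ℤ) :
    ((cat C).hom E F).X a →+ ((cat C).hom (cshift n E) (cshift n F)).X a := shiftFam n a

lemma cmap_comp (n : ℤ) {E F G : (cat C).Obj} {a b c : ℤ} (h : a + b = c)
    (ψ : ((cat C).hom F G).X a) (φ : ((cat C).hom E F).X b) :
    cmap n c ((cat C).comp h ψ φ) = (cat C).comp h (cmap n a ψ) (cmap n b φ) :=
  shiftFam_mul n h ψ φ

lemma d_cmap (n : ℤ) {E F : (cat C).Obj} {a b : ℤ} (h : a + 1 = b)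
    (φ : ((cat C).hom E F).X a) :
    ((cat C).hom _ _).d a b h (cmap n a φ) = n.negOnePow • cmap n b (((cat C).hom _ _).d a b h φ) :=
  dFam_shiftFam n h φ

lemma cmap_id (n : ℤ) (E : (cat C).Obj) : cmap n 0 ((cat C).id E) = (cat C).id (cshift n E) :=
  shiftFam_id n E

/-- The map `φ ↦ φ_{i,j+1}` on morphisms. -/
noncomputable def cbar {E F : (cat C).Obj} (a b : ℤ) (h : a + 1 = b) :
    ((cat C).hom E F).X a →+ ((cat C).hom (cshift 1 E) F).X b := barFam a b h

lemma comp_cbar {E F G : (cat C).Obj} {a b c b' c' : ℤ} (h : a + b = c) (hb : b + 1 = b')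
    (hc : c + 1 = c') (ψ : ((cat C).hom F G).X a) (φ : ((cat C).hom E F).X b) :
    cbar c c' hc ((cat C).comp h ψ φ) = (cat C).comp (by omega) ψ (cbar b b' hb φ) :=
  mul_barFam h hb hc ψ φ

lemma cbar_comp {E F G : (cat C).Obj} {a b c a' c' : ℤ} (h : a + b = c) (ha : a + 1 = a')
    (hc : c + 1 = c') (ψ : ((cat C).hom F G).X a) (φ : ((cat C).hom E F).X b) :
    cbar c c' hc ((cat C).comp h ψ φ) = (cat C).comp (by omega) (cbar a a' ha ψ) (cmap 1 b φ) :=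
  barFam_mul h ha hc ψ φ

lemma d_cbar {E F : (cat C).Obj} {a b c : ℤ} (h : a + 1 = b) (h' : b + 1 = c)
    (φ : ((cat C).hom E F).X a) :
    ((cat C).hom _ _).d b c h' (cbar a b h φ) = cbar b c h' (((cat C).hom _ _).d a b h φ) :=
  dFam_barFam h h' φ

end FinFam

namespace PreTr

variable {C : PreDG.{u, v}}

/-- The translation `E[n]`: `E[n]_i = E_{n+i}`, `e[n]_{ij} = (-1)^n e_{n+i,n+j}`. -/
noncomputable def shift (n : ℤ) (E : PreTr C) : PreTr C where
  obj := FinFam.cshift n E.obj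
  e := n.negOnePow • FinFam.cmap n 1 E.e
  maurer_cartan := by
    have h := congrArg (FinFam.cmap n 2) E.maurer_cartan
    rw [map_zero, map_add, FinFam.cmap_comp] at h
    rw [map_negOnePow, map_negOnePow, comp_negOnePow, smul_smul, Int.units_mul_self, one_smul,
      FinFam.d_cmap, smul_smul, Int.units_mul_self, one_smul]
    exact h

lemma del_cmap (n : ℤ) {X Y : (FinFam.cat C).Obj} {a b : ℤ} (h : a + 1 = b)
    (φ : ((FinFam.cat C).hom X Y).X a) (e : ((FinFam.cat C).hom X X).X 1)
    (f : ((FinFam.cat C).hom Y Y).X 1) :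
    (n * b).negOnePow • FinFam.cmap n b (((FinFam.cat C).hom X Y).d a b h φ +
        (FinFam.cat C).comp (by omega) f φ - a.negOnePow • (FinFam.cat C).comp h φ e) =
      ((FinFam.cat C).hom _ _).d a b h ((n * a).negOnePow • FinFam.cmap n a φ) +
        (FinFam.cat C).comp (by omega) (n.negOnePow • FinFam.cmap n 1 f)
          ((n * a).negOnePow • FinFam.cmap n a φ) -
        a.negOnePow • (FinFam.cat C).comp h ((n * a).negOnePow • FinFam.cmap n a φ)
          (n.negOnePow • FinFam.cmap n 1 e) := by
  simp only [map_add, map_sub, map_negOnePow, FinFam.cmap_comp, FinFam.d_cmap,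
    smul_add, smul_sub, smul_smul, ← Int.negOnePow_add, negOnePow_smul_apply]
  subst h
  have e₁ : n * (a + 1) = n * a + n := by ring
  have e₃ : n + n * a = n * a + n := by ring
  rw [e₃, e₁, add_comm (n * a + n) a]

lemma cmap_comp_sign (n : ℤ) {E F G : (FinFam.cat C).Obj} {a b c : ℤ} (h : a + b = c)
    (ψ : ((FinFam.cat C).hom F G).X a) (φ : ((FinFam.cat C).hom E F).X b) :
    (n * c).negOnePow • FinFam.cmap n c ((FinFam.cat C).comp h ψ φ) =
      (FinFam.cat C).comp h ((n * a).negOnePow • FinFam.cmap n a ψ)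
        ((n * b).negOnePow • FinFam.cmap n b φ) := by
  rw [FinFam.cmap_comp, map_negOnePow, comp_negOnePow, smul_smul,
      ← Int.negOnePow_add]
  subst h
  rw [mul_add, add_comm (n * a)]

lemma cmap_id_sign (n : ℤ) (E : (FinFam.cat C).Obj) :
    (n * 0).negOnePow • FinFam.cmap n 0 ((FinFam.cat C).id E) =
      (FinFam.cat C).id (FinFam.cshift n E) := by
  rw [mul_zero, Int.negOnePow_zero, one_smul, FinFam.cmap_id]

/-- Translation, as a DG functor: `φ[n]_{ij} = (-1)^(n a) φ_{n+i,n+j}` for `φ` of degree `a`. -/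
noncomputable def shiftFun (C : PreDG.{u, v}) (n : ℤ) : DGFun (PreTr.cat C) (PreTr.cat C) where
  obj := shift n
  map E F :=
    { f := fun a => (n * a).negOnePow • FinFam.cmap n a
      comm := fun _ _ h φ => del_cmap n h φ (MC.e E) (MC.e F) }
  map_id E := cmap_id_sign n (MC.obj E)
  map_comp := fun h ψ φ => cmap_comp_sign n h ψ φ

end PreTr

/-! ### Cones -/

namespace FinFam

variable {C : DGCat.{u, v}}

/-- The direct sum of two finite families of objects of a DG category. -/
def sum (E F : FinFam C.toPreDG) : FinFam C.toPreDG where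
  N := min E.N F.N
  M := max E.M F.M
  E i := C.sum (E.E i) (F.E i)
  id_eq_zero i hi := by
    rw [← C.total, PreDG.eq_zero_of_source (E.id_eq_zero i (by omega)) (C.inl _ _),
      PreDG.eq_zero_of_source (F.id_eq_zero i (by omega)) (C.inr _ _)]
    simp

lemma diag_diag {C : PreDG.{u, v}} {E F G : FinFam C} (m : ∀ i, (C.hom (F.E i) (G.E i)).X 0)
    (m' : ∀ i, (C.hom (E.E i) (F.E i)).X 0) :
    mul (add_zero 0) (diag m) (diag m') = diag (fun i => C.comp (add_zero 0) (m i) (m' i)) := by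
  funext i j
  rw [diag_mul]
  by_cases h : i = j
  · subst h
    rw [diag_self, diag_self, PreDG.comp_cast_right, PreDG.cast_comp]
  · rw [diag_ne _ h, diag_ne _ h, map_zero]

lemma diag_zero {C : PreDG.{u, v}} {E F : FinFam C} {m : ∀ i, (C.hom (E.E i) (F.E i)).X 0}
    (h : ∀ i, m i = 0) : diag m = 0 := by
  funext i j
  by_cases hij : i = j
  · subst hij
    rw [diag_self, h, map_zero]; rfl
  · rw [diag_ne _ hij]; rfl

/-- The direct sum of two finite families of objects, with its inclusions and projections. -/
noncomputable def biprod (E F : (cat C.toPreDG).Obj) : (cat C.toPreDG).Biprod E F where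
  sum := sum E F
  inl := diag (E := E) (F := sum E F) fun i => C.inl (FinFam.E E i) (FinFam.E F i)
  inr := diag (E := F) (F := sum E F) fun i => C.inr (FinFam.E E i) (FinFam.E F i)
  fst := diag (E := sum E F) (F := E) fun i => C.fst (FinFam.E E i) (FinFam.E F i)
  snd := diag (E := sum E F) (F := F) fun i => C.snd (FinFam.E E i) (FinFam.E F i)
  d_inl := dFam_diag _ fun _ => C.d_inl _ _
  d_inr := dFam_diag _ fun _ => C.d_inr _ _
  d_fst := dFam_diag _ fun _ => C.d_fst _ _
  d_snd := dFam_diag _ fun _ => C.d_snd _ _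
  fst_inl := (diag_diag _ _).trans (congrArg _ (funext fun _ => C.fst_inl _ _))
  snd_inr := (diag_diag _ _).trans (congrArg _ (funext fun _ => C.snd_inr _ _))
  snd_inl := (diag_diag _ _).trans (diag_zero fun _ => C.snd_inl _ _)
  fst_inr := (diag_diag _ _).trans (diag_zero fun _ => C.fst_inr _ _)

end FinFam

namespace PreTr

lemma cone_aux {C : PreDG.{u, v}} {X Y : (FinFam.cat C).Obj} (ψ : ((FinFam.cat C).hom X Y).X 0)
    (e : ((FinFam.cat C).hom X X).X 1) (f : ((FinFam.cat C).hom Y Y).X 1)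
    (h : ((FinFam.cat C).hom X Y).d 0 1 rfl ψ + (FinFam.cat C).comp (add_zero 1) f ψ -
      Int.negOnePow 0 • (FinFam.cat C).comp (zero_add 1) ψ e = 0) :
    ((FinFam.cat C).hom _ _).d 1 2 rfl (FinFam.cbar 0 1 rfl ψ) +
      (FinFam.cat C).comp (by rfl) f (FinFam.cbar 0 1 rfl ψ) +
      (FinFam.cat C).comp (by rfl) (FinFam.cbar 0 1 rfl ψ)
        (Int.negOnePow 1 • FinFam.cmap 1 1 e) = 0 := by
  have := congrArg (FinFam.cbar 1 2 rfl) h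
  rw [map_sub, map_add, map_negOnePow, FinFam.comp_cbar (b' := 1) _ rfl,
    FinFam.cbar_comp (a' := 1) _ rfl, map_zero, Int.negOnePow_zero, one_smul] at this
  rw [FinFam.d_cbar, map_negOnePow, Int.negOnePow_one, Units.neg_smul, one_smul, ← sub_eq_add_neg]
  exact this

variable {C : DGCat.{u, v}}

/-- The cone of a closed morphism of degree zero: `Cone(ψ)_i = F_i ⊕ E_{i+1}`, with the matrix
with rows `(f_{ij}, ψ_{i,j+1})` and `(0, e[1]_{ij})`. -/
noncomputable def cone {E F : PreTr C.toPreDG} (ψ : ((PreTr.cat C.toPreDG).hom E F).X 0)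
    (hψ : ((PreTr.cat C.toPreDG).hom E F).d 0 1 rfl ψ = 0) : PreTr C.toPreDG :=
  MC.extend F (E.shift 1) (FinFam.biprod _ _) (FinFam.cbar 0 1 rfl ψ) (cone_aux ψ E.e F.e hψ)

/-- The inclusion `F → Cone(ψ)`. -/
noncomputable def coneInl {E F : PreTr C.toPreDG} (ψ : ((PreTr.cat C.toPreDG).hom E F).X 0)
    (hψ : ((PreTr.cat C.toPreDG).hom E F).d 0 1 rfl ψ = 0) :
    ((PreTr.cat C.toPreDG).hom F (cone ψ hψ)).X 0 :=
  (FinFam.biprod F.obj (E.shift 1).obj).inl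

/-- The projection `Cone(ψ) → E[1]`. -/
noncomputable def coneSnd {E F : PreTr C.toPreDG} (ψ : ((PreTr.cat C.toPreDG).hom E F).X 0)
    (hψ : ((PreTr.cat C.toPreDG).hom E F).d 0 1 rfl ψ = 0) :
    ((PreTr.cat C.toPreDG).hom (cone ψ hψ) (E.shift 1)).X 0 :=
  (FinFam.biprod F.obj (E.shift 1).obj).snd

lemma d_coneInl {E F : PreTr C.toPreDG} (ψ : ((PreTr.cat C.toPreDG).hom E F).X 0)
    (hψ : ((PreTr.cat C.toPreDG).hom E F).d 0 1 rfl ψ = 0) :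
    ((PreTr.cat C.toPreDG).hom F (cone ψ hψ)).d 0 1 rfl (coneInl ψ hψ) = 0 :=
  MC.extend_inl _ _ _ _ _

lemma d_coneSnd {E F : PreTr C.toPreDG} (ψ : ((PreTr.cat C.toPreDG).hom E F).X 0)
    (hψ : ((PreTr.cat C.toPreDG).hom E F).d 0 1 rfl ψ = 0) :
    ((PreTr.cat C.toPreDG).hom (cone ψ hψ) (E.shift 1)).d 0 1 rfl (coneSnd ψ hψ) = 0 :=
  MC.extend_snd _ _ _ _ _

/-- The embedding `C → Pre-Tr(C)`: `E_0 = X`, `e_{00} = 0`. -/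
noncomputable def incl (X : C.Obj) : PreTr C.toPreDG where
  obj :=
    { N := 0
      M := 0
      E := fun i => if i = 0 then X else C.zero
      id_eq_zero := fun i hi => by rw [if_neg (by omega)]; exact C.id_zero }
  e := 0
  maurer_cartan := by simp

end PreTr

/-! ### The pretriangulated DG category `C^pretr` and its homotopy category -/

/-- The objects of `C^pretr`: the smallest class of objects of `Pre-Tr(C)` containing the objects
of `C` and closed under translations and cones. -/
inductive DGCat.IsPretr (C : DGCat.{u, v}) : PreTr C.toPreDG → Prop
  | incl (X : C.Obj) : C.IsPretr (PreTr.incl X)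
  | shift (n : ℤ) {E : PreTr C.toPreDG} : C.IsPretr E → C.IsPretr (E.shift n)
  | cone {E F : PreTr C.toPreDG} (ψ : ((PreTr.cat C.toPreDG).hom E F).X 0)
      (hψ : ((PreTr.cat C.toPreDG).hom E F).d 0 1 rfl ψ = 0) :
      C.IsPretr E → C.IsPretr F → C.IsPretr (PreTr.cone ψ hψ)

namespace DGCat

variable (C : DGCat.{u, v})

/-- The DG category `C^pretr`. -/
noncomputable abbrev pretr : PreDG.{max u v, v} :=
  (PreTr.cat C.toPreDG).full C.IsPretr

/-- The category `K^b_dg(C) = H⁰ C^pretr`. -/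
abbrev Kb := Ho C.pretr

/-- The translation functor of `C^pretr`. -/
noncomputable def pretrShift (n : ℤ) : DGFun C.pretr C.pretr where
  obj E := ⟨PreTr.shift n E.1, .shift n E.2⟩
  map E F := (PreTr.shiftFun C.toPreDG n).map E.1 F.1
  map_id E := (PreTr.shiftFun C.toPreDG n).map_id E.1
  map_comp h f g := (PreTr.shiftFun C.toPreDG n).map_comp h f g

/-- The translation functor `E ↦ E[1]` of `K^b_dg(C)`. -/
noncomputable abbrev translation : C.Kb ⥤ C.Kb := (C.pretrShift 1).ho

variable {C}

/-- The cone of a closed morphism of degree zero of `C^pretr`. -/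
noncomputable def pretrCone {E F : C.pretr.Obj} (ψ : (C.pretr.hom E F).X 0)
    (hψ : (C.pretr.hom E F).d 0 1 rfl ψ = 0) : C.pretr.Obj :=
  ⟨PreTr.cone (E := E.1) (F := F.1) ψ hψ, .cone ψ hψ E.2 F.2⟩

/-- The distinguished triangles of `K^b_dg(C)`: the triangles isomorphic to the image of a cone
sequence `E → F → Cone(ψ) → E[1]`. -/
def dist {X Y Z : C.Kb} (f : X ⟶ Y) (g : Y ⟶ Z) (h : Z ⟶ C.translation.obj X) : Prop :=
  ∃ (E F : C.pretr.Obj) (ψ : (C.pretr.hom E F).X 0) (hψ : (C.pretr.hom E F).d 0 1 rfl ψ = 0)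
    (a : X ≅ (⟨E⟩ : C.Kb)) (b : Y ≅ (⟨F⟩ : C.Kb)) (c : Z ≅ (⟨pretrCone ψ hψ⟩ : C.Kb)),
    f ≫ b.hom = a.hom ≫ Ho.ofClosed ψ hψ ∧
    g ≫ c.hom = b.hom ≫ Ho.ofClosed (X := F) (Y := pretrCone ψ hψ)
      (PreTr.coneInl (E := E.1) (F := F.1) ψ hψ) (PreTr.d_coneInl (E := E.1) (F := F.1) ψ hψ) ∧
    h ≫ C.translation.map a.hom = c.hom ≫ Ho.ofClosed (X := pretrCone ψ hψ)
      (Y := (C.pretrShift 1).obj E)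
      (PreTr.coneSnd (E := E.1) (F := F.1) ψ hψ) (PreTr.d_coneSnd (E := E.1) (F := F.1) ψ hψ)

end DGCat

/-! ### The induced pseudo-tensor structure -/

namespace PreTr

variable {C : PreDG.{u, v}}

/-- The object `E_i`. -/
abbrev ob (E : PreTr C) (i : ℤ) : C.Obj := FinFam.E E.obj i

/-- The finite set of indices `N ≤ i ≤ M`. -/
noncomputable abbrev rng (E : PreTr C) : Finset ℤ := FinFam.rng E.obj

/-- The morphism `e_{ij} : E_j → E_i`. -/
def entry (E : PreTr C) (i j : ℤ) : (C.hom (ob E j) (ob E i)).X (1 + j - i) :=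
  (E.e : FinFam.Fam E.obj E.obj 1) i j

/-- The entry `E_j → E_i` of the identity of `E`: the identity if `i = j`, and zero otherwise. -/
noncomputable def idEntry (E : PreTr C) (i j : ℤ) : (C.hom (ob E j) (ob E i)).X (0 + j - i) :=
  ((FinFam.cat C).id E.obj : FinFam.Fam E.obj E.obj 0) i j

end PreTr

lemma sum_update {n : ℕ} (j : Fin n → ℤ) (i : Fin n) (l : ℤ) :
    ∑ a, Function.update j i l a = ∑ a, j a - j i + l := by
  rw [Finset.sum_update_of_mem (Finset.mem_univ i), Finset.sdiff_singleton_eq_erase,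
    ← Finset.add_sum_erase _ j (Finset.mem_univ i)]
  ring

namespace PT

variable {C : PreDG.{u, v}} (P : PT C)

/-- The elements of degree `N` of `P^pretr({E^i}, F)`: families
`φ k j ∈ P({E^i_{j_i}}, F_k)` of elements of degree `N - k + ∑ i, j_i`. -/
abbrev TFam {n : ℕ} (E : Fin (n + 1) → PreTr C) (F : PreTr C) (N : ℤ) : Type v :=
  ∀ (k : ℤ) (j : Fin (n + 1) → ℤ), (P.P n (fun i => PreTr.ob (E i) (j i)) (PreTr.ob F k)).X (N + ∑ i, j i - k)

/-- The `b`-th member of the family `(id, …, id, e^i_{l,j_i}, id, …, id)`, with `e^i_{l,j_i}` in the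
`i`-th place. -/
noncomputable def slot {n : ℕ} (E : Fin (n + 1) → PreTr C) (j : Fin (n + 1) → ℤ) (i : Fin (n + 1))
    (l : ℤ) (b : Fin (n + 1)) :
    (P.P 0 (fun _ => PreTr.ob (E b) (j b)) (PreTr.ob (E b) (Function.update j i l b))).X
      (if b = i then j i - l + 1 else 0) :=
  if h : b = i then
    P.one (X := fun _ => PreTr.ob (E b) (j b)) ((C.hom _ _).cast (by subst h; simp; ring)
      (PreTr.entry (E b) (Function.update j i l b) (j b)))
  else
    P.one (X := fun _ => PreTr.ob (E b) (j b)) ((C.hom _ _).cast (by simp [h])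
      (PreTr.idEntry (E b) (Function.update j i l b) (j b)))

/-- The exponent `s(i, j, l)` of the sign in the differential. -/
def sgnD {n : ℕ} (j : Fin (n + 1) → ℤ) (i : Fin (n + 1)) (l : ℤ) : ℤ :=
  (∑ a with a < i, j a) + (j i - l + 1) * ∑ a with i < a, j a

/-- The element `φ_{k, (j_0, …, l, …, j_n)}(id, …, e^i_{l,j_i}, …, id)`, with `l` in the `i`-th
place. -/
noncomputable def subst {n : ℕ} {E : Fin (n + 1) → PreTr C} {F : PreTr C} {a b : ℤ} (h : a + 1 = b)
    (φ : P.TFam E F a) (k : ℤ) (j : Fin (n + 1) → ℤ) (i : Fin (n + 1)) (l : ℤ) :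
    (P.P n (fun i => PreTr.ob (E i) (j i)) (PreTr.ob F k)).X (b + ∑ i, j i - k) :=
  P.comp (FinSurj.refl n) (X' := fun i _ => PreTr.ob (E i) (j i)) (fun _ _ => rfl)
    (by rw [sum_update, Finset.sum_ite_eq' Finset.univ i, if_pos (Finset.mem_univ i)]; omega)
    (φ k (Function.update j i l)) (P.slot E j i l)

/-- The differential of `P^pretr({E^i}, F)`:
`(∂ φ)_{k,j} = (-1)^k d φ_{k,j} + ∑ l, f_{kl}(φ_{l,j})
  - (-1)^N ∑ i, ∑ l, (-1)^(s(i,j,l)) φ_{k,(j_0,…,l,…,j_n)}(id, …, e^i_{l,j_i}, …, id)`. -/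
noncomputable def tDel {n : ℕ} (E : Fin (n + 1) → PreTr C) (F : PreTr C) (a b : ℤ) (h : a + 1 = b) :
    P.TFam E F a →+ P.TFam E F b :=
  AddMonoidHom.mk' (fun φ k j =>
      k.negOnePow • (P.P n _ _).d _ _ (by omega) (φ k j) +
      ∑ l ∈ PreTr.rng F, P.act (by omega) (PreTr.entry F k l) (φ l j) -
      a.negOnePow • ∑ i, ∑ l ∈ PreTr.rng (E i), (sgnD j i l).negOnePow • P.subst h φ k j i l)
    (fun φ ψ => by
      funext k j
      simp only [Pi.add_apply, map_add, P.act_add_right, subst, P.lawful.comp_add_left,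
        Finset.sum_add_distrib, smul_add]
      abel)

/-- The exponent of the sign in the composition,
`∑ p, ∑ i < p, (j_p (q_i - j_i + K_i) + K_i q_p)` with `K_i` the sum of the `t_a` with `π a = i`,
together with the Koszul sign of the permutation which groups the `t_a` according to the fibres of
`π` (it is trivial if `π` is monotone). -/
def sgnC {m n : ℕ} {κ : Fin (n + 1) → ℕ} (π : FinSurj m n κ) (q j : Fin (n + 1) → ℤ)
    (t : Fin (m + 1) → ℤ) : ℤ :=
  (∑ p, ∑ i with i < p, (j p * (q i - j i + ∑ a, t (π.emb i a)) + (∑ a, t (π.emb i a)) * q p)) +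
    ∑ b, ∑ a with a < b ∧ π.map b < π.map a, t a * t b

/-- The pseudo-tensor structure on `Pre-Tr(C)` induced by a pseudo-tensor structure on `C`. -/
noncomputable def preTrData : PTData (PreTr.cat C) where
  P n E F :=
    { X := P.TFam E F
      d := P.tDel E F }
  one := fun {X Y a} =>
    AddMonoidHom.mk' (fun (φ : FinFam.Fam (MC.obj (X 0)) (MC.obj Y) a) k j =>
      P.one (X := fun i => PreTr.ob (X i) (j i)) ((C.hom _ _).cast (by simp) (φ k (j 0))))
      (fun φ ψ => by
        funext k j
        exact (congrArg _ (map_add _ _ _)).trans (map_add _ _ _))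
  comp := fun {m n κ} π {X X'} hX {Y Z p r q} h φ ψ k t =>
    ∑ j ∈ Fintype.piFinset (fun i => PreTr.rng (Y i)), (sgnC π q j t).negOnePow •
      P.comp π (X := fun b => PreTr.ob (X b) (t b))
        (X' := fun i a => PreTr.ob (X' i a) (t (π.emb i a))) (fun i a => by rw [hX])
        (by
          rw [Finset.sum_sub_distrib, Finset.sum_add_distrib, π.sum_fibres t]
          omega)
        (φ k j) (fun i => ψ i (j i) (fun a => t (π.emb i a)))

end PT

/-- The restriction of a pseudo-tensor structure to a full DG subcategory. -/
def PTData.full {C : PreDG.{u, v}} (D : PTData C) (p : C.Obj → Prop) : PTData (C.full p) where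
  P n X Y := D.P n (fun i => (X i).1) Y.1
  one := fun {X} => D.one (X := fun i => (X i).1)
  comp π _ _ hX _ _ _ _ _ h f g := D.comp π (fun i a => congrArg Subtype.val (hX i a)) h f g

/-- The pseudo-tensor structure on `C^pretr` induced by a pseudo-tensor structure on `C`. -/
noncomputable def DGCat.pretrData (C : DGCat.{u, v}) (P : PT C.toPreDG) : PTData C.pretr :=
  P.preTrData.full C.IsPretr

end DGTensor

namespace DGTensor

namespace PreDG

variable {C : PreDG.{u, v}}

/-- The differential of the `i`-th member of a family of morphisms. -/
def dAtHom {n : ℕ} {X Y : Fin (n + 1) → C.Obj} {δ : Fin (n + 1) → ℤ}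
    (a : ∀ b, (C.hom (X b) (Y b)).X (δ b)) (i b : Fin (n + 1)) :
    (C.hom (X b) (Y b)).X (δ b + if b = i then 1 else 0) :=
  if h : b = i then (C.hom (X b) (Y b)).d _ _ (by simp [h]) (a b)
  else (C.hom (X b) (Y b)).cast (by simp [h]) (a b)

end PreDG

lemma koszul_of_right_eq_zero {m n : ℕ} (π : Fin (m + 1) → Fin (n + 1)) (q : Fin (n + 1) → ℤ)
    {t : Fin (m + 1) → ℤ} (ht : ∀ b, t b = 0) : koszul π q t = 0 := by
  simp [koszul, ht]

lemma koszul_toOne {m : ℕ} (q : Fin 1 → ℤ) (t : Fin (m + 1) → ℤ) :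
    koszul (FinSurj.toOne m).map q t = 0 := by
  simp [koszul]

lemma koszul_refl {n : ℕ} (q t : Fin (n + 1) → ℤ) :
    koszul (FinSurj.refl n).map q t = ∑ i, ∑ j with j < i, t j * q i := by
  unfold koszul
  rw [Finset.sum_eq_zero (s := Finset.univ) (f := fun b => ∑ a with a < b ∧ _, t a * t b), add_zero]
  intro b _
  refine Finset.sum_eq_zero fun a ha => ?_
  simp only [Finset.mem_filter, Finset.mem_univ, true_and] at ha
  exact absurd ha.1 (not_lt.2 ha.2.le)

namespace PT

variable {C : PreDG.{u, v}} (D : PT C)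

section multilinear

variable {m n : ℕ} {k : Fin (n + 1) → ℕ} (π : FinSurj m n k) {X : Fin (m + 1) → C.Obj}
  {X' : ∀ i, Fin (k i + 1) → C.Obj} (hX : ∀ i a, X' i a = X (π.emb i a))
  {Y : Fin (n + 1) → C.Obj} {Z : C.Obj} {p r : ℤ} {q : Fin (n + 1) → ℤ}

/-- Composition as a multilinear map in its right arguments. -/
def compML (h : p + ∑ i, q i = r) (f : (D.P n Y Z).X p) :
    MultilinearMap ℤ (fun i => (D.P (k i) (X' i) (Y i)).X (q i)) ((D.P m X Z).X r) where
  toFun := D.comp π hX h f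
  map_update_add' g i x y := by
    convert D.lawful.comp_add_right π hX h f g i x y
  map_update_smul' := by
    intro inst g i c x
    obtain rfl : inst = instDecidableEqFin _ := Subsingleton.elim _ _
    have := map_zsmul (AddMonoidHom.mk' (fun x => D.comp π hX h f (Function.update g i x))
      (D.lawful.comp_add_right π hX h f g i)) c x
    exact this

/-- Composition as an additive map in its left argument. -/
def compL (h : p + ∑ i, q i = r) (g : ∀ i, (D.P (k i) (X' i) (Y i)).X (q i)) :
    (D.P n Y Z).X p →+ (D.P m X Z).X r :=
  AddMonoidHom.mk' (fun f => D.comp π hX h f g) (fun f f' => D.lawful.comp_add_left π hX h f f' g)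

variable {π hX}

lemma comp_sum_left (h : p + ∑ i, q i = r) {ι : Type*} (s : Finset ι) (f : ι → (D.P n Y Z).X p)
    (g : ∀ i, (D.P (k i) (X' i) (Y i)).X (q i)) :
    D.comp π hX h (∑ x ∈ s, f x) g = ∑ x ∈ s, D.comp π hX h (f x) g :=
  map_sum (D.compL π hX h g) f s

lemma comp_sub_left (h : p + ∑ i, q i = r) (f f' : (D.P n Y Z).X p)
    (g : ∀ i, (D.P (k i) (X' i) (Y i)).X (q i)) :
    D.comp π hX h (f - f') g = D.comp π hX h f g - D.comp π hX h f' g :=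
  map_sub (D.compL π hX h g) f f'

lemma comp_smul_left (h : p + ∑ i, q i = r) (c : ℤ) (f : (D.P n Y Z).X p)
    (g : ∀ i, (D.P (k i) (X' i) (Y i)).X (q i)) :
    D.comp π hX h (c.negOnePow • f) g = c.negOnePow • D.comp π hX h f g :=
  map_negOnePow (D.compL π hX h g) c f

lemma comp_smul_right (h : p + ∑ i, q i = r) (f : (D.P n Y Z).X p) (c : Fin (n + 1) → ℤ)
    (g : ∀ i, (D.P (k i) (X' i) (Y i)).X (q i)) :
    D.comp π hX h f (fun i => (c i).negOnePow • g i) =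
      (∑ i, c i).negOnePow • D.comp π hX h f g := by
  have := (D.compML π hX h f).map_smul_univ (fun i => (((c i).negOnePow : ℤˣ) : ℤ)) g
  have e : ((∏ i, (c i).negOnePow : ℤˣ)) = (∑ i, c i).negOnePow := by
    have h2 := map_prod (zpowersHom ℤˣ (-1)) (fun i => Multiplicative.ofAdd (c i)) Finset.univ
    rw [← ofAdd_sum] at h2
    exact h2.symm
  rw [← e]
  refine this.trans ?_
  rw [Units.smul_def, Units.coe_prod]
  rfl

lemma comp_sum_right (h : p + ∑ i, q i = r) (f : (D.P n Y Z).X p) {α : Fin (n + 1) → Type}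
    (A : ∀ i, Finset (α i)) (g : ∀ i, α i → (D.P (k i) (X' i) (Y i)).X (q i)) :
    D.comp π hX h f (fun i => ∑ x ∈ A i, g i x) =
      ∑ x ∈ Fintype.piFinset A, D.comp π hX h f (fun i => g i (x i)) := by
  exact (D.compML π hX h f).map_sum_finset g A

lemma comp_add_of (h : p + ∑ i, q i = r) (f : (D.P n Y Z).X p)
    {g g' g'' : ∀ i, (D.P (k i) (X' i) (Y i)).X (q i)} (i : Fin (n + 1))
    (hi : g'' i = g i + g' i) (h₁ : ∀ j, j ≠ i → g j = g'' j) (h₂ : ∀ j, j ≠ i → g' j = g'' j) :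
    D.comp π hX h f g'' = D.comp π hX h f g + D.comp π hX h f g' := by
  have e : g'' = Function.update g'' i (g i + g' i) := by rw [← hi, Function.update_eq_self]
  have e₁ : g = Function.update g'' i (g i) := by
    funext j
    by_cases hj : j = i
    · subst hj; simp
    · rw [Function.update_of_ne hj, h₁ j hj]
  have e₂ : g' = Function.update g'' i (g' i) := by
    funext j
    by_cases hj : j = i
    · subst hj; simp
    · rw [Function.update_of_ne hj, h₂ j hj]
  conv_lhs => rw [e]
  rw [D.lawful.comp_add_right, ← e₁, ← e₂]

lemma comp_neg_of (h : p + ∑ i, q i = r) (f : (D.P n Y Z).X p)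
    {g g' : ∀ i, (D.P (k i) (X' i) (Y i)).X (q i)} (i : Fin (n + 1))
    (hi : g' i = - g i) (h₁ : ∀ j, j ≠ i → g' j = g j) :
    D.comp π hX h f g' = - D.comp π hX h f g := by
  have := D.comp_add_of (π := π) (hX := hX) h f (g := g) (g' := g')
    (g'' := Function.update g i 0) i (by simp [hi]) (fun j hj => by simp [hj])
    (fun j hj => by simp [hj, h₁])
  rw [D.comp_zero_right π hX h f _ i (by simp)] at this
  exact eq_neg_of_add_eq_zero_right this.symm

end multilinear

lemma one_dAtHom {n : ℕ} {X Y : Fin (n + 1) → C.Obj} {δ : Fin (n + 1) → ℤ}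
    (a : ∀ b, (C.hom (X b) (Y b)).X (δ b)) (i b : Fin (n + 1)) :
    D.one (X := fun _ => X b) (C.dAtHom a i b) =
      D.dAt (k := fun _ => 0) (X := fun b _ => X b) (Y := Y)
        (fun b => D.one (X := fun _ => X b) (a b)) i b := by
  unfold PreDG.dAtHom PTData.dAt
  split_ifs with h
  · exact D.lawful.one_d _ _
  · have : ∀ {c c' : ℤ} (e : c = c') (x : (C.hom (X b) (Y b)).X c),
        D.one (X := fun _ => X b) ((C.hom (X b) (Y b)).cast e x) =
          (D.P 0 (fun _ => X b) (Y b)).cast e (D.one (X := fun _ => X b) x) := by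
      intro c c' e x; subst e; rfl
    exact this _ _

/-- Substitution of morphisms `a_b : X'_b → X_b` into an element of `P({X_b}, Z)`. -/
def pull {n : ℕ} {X X' : Fin (n + 1) → C.Obj} {Z : C.Obj} {p r : ℤ} {δ : Fin (n + 1) → ℤ}
    (h : p + ∑ i, δ i = r) (a : ∀ b, (C.hom (X' b) (X b)).X (δ b)) :
    (D.P n X Z).X p →+ (D.P n X' Z).X r :=
  D.compL (FinSurj.refl n) (X' := fun i _ => X' i) (fun _ _ => rfl) h
    (fun b => D.one (X := fun _ => X' b) (a b))

section pull

variable {n : ℕ} {X X' X'' : Fin (n + 1) → C.Obj} {Z Z' : C.Obj} {p r : ℤ}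
  {δ δ' : Fin (n + 1) → ℤ}

lemma pull_eq (h : p + ∑ i, δ i = r) (a : ∀ b, (C.hom (X' b) (X b)).X (δ b))
    (f : (D.P n X Z).X p) : D.pull h a f =
      D.comp (FinSurj.refl n) (X' := fun i _ => X' i) (fun _ _ => rfl) h f
        (fun b => D.one (X := fun _ => X' b) (a b)) := rfl

lemma pull_congr (h : p + ∑ i, δ i = r) (a : ∀ b, (C.hom (X' b) (X b)).X (δ b))
    (h' : p + ∑ i, δ' i = r) (a' : ∀ b, (C.hom (X' b) (X b)).X (δ' b))
    (e : ∀ b, ∃ e : δ b = δ' b, (C.hom _ _).cast e (a b) = a' b) (f : (D.P n X Z).X p) :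
    D.pull h a f = D.pull h' a' f := by
  obtain rfl : δ = δ' := funext fun b => (e b).1
  obtain rfl : a = a' := funext fun b => (e b).2
  rfl

lemma pull_id (h : p + ∑ _i : Fin (n + 1), (0 : ℤ) = r) (h' : p = r) (f : (D.P n X Z).X p) :
    D.pull h (fun b => C.id (X b)) f = (D.P n X Z).cast h' f := by
  subst h'
  exact D.lawful.comp_id f

lemma pull_pull {r' : ℤ} (h : p + ∑ i, δ i = r) (h' : r + ∑ i, δ' i = r')
    (a : ∀ b, (C.hom (X' b) (X b)).X (δ b)) (a' : ∀ b, (C.hom (X'' b) (X' b)).X (δ' b))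
    {δ'' : Fin (n + 1) → ℤ} (hδ : ∀ i, δ i + δ' i = δ'' i) (h'' : p + ∑ i, δ'' i = r')
    (f : (D.P n X Z).X p) :
    D.pull h'' (fun b => C.comp (hδ b) (a b) (a' b)) f =
      (∑ i, ∑ j with j < i, δ' j * δ i).negOnePow • D.pull h' a' (D.pull h a f) := by
  have := D.lawful.assoc (FinSurj.refl n) (FinSurj.refl n) (FinSurj.refl n)
    (fun _ => FinSurj.toOne 0) (fun _ _ _ => rfl) (W := X'') (X := X') (Y := X) (Z := Z)
    h h' (u := δ'') (fun i => by simpa using hδ i) h'' f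
    (fun b => D.one (X := fun _ => X' b) (a b)) (fun b => D.one (X := fun _ => X'' b) (a' b))
  rw [koszul_refl] at this
  refine Eq.trans ?_ this
  simp only [pull_eq]
  congr 1
  funext b
  exact D.lawful.one_comp (X := fun _ => X'' b) (Y := fun _ => X' b) (hδ b) (a b) (fun _ => a' b)

lemma pull_pull_of_zero {r' : ℤ} (h : p + ∑ i, δ i = r) (h' : r + ∑ i, δ' i = r')
    (a : ∀ b, (C.hom (X' b) (X b)).X (δ b)) (a' : ∀ b, (C.hom (X'' b) (X' b)).X (δ' b))
    {δ'' : Fin (n + 1) → ℤ} (hδ : ∀ i, δ i + δ' i = δ'' i) (h'' : p + ∑ i, δ'' i = r')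
    (hz : ∀ i j, j < i → δ' j * δ i = 0)
    (f : (D.P n X Z).X p) :
    D.pull h' a' (D.pull h a f) = D.pull h'' (fun b => C.comp (hδ b) (a b) (a' b)) f := by
  rw [D.pull_pull h h' a a' hδ h'', Finset.sum_eq_zero]
  · simp
  · intro i _
    refine Finset.sum_eq_zero fun j hj => hz i j ?_
    simpa using hj

/-- `d` of a substitution. -/
lemma d_pull {p' r' : ℤ} (h : p + ∑ i, δ i = r) (hp : p + 1 = p') (hr : r + 1 = r')
    (a : ∀ b, (C.hom (X' b) (X b)).X (δ b)) (f : (D.P n X Z).X p) :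
    (D.P n X' Z).d r r' hr (D.pull h a f) =
      D.pull (by omega) a ((D.P n X Z).d p p' hp f) +
        ∑ i, (p + ∑ j with j < i, δ j).negOnePow •
          D.pull (by rw [Finset.sum_add_distrib]; simp; omega) (C.dAtHom a i) f := by
  simp only [pull_eq]
  rw [D.lawful.leibniz _ _ h hp hr]
  congr 1
  refine Finset.sum_congr rfl fun i _ => ?_
  congr 2
  funext b
  exact (D.one_dAtHom a i b).symm

lemma pull_eq_zero (h : p + ∑ i, δ i = r) (a : ∀ b, (C.hom (X' b) (X b)).X (δ b)) (i : Fin (n + 1))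
    (hi : a i = 0) (f : (D.P n X Z).X p) : D.pull h a f = 0 :=
  D.comp_zero_right _ _ _ _ _ i (by simp only [hi, map_zero])

lemma pull_add_of (h : p + ∑ i, δ i = r) {a a' a'' : ∀ b, (C.hom (X' b) (X b)).X (δ b)}
    (i : Fin (n + 1)) (hi : a'' i = a i + a' i) (h₁ : ∀ j, j ≠ i → a j = a'' j)
    (h₂ : ∀ j, j ≠ i → a' j = a'' j) (f : (D.P n X Z).X p) :
    D.pull h a'' f = D.pull h a f + D.pull h a' f :=
  D.comp_add_of _ _ i (by simp only [hi, map_add]) (fun j hj => by simp only [h₁ j hj])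
    (fun j hj => by simp only [h₂ j hj])

lemma pull_neg_of (h : p + ∑ i, δ i = r) {a a' : ∀ b, (C.hom (X' b) (X b)).X (δ b)}
    (i : Fin (n + 1)) (hi : a' i = - a i) (h₁ : ∀ j, j ≠ i → a' j = a j) (f : (D.P n X Z).X p) :
    D.pull h a' f = - D.pull h a f :=
  D.comp_neg_of _ _ i (by simp only [hi, map_neg]) (fun j hj => by simp only [h₁ j hj])

lemma dAtHom_eq_zero (a : ∀ b, (C.hom (X' b) (X b)).X (δ b)) (i : Fin (n + 1))
    (hi : (C.hom (X' i) (X i)).d (δ i) (δ i + 1) rfl (a i) = 0) : C.dAtHom a i i = 0 := by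
  have := congrArg ((C.hom (X' i) (X i)).cast
    (show δ i + 1 = δ i + if i = i then 1 else 0 by simp)) hi
  rw [PreCx.cast_d, map_zero] at this
  rw [PreDG.dAtHom, dif_pos rfl, this]

lemma d_pull_of_closed {p' r' : ℤ} (h : p + ∑ i, δ i = r) (hp : p + 1 = p') (hr : r + 1 = r')
    (a : ∀ b, (C.hom (X' b) (X b)).X (δ b))
    (ha : ∀ i, (C.hom (X' i) (X i)).d (δ i) (δ i + 1) rfl (a i) = 0) (f : (D.P n X Z).X p) :
    (D.P n X' Z).d r r' hr (D.pull h a f) = D.pull (by omega) a ((D.P n X Z).d p p' hp f) := by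
  rw [D.d_pull h hp hr]
  refine (congrArg _ (Finset.sum_eq_zero fun i _ => ?_)).trans (add_zero _)
  rw [D.pull_eq_zero _ _ i (dAtHom_eq_zero a i (ha i)), smul_zero]

lemma d_pull_of_ne {p' r' : ℤ} (h : p + ∑ i, δ i = r) (hp : p + 1 = p') (hr : r + 1 = r')
    (a : ∀ b, (C.hom (X' b) (X b)).X (δ b)) (i : Fin (n + 1))
    (ha : ∀ j, j ≠ i → (C.hom (X' j) (X j)).d (δ j) (δ j + 1) rfl (a j) = 0)
    (f : (D.P n X Z).X p) :
    (D.P n X' Z).d r r' hr (D.pull h a f) =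
      D.pull (by omega) a ((D.P n X Z).d p p' hp f) +
        (p + ∑ j with j < i, δ j).negOnePow •
          D.pull (by rw [Finset.sum_add_distrib]; simp; omega) (C.dAtHom a i) f := by
  rw [D.d_pull h hp hr]
  refine congrArg _ (Finset.sum_eq_single i ?_ ?_)
  · intro j _ hj
    rw [D.pull_eq_zero _ _ j (dAtHom_eq_zero a j (ha j hj)), smul_zero]
  · simp

end pull

section assoc

variable {m n : ℕ} {k : Fin (n + 1) → ℕ} (π : FinSurj m n k) {X : Fin (m + 1) → C.Obj}
  {Y : Fin (n + 1) → C.Obj} {Z : C.Obj} {p r : ℤ} {q : Fin (n + 1) → ℤ}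

lemma act_comp {Z' : C.Obj} {a b c : ℤ} (h : p + ∑ i, q i = b) (h₁ : a + b = c) (h₂ : a + p = r)
    (h₃ : r + ∑ i, q i = c) (e : (C.hom Z Z').X a) (f : (D.P n Y Z).X p)
    (g : ∀ i, (D.P (k i) (fun a => X (π.emb i a)) (Y i)).X (q i)) :
    D.act h₁ e (D.comp π (fun _ _ => rfl) h f g) =
      D.comp π (fun _ _ => rfl) h₃ (D.act h₂ e f) g := by
  have := D.lawful.assoc (FinSurj.toOne n) π (FinSurj.toOne m) (fun _ => π) (fun _ _ _ => rfl)
    (W := X) (X := Y) (Y := fun _ => Z) (Z := Z') (p := a) (r := r) (N := c) (q := fun _ => p)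
    (u := fun _ => b) (t := q) (by simpa) h₃ (fun _ => h) (by simpa) (D.one e) (fun _ => f) g
  rw [koszul_toOne] at this
  exact this.trans (one_smul _ _)

lemma act_pull {n : ℕ} {X X' : Fin (n + 1) → C.Obj} {Z Z' : C.Obj} {p r a b c : ℤ}
    {δ : Fin (n + 1) → ℤ} (h : p + ∑ i, δ i = b) (h₁ : a + b = c) (h₂ : a + p = r)
    (h₃ : r + ∑ i, δ i = c) (e : (C.hom Z Z').X a) (g : ∀ b, (C.hom (X' b) (X b)).X (δ b))
    (f : (D.P n X Z).X p) :
    D.act h₁ e (D.pull h g f) = D.pull h₃ g (D.act h₂ e f) :=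
  D.act_comp (FinSurj.refl n) h h₁ h₂ h₃ e f _

lemma comp_pull {Y' : Fin (n + 1) → C.Obj} {δ u : Fin (n + 1) → ℤ} {N : ℤ}
    (h : p + ∑ i, δ i = r) (h₂ : r + ∑ i, q i = N) (h₃ : ∀ i, δ i + q i = u i)
    (h₄ : p + ∑ i, u i = N) (a : ∀ i, (C.hom (Y i) (Y' i)).X (δ i)) (f : (D.P n Y' Z).X p)
    (g : ∀ i, (D.P (k i) (fun a => X (π.emb i a)) (Y i)).X (q i)) :
    D.comp π (X := X) (fun _ _ => rfl) h₄ f (fun i => D.act (h₃ i) (a i) (g i)) =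
      (∑ i, ∑ j with j < i, q j * δ i).negOnePow •
        D.comp π (X := X) (fun _ _ => rfl) h₂ (D.pull h a f) g := by
  have := D.lawful.assoc (FinSurj.refl n) π π (fun i => FinSurj.toOne (k i)) (fun _ _ _ => rfl)
    (W := X) (X := Y) (Y := Y') (Z := Z) (q := δ) (t := q) (u := u) h h₂ (by simpa) h₄ f
    (fun i => D.one (X := fun _ => Y i) (a i)) g
  rw [koszul_refl] at this
  exact this

lemma pull_comp {X' : Fin (m + 1) → C.Obj} {t : Fin (m + 1) → ℤ} {u : Fin (n + 1) → ℤ} {N : ℤ}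
    (h : p + ∑ i, q i = r) (h₂ : r + ∑ i, t i = N) (h₃ : ∀ i, q i + ∑ a, t (π.emb i a) = u i)
    (h₄ : p + ∑ i, u i = N) (a : ∀ b, (C.hom (X' b) (X b)).X (t b)) (f : (D.P n Y Z).X p)
    (g : ∀ i, (D.P (k i) (fun a => X (π.emb i a)) (Y i)).X (q i)) :
    D.comp π (X := X') (fun _ _ => rfl) h₄ f
        (fun i => D.pull (h₃ i) (fun b => a (π.emb i b)) (g i)) =
      (koszul π.map q t).negOnePow •
        D.pull h₂ a (D.comp π (X := X) (fun _ _ => rfl) h f g) :=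
  D.lawful.assoc π (FinSurj.refl m) π (fun i => FinSurj.refl (k i)) (fun _ _ _ => rfl)
    h h₂ h₃ h₄ f g (fun b => D.one (X := fun _ => X' b) (a b))

end assoc

end PT

lemma FinSurj.ext_map {m n : ℕ} {k : Fin (n + 1) → ℕ} {π π' : FinSurj m n k}
    (h : π.map = π'.map) : π = π' := by
  obtain ⟨f, e, he, hr⟩ := π
  obtain ⟨f', e', he', hr'⟩ := π'
  obtain rfl : f = f' := h
  obtain rfl : e = e' := funext fun i =>
    (StrictMono.range_inj (he i) (he' i)).1 ((hr i).trans (hr' i).symm)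
  rfl

lemma FinSurj.refl_zero : FinSurj.refl 0 = FinSurj.toOne 0 :=
  FinSurj.ext_map (funext fun _ => Subsingleton.elim (α := Fin 1) _ _)

lemma FinSurj.map_emb {m n : ℕ} {k : Fin (n + 1) → ℕ} (π : FinSurj m n k) (i : Fin (n + 1))
    (a : Fin (k i + 1)) : π.map (π.emb i a) = i := by
  have : π.emb i a ∈ π.map ⁻¹' {i} := π.range_emb i ▸ ⟨a, rfl⟩
  exact this

lemma FinSurj.emb_injective {m n : ℕ} {k : Fin (n + 1) → ℕ} (π : FinSurj m n k) (i : Fin (n + 1)) :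
    Function.Injective (π.emb i) := (π.strictMono i).injective

lemma FinSurj.exists_emb {m n : ℕ} {k : Fin (n + 1) → ℕ} (π : FinSurj m n k) (b : Fin (m + 1)) :
    ∃ i a, π.emb i a = b := by
  have : b ∈ Set.range (π.emb (π.map b)) := by rw [π.range_emb]; rfl
  obtain ⟨a, ha⟩ := this
  exact ⟨_, a, ha⟩

lemma sum_sum_eq_sum_diag {ι M : Type*} [Fintype ι] [DecidableEq ι] [AddCommGroup M]
    (T : ι → ι → M) (h : ∀ i j, i ≠ j → T i j + T j i = 0) : ∑ i, ∑ j, T i j = ∑ i, T i i := by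
  rw [← Finset.sum_product', Finset.univ_product_univ]
  have h1 := Finset.sum_filter_add_sum_filter_not (Finset.univ : Finset (ι × ι))
    (fun x => x.1 = x.2) (fun x => T x.1 x.2)
  rw [← h1]
  have h2 : ∑ x : ι × ι with ¬ x.1 = x.2, T x.1 x.2 = 0 := by
    refine Finset.sum_involution (fun x _ => (x.2, x.1)) ?_ ?_ ?_ ?_
    · intro x hx
      exact h _ _ (by simpa using hx)
    · intro x hx _ e
      simp only [Finset.mem_filter, Finset.mem_univ, true_and] at hx
      exact hx (congrArg Prod.snd e)
    · intro x hx
      simp only [Finset.mem_filter, Finset.mem_univ, true_and] at hx ⊢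
      exact fun e => hx e.symm
    · intros; rfl
  rw [h2, add_zero]
  refine Finset.sum_bij' (fun x _ => x.1) (fun i _ => (i, i)) ?_ ?_ ?_ ?_ ?_
  · simp
  · simp
  · rintro ⟨x, y⟩ hx; simp at hx; simp [hx]
  · simp
  · rintro ⟨x, y⟩ hx; simp at hx; simp [hx]

namespace PTData

variable {C : PreDG.{u, v}} (D : PTData C)

/-- The family `g` with the `i`-th member replaced by an element of degree one higher. -/
def modAt {n : ℕ} {k : Fin (n + 1) → ℕ} {X : ∀ i, Fin (k i + 1) → C.Obj} {Y : Fin (n + 1) → C.Obj}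
    {q : Fin (n + 1) → ℤ} (g : ∀ i, (D.P (k i) (X i) (Y i)).X (q i)) (i : Fin (n + 1))
    (x : (D.P (k i) (X i) (Y i)).X (q i + 1)) (j : Fin (n + 1)) :
    (D.P (k j) (X j) (Y j)).X (q j + if j = i then 1 else 0) :=
  if h : j = i then (D.P (k j) (X j) (Y j)).cast (by simp [h]) (h ▸ x)
  else (D.P (k j) (X j) (Y j)).cast (by simp [h]) (g j)

lemma dAt_eq_modAt {n : ℕ} {k : Fin (n + 1) → ℕ} {X : ∀ i, Fin (k i + 1) → C.Obj}
    {Y : Fin (n + 1) → C.Obj} {q : Fin (n + 1) → ℤ} (g : ∀ i, (D.P (k i) (X i) (Y i)).X (q i))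
    (i : Fin (n + 1)) : D.dAt g i = D.modAt g i ((D.P (k i) (X i) (Y i)).d _ _ rfl (g i)) := by
  funext j
  unfold dAt modAt
  split_ifs with h
  · subst h
    rw [PreCx.cast_d]
  · rfl

lemma comp_congr {m n : ℕ} {k : Fin (n + 1) → ℕ} (π : FinSurj m n k) {X : Fin (m + 1) → C.Obj}
    {X' : ∀ i, Fin (k i + 1) → C.Obj} (hX : ∀ i a, X' i a = X (π.emb i a))
    {Y : Fin (n + 1) → C.Obj} {Z : C.Obj} {p r : ℤ} {q q' : Fin (n + 1) → ℤ} (h : p + ∑ i, q i = r)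
    (h' : p + ∑ i, q' i = r)
    (f : (D.P n Y Z).X p) (g : ∀ i, (D.P (k i) (X' i) (Y i)).X (q i))
    (g' : ∀ i, (D.P (k i) (X' i) (Y i)).X (q' i))
    (e : ∀ i, ∃ e : q i = q' i, (D.P (k i) (X' i) (Y i)).cast e (g i) = g' i) :
    D.comp π hX h f g = D.comp π hX h' f g' := by
  obtain rfl : q = q' := funext fun b => (e b).1
  obtain rfl : g = g' := funext fun b => (e b).2
  rfl

lemma comp_congr_surj {m n : ℕ} {k : Fin (n + 1) → ℕ} {π π' : FinSurj m n k} (e : π = π')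
    {X : Fin (m + 1) → C.Obj}
    {X' : ∀ i, Fin (k i + 1) → C.Obj} {hX : ∀ i a, X' i a = X (π.emb i a)}
    (hX' : ∀ i a, X' i a = X (π'.emb i a))
    {Y : Fin (n + 1) → C.Obj} {Z : C.Obj} {p r : ℤ} {q : Fin (n + 1) → ℤ} (h : p + ∑ i, q i = r)
    (f : (D.P n Y Z).X p) (g : ∀ i, (D.P (k i) (X' i) (Y i)).X (q i)) :
    D.comp π hX h f g = D.comp π' hX' h f g := by
  subst e; rfl

end PTData

/-- The endomorphism `e` if `c` holds, and the identity otherwise. -/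
def PreDG.iteEnd {C : PreDG.{u, v}} (c : Prop) [inst : Decidable c] {E : C.Obj} {d : ℤ}
    (e : (C.hom E E).X d) : (C.hom E E).X (if c then d else 0) :=
  match inst with
  | isTrue _ => e
  | isFalse _ => C.id E

lemma PreDG.iteEnd_true {C : PreDG.{u, v}} {c : Prop} [inst : Decidable c] (hc : c) {E : C.Obj}
    {d : ℤ} (e : (C.hom E E).X d) : C.iteEnd c e = (C.hom E E).cast (by simp [hc]) e := by
  obtain rfl : inst = isTrue hc := Subsingleton.elim _ _
  rfl

lemma PreDG.iteEnd_false {C : PreDG.{u, v}} {c : Prop} [inst : Decidable c] (hc : ¬ c) {E : C.Obj}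
    {d : ℤ} (e : (C.hom E E).X d) :
    C.iteEnd c e = (C.hom E E).cast (by simp [hc]) (C.id E) := by
  obtain rfl : inst = isFalse hc := Subsingleton.elim _ _
  rfl

lemma PreDG.d_iteEnd {C : PreDG.{u, v}} {c : Prop} [inst : Decidable c] (hc : ¬ c) {E : C.Obj}
    {d : ℤ} (e : (C.hom E E).X d) (h) :
    (C.hom E E).d (if c then d else 0) ((if c then d else 0) + 1) h (C.iteEnd c e) = 0 := by
  obtain rfl : inst = isFalse hc := Subsingleton.elim _ _
  exact C.d_id E

namespace PT

variable {A : PreDG.{u, v}} (D : PT A)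

section

variable {m n : ℕ} {k : Fin (n + 1) → ℕ} {π : FinSurj m n k} {X : Fin (m + 1) → A.Obj}
  {X' : ∀ i, Fin (k i + 1) → A.Obj} {hX : ∀ i a, X' i a = X (π.emb i a)}
  {Y : Fin (n + 1) → A.Obj} {Z : A.Obj} {p r : ℤ} {q : Fin (n + 1) → ℤ}

/-- Composition with a family modified in one place, as an additive map. -/
def compAt (i : Fin (n + 1)) (h : p + ∑ j, (q j + if j = i then 1 else 0) = r)
    (f : (D.P n Y Z).X p)
    (g : ∀ i, (D.P (k i) (X' i) (Y i)).X (q i)) :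
    (D.P (k i) (X' i) (Y i)).X (q i + 1) →+ (D.P m X Z).X r :=
  AddMonoidHom.mk' (fun x => D.comp π hX h f (D.modAt g i x)) (fun x y =>
    D.comp_add_of h f i
      (by simp [PTData.modAt])
      (fun j hj => by simp [PTData.modAt, hj]) (fun j hj => by simp [PTData.modAt, hj]))

lemma compAt_apply (i : Fin (n + 1)) (h : p + ∑ j, (q j + if j = i then 1 else 0) = r)
    (f : (D.P n Y Z).X p)
    (g : ∀ i, (D.P (k i) (X' i) (Y i)).X (q i)) (x : (D.P (k i) (X' i) (Y i)).X (q i + 1)) :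
    D.compAt (π := π) (X := X) (hX := hX) i h f g x = D.comp π hX h f (D.modAt g i x) := rfl

end

lemma pull_one {X X' : Fin 1 → A.Obj} {Z : A.Obj} {p q r : ℤ} (h' : p + q = r)
    (h : p + ∑ _i : Fin 1, q = r) (φ : (A.hom (X 0) Z).X p)
    (a : ∀ b, (A.hom (X' b) (X b)).X q) :
    D.pull h a (D.one φ) = D.one (A.comp h' φ (a 0)) := by
  obtain ⟨x, rfl⟩ : ∃ x, X' = fun _ => x :=
    ⟨X' 0, funext fun i => congrArg X' (Subsingleton.elim _ _)⟩
  obtain ⟨y, rfl⟩ : ∃ y, X = fun _ => y :=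
    ⟨X 0, funext fun i => congrArg X (Subsingleton.elim _ _)⟩
  obtain ⟨c, rfl⟩ : ∃ c, a = fun _ => c :=
    ⟨a 0, funext fun i => congrArg a (Subsingleton.elim _ _)⟩
  refine Eq.trans ?_ (D.lawful.one_comp (X := fun _ => x) (Y := fun _ => y) h' φ
    (fun _ => c)).symm
  exact D.comp_congr_surj FinSurj.refl_zero (k := fun _ => 0) (X' := fun _ _ => x)
    (fun _ _ => rfl) _ _ _

lemma act_one {X : Fin 1 → A.Obj} {Y Z : A.Obj} {a b c : ℤ} (h : a + b = c)
    (f : (A.hom Y Z).X a) (g : (A.hom (X 0) Y).X b) :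
    D.act h f (D.one g) = D.one (X := X) (A.comp h f g) :=
  (D.lawful.one_comp (X := X) (Y := fun _ => Y) h f (fun _ => g)).symm

section rho

variable {n : ℕ} (E : Fin (n + 1) → MC A) {Z : A.Obj} {a b : ℤ}

/-- The substitution of `e_i` in the `i`-th place. -/
def rhoAt (h : a + 1 = b) (i : Fin (n + 1)) :
    (D.P n (fun i => (E i).obj) Z).X a →+ (D.P n (fun i => (E i).obj) Z).X b :=
  D.pull (by simpa using h) (fun b => A.iteEnd (b = i) (E b).e)

/-- The sum over all places `i` of the substitutions of `e_i` in the `i`-th place. -/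
def rho (h : a + 1 = b) :
    (D.P n (fun i => (E i).obj) Z).X a →+ (D.P n (fun i => (E i).obj) Z).X b :=
  ∑ i, D.rhoAt E h i

lemma rho_apply (h : a + 1 = b) (φ : (D.P n (fun i => (E i).obj) Z).X a) :
    D.rho E h φ = ∑ i, D.rhoAt E h i φ := by
  simp [rho]

/-- The substitution of `e_i e_i` in the `i`-th place. -/
def sq (h : a + 2 = b) (i : Fin (n + 1)) :
    (D.P n (fun i => (E i).obj) Z).X a →+ (D.P n (fun i => (E i).obj) Z).X b :=
  D.pull (by rw [Finset.sum_add_distrib]; simp; omega)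
    (fun b => A.comp rfl (A.iteEnd (b = i) (E b).e) (A.iteEnd (b = i) (E b).e))

lemma rhoAt_rhoAt_self {c : ℤ} (h : a + 1 = b) (h' : b + 1 = c) (i : Fin (n + 1))
    (φ : (D.P n (fun i => (E i).obj) Z).X a) :
    D.rhoAt E h' i (D.rhoAt E h i φ) = D.sq E (by omega) i φ := by
  refine D.pull_pull_of_zero _ _ _ _ _ _ (fun j j' hj => ?_) φ
  split_ifs <;> omega

lemma rhoAt_rhoAt {c : ℤ} (h : a + 1 = b) (h' : b + 1 = c) (i j : Fin (n + 1)) (hij : i ≠ j)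
    (φ : (D.P n (fun i => (E i).obj) Z).X a) :
    D.rhoAt E h' j (D.rhoAt E h i φ) + D.rhoAt E h' i (D.rhoAt E h j φ) = 0 := by
  wlog hlt : i < j generalizing i j
  · exact (add_comm _ _).trans <| this j i hij.symm (lt_of_le_of_ne (not_lt.1 hlt) hij.symm)
  have hd : a + ∑ b : Fin (n + 1), ((if b = i then 1 else 0) + if b = j then 1 else 0) = c := by
    rw [Finset.sum_add_distrib]; simp; omega
  have hd' : a + ∑ b : Fin (n + 1), ((if b = j then 1 else 0) + if b = i then 1 else 0) = c := by
    rw [Finset.sum_add_distrib]; simp; omega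
  have h1 := D.pull_pull (by simpa using h) (by simpa using h')
    (fun b => A.iteEnd (b = i) (E b).e) (fun b => A.iteEnd (b = j) (E b).e) (fun _ => rfl) hd φ
  have h2 := D.pull_pull (by simpa using h) (by simpa using h')
    (fun b => A.iteEnd (b = j) (E b).e) (fun b => A.iteEnd (b = i) (E b).e) (fun _ => rfl) hd' φ
  have s1 : (∑ x : Fin (n + 1), ∑ y with y < x,
      (if y = j then (1 : ℤ) else 0) * (if x = i then 1 else 0)) = 0 := by
    refine Finset.sum_eq_zero fun x _ => Finset.sum_eq_zero fun y hy => ?_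
    simp only [Finset.mem_filter, Finset.mem_univ, true_and] at hy
    by_cases hx : x = i
    · subst hx
      rw [if_neg (by rintro rfl; exact lt_asymm hlt hy), zero_mul]
    · rw [if_neg hx, mul_zero]
  have s2 : (∑ x : Fin (n + 1), ∑ y with y < x,
      (if y = i then (1 : ℤ) else 0) * (if x = j then 1 else 0)) = 1 := by
    rw [Finset.sum_eq_single j, Finset.sum_eq_single i]
    · simp
    · intro y _ hy; simp [hy]
    · simp [hlt]
    · intro x _ hx; simp [hx]
    · simp
  rw [s1, Int.negOnePow_zero, one_smul] at h1
  rw [s2, Int.negOnePow_one, Units.neg_smul, one_smul] at h2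
  have h3 := D.pull_congr hd
    (fun b => A.comp rfl (A.iteEnd (b = i) (E b).e) (A.iteEnd (b = j) (E b).e)) hd'
    (fun b => A.comp rfl (A.iteEnd (b = j) (E b).e) (A.iteEnd (b = i) (E b).e))
    (fun b => ⟨add_comm _ _, by
      by_cases hi : b = i
      · have hj : ¬ b = j := fun e => hij (hi.symm.trans e)
        rw [PreDG.iteEnd_true hi, PreDG.iteEnd_false hj, PreDG.comp_cast_left,
          PreDG.comp_cast_right, PreDG.comp_cast_left, PreDG.comp_cast_right, PreDG.cast_comp]
        have : ∀ {c : ℤ} (e : 1 = c), A.comp (show 1 + 0 = c by omega) (E b).e (A.id _) =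
            A.comp (show 0 + 1 = c by omega) (A.id _) (E b).e := by
          intro c e; subst e; rw [A.comp_id, A.id_comp]
        exact this (by simp [hi, hij])
      · rw [PreDG.iteEnd_false hi]
        have : ∀ {c d : ℤ} (e : d = c) (x : (A.hom (E b).obj (E b).obj).X d),
            A.comp (show 0 + d = c by omega) (A.id _) x =
            A.comp (show d + 0 = c by omega) x (A.id _) := by
          intro c d e x; subst e; rw [A.comp_id, A.id_comp]
        rw [PreDG.comp_cast_left, PreDG.comp_cast_right, PreDG.cast_comp]
        exact this (by simp [hi]) _⟩) φ
  have h4 := h1.symm.trans (h3.trans h2)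
  exact (eq_neg_iff_add_eq_zero).1 h4

lemma rho_rho {c : ℤ} (h : a + 1 = b) (h' : b + 1 = c) (φ : (D.P n (fun i => (E i).obj) Z).X a) :
    D.rho E h' (D.rho E h φ) = ∑ i, D.sq E (by omega) i φ := by
  simp only [rho_apply, map_sum]
  rw [sum_sum_eq_sum_diag (fun i j => D.rhoAt E h' j (D.rhoAt E h i φ))
    (fun i j hij => D.rhoAt_rhoAt E h h' i j hij φ)]
  exact Finset.sum_congr rfl fun i _ => D.rhoAt_rhoAt_self E h h' i φ

lemma d_rhoAt {b' c : ℤ} (h : a + 1 = b) (h' : b + 1 = c) (ha : a + 1 = b') (hc : b' + 1 = c)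
    (i : Fin (n + 1))
    (φ : (D.P n (fun i => (E i).obj) Z).X a) :
    (D.P n _ Z).d b c h' (D.rhoAt E h i φ) = D.rhoAt E hc i ((D.P n _ Z).d a b' ha φ) -
      a.negOnePow • D.sq E (by omega) i φ := by
  have h0 : (∑ j with j < i, if j = i then (1 : ℤ) else 0) = 0 :=
    Finset.sum_eq_zero fun j hj => if_neg (by simp at hj; exact ne_of_lt hj)
  have := D.d_pull_of_ne (by simpa using h) ha h' (fun b => A.iteEnd (b = i) (E b).e) i
    (fun j hj => PreDG.d_iteEnd hj _ _) φ
  refine this.trans ?_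
  rw [sub_eq_add_neg, h0, add_zero, ← smul_neg]
  congr 2
  refine D.pull_neg_of _ i ?_ ?_ φ
  · rw [PreDG.dAtHom, dif_pos rfl, PreDG.iteEnd_true rfl, PreCx.d_cast, PreDG.comp_cast_left,
      PreDG.comp_cast_right]
    have : ∀ {c : ℤ} (e : 2 = c), (A.hom (E i).obj (E i).obj).d 1 c (by omega) (E i).e =
        - A.comp (by omega) (E i).e (E i).e := by
      intro c e; subst e; exact (E i).d_e
    exact this (by simp)
  · intro j hj
    rw [PreDG.dAtHom, dif_neg hj, PreDG.iteEnd_false hj, PreCx.cast_cast, PreDG.comp_cast_left,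
      PreDG.comp_cast_right]
    have : ∀ {c : ℤ} (e : 0 = c), (A.hom (E j).obj (E j).obj).cast e (A.id _) =
        A.comp (by omega) (A.id _) (A.id _) := by
      intro c e; subst e; rw [A.id_comp]; rfl
    exact this (by simp [hj])

lemma d_rho {b' c : ℤ} (h : a + 1 = b) (h' : b + 1 = c) (ha : a + 1 = b') (hc : b' + 1 = c)
    (φ : (D.P n (fun i => (E i).obj) Z).X a) :
    (D.P n _ Z).d b c h' (D.rho E h φ) = D.rho E hc ((D.P n _ Z).d a b' ha φ) -
      a.negOnePow • ∑ i, D.sq E (by omega) i φ := by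
  simp only [rho_apply, map_sum, Finset.smul_sum, ← Finset.sum_sub_distrib]
  exact Finset.sum_congr rfl fun i _ => D.d_rhoAt E h h' ha hc i φ

lemma act_rho {c b' : ℤ} {Z' : A.Obj} {d : ℤ} (h : a + 1 = b) (h₁ : d + b = c) (h₂ : d + a = b')
    (h₃ : b' + 1 = c) (f : (A.hom Z Z').X d) (φ : (D.P n (fun i => (E i).obj) Z).X a) :
    D.act h₁ f (D.rho E h φ) = D.rho E h₃ (D.act h₂ f φ) := by
  simp only [rho_apply]
  have : ∀ (s : Finset (Fin (n + 1))) (x : Fin (n + 1) → (D.P n (fun i => (E i).obj) Z).X b),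
      D.act h₁ f (∑ i ∈ s, x i) = ∑ i ∈ s, D.act h₁ f (x i) := fun s x =>
    map_sum (AddMonoidHom.mk' (fun x => D.act h₁ f x) (D.act_add_right h₁ f)) x s
  rw [this]
  exact Finset.sum_congr rfl fun i _ => D.act_pull _ h₁ h₂ _ f _ φ

end rho

end PT

namespace PT

variable {A : PreDG.{u, v}} (D : PT A)

lemma koszul_single {m n : ℕ} {k : Fin (n + 1) → ℕ} (π : FinSurj m n k) (q : Fin (n + 1) → ℤ)
    (i : Fin (n + 1)) (a : Fin (k i + 1)) :
    koszul π.map q (fun b => if b = π.emb i a then 1 else 0) = ∑ j with i < j, q j := by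
  unfold koszul
  rw [Finset.sum_eq_zero (s := Finset.univ) (f := fun b => ∑ a with a < b ∧ _, _), add_zero]
  · rw [Finset.sum_filter]
    refine Finset.sum_congr rfl fun j _ => ?_
    rw [Finset.sum_filter, Finset.sum_eq_single (π.emb i a)]
    · rw [π.map_emb]; simp
    · intro b _ hb; simp [hb]
    · simp
  · intro b _
    refine Finset.sum_eq_zero fun c hc => ?_
    simp only [Finset.mem_filter, Finset.mem_univ, true_and] at hc
    dsimp only
    split_ifs with h1 h2
    · subst h1 h2; exact absurd hc.1 (lt_irrefl _)
    all_goals simp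

section

variable {m n : ℕ} {k : Fin (n + 1) → ℕ} {π : FinSurj m n k} {X : Fin (m + 1) → MC A}
  {Y : Fin (n + 1) → MC A} {Z : A.Obj} {p r p' r' : ℤ} {q : Fin (n + 1) → ℤ}

lemma rhoAt_comp (h : p + ∑ i, q i = r) (hr : r + 1 = r') (f : (D.P n (fun i => (Y i).obj) Z).X p)
    (g : ∀ i, (D.P (k i) (fun a => (X (π.emb i a)).obj) (Y i).obj).X (q i)) (i : Fin (n + 1))
    (a : Fin (k i + 1)) :
    D.comp π (X := fun b => (X b).obj) (fun _ _ => rfl)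
        (by rw [Finset.sum_add_distrib]; simp; omega) f
        (D.modAt g i (D.rhoAt (fun a => X (π.emb i a)) rfl a (g i))) =
      (∑ j with i < j, q j).negOnePow •
        D.rhoAt X hr (π.emb i a) (D.comp π (X := fun b => (X b).obj) (fun _ _ => rfl) h f g) := by
  rw [← koszul_single π q i a]
  have hsum : ∀ j, (∑ c, if π.emb j c = π.emb i a then (1 : ℤ) else 0) = if j = i then 1 else 0 := by
    intro j
    split_ifs with hj
    · subst hj
      simp [(π.emb_injective j).eq_iff]
    · refine Finset.sum_eq_zero fun c _ => if_neg fun e => hj ?_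
      have := congrArg π.map e
      rwa [π.map_emb, π.map_emb] at this
  have := D.pull_comp π (X := fun b => (X b).obj) h (by simpa using hr)
    (fun i => rfl) (by rw [Finset.sum_add_distrib, Finset.sum_congr rfl (fun j _ => hsum j)]; simp; omega)
    (fun b => A.iteEnd (b = π.emb i a) (X b).e) f g
  refine Eq.trans ?_ this
  refine D.comp_congr _ _ _ _ _ _ _ fun j => ⟨by rw [hsum], ?_⟩
  unfold PTData.modAt
  by_cases hj : j = i
  · subst hj
    rw [dif_pos rfl, PreCx.cast_cast]
    change (D.P _ _ _).cast _ (D.pull _ _ _) = D.pull _ _ _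
    have e : ∀ {s s' : ℤ} (e : s = s') (h : q j + ∑ b, (if b = a then (1 : ℤ) else 0) = s) (h'),
        (D.P _ _ _).cast e (D.pull h (fun b => A.iteEnd (b = a) (X (π.emb j b)).e) (g j)) =
        D.pull h' (fun b => A.iteEnd (b = a) (X (π.emb j b)).e) (g j) := by
      intro s s' e h h'; subst e; rfl
    rw [e]
    · refine D.pull_congr _ _ _ _ (fun b => ⟨by simp [(π.emb_injective j).eq_iff], ?_⟩) _
      by_cases hb : b = a
      · subst hb
        rw [PreDG.iteEnd_true rfl, PreDG.iteEnd_true rfl, PreCx.cast_cast]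
      · rw [PreDG.iteEnd_false hb, PreDG.iteEnd_false ((π.emb_injective j).ne hb),
          PreCx.cast_cast]
    · simp [(π.emb_injective j).eq_iff]
  · rw [dif_neg hj, PreCx.cast_cast]
    have hne : ∀ c, π.emb j c ≠ π.emb i a := fun c e => hj (by
      have := congrArg π.map e
      rwa [π.map_emb, π.map_emb] at this)
    rw [← D.pull_id (by simp; exact fun x => hne x)]
    refine D.pull_congr _ _ _ _ (fun b => ⟨(if_neg (hne b)).symm, ?_⟩) _
    rw [PreDG.iteEnd_false (hne b)]

lemma rho_comp (h : p + ∑ i, q i = r) (hr : r + 1 = r') (f : (D.P n (fun i => (Y i).obj) Z).X p)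
    (g : ∀ i, (D.P (k i) (fun a => (X (π.emb i a)).obj) (Y i).obj).X (q i)) :
    D.rho X hr (D.comp π (X := fun b => (X b).obj) (fun _ _ => rfl) h f g) =
      ∑ i, (∑ j with i < j, q j).negOnePow • D.comp π (X := fun b => (X b).obj) (fun _ _ => rfl)
        (by rw [Finset.sum_add_distrib]; simp; omega) f
        (D.modAt g i (D.rho (fun a => X (π.emb i a)) rfl (g i))) := by
  rw [rho_apply, ← π.sum_fibres]
  refine Finset.sum_congr rfl fun i _ => ?_
  rw [rho_apply]
  have := map_sum (D.compAt (π := π) (X := fun b => (X b).obj) (hX := fun _ _ => rfl) (r := r') i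
    (by rw [Finset.sum_add_distrib]; simp; omega) f g)
    (fun a => D.rhoAt (fun a => X (π.emb i a)) rfl a (g i)) Finset.univ
  simp only [compAt_apply] at this
  rw [this, Finset.smul_sum]
  refine Finset.sum_congr rfl fun a _ => ?_
  rw [D.rhoAt_comp h hr f g i a, smul_smul, Int.units_mul_self, one_smul]

lemma comp_rho (h : p + ∑ i, q i = r) (hp : p + 1 = p') (hr : r + 1 = r')
    (f : (D.P n (fun i => (Y i).obj) Z).X p)
    (g : ∀ i, (D.P (k i) (fun a => (X (π.emb i a)).obj) (Y i).obj).X (q i)) :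
    D.comp π (X := fun b => (X b).obj) (fun _ _ => rfl) (r := r') (by omega) (D.rho Y hp f) g =
      ∑ i, (∑ j with j < i, q j).negOnePow • D.comp π (X := fun b => (X b).obj) (fun _ _ => rfl)
        (by rw [Finset.sum_add_distrib]; simp; omega) f
        (D.modAt g i (D.act (add_comm 1 (q i)) (Y i).e (g i))) := by
  rw [rho_apply, D.comp_sum_left]
  refine Finset.sum_congr rfl fun i _ => ?_
  have h0 : (∑ a, ∑ j with j < a, q j * if a = i then (1 : ℤ) else 0) = ∑ j with j < i, q j := by
    rw [Finset.sum_eq_single i]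
    · simp
    · intro b _ hb; simp [hb]
    · simp
  have := D.comp_pull π (X := fun b => (X b).obj) (δ := fun j => if j = i then 1 else 0) (q := q)
    (by simpa using hp) (show p' + ∑ i, q i = r' by omega) (fun _ => rfl)
    (by rw [Finset.sum_add_distrib]; simp; omega)
    (fun b => A.iteEnd (b = i) (Y b).e) f g
  rw [h0] at this
  have h2 : D.comp π (X := fun b => (X b).obj) (fun _ _ => rfl)
        (by rw [Finset.sum_add_distrib]; simp; omega) f
        (D.modAt g i (D.act (add_comm 1 (q i)) (Y i).e (g i))) =
      D.comp π (X := fun b => (X b).obj) (fun _ _ => rfl) (r := r')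
        (by rw [Finset.sum_add_distrib]; simp; omega) f
        (fun j => D.act rfl (A.iteEnd (j = i) (Y j).e) (g j)) := by
    refine D.comp_congr _ _ _ _ _ _ _ fun j => ⟨add_comm _ _, ?_⟩
    unfold PTData.modAt
    have e : ∀ {s s' t t' : ℤ} (e : s = s') (e' : t' = t) (x : (A.hom (Y j).obj (Y j).obj).X t') (h : t + q j = s) (h'),
        (D.P _ _ _).cast e (D.act h ((A.hom _ _).cast e' x) (g j)) = D.act h' x (g j) := by
      intro s s' t t' e e' x h h'; subst e; subst e'; rfl
    by_cases hj : j = i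
    · subst hj
      rw [dif_pos rfl, PreCx.cast_cast, PreDG.iteEnd_true rfl]
      have e1 := e (s := (if j = j then 1 else 0) + q j) (t := if j = j then 1 else 0) (t' := 1)
        rfl (by simp) (Y j).e rfl (by simp)
      refine Eq.trans ?_ e1.symm
      have e2 : ∀ {s s' : ℤ} (e : s = s') (h : 1 + q j = s) (h'),
        (D.P _ _ _).cast e (D.act h (Y j).e (g j)) = D.act h' (Y j).e (g j) := by
          intro s s' e h h'; subst e; rfl
      exact e2 _ _ _
    · rw [dif_neg hj, PreCx.cast_cast, PreDG.iteEnd_false hj]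
      have e1 := e (s := (if j = i then 1 else 0) + q j) (t := if j = i then 1 else 0) (t' := 0)
        rfl (by simp [hj]) (A.id _) rfl (by simp [hj])
      refine Eq.trans ?_ e1.symm
      have e2 : ∀ {s : ℤ} (h : q j = s) (h'),
        (D.P _ _ _).cast h (g j) = D.act h' (A.id (Y j).obj) (g j) := by
          intro s h h'; subst h
          exact (D.lawful.id_comp (g j)).symm
      exact e2 _ _
  rw [h2, this, smul_smul, Int.units_mul_self, one_smul]
  rfl

end

end PT

/-- A pseudo-tensor structure with modified differentials, on the category of objects with a
Maurer-Cartan element. -/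
def MC.ptData {A : PreDG.{u, v}} (D : PTData A)
    (del : ∀ {n : ℕ} (E : Fin (n + 1) → MC A) (F : MC A) (a b : ℤ) (_ : a + 1 = b),
      (D.P n (fun i => (E i).obj) F.obj).X a →+ (D.P n (fun i => (E i).obj) F.obj).X b) :
    PTData (MC.cat A) where
  P n E F :=
    { X := (D.P n (fun i => MC.obj (E i)) (MC.obj F)).X
      d := del E F }
  one := fun {X _ _} => D.one (X := fun i => MC.obj (X i))
  comp π _ _ hX _ _ _ _ _ h f g := D.comp π (fun i a => congrArg MC.obj (hX i a)) h f g

namespace MC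

variable {A : PreDG.{u, v}} (D : PT A)
    {del : ∀ {n : ℕ} (E : Fin (n + 1) → MC A) (F : MC A) (a b : ℤ) (_ : a + 1 = b),
      (D.P n (fun i => (E i).obj) F.obj).X a →+ (D.P n (fun i => (E i).obj) F.obj).X b}
    (hdel : ∀ {n : ℕ} (E : Fin (n + 1) → MC A) (F : MC A) (a b : ℤ) (h : a + 1 = b)
      (φ : (D.P n (fun i => (E i).obj) F.obj).X a),
      del E F a b h φ = (D.P n (fun i => (E i).obj) F.obj).d a b h φ +
        D.act ((add_comm 1 a).trans h) F.e φ - a.negOnePow • D.rho E h φ)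

include hdel

lemma ptData_d_d {n : ℕ} (E : Fin (n + 1) → MC A) (F : MC A) (a b c : ℤ) (h : a + 1 = b)
    (h' : b + 1 = c) (φ : (D.P n (fun i => (E i).obj) F.obj).X a) :
    del E F b c h' (del E F a b h φ) = 0 := by
  have hact : ∀ {a b c : ℤ} (h : a + b = c) (f : (A.hom F.obj F.obj).X a)
      (x y : (D.P n (fun i => (E i).obj) F.obj).X b),
      D.act h f (x - y) = D.act h f x - D.act h f y := fun h f x y =>
    map_sub (AddMonoidHom.mk' (fun x => D.act h f x) (D.act_add_right h f)) x y
  have hact' : ∀ {a b c : ℤ} (h : a + b = c) (f : (A.hom F.obj F.obj).X a) (s : ℤ)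
      (x : (D.P n (fun i => (E i).obj) F.obj).X b),
      D.act h f (s.negOnePow • x) = s.negOnePow • D.act h f x := fun h f s x =>
    map_negOnePow (AddMonoidHom.mk' (fun x => D.act h f x) (D.act_add_right h f)) s x
  have hneg : ∀ {a b c : ℤ} (h : a + b = c) (f : (A.hom F.obj F.obj).X a)
      (x : (D.P n (fun i => (E i).obj) F.obj).X b),
      D.act h (-f) x = - D.act h f x := fun h f x =>
    map_neg (AddMonoidHom.mk' (fun f => D.act h f x) (fun f f' => D.act_add_left h f f' x)) f
  subst h
  rw [hdel E F a _ rfl, hdel]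
  simp only [map_add, map_sub, map_negOnePow, D.act_add_right, hact, hact']
  rw [D.lawful.d_d, D.d_act (a' := 2) (b' := a + 1) _ rfl rfl, F.d_e, hneg,
    D.comp_act (ab := 2) (abc := c) (bc := a + 1) rfl (by omega) (by omega) (by omega),
    D.d_rho E rfl h' rfl h', D.act_rho E rfl (by omega) (b' := a + 1) (by omega) h', D.rho_rho E rfl h',
    Int.negOnePow_succ]
  simp only [Int.negOnePow_one, Units.neg_smul, one_smul,
    smul_add, smul_sub, smul_smul, neg_mul, Int.units_mul_self]
  abel

lemma ptData_leibniz {m n : ℕ} {k : Fin (n + 1) → ℕ} (π : FinSurj m n k) {X : Fin (m + 1) → MC A}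
    {Y : Fin (n + 1) → MC A} {Z : MC A} {p r p' r' : ℤ} {q : Fin (n + 1) → ℤ}
    (h : p + ∑ i, q i = r) (hp : p + 1 = p') (hr : r + 1 = r')
    (f : (D.P n (fun i => (Y i).obj) Z.obj).X p)
    (g : ∀ i, (D.P (k i) (fun a => (X (π.emb i a)).obj) (Y i).obj).X (q i)) :
    del X Z r r' hr (D.comp π (X := fun b => (X b).obj) (fun _ _ => rfl) h f g) =
      D.comp π (X := fun b => (X b).obj) (fun _ _ => rfl) (by omega) (del Y Z p p' hp f) g +
        ∑ i, (p + ∑ j with j < i, q j).negOnePow •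
          D.comp π (X := fun b => (X b).obj) (fun _ _ => rfl)
            (by rw [Finset.sum_add_distrib]; simp; omega) f
            (D.modAt g i (del (fun a => X (π.emb i a)) (Y i) _ _ rfl (g i))) := by
  have hsum : ∀ i, r' = p + ∑ j, (q j + if j = i then 1 else 0) := fun i => by
    rw [Finset.sum_add_distrib]; simp; omega
  have key : ∀ i, D.comp π (X := fun b => (X b).obj) (fun _ _ => rfl) (hsum i).symm f
            (D.modAt g i (del (fun a => X (π.emb i a)) (Y i) _ _ rfl (g i))) =
      D.comp π (X := fun b => (X b).obj) (fun _ _ => rfl) (hsum i).symm f (D.dAt g i) +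
      D.comp π (X := fun b => (X b).obj) (fun _ _ => rfl) (hsum i).symm f
        (D.modAt g i (D.act (add_comm 1 (q i)) (Y i).e (g i))) -
      (q i).negOnePow • D.comp π (X := fun b => (X b).obj) (fun _ _ => rfl) (hsum i).symm f
        (D.modAt g i (D.rho (fun a => X (π.emb i a)) rfl (g i))) := by
    intro i
    rw [PTData.dAt_eq_modAt, hdel]
    simp only [← PT.compAt_apply, map_sub, map_add, map_negOnePow]
  simp only [key, smul_sub, smul_add, Finset.sum_add_distrib, Finset.sum_sub_distrib]
  rw [hdel, hdel, D.comp_sub_left, D.lawful.comp_add_left, D.comp_smul_left,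
    D.lawful.leibniz _ _ h hp hr, D.rho_comp h hr, D.comp_rho h hp hr,
    D.act_comp π h _ ((add_comm 1 p).trans hp) (by omega)]
  have e1 : ∀ i, (p + ∑ j with j < i, q j).negOnePow = p.negOnePow * (∑ j with j < i, q j).negOnePow :=
    fun i => Int.negOnePow_add _ _
  have e2 : ∀ i, (p + ∑ j with j < i, q j).negOnePow * (q i).negOnePow =
      r.negOnePow * (∑ j with i < j, q j).negOnePow := by
    intro i
    rw [← Int.negOnePow_add, ← Int.negOnePow_add, Int.negOnePow_eq_iff]
    have : ∑ j, q j = (∑ j with j < i, q j) + q i + ∑ j with i < j, q j := by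
      rw [← Finset.sum_filter_add_sum_filter_not Finset.univ (fun j => j < i), add_assoc]
      congr 1
      rw [← Finset.sum_filter_add_sum_filter_not (Finset.univ.filter fun j => ¬ j < i) (fun j => j = i)]
      congr 1
      · rw [Finset.filter_filter]
        rw [Finset.sum_eq_single i]
        · intro b hb hbi; simp at hb; exact absurd hb.2 hbi
        · intro hi; simp at hi
      · rw [Finset.filter_filter]
        refine Finset.sum_congr (Finset.filter_congr fun j _ => ?_) fun _ _ => rfl
        rw [not_lt]
        exact ⟨fun h => lt_of_le_of_ne h.1 (Ne.symm h.2), fun h => ⟨h.le, ne_of_gt h⟩⟩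
    rw [← h, this]
    exact ⟨- ∑ j with i < j, q j, by ring⟩
  simp only [Finset.smul_sum, smul_smul, e2]
  simp only [e1]
  abel

lemma ptData_one_d {X : Fin 1 → MC A} {Y : MC A} {a b : ℤ} (h : a + 1 = b)
    (f : (A.hom (X 0).obj Y.obj).X a) :
    D.one (X := fun i => (X i).obj) (MC.del (X 0) Y a b h f) = del X Y a b h (D.one f) := by
  rw [hdel, MC.del_apply, map_sub, map_add, map_negOnePow, D.lawful.one_d, D.act_one]
  congr 2
  rw [PT.rho_apply]
  refine Eq.trans ?_ (Fin.sum_univ_one _).symm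
  refine (D.pull_one (X := fun i => (X i).obj) (X' := fun i => (X i).obj) h (by simpa using h) f
    (fun i => (X i).e)).symm.trans ?_
  refine D.pull_congr _ _ _ _ (fun b => ⟨by simp [Fin.ext_iff], ?_⟩) _
  rw [PreDG.iteEnd_true (Subsingleton.elim (α := Fin 1) _ _)]

lemma ptData_lawful : (MC.ptData D.toPTData del).Lawful where
  d_d a b c h h' x := ptData_d_d D hdel _ _ a b c h h' x
  one_bijective := D.lawful.one_bijective
  one_d := ptData_one_d D hdel
  one_comp := fun {X Y Z _ _ _} h f g => D.lawful.one_comp (X := fun i => MC.obj (X i))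
    (Y := fun i => MC.obj (Y i)) (Z := MC.obj Z) h f g
  comp_add_left := fun π _ _ hX => D.lawful.comp_add_left π (fun i a => congrArg MC.obj (hX i a))
  comp_add_right := fun π _ _ hX => D.lawful.comp_add_right π (fun i a => congrArg MC.obj (hX i a))
  leibniz := by
    intro m n k π X X' hX Y Z p r p' r' q h hp hr f g
    obtain rfl : X' = fun i a => X (π.emb i a) := funext fun i => funext fun a => hX i a
    have := ptData_leibniz D hdel π h hp hr f g
    refine this.trans ?_
    congr 1
    refine Finset.sum_congr rfl fun i _ => ?_
    rw [PTData.dAt_eq_modAt]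
    rfl
  assoc := by
    intro l m n k k' s π ρ σ τ hτ W X Y Z p r N q u t h₁ h₂ h₃ h₄ f g h
    exact D.lawful.assoc π ρ σ τ hτ (W := fun i => MC.obj (W i)) (X := fun i => MC.obj (X i))
      (Y := fun i => MC.obj (Y i)) (Z := MC.obj Z) h₁ h₂ h₃ h₄ f g h
  id_comp := fun {_ X Y _} f => D.lawful.id_comp (X := fun i => MC.obj (X i)) (Y := MC.obj Y) f
  comp_id := fun {_ X Y _} f => D.lawful.comp_id (X := fun i => MC.obj (X i)) (Y := MC.obj Y) f

end MC

namespace FinSurj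

variable {m n : ℕ} {k : Fin (n + 1) → ℕ} (π : FinSurj m n k) {A : Type*}

lemma sum_fibre_mul [CommSemiring A] (f g : Fin (m + 1) → A)
    (R : Fin (n + 1) → Fin (n + 1) → Prop) [∀ i j, Decidable (R i j)] :
    ∑ i, ∑ j, (if R i j then (∑ a, f (π.emb i a)) * (∑ a, g (π.emb j a)) else 0) =
      ∑ b, ∑ c, if R (π.map b) (π.map c) then f b * g c else 0 := by
  rw [← π.sum_fibres]
  refine Finset.sum_congr rfl fun i _ => ?_
  refine Eq.trans ?_ Finset.sum_comm
  rw [← π.sum_fibres]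
  refine Finset.sum_congr rfl fun j _ => ?_
  simp only [π.map_emb]
  split_ifs
  · rw [Finset.sum_mul_sum, Finset.sum_comm]
  · simp

lemma sum_fibre_pairs [AddCommMonoid A] (w : Fin (m + 1) → Fin (m + 1) → A) :
    ∑ i, ∑ a, ∑ b, (if a < b then w (π.emb i a) (π.emb i b) else 0) =
      ∑ b, ∑ c, if b < c ∧ π.map b = π.map c then w b c else 0 := by
  rw [← π.sum_fibres]
  refine Finset.sum_congr rfl fun i _ => Finset.sum_congr rfl fun a _ => ?_
  rw [← π.sum_fibres, Finset.sum_eq_single i]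
  · simp only [π.map_emb, and_true, (π.strictMono i).lt_iff_lt]
  · intro j _ hj
    simp [π.map_emb, hj.symm]
  · simp

end FinSurj

lemma sum_pairs_swap {ι A : Type*} [Fintype ι] [LinearOrder ι] [AddCommMonoid A]
    (w : ι → ι → A) (hw : ∀ b, w b b = 0) :
    ∑ b, ∑ c, w b c = ∑ b, ∑ c, if b < c then w b c + w c b else 0 := by
  have h1 : ∀ b c, w b c = (if b < c then w b c else 0) + (if c < b then w b c else 0) := by
    intro b c
    rcases lt_trichotomy b c with h | h | h
    · simp [h, h.not_gt]
    · subst h; simp [hw]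
    · simp [h, h.not_gt]
  conv_lhs => enter [2, b, 2, c]; rw [h1]
  simp only [Finset.sum_add_distrib]
  rw [Finset.sum_comm (s := Finset.univ) (t := Finset.univ)
    (f := fun b c => if c < b then w b c else 0)]
  simp only [← Finset.sum_add_distrib]
  refine Finset.sum_congr rfl fun b _ => Finset.sum_congr rfl fun c _ => ?_
  split_ifs <;> simp

section sign

variable {R : Type*} [CommRing R]

lemma cast_koszul {m n : ℕ} {k : Fin (n + 1) → ℕ} (π : FinSurj m n k) (q : Fin (n + 1) → ℤ)
    (t : Fin (m + 1) → ℤ) : ((koszul π.map q t : ℤ) : R) =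
      ∑ i, ∑ p, (if i < p then (∑ a, (t (π.emb i a) : R)) * q p else 0) +
      ∑ b, ∑ c, if b < c ∧ π.map c < π.map b then (t b * t c : R) else 0 := by
  unfold koszul
  push_cast
  simp only [Finset.sum_filter]
  congr 1
  · refine Eq.trans ?_ Finset.sum_comm
    refine Finset.sum_congr rfl fun p _ => ?_
    rw [← π.sum_fibres]
    refine Finset.sum_congr rfl fun i _ => ?_
    simp only [π.map_emb]
    split_ifs
    · rw [Finset.sum_mul]
    · simp
  · exact Finset.sum_comm

lemma cast_sgnC {m n : ℕ} {k : Fin (n + 1) → ℕ} (π : FinSurj m n k) (q j : Fin (n + 1) → ℤ)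
    (t : Fin (m + 1) → ℤ) : ((PT.sgnC π q j t : ℤ) : R) =
      ∑ i, ∑ p, (if i < p then ((j p : R) * (q i - j i + ∑ a, (t (π.emb i a) : R)) +
        (∑ a, (t (π.emb i a) : R)) * q p) else 0) +
      ∑ b, ∑ c, if b < c ∧ π.map c < π.map b then (t b * t c : R) else 0 := by
  unfold PT.sgnC
  push_cast
  simp only [Finset.sum_filter]
  congr 1
  · exact Finset.sum_comm
  · exact Finset.sum_comm

end sign

lemma negOnePow_eq_of_cast {a b : ℤ} (h : (a : ZMod 2) = b) : a.negOnePow = b.negOnePow := by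
  rw [Int.negOnePow_eq_iff, even_iff_two_dvd]
  exact (ZMod.intCast_eq_intCast_iff_dvd_sub b a 2).1 h.symm

/-- The compatibility of the signs which gives the associativity of the composition. -/
lemma sgnC_assoc {l m n : ℕ} {k : Fin (n + 1) → ℕ} {k' : Fin (m + 1) → ℕ} {s : Fin (n + 1) → ℕ}
    (π : FinSurj m n k) (ρ : FinSurj l m k') (σ : FinSurj l n s)
    (τ : ∀ i, FinSurj (s i) (k i) (fun a => k' (π.emb i a)))
    (hτ : ∀ i a b, σ.emb i ((τ i).emb a b) = ρ.emb (π.emb i a) b)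
    (q j : Fin (n + 1) → ℤ) (t y : Fin (m + 1) → ℤ) (x : Fin (l + 1) → ℤ) :
    (koszul π.map (fun i => q i + ∑ a, y (π.emb i a) - j i)
        (fun b => t b + ∑ c, x (ρ.emb b c) - y b) +
      PT.sgnC σ (fun i => q i + ∑ a, t (π.emb i a)) j x +
      ∑ i, PT.sgnC (τ i) (fun a => t (π.emb i a)) (fun a => y (π.emb i a))
        (fun c => x (σ.emb i c))).negOnePow =
    (koszul π.map q t + PT.sgnC ρ t y x + PT.sgnC π q j y).negOnePow := by
  have hx : ∀ i, ∑ c, (x (σ.emb i c) : ZMod 2) = ∑ a, ∑ c, (x (ρ.emb (π.emb i a) c) : ZMod 2) := by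
    intro i
    rw [← (τ i).sum_fibres]
    simp only [hτ]
  have hmap : ∀ i c, π.emb i ((τ i).map c) = ρ.map (σ.emb i c) := by
    intro i c
    obtain ⟨a, b, rfl⟩ := (τ i).exists_emb c
    rw [hτ, (τ i).map_emb, ρ.map_emb]
  have hσ : ∀ c, σ.map c = π.map (ρ.map c) := by
    intro c
    obtain ⟨i, d, rfl⟩ := σ.exists_emb c
    rw [← hmap, π.map_emb, σ.map_emb]
  obtain ⟨X, hX⟩ : ∃ X : Fin (m + 1) → ZMod 2, ∀ b, ∑ c, (x (ρ.emb b c) : ZMod 2) = X b :=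
    ⟨_, fun _ => rfl⟩
  apply negOnePow_eq_of_cast
  push_cast
  simp only [cast_koszul, cast_sgnC, Int.cast_add, Int.cast_sub, Int.cast_sum, hx, hτ, hX,
    Finset.sum_add_distrib (s := Finset.univ (α := Fin (n + 1)))]
  rw [π.sum_fibre_pairs (fun b c => (y c : ZMod 2) * (t b - y b + X b) + X b * t c)]
  have e2 : (∑ i, ∑ a, ∑ b, if a < b ∧ (τ i).map b < (τ i).map a then
        (x (σ.emb i a) : ZMod 2) * x (σ.emb i b) else 0) =
      ∑ b, ∑ c, if b < c ∧ σ.map b = σ.map c then (if ρ.map c < ρ.map b then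
        (x b : ZMod 2) * x c else 0) else 0 := by
    refine Eq.trans ?_ (σ.sum_fibre_pairs (fun b c => if ρ.map c < ρ.map b then
      (x b : ZMod 2) * x c else 0))
    refine Finset.sum_congr rfl fun i _ => Finset.sum_congr rfl fun a _ =>
      Finset.sum_congr rfl fun b _ => ?_
    simp only [← hmap, (π.strictMono i).lt_iff_lt, ite_and]
  rw [e2]
  have e3 : (∑ b, ∑ c, if b < c ∧ π.map c < π.map b then X b * X c else 0) =
      ∑ d, ∑ e, if ρ.map d < ρ.map e ∧ σ.map e < σ.map d then (x d : ZMod 2) * x e else 0 := by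
    have := ρ.sum_fibre_mul (fun d => (x d : ZMod 2)) (fun d => (x d : ZMod 2))
      (fun b c => b < c ∧ π.map c < π.map b)
    simp only [hX] at this
    simp only [this, hσ]
  have e4 : (∑ i, ∑ p, if i < p then (∑ a, X (π.emb i a)) * (∑ a, (t (π.emb p a) : ZMod 2)) +
      ((∑ a, (t (π.emb i a) : ZMod 2)) + (∑ a, X (π.emb i a)) + ∑ a, (y (π.emb i a) : ZMod 2)) *
        (∑ a, (y (π.emb p a) : ZMod 2)) else 0) =
      ∑ b, ∑ c, if π.map b < π.map c then X b * t c + (t b + X b + y b) * y c else 0 := by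
    have h1 := π.sum_fibre_mul X (fun b => (t b : ZMod 2)) (fun i p => i < p)
    have h2 := π.sum_fibre_mul (fun b => (t b + X b + y b : ZMod 2)) (fun b => (y b : ZMod 2))
      (fun i p => i < p)
    have h3 := congrArg₂ (· + ·) h1 h2
    simp only [← Finset.sum_add_distrib, ← ite_add_zero] at h3
    simp only [← Finset.sum_add_distrib]
    exact h3
  replace e4 := e4.trans (sum_pairs_swap (fun b c => if π.map b < π.map c then
    X b * t c + (t b + X b + y b) * y c else 0) (by simp))
  rw [sum_pairs_swap (fun d e => if ρ.map d < ρ.map e ∧ σ.map e < σ.map d then _ else _)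
    (by simp)] at e3
  simp only [Finset.sum_add_distrib, Finset.sum_sub_distrib]
  have hI : (∑ i, ∑ p, if i < p then
        ((∑ a, (t (π.emb i a) : ZMod 2)) + (∑ a, X (π.emb i a)) - ∑ a, (y (π.emb i a) : ZMod 2)) *
          (q p + ∑ a, (y (π.emb p a) : ZMod 2) - j p) else 0) +
      (∑ i, ∑ p, if i < p then
        (j p : ZMod 2) * (q i + ∑ a, (t (π.emb i a) : ZMod 2) - j i + ∑ a, X (π.emb i a)) +
          (∑ a, X (π.emb i a)) * (q p + ∑ a, (t (π.emb p a) : ZMod 2)) else 0) =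
      (∑ i, ∑ p, if i < p then (∑ a, (t (π.emb i a) : ZMod 2)) * q p else 0) +
      (∑ i, ∑ p, if i < p then (j p : ZMod 2) * (q i - j i + ∑ a, (y (π.emb i a) : ZMod 2)) +
        (∑ a, (y (π.emb i a) : ZMod 2)) * q p else 0) +
      ∑ b, ∑ c, (if b < c then
        (if π.map b < π.map c then X b * t c + (t b + X b + y b) * y c else 0) +
          (if π.map c < π.map b then X c * t b + (t c + X c + y c) * y b else 0) else 0) := by
    refine Eq.trans ?_ (congrArg _ e4)
    simp only [← Finset.sum_add_distrib]
    refine Finset.sum_congr rfl fun i _ => Finset.sum_congr rfl fun p _ => ?_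
    split_ifs
    · simp only [Finset.sum_add_distrib]
      ring_nf
      reduce_mod_char
    · simp
  have hJ : (∑ b, ∑ c, if b < c then
        (if π.map b < π.map c then X b * t c + (t b + X b + y b) * y c else 0) +
          (if π.map c < π.map b then X c * t b + (t c + X c + y c) * y b else 0) else 0) +
      (∑ b, ∑ c, if b < c ∧ π.map c < π.map b then
        (t b + X b - y b : ZMod 2) * (t c + X c - y c) else 0) +
      (∑ b, ∑ c, if b < c ∧ π.map b = π.map c then
        (y c : ZMod 2) * (t b - y b + X b) + X b * t c else 0) =
      (∑ b, ∑ c, if b < c ∧ π.map c < π.map b then (t b * t c : ZMod 2) else 0) +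
      (∑ b, ∑ c, if b < c then (y c : ZMod 2) * (t b - y b + X b) + X b * t c else 0) +
      (∑ b, ∑ c, if b < c ∧ π.map c < π.map b then (y b * y c : ZMod 2) else 0) +
      (∑ b, ∑ c, if b < c ∧ π.map c < π.map b then X b * X c else 0) := by
    simp only [← Finset.sum_add_distrib]
    refine Finset.sum_congr rfl fun b _ => Finset.sum_congr rfl fun c _ => ?_
    by_cases hbc : b < c
    · rcases lt_trichotomy (π.map b) (π.map c) with h | h | h
      · simp only [hbc, h, h.not_gt, h.ne, if_true, if_false, and_false]
        ring_nf
        reduce_mod_char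
      · simp only [hbc, h, lt_irrefl, if_true, if_false, and_true, and_false]
        ring_nf
      · simp only [hbc, h, h.not_gt, h.ne', if_true, if_false, and_true, and_false]
        ring_nf
        reduce_mod_char
    · simp [hbc]
  have hL : (∑ b, ∑ c, if b < c ∧ σ.map c < σ.map b then (x b * x c : ZMod 2) else 0) +
      (∑ b, ∑ c, if b < c ∧ σ.map b = σ.map c then (if ρ.map c < ρ.map b then
        (x b : ZMod 2) * x c else 0) else 0) +
      (∑ d, ∑ e, if d < e then
        (if ρ.map d < ρ.map e ∧ σ.map e < σ.map d then (x d : ZMod 2) * x e else 0) +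
        (if ρ.map e < ρ.map d ∧ σ.map d < σ.map e then (x e : ZMod 2) * x d else 0) else 0) =
      ∑ b, ∑ c, if b < c ∧ ρ.map c < ρ.map b then (x b * x c : ZMod 2) else 0 := by
    simp only [← Finset.sum_add_distrib]
    refine Finset.sum_congr rfl fun b _ => Finset.sum_congr rfl fun c _ => ?_
    by_cases hbc : b < c
    · rcases lt_trichotomy (ρ.map b) (ρ.map c) with h | h | h
      · rcases lt_trichotomy (σ.map b) (σ.map c) with h' | h' | h'
        · simp [hbc, h, h.not_gt, h', h'.not_gt, h'.ne]
        · simp [hbc, h, h.not_gt, h']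
        · simp only [hbc, h, h.not_gt, h', h'.not_gt, h'.ne', if_true, if_false, and_true, and_false]
          ring_nf
          reduce_mod_char
      · simp [hσ, h]
      · rcases lt_trichotomy (σ.map b) (σ.map c) with h' | h' | h'
        · simp [hbc, h, h.not_gt, h', h'.not_gt, h'.ne, mul_comm]
        · simp [hbc, h, h.not_gt, h']
        · simp [hbc, h, h.not_gt, h', h'.not_gt, h'.ne']
    · simp [hbc]
  rw [← e3] at hL
  linear_combination hI + hJ + hL

lemma sgnC_add_single {m n : ℕ} {k : Fin (n + 1) → ℕ} (π : FinSurj m n k)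
    (q j : Fin (n + 1) → ℤ) (t : Fin (m + 1) → ℤ) (i : Fin (n + 1)) :
    PT.sgnC π (fun a => q a + if a = i then 1 else 0) j t =
      PT.sgnC π q j t + (∑ p with i < p, j p + ∑ a with a < i, ∑ c, t (π.emb a c)) := by
  have h1 : ∀ p a : Fin (n + 1), j p * ((q a + if a = i then 1 else 0) - j a + ∑ c, t (π.emb a c)) +
      (∑ c, t (π.emb a c)) * (q p + if p = i then 1 else 0) =
      (j p * (q a - j a + ∑ c, t (π.emb a c)) + (∑ c, t (π.emb a c)) * q p) +
      ((if a = i then j p else 0) + if p = i then ∑ c, t (π.emb a c) else 0) := by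
    intro p a
    split_ifs <;> ring
  unfold PT.sgnC
  simp only [h1]
  simp only [Finset.sum_add_distrib (f := fun a => _ + _) (g := fun a => (if _ then _ else _) + _)]
  have h2 : ∑ p, ∑ a with a < p, (if a = i then j p else 0) = ∑ p with i < p, j p := by
    rw [Finset.sum_filter]
    refine Finset.sum_congr rfl fun p _ => ?_
    rw [Finset.sum_filter, Finset.sum_eq_single i]
    · simp
    · intro b _ hb; simp [hb]
    · simp
  have h3 : ∑ p, ∑ a with a < p, (if p = i then ∑ c, t (π.emb a c) else 0) =
      ∑ a with a < i, ∑ c, t (π.emb a c) := by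
    rw [Finset.sum_eq_single i]
    · simp
    · intro b _ hb; simp [hb]
    · simp
  simp only [Finset.sum_add_distrib] at h2 h3 ⊢
  rw [h2, h3]
  ring

lemma sgnC_refl_self {n : ℕ} (t : Fin (n + 1) → ℤ) :
    PT.sgnC (FinSurj.refl n) (fun _ => 0) t t = 0 := by
  unfold PT.sgnC
  rw [Finset.sum_eq_zero, Finset.sum_eq_zero, add_zero]
  · intro b _
    refine Finset.sum_eq_zero fun a ha => ?_
    simp only [Finset.mem_filter, Finset.mem_univ, true_and] at ha
    exact absurd ha.1 (not_lt.2 ha.2.le)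
  · intro p _
    refine Finset.sum_eq_zero fun i _ => ?_
    simp

lemma sgnC_toOne {m : ℕ} (q j : Fin 1 → ℤ) (t : Fin (m + 1) → ℤ) :
    PT.sgnC (FinSurj.toOne m) q j t = 0 := by
  simp [PT.sgnC]

lemma FinSurj.exists_emb_map {m n : ℕ} {k : Fin (n + 1) → ℕ} (π : FinSurj m n k) (b : Fin (m + 1)) :
    ∃ a, π.emb (π.map b) a = b := by
  have : b ∈ Set.range (π.emb (π.map b)) := by rw [π.range_emb]; rfl
  exact this

lemma sum_piFinset_one {M : Type*} [AddCommMonoid M] (A : Fin 1 → Finset ℤ)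
    (f : (Fin 1 → ℤ) → M) : ∑ j ∈ Fintype.piFinset A, f j = ∑ l ∈ A 0, f (fun _ => l) := by
  refine Finset.sum_bij' (fun j _ => j 0) (fun l _ _ => l) ?_ ?_ ?_ ?_ ?_
  · intro j hj; exact Fintype.mem_piFinset.1 hj 0
  · intro l hl
    refine Fintype.mem_piFinset.2 fun i => ?_
    rw [Subsingleton.elim i 0]; exact hl
  · intro j _; funext i; rw [Subsingleton.elim i 0]
  · intros; rfl
  · intro j _
    congr 1
    funext i; rw [Subsingleton.elim i 0]

lemma FinFam.id_self {C : PreDG.{u, v}} (E : (FinFam.cat C).Obj) (i : ℤ) :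
    (FinFam.cat C).id E i i = (C.hom (FinFam.E E i) (FinFam.E E i)).cast (by omega) (C.id _) :=
  FinFam.diag_self (E := E) (F := E) (fun i => C.id (FinFam.E E i)) i

lemma FinFam.id_ne {C : PreDG.{u, v}} (E : (FinFam.cat C).Obj) {i j : ℤ} (h : i ≠ j) :
    (FinFam.cat C).id E i j = 0 :=
  FinFam.diag_ne (E := E) (F := E) (fun i => C.id (FinFam.E E i)) h

namespace PTData

variable {C : PreDG.{u, v}} (D : PTData C) {n : ℕ} {k : Fin (n + 1) → ℕ}
  {X : ∀ i, Fin (k i + 1) → C.Obj} {Y : Fin (n + 1) → C.Obj} {q : Fin (n + 1) → ℤ}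
  (g : ∀ i, (D.P (k i) (X i) (Y i)).X (q i))

lemma dAt_self (i : Fin (n + 1)) : D.dAt g i i =
    (D.P (k i) (X i) (Y i)).cast (by simp) ((D.P (k i) (X i) (Y i)).d _ _ rfl (g i)) := by
  rw [PreCx.cast_d, dAt, dif_pos rfl]

lemma dAt_of_ne {i j : Fin (n + 1)} (h : j ≠ i) : D.dAt g i j =
    (D.P (k j) (X j) (Y j)).cast (by simp [h]) (g j) := by
  rw [dAt, dif_neg h]

end PTData

namespace PT

variable {C : PreDG.{u, v}} (P : PT C)

lemma eq_zero_of_source {n : ℕ} {X : Fin (n + 1) → C.Obj} {Y : C.Obj} {a : ℤ} (i : Fin (n + 1))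
    (h : C.id (X i) = 0) (x : (P.P n X Y).X a) : x = 0 := by
  rw [← P.lawful.comp_id x]
  exact P.comp_zero_right _ _ _ _ _ i (by simp only [h, map_zero])

lemma eq_zero_of_target {n : ℕ} {X : Fin (n + 1) → C.Obj} {Y : C.Obj} {a : ℤ}
    (h : C.id Y = 0) (x : (P.P n X Y).X a) : x = 0 := by
  rw [← P.lawful.id_comp x, h, map_zero]
  exact P.comp_zero_left _ _ _ _

/-- The pseudo-tensor structure on finite families of objects. -/
noncomputable def finFamData : PTData (FinFam.cat C) where
  P n E F :=
    { X := fun N => ∀ (k : ℤ) (j : Fin (n + 1) → ℤ),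
        (P.P n (fun i => FinFam.E (E i) (j i)) (FinFam.E F k)).X (N + ∑ i, j i - k)
      d := fun a b h => AddMonoidHom.mk' (fun φ k j =>
        k.negOnePow • (P.P n _ _).d _ _ (by omega) (φ k j)) (fun φ ψ => by funext k j; simp) }
  one := fun {X Y a} =>
    AddMonoidHom.mk' (fun (φ : FinFam.Fam (X 0) Y a) k j =>
      P.one (X := fun i => FinFam.E (X i) (j i)) ((C.hom _ _).cast (by simp) (φ k (j 0))))
      (fun φ ψ => by
        funext k j
        exact (congrArg _ (map_add _ _ _)).trans (map_add _ _ _))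
  comp := fun {m n κ} π {X X'} hX {Y Z p r q} h φ ψ k t =>
    ∑ j ∈ Fintype.piFinset (fun i => FinFam.rng (Y i)), (sgnC π q j t).negOnePow •
      P.comp π (X := fun b => FinFam.E (X b) (t b))
        (X' := fun i a => FinFam.E (X' i a) (t (π.emb i a))) (fun i a => by rw [hX])
        (by
          rw [Finset.sum_sub_distrib, Finset.sum_add_distrib, π.sum_fibres t]
          omega)
        (φ k j) (fun i => ψ i (j i) (fun a => t (π.emb i a)))

lemma finFam_d_apply {n : ℕ} {E : Fin (n + 1) → (FinFam.cat C).Obj} {F : (FinFam.cat C).Obj} {a b : ℤ} (h : a + 1 = b)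
    (φ : (P.finFamData.P n E F).X a) (k : ℤ) (j : Fin (n + 1) → ℤ) :
    (P.finFamData.P n E F).d a b h φ k j = k.negOnePow • (P.P n _ _).d _ _ (by omega) (φ k j) := rfl

lemma finFam_cast_apply {n : ℕ} {E : Fin (n + 1) → (FinFam.cat C).Obj} {F : (FinFam.cat C).Obj} {a b : ℤ} (h : a = b)
    (φ : (P.finFamData.P n E F).X a) (k : ℤ) (j : Fin (n + 1) → ℤ) :
    (P.finFamData.P n E F).cast h φ k j = (P.P n _ _).cast (by omega) (φ k j) := by
  subst h; rfl

lemma one_cast {X : Fin 1 → C.Obj} {Y : C.Obj} {a b : ℤ} (h : a = b) (f : (C.hom (X 0) Y).X a) :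
    P.one ((C.hom (X 0) Y).cast h f) = (P.P 0 X Y).cast h (P.one f) := by
  subst h; rfl

lemma finFam_one_bijective {X : Fin 1 → FinFam C} {Y : FinFam C} {a : ℤ} :
    Function.Bijective (P.finFamData.one (X := X) (Y := Y) (a := a)) := by
  constructor
  · rw [injective_iff_map_eq_zero]
    intro φ hφ
    funext k j
    have h1 := congrFun (congrFun hφ k) (fun _ => j)
    have h2 : (C.hom _ _).cast _ ((φ : FinFam.Fam (X 0) Y a) k j) = 0 :=
      P.lawful.one_bijective.1 (h1.trans (map_zero _).symm)
    have h3 := congrArg ((C.hom (FinFam.E (X 0) j) (FinFam.E Y k)).cast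
      (show a + ∑ _i : Fin 1, j - k = a + j - k by simp)) h2
    rw [PreCx.cast_cast, map_zero] at h3
    exact h3
  · intro y
    choose f hf using fun (k j : ℤ) => P.lawful.one_bijective.2 (y k (fun _ => j))
    refine ⟨fun k j => (C.hom _ _).cast (by simp) (f k j), ?_⟩
    funext k j
    obtain ⟨c, rfl⟩ : ∃ c, j = fun _ => c :=
      ⟨j 0, funext fun i => congrArg j (Subsingleton.elim (α := Fin 1) _ _)⟩
    refine Eq.trans ?_ (hf k c)
    refine congrArg P.one ?_
    exact PreCx.cast_cast _ _ _ _

lemma finFam_one_d {X : Fin 1 → FinFam C} {Y : FinFam C} {a b : ℤ} (h : a + 1 = b)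
    (φ : FinFam.Fam (X 0) Y a) :
    P.finFamData.one (X := X) (Y := Y) (FinFam.dFam (X 0) Y a b h φ) =
      (P.finFamData.P 0 X Y).d a b h (P.finFamData.one (X := X) (Y := Y) (a := a) φ) := by
  funext k j
  change P.one (X := fun i => FinFam.E (X i) (j i))
      ((C.hom _ _).cast _ (k.negOnePow • (C.hom _ _).d _ _ _ (φ k (j 0)))) =
    k.negOnePow • (P.P 0 _ _).d _ _ _ (P.one (X := fun i => FinFam.E (X i) (j i))
      ((C.hom _ _).cast _ (φ k (j 0))))
  rw [map_negOnePow, map_negOnePow, ← P.lawful.one_d, PreCx.cast_d, PreCx.d_cast]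

lemma finFam_one_comp {X Y : Fin 1 → FinFam C} {Z : FinFam C} {a b c : ℤ} (h : a + b = c)
    (f : FinFam.Fam (Y 0) Z a) (g : ∀ i : Fin 1, FinFam.Fam (X 0) (Y i) b) :
    P.finFamData.one (X := X) (Y := Z) (a := c) (FinFam.mul h f (g 0)) =
      P.finFamData.comp (FinSurj.toOne 0) (X := X) (Y := Y) (Z := Z)
        (X' := fun _ => X) (fun _ _ => rfl) (q := fun _ => b) (by simpa)
        (P.finFamData.one (X := Y) (Y := Z) (a := a) f)
        (fun i => P.finFamData.one (X := X) (Y := Y i) (a := b) (g i)) := by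
  funext k t
  change P.one (X := fun i => FinFam.E (X i) (t i)) ((C.hom _ _).cast _ (∑ l ∈ (Y 0).rng, C.comp _ (f k l) (g 0 l (t 0)))) =
    ∑ j ∈ Fintype.piFinset (fun i => (Y i).rng), (sgnC (FinSurj.toOne 0) (fun _ => b) j t).negOnePow •
      P.comp _ _ _ (P.one (X := fun i => FinFam.E (Y i) (j i)) ((C.hom _ _).cast _ (f k (j 0)))) fun i =>
        P.one (X := fun a => (X a).E (t a)) ((C.hom _ _).cast _ (g i (j i) (t 0)))
  rw [sum_piFinset_one, map_sum, map_sum]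
  refine Finset.sum_congr rfl fun l _ => ?_
  rw [sgnC_toOne, Int.negOnePow_zero, one_smul, PreDG.cast_comp]
  have e : ∀ {d e : ℤ} (hd : a + l - k = d) (he : b + t 0 - l = e) (h : d + e = c + ∑ i, t i - k)
     (h') (h''),
      P.one (X := fun i => FinFam.E (X i) (t i)) (C.comp h' (f k l) (g 0 l (t 0))) =
      P.comp (r := c + ∑ i, t i - k) (FinSurj.toOne 0) (X := fun i => FinFam.E (X i) (t i))
        (X' := fun _ i => FinFam.E (X i) (t i)) (Y := fun i => FinFam.E (Y i) l)
        (q := fun _ => e)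
        (fun _ _ => rfl) h'' (P.one (X := fun i => FinFam.E (Y i) l) ((C.hom _ _).cast hd (f k l)))
        (fun i => P.one (X := fun a => FinFam.E (X a) (t a)) ((C.hom _ _).cast
          (show b + t 0 - l = e from he) (g i l (t 0)))) := by
    intro d e hd he h h' h''
    subst hd he
    exact P.lawful.one_comp (X := fun i => FinFam.E (X i) (t i)) (Y := fun i => FinFam.E (Y i) l)
      h' (f k l) (fun i => g i l (t 0))
  exact e (d := a + ∑ _i : Fin (0 + 1), l - k) (e := b + ∑ i : Fin (0 + 1), t i - l)
    (by simp) (by simp) (by simp; omega) _ (by simp; omega)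


lemma finFam_d_d {n : ℕ} {E : Fin (n + 1) → FinFam C} {F : FinFam C} (a b c : ℤ) (h : a + 1 = b)
    (h' : b + 1 = c) (φ : (P.finFamData.P n E F).X a) :
    (P.finFamData.P n E F).d b c h' ((P.finFamData.P n E F).d a b h φ) = 0 := by
  funext k j
  change k.negOnePow • (P.P n _ _).d _ _ _ (k.negOnePow • (P.P n _ _).d _ _ _ (φ k j)) = 0
  rw [map_negOnePow, P.lawful.d_d, smul_zero, smul_zero]

section

variable {m n : ℕ} {κ : Fin (n + 1) → ℕ} {π : FinSurj m n κ} {X : Fin (m + 1) → (FinFam.cat C).Obj}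
  {X' : ∀ i, Fin (κ i + 1) → (FinFam.cat C).Obj} {hX : ∀ i a, X' i a = X (π.emb i a)}
  {Y : Fin (n + 1) → (FinFam.cat C).Obj} {Z : (FinFam.cat C).Obj} {p r : ℤ} {q : Fin (n + 1) → ℤ}

lemma finFam_comp_apply (h : p + ∑ i, q i = r) (φ : (P.finFamData.P n Y Z).X p)
    (ψ : ∀ i, (P.finFamData.P (κ i) (X' i) (Y i)).X (q i)) (k : ℤ) (t : Fin (m + 1) → ℤ) :
    P.finFamData.comp π hX h φ ψ k t =
    ∑ j ∈ Fintype.piFinset (fun i => FinFam.rng (Y i)), (sgnC π q j t).negOnePow •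
      P.comp π (X := fun b => FinFam.E (X b) (t b))
        (X' := fun i a => FinFam.E (X' i a) (t (π.emb i a))) (fun i a => by rw [hX])
        (by
          rw [Finset.sum_sub_distrib, Finset.sum_add_distrib, π.sum_fibres t]
          omega)
        (φ k j) (fun i => ψ i (j i) (fun a => t (π.emb i a))) := rfl

lemma finFam_comp_add_left (h : p + ∑ i, q i = r) (φ φ' : (P.finFamData.P n Y Z).X p)
    (ψ : ∀ i, (P.finFamData.P (κ i) (X' i) (Y i)).X (q i)) :
    P.finFamData.comp π hX h (φ + φ') ψ =
      P.finFamData.comp π hX h φ ψ + P.finFamData.comp π hX h φ' ψ := by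
  funext k t
  refine Eq.trans ?_ Finset.sum_add_distrib
  refine Finset.sum_congr rfl fun j _ => ?_
  rw [← smul_add, ← P.lawful.comp_add_left]
  rfl

lemma finFam_comp_add_right (h : p + ∑ i, q i = r) (φ : (P.finFamData.P n Y Z).X p)
    (ψ : ∀ i, (P.finFamData.P (κ i) (X' i) (Y i)).X (q i)) (i : Fin (n + 1))
    (x y : (P.finFamData.P (κ i) (X' i) (Y i)).X (q i)) :
    P.finFamData.comp π hX h φ (Function.update ψ i (x + y)) =
      P.finFamData.comp π hX h φ (Function.update ψ i x) +
        P.finFamData.comp π hX h φ (Function.update ψ i y) := by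
  funext k t
  refine Eq.trans ?_ Finset.sum_add_distrib
  refine Finset.sum_congr rfl fun j _ => ?_
  rw [← smul_add]
  refine congrArg _ (P.comp_add_of _ _ i ?_ (fun j hj => ?_) (fun j hj => ?_))
  · simp only [Function.update_self]; rfl
  · simp only [Function.update_of_ne hj]
  · simp only [Function.update_of_ne hj]

lemma finFam_dAt (ψ : ∀ i, (P.finFamData.P (κ i) (X' i) (Y i)).X (q i)) (i i' : Fin (n + 1))
    (j : Fin (n + 1) → ℤ) (t : ∀ i, Fin (κ i + 1) → ℤ) :
    ∃ e, (P.P (κ i') (fun a => FinFam.E (X' i' a) (t i' a)) (FinFam.E (Y i') (j i'))).cast e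
      (P.finFamData.dAt ψ i i' (j i') (t i')) = (if i' = i then j i else 0).negOnePow •
        P.dAt (X := fun i a => FinFam.E (X' i a) (t i a)) (Y := fun i => FinFam.E (Y i) (j i))
          (q := fun i => q i + ∑ a, t i a - j i) (fun i => ψ i (j i) (t i)) i i' := by
  refine ⟨by omega, ?_⟩
  by_cases hi : i' = i
  · subst hi
    have e : (if i' = i' then j i' else 0).negOnePow = (j i').negOnePow := by simp
    have e1 := (congrFun (congrFun (P.finFamData.dAt_self ψ i') (j i')) (t i')).trans
      (P.finFam_cast_apply _ _ _ _)
    rw [e, e1, P.dAt_self, PreCx.cast_cast]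
    refine (congrArg _ (P.finFam_d_apply _ _ _ _)).trans ?_
    simp only [map_negOnePow, PreCx.cast_d]
  · have e : (if i' = i then j i else 0).negOnePow = 1 := by simp [hi]
    have e1 := (congrFun (congrFun (P.finFamData.dAt_of_ne ψ hi) (j i')) (t i')).trans
      (P.finFam_cast_apply _ _ _ _)
    rw [e, e1, one_smul, P.dAt_of_ne _ hi, PreCx.cast_cast]

lemma finFam_leibniz {p' r' : ℤ} (h : p + ∑ i, q i = r) (hp : p + 1 = p') (hr : r + 1 = r')
    (f : (P.finFamData.P n Y Z).X p) (g : ∀ i, (P.finFamData.P (κ i) (X' i) (Y i)).X (q i)) :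
    (P.finFamData.P m X Z).d r r' hr (P.finFamData.comp π hX h f g) =
      P.finFamData.comp π hX (by omega) ((P.finFamData.P n Y Z).d p p' hp f) g +
        ∑ i, (p + ∑ j with j < i, q j).negOnePow •
          P.finFamData.comp π hX (by rw [Finset.sum_add_distrib]; simp; omega) f
            (P.finFamData.dAt g i) := by
  funext k t
  have hK : ∀ j : Fin (n + 1) → ℤ, ∑ i, (q i + ∑ a, t (π.emb i a) - j i) =
      ∑ i, q i + ∑ b, t b - ∑ i, j i := fun j => by
    rw [Finset.sum_sub_distrib, Finset.sum_add_distrib, π.sum_fibres t]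
  have key : ∀ j : Fin (n + 1) → ℤ, ∀ i,
      (p + ∑ a with a < i, q a).negOnePow • (sgnC π (fun a => q a + if a = i then 1 else 0) j t).negOnePow •
      P.comp π (X := fun b => FinFam.E (X b) (t b)) (Z := FinFam.E Z k)
        (X' := fun i a => FinFam.E (X' i a) (t (π.emb i a))) (fun i a => by rw [hX])
        (r := r' + ∑ b, t b - k)
        (by
          rw [Finset.sum_sub_distrib, Finset.sum_add_distrib, π.sum_fibres t,
            Finset.sum_add_distrib]
          simp
          omega)
        (f k j) (fun i' => P.finFamData.dAt g i i' (j i') (fun a => t (π.emb i' a))) =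
      (k.negOnePow * (sgnC π q j t).negOnePow) •
        (p + ∑ i, j i - k + ∑ a with a < i, (q a + ∑ c, t (π.emb a c) - j a)).negOnePow •
      P.comp π (X := fun b => FinFam.E (X b) (t b))
        (X' := fun i a => FinFam.E (X' i a) (t (π.emb i a))) (fun i a => by rw [hX])
        (by
          rw [Finset.sum_add_distrib, hK]
          simp
          omega)
        (f k j) (P.dAt (X := fun i a => FinFam.E (X' i a) (t (π.emb i a)))
          (Y := fun i => FinFam.E (Y i) (j i))
          (q := fun i => q i + ∑ a, t (π.emb i a) - j i)
          (fun i => g i (j i) (fun a => t (π.emb i a))) i) := by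
    intro j i
    have h0 : p + ∑ i, j i - k + ∑ i', (q i' + ∑ a, t (π.emb i' a) - j i' + if i' = i then 1 else 0) =
        r' + ∑ b, t b - k := by
      rw [Finset.sum_add_distrib, hK]
      simp
      omega
    have h1 := P.comp_smul_right (π := π) (X := fun b => FinFam.E (X b) (t b))
        (X' := fun i a => FinFam.E (X' i a) (t (π.emb i a))) (hX := fun i a => by rw [hX]) h0 (f k j)
        (fun i' => if i' = i then j i else 0) (P.dAt (X := fun i a => FinFam.E (X' i a) (t (π.emb i a)))
          (Y := fun i => FinFam.E (Y i) (j i))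
          (q := fun i => q i + ∑ a, t (π.emb i a) - j i)
          (fun i => g i (j i) (fun a => t (π.emb i a))) i)
    rw [Finset.sum_ite_eq' Finset.univ i, if_pos (Finset.mem_univ i)] at h1
    have h2 := PTData.comp_congr P.toPTData π (X := fun b => FinFam.E (X b) (t b))
        (X' := fun i a => FinFam.E (X' i a) (t (π.emb i a))) (fun i a => by rw [hX])
        (by
          rw [Finset.sum_sub_distrib, Finset.sum_add_distrib, π.sum_fibres t,
            Finset.sum_add_distrib]
          simp
          omega) h0 (f k j) _ _ (fun i' => P.finFam_dAt g i i' j (fun i a => t (π.emb i a)))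
    refine (congrArg _ (congrArg _ (h2.trans h1))).trans ?_
    simp only [smul_smul, ← Int.negOnePow_add]
    congr 1
    rw [sgnC_add_single, Finset.sum_sub_distrib, Finset.sum_add_distrib]
    have : ∑ p, j p = (∑ p with p < i, j p) + j i + ∑ p with i < p, j p := by
      rw [← Finset.sum_filter_add_sum_filter_not Finset.univ (fun p => p < i), add_assoc]
      congr 1
      rw [← Finset.sum_filter_add_sum_filter_not (Finset.univ.filter fun p => ¬ p < i) (fun p => p = i)]
      congr 1
      · rw [Finset.filter_filter, Finset.sum_eq_single i]
        · intro b hb hbi; simp at hb; exact absurd hb.2 hbi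
        · intro hi; simp at hi
      · rw [Finset.filter_filter]
        refine Finset.sum_congr (Finset.filter_congr fun p _ => ?_) fun _ _ => rfl
        rw [not_lt]
        exact ⟨fun h => lt_of_le_of_ne h.1 (Ne.symm h.2), fun h => ⟨h.le, ne_of_gt h⟩⟩
    rw [this, Int.negOnePow_eq_iff]
    exact ⟨0, by ring⟩
  refine (congrArg (k.negOnePow • ·) (map_sum ((P.P m _ _).d _ _ _) _ _)).trans ?_
  have eR : ∀ x : Fin (n + 1) → (P.finFamData.P m X Z).X r', (∑ i, x i) k t = ∑ i, x i k t :=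
    fun x => (congrFun (Finset.sum_apply k Finset.univ x) t).trans (Finset.sum_apply t Finset.univ _)
  have eS : ∀ (s : ℤ) (x : (P.finFamData.P m X Z).X r'),
    (s.negOnePow • x) k t = s.negOnePow • x k t := fun _ _ => rfl
  refine Eq.trans ?_ (congrArg _ (eR _).symm)
  simp only [eS, finFam_comp_apply, Finset.smul_sum, key]
  refine Eq.trans ?_ (Eq.trans Finset.sum_add_distrib (congrArg (HAdd.hAdd _) Finset.sum_comm))
  refine Finset.sum_congr rfl fun j _ => ?_
  rw [map_negOnePow, P.lawful.leibniz (p' := p' + ∑ i, j i - k) π _ _ (by omega) (by omega),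
    smul_add, smul_add, Finset.smul_sum, Finset.smul_sum, finFam_d_apply, P.comp_smul_left,
    smul_comm]
  simp only [smul_smul, mul_assoc]

end

lemma finFam_comp_congr {m n : ℕ} {κ : Fin (n + 1) → ℕ} (π : FinSurj m n κ) {X : Fin (m + 1) → C.Obj}
    {X' : ∀ i, Fin (κ i + 1) → FinFam C} {Y : Fin (n + 1) → FinFam C} {Z : C.Obj} {p r : ℤ}
    {q : Fin (n + 1) → ℤ} {j : Fin (n + 1) → ℤ} (s s' : ∀ i, Fin (κ i + 1) → ℤ)
    (e : ∀ i a, s i a = s' i a)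
    (hX : ∀ i a, FinFam.E (X' i a) (s i a) = X (π.emb i a))
    (hX' : ∀ i a, FinFam.E (X' i a) (s' i a) = X (π.emb i a))
    (h : p + ∑ i, (q i + ∑ a, s i a - j i) = r) (h' : p + ∑ i, (q i + ∑ a, s' i a - j i) = r)
    (f : (P.P n (fun i => FinFam.E (Y i) (j i)) Z).X p)
    (ψ : ∀ i, (P.finFamData.P (κ i) (X' i) (Y i)).X (q i)) :
    P.comp π (X := X) (X' := fun i a => FinFam.E (X' i a) (s i a)) hX h f
        (fun i => ψ i (j i) (s i)) =
      P.comp π (X := X) (X' := fun i a => FinFam.E (X' i a) (s' i a)) hX' h' f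
        (fun i => ψ i (j i) (s' i)) := by
  obtain rfl : s = s' := funext fun i => funext fun a => e i a
  rfl

lemma finFam_assoc {l m n : ℕ} {k : Fin (n + 1) → ℕ} {k' : Fin (m + 1) → ℕ} {s : Fin (n + 1) → ℕ}
    (π : FinSurj m n k) (ρ : FinSurj l m k') (σ : FinSurj l n s)
    (τ : ∀ i, FinSurj (s i) (k i) (fun a => k' (π.emb i a)))
    (hτ : ∀ i a b, σ.emb i ((τ i).emb a b) = ρ.emb (π.emb i a) b)
    {W : Fin (l + 1) → (FinFam.cat C).Obj} {X : Fin (m + 1) → (FinFam.cat C).Obj}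
    {Y : Fin (n + 1) → (FinFam.cat C).Obj} {Z : (FinFam.cat C).Obj}
    {p r N : ℤ} {q u : Fin (n + 1) → ℤ} {t : Fin (m + 1) → ℤ}
    (h₁ : p + ∑ i, q i = r) (h₂ : r + ∑ j, t j = N)
    (h₃ : ∀ i, q i + ∑ a, t (π.emb i a) = u i) (h₄ : p + ∑ i, u i = N)
    (f : (P.finFamData.P n Y Z).X p)
    (g : ∀ i, (P.finFamData.P (k i) (fun a => X (π.emb i a)) (Y i)).X (q i))
    (h : ∀ j, (P.finFamData.P (k' j) (fun b => W (ρ.emb j b)) (X j)).X (t j)) :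
    P.finFamData.comp σ (X := W) (X' := fun i c => W (σ.emb i c)) (fun _ _ => rfl) h₄ f
        (fun i => P.finFamData.comp (τ i) (fun a b => by rw [hτ]) (h₃ i) (g i)
          (fun a => h (π.emb i a))) =
      (koszul π.map q t).negOnePow •
        P.finFamData.comp ρ (fun _ _ => rfl) h₂
          (P.finFamData.comp π (fun _ _ => rfl) h₁ f g) h := by
  obtain rfl : u = fun i => q i + ∑ a, t (π.emb i a) := funext fun i => (h₃ i).symm
  funext c x
  have hK : ∀ (y : Fin (m + 1) → ℤ) (j : Fin (n + 1) → ℤ),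
      ∑ i, (q i + ∑ a, y (π.emb i a) - j i) = ∑ i, q i + ∑ b, y b - ∑ i, j i := fun y j => by
    rw [Finset.sum_sub_distrib, Finset.sum_add_distrib, π.sum_fibres y]
  have hK' : ∀ (y : Fin (m + 1) → ℤ),
      ∑ b, (t b + ∑ a, x (ρ.emb b a) - y b) = ∑ b, t b + ∑ b, x b - ∑ b, y b := fun y => by
    rw [Finset.sum_sub_distrib, Finset.sum_add_distrib, ρ.sum_fibres x]
  have hx : ∀ i a, ∑ b, x (σ.emb i ((τ i).emb a b)) = ∑ b, x (ρ.emb (π.emb i a) b) := fun i a =>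
    Finset.sum_congr rfl fun b _ => by rw [hτ]
  have hK'' : ∀ (y : Fin (m + 1) → ℤ) i,
      ∑ a, (t (π.emb i a) + ∑ b, x (σ.emb i ((τ i).emb a b)) - y (π.emb i a)) =
      ∑ a, t (π.emb i a) + ∑ c, x (σ.emb i c) - ∑ a, y (π.emb i a) := fun y i => by
    rw [Finset.sum_sub_distrib, Finset.sum_add_distrib, (τ i).sum_fibres (fun c => x (σ.emb i c))]
  have hK4 : ∀ (j : Fin (n + 1) → ℤ), p + ∑ i, j i - c +
      ∑ i, (q i + ∑ a, t (π.emb i a) + ∑ c, x (σ.emb i c) - j i) = N + ∑ b, x b - c := fun j => by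
    rw [Finset.sum_sub_distrib, Finset.sum_add_distrib, Finset.sum_add_distrib, σ.sum_fibres x,
      π.sum_fibres t]
    omega
  have key : ∀ (j : Fin (n + 1) → ℤ) (y : Fin (m + 1) → ℤ),
      (sgnC σ (fun i => q i + ∑ a, t (π.emb i a)) j x).negOnePow •
      (∑ i, sgnC (τ i) (fun a => t (π.emb i a)) (fun a => y (π.emb i a))
        (fun c => x (σ.emb i c))).negOnePow •
      P.comp σ (X := fun b => FinFam.E (W b) (x b)) (X' := fun i c => FinFam.E (W (σ.emb i c)) (x (σ.emb i c)))
        (fun _ _ => rfl) (hK4 j) (f c j) (fun i =>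
          P.comp (τ i) (X := fun c => FinFam.E (W (σ.emb i c)) (x (σ.emb i c)))
            (X' := fun a b => FinFam.E (W (ρ.emb (π.emb i a) b)) (x (σ.emb i ((τ i).emb a b))))
            (fun a b => by rw [hτ]) (by rw [hK'' y i]; omega)
            (g i (j i) (fun a => y (π.emb i a)))
            (fun a => h (π.emb i a) (y (π.emb i a)) (fun b => x (σ.emb i ((τ i).emb a b))))) =
      (koszul π.map q t).negOnePow • (sgnC ρ t y x).negOnePow • (sgnC π q j y).negOnePow •
      P.comp ρ (X := fun b => FinFam.E (W b) (x b))
        (X' := fun i c => FinFam.E (W (ρ.emb i c)) (x (ρ.emb i c)))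
        (fun _ _ => rfl) (by rw [hK']; omega)
        (P.comp π (r := r + ∑ b, y b - c) (X := fun b => FinFam.E (X b) (y b))
          (X' := fun i a => FinFam.E (X (π.emb i a)) (y (π.emb i a))) (fun _ _ => rfl)
          (by rw [hK]; omega) (f c j) (fun i => g i (j i) (fun a => y (π.emb i a))))
        (fun b => h b (y b) (fun a => x (ρ.emb b a))) := by
    intro j y
    have h1 := P.lawful.assoc π ρ σ τ hτ (W := fun b => FinFam.E (W b) (x b))
      (X := fun b => FinFam.E (X b) (y b)) (Y := fun i => FinFam.E (Y i) (j i))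
      (Z := FinFam.E Z c) (p := p + ∑ i, j i - c) (r := r + ∑ b, y b - c) (N := N + ∑ b, x b - c)
      (q := fun i => q i + ∑ a, y (π.emb i a) - j i)
      (u := fun i => q i + ∑ a, t (π.emb i a) + ∑ c, x (σ.emb i c) - j i)
      (t := fun b => t b + ∑ a, x (ρ.emb b a) - y b)
      (by rw [hK]; omega) (by rw [hK']; omega)
      (fun i => by
        have := hK'' y i
        simp only [hx] at this
        rw [this]; omega)
      (hK4 j) (f c j) (fun i => g i (j i) (fun a => y (π.emb i a)))
      (fun b => h b (y b) (fun a => x (ρ.emb b a)))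
    have h2 : ∀ i, P.comp (τ i) (r := q i + ∑ a, t (π.emb i a) + ∑ c, x (σ.emb i c) - j i) (X := fun c => FinFam.E (W (σ.emb i c)) (x (σ.emb i c)))
            (X' := fun a b => FinFam.E (W (ρ.emb (π.emb i a) b)) (x (σ.emb i ((τ i).emb a b))))
            (fun a b => by rw [hτ]) (by rw [hK'' y i]; omega)
            (g i (j i) (fun a => y (π.emb i a)))
            (fun a => h (π.emb i a) (y (π.emb i a)) (fun b => x (σ.emb i ((τ i).emb a b)))) =
          P.comp (τ i) (r := q i + ∑ a, t (π.emb i a) + ∑ c, x (σ.emb i c) - j i)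
            (X := fun c => FinFam.E (W (σ.emb i c)) (x (σ.emb i c)))
            (X' := fun a b => FinFam.E (W (ρ.emb (π.emb i a) b)) (x (ρ.emb (π.emb i a) b)))
            (fun a b => by rw [hτ]) (by
              have := hK'' y i
              simp only [hx] at this
              rw [this]; omega)
            (g i (j i) (fun a => y (π.emb i a)))
            (fun a => h (π.emb i a) (y (π.emb i a)) (fun b => x (ρ.emb (π.emb i a) b))) :=
      fun i => P.finFam_comp_congr (r := q i + ∑ a, t (π.emb i a) + ∑ c, x (σ.emb i c) - j i) (τ i)
        (X := fun c => FinFam.E (W (σ.emb i c)) (x (σ.emb i c)))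
        (X' := fun a b => W (ρ.emb (π.emb i a) b)) (fun a b => x (σ.emb i ((τ i).emb a b)))
        (fun a b => x (ρ.emb (π.emb i a) b)) (fun a b => by rw [hτ]) (fun a b => by rw [hτ])
        (fun a b => by rw [hτ])
        (by rw [hK'' y i]; omega) (by
          have := hK'' y i
          simp only [hx] at this
          rw [this]; omega) (g i (j i) (fun a => y (π.emb i a))) (fun a => h (π.emb i a))
    refine (congrArg _ (congrArg _ ((congrArg _ (funext h2)).trans h1))).trans ?_
    simp only [smul_smul, ← Int.negOnePow_add]
    congr 1
    rw [← add_assoc (koszul π.map q t), ← sgnC_assoc π ρ σ τ hτ q j t y x]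
    congr 1
    ring
  have hR : ∀ y : Fin (m + 1) → ℤ,
      P.comp ρ (X := fun b => FinFam.E (W b) (x b))
        (X' := fun i c => FinFam.E (W (ρ.emb i c)) (x (ρ.emb i c)))
        (fun _ _ => rfl) (r := N + ∑ b, x b - c) (by rw [hK']; omega)
        (P.finFamData.comp π (fun _ _ => rfl) h₁ f g c y)
        (fun b => h b (y b) (fun a => x (ρ.emb b a))) =
      ∑ j ∈ Fintype.piFinset (fun i => FinFam.rng (Y i)), (sgnC π q j y).negOnePow •
      P.comp ρ (X := fun b => FinFam.E (W b) (x b))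
        (X' := fun i c => FinFam.E (W (ρ.emb i c)) (x (ρ.emb i c)))
        (fun _ _ => rfl) (by rw [hK']; omega)
        (P.comp π (r := r + ∑ b, y b - c) (X := fun b => FinFam.E (X b) (y b))
          (X' := fun i a => FinFam.E (X (π.emb i a)) (y (π.emb i a))) (fun _ _ => rfl)
          (by rw [hK]; omega) (f c j) (fun i => g i (j i) (fun a => y (π.emb i a))))
        (fun b => h b (y b) (fun a => x (ρ.emb b a))) := by
    intro y
    rw [finFam_comp_apply, P.comp_sum_left]
    refine Finset.sum_congr rfl fun j _ => ?_
    rw [P.comp_smul_left]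
  have hL : ∀ j : Fin (n + 1) → ℤ,
      P.comp σ (X := fun b => FinFam.E (W b) (x b)) (X' := fun i c => FinFam.E (W (σ.emb i c)) (x (σ.emb i c)))
        (fun _ _ => rfl) (hK4 j) (f c j) (fun i =>
          P.finFamData.comp (τ i) (fun a b => by rw [hτ]) rfl (g i)
            (fun a => h (π.emb i a)) (j i) (fun c => x (σ.emb i c))) =
      ∑ y ∈ Fintype.piFinset (fun b => FinFam.rng (X b)),
      (∑ i, sgnC (τ i) (fun a => t (π.emb i a)) (fun a => y (π.emb i a))
        (fun c => x (σ.emb i c))).negOnePow •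
      P.comp σ (X := fun b => FinFam.E (W b) (x b)) (X' := fun i c => FinFam.E (W (σ.emb i c)) (x (σ.emb i c)))
        (fun _ _ => rfl) (hK4 j) (f c j) (fun i =>
          P.comp (τ i) (X := fun c => FinFam.E (W (σ.emb i c)) (x (σ.emb i c)))
            (X' := fun a b => FinFam.E (W (ρ.emb (π.emb i a) b)) (x (σ.emb i ((τ i).emb a b))))
            (fun a b => by rw [hτ]) (by rw [hK'' y i]; omega)
            (g i (j i) (fun a => y (π.emb i a)))
            (fun a => h (π.emb i a) (y (π.emb i a)) (fun b => x (σ.emb i ((τ i).emb a b))))) := by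
    intro j
    simp only [finFam_comp_apply]
    rw [P.comp_sum_right]
    refine Eq.symm (Finset.sum_bij (fun y _ i a => y (π.emb i a)) ?_ ?_ ?_ ?_)
    · intro y hy
      simp only [Fintype.mem_piFinset] at hy ⊢
      exact fun i a => hy _
    · intro y _ y' _ e
      funext b
      obtain ⟨i, a, rfl⟩ := π.exists_emb b
      exact congrFun (congrFun e i) a
    · intro r hr
      simp only [Fintype.mem_piFinset] at hr
      choose idx hidx using π.exists_emb_map
      have : ∀ i a i' a', i' = i → π.emb i' a' = π.emb i a → r i' a' = r i a := by
        rintro i a _ a' rfl e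
        rw [π.emb_injective _ e]
      refine ⟨fun b => r (π.map b) (idx b), Fintype.mem_piFinset.2 fun b => ?_, ?_⟩
      · have := hr (π.map b) (idx b)
        rwa [hidx] at this
      · funext i a
        exact this _ _ _ _ (π.map_emb i a) (hidx _)
    · intro y _
      rw [P.comp_smul_right]
  refine (Finset.sum_congr rfl fun j _ => congrArg _ (hL j)).trans ?_
  refine Eq.trans ?_ (congrArg _ (Finset.sum_congr rfl fun y _ => congrArg _ (hR y).symm))
  simp only [Finset.smul_sum, key]
  refine Eq.trans ?_ (Finset.smul_sum (r := (koszul π.map q t).negOnePow)).symm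
  simp only [Finset.smul_sum]
  exact Finset.sum_comm

lemma finFam_id_comp {n : ℕ} {X : Fin (n + 1) → (FinFam.cat C).Obj} {Y : (FinFam.cat C).Obj}
    {a : ℤ} (f : (P.finFamData.P n X Y).X a) :
    P.finFamData.comp (FinSurj.toOne n) (X' := fun _ => X) (Y := fun _ => Y) (fun _ _ => rfl)
      (q := fun _ => a) (by simp) (P.finFamData.one (X := fun _ => Y) ((FinFam.cat C).id Y))
      (fun _ => f) = f := by
  funext k t
  rw [finFam_comp_apply, sum_piFinset_one, Finset.sum_eq_single k]
  · rw [sgnC_toOne, Int.negOnePow_zero, one_smul]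
    have e : ∀ {d b c : ℤ} (hd : d = 0) (hb : b = c) (h : d + ∑ _i : Fin 1, b = c)
        (y : (C.hom (FinFam.E Y k) (FinFam.E Y k)).X d) (hy : y = (C.hom _ _).cast hd.symm (C.id _))
        (x : (P.P n (fun i => FinFam.E (X i) (t i)) (FinFam.E Y k)).X b),
        P.comp (FinSurj.toOne n) (X := fun i => FinFam.E (X i) (t i))
          (X' := fun _ i => FinFam.E (X i) (t i)) (Y := fun _ => FinFam.E Y k) (fun _ _ => rfl)
          (q := fun _ => b) h (P.one (X := fun _ => FinFam.E Y k) y) (fun _ => x) =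
        (P.P n _ _).cast hb x := by
      rintro d b c rfl rfl h y rfl x
      exact P.lawful.id_comp x
    refine e (by simp) rfl _ _ ?_ (f k t)
    exact (congrArg _ (FinFam.id_self Y k)).trans (PreCx.cast_cast _ _ _ _)
  · intro l _ hl
    have h0 : P.finFamData.one (X := fun _ => Y) ((FinFam.cat C).id Y) k (fun _ => l) = 0 :=
      (congrArg (P.one (X := fun _ => FinFam.E Y l))
        ((congrArg _ (FinFam.id_ne Y hl.symm)).trans (map_zero _))).trans (map_zero _)
    rw [h0, P.comp_zero_left, smul_zero]
  · intro hk
    exact P.eq_zero_of_target (FinFam.id_eq_zero_of_notMem Y hk) _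

lemma finFam_comp_id {n : ℕ} {X : Fin (n + 1) → (FinFam.cat C).Obj} {Y : (FinFam.cat C).Obj}
    {a : ℤ} (f : (P.finFamData.P n X Y).X a) :
    P.finFamData.comp (FinSurj.refl n) (X' := fun i _ => X i) (fun _ _ => rfl) (q := fun _ => 0)
      (by simp) f (fun i => P.finFamData.one (X := fun _ => X i) ((FinFam.cat C).id (X i))) = f := by
  funext k t
  rw [finFam_comp_apply, Finset.sum_eq_single t]
  · rw [sgnC_refl_self, Int.negOnePow_zero, one_smul]
    refine Eq.trans ?_ (P.lawful.comp_id (f k t))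
    refine PTData.comp_congr _ _ _ _ _ _ _ _ fun i => ⟨by simp, ?_⟩
    refine (P.one_cast _ _).symm.trans (congrArg P.one ?_)
    refine (PreCx.cast_cast _ _ _ _).trans ?_
    refine (congrArg _ (FinFam.id_self (X i) (t i))).trans ?_
    exact PreCx.cast_cast _ _ _ _
  · intro j _ hj
    obtain ⟨i, hi⟩ := Function.ne_iff.1 hj
    refine (congrArg _ (P.comp_zero_right _ _ _ _ _ i ?_)).trans (smul_zero _)
    exact (congrArg P.one ((congrArg _ (FinFam.id_ne (X i) hi)).trans (map_zero _))).trans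
      (map_zero _)
  · intro ht
    rw [Fintype.mem_piFinset] at ht
    push Not at ht
    obtain ⟨i, hi⟩ := ht
    exact P.eq_zero_of_source i (FinFam.id_eq_zero_of_notMem (X i) hi) _

lemma finFam_lawful : P.finFamData.Lawful where
  d_d := P.finFam_d_d
  one_bijective := P.finFam_one_bijective
  one_d := P.finFam_one_d
  one_comp := P.finFam_one_comp
  comp_add_left _ _ _ _ _ _ _ _ _ h := P.finFam_comp_add_left h
  comp_add_right _ _ _ _ _ _ _ _ _ h := P.finFam_comp_add_right h
  leibniz _ _ _ _ _ _ _ _ _ _ _ h hp hr := P.finFam_leibniz h hp hr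
  assoc := P.finFam_assoc
  id_comp := P.finFam_id_comp
  comp_id := P.finFam_comp_id

end PT

lemma sum_piFinset_update {n : ℕ} {M : Type*} [AddCommMonoid M] (A : Fin (n + 1) → Finset ℤ)
    (t : Fin (n + 1) → ℤ) (i : Fin (n + 1)) (ht : ∀ b, b ≠ i → t b ∈ A b)
    (f : (Fin (n + 1) → ℤ) → M) (hf : ∀ j b, b ≠ i → j b ≠ t b → f j = 0) :
    ∑ j ∈ Fintype.piFinset A, f j = ∑ l ∈ A i, f (Function.update t i l) := by
  symm
  refine Finset.sum_of_injOn (fun l => Function.update t i l) ?_ ?_ ?_ ?_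
  · intro l _ l' _ e
    simpa using congrFun e i
  · intro l hl
    simp only [Finset.mem_coe, Fintype.mem_piFinset] at hl ⊢
    intro b
    by_cases hb : b = i
    · subst hb; simpa using hl
    · simpa [hb] using ht b hb
  · intro j hj hj'
    by_contra h0
    have h1 : ∀ b, b ≠ i → j b = t b := fun b hb => by
      by_contra h; exact h0 (hf j b hb h)
    refine hj' ⟨j i, Fintype.mem_piFinset.1 hj i, ?_⟩
    funext b
    by_cases hb : b = i
    · subst hb; simp
    · simp [hb, h1 b hb]
  · intros; rfl

lemma sgnC_refl_update {n : ℕ} (t : Fin (n + 1) → ℤ) (i : Fin (n + 1)) (l : ℤ) :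
    PT.sgnC (FinSurj.refl n) (fun b => if b = i then 1 else 0) (Function.update t i l) t =
      PT.sgnD t i l := by
  unfold PT.sgnC PT.sgnD
  rw [Finset.sum_eq_zero (s := Finset.univ) (f := fun b => ∑ a with a < b ∧ _, _), add_zero]
  · have h : ∀ p a : Fin (n + 1), a < p → Function.update t i l p *
        ((if a = i then 1 else 0) - Function.update t i l a + ∑ c : Fin (0 + 1), t ((FinSurj.refl n).emb a c)) +
        (∑ c : Fin (0 + 1), t ((FinSurj.refl n).emb a c)) * (if p = i then 1 else 0) =
        (if a = i then t p * (t i - l + 1) else 0) + if p = i then t a else 0 := by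
      intro p a hap
      by_cases ha : a = i
      · subst ha
        simp only [ne_of_gt hap, if_true, if_false, Function.update_self,
          Function.update_of_ne (ne_of_gt hap)]
        rw [show ∑ _c : Fin (0 + 1), t a = t a by simp]
        ring
      · simp [ha]
    have h2 : ∀ p, ∑ a with a < p, (Function.update t i l p *
        ((if a = i then 1 else 0) - Function.update t i l a + ∑ c : Fin (0 + 1), t ((FinSurj.refl n).emb a c)) +
        (∑ c : Fin (0 + 1), t ((FinSurj.refl n).emb a c)) * (if p = i then 1 else 0)) =
        ∑ a with a < p, ((if a = i then t p * (t i - l + 1) else 0) + if p = i then t a else 0) :=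
      fun p => Finset.sum_congr rfl fun a ha => h p a (by simpa using ha)
    simp only [h2, Finset.sum_add_distrib]
    rw [add_comm, Finset.sum_eq_single i]
    · congr 1
      · simp
      · rw [Finset.mul_sum, Finset.sum_filter]
        refine Finset.sum_congr rfl fun p _ => ?_
        rw [Finset.sum_ite_eq']
        simp [mul_comm]
    · intro b _ hb; simp [hb]
    · simp
  · intro b _
    refine Finset.sum_eq_zero fun a ha => ?_
    simp only [Finset.mem_filter, Finset.mem_univ, true_and] at ha
    exact absurd ha.1 (not_lt.2 ha.2.le)

namespace PT

variable {C : PreDG.{u, v}} (P : PT C)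

/-- The pseudo-tensor structure on finite families of objects. -/
noncomputable def finFam : PT (FinFam.cat C) := ⟨P.finFamData, P.finFam_lawful⟩

lemma finFam_act_apply {n : ℕ} {E : Fin (n + 1) → (FinFam.cat C).Obj} {F G : (FinFam.cat C).Obj}
    {a b c : ℤ} (h : a + b = c) (f : ((FinFam.cat C).hom F G).X a) (φ : (P.finFam.P n E F).X b)
    (k : ℤ) (t : Fin (n + 1) → ℤ) :
    P.finFam.act h f φ k t = ∑ l ∈ FinFam.rng F, P.act (by omega) (f k l) (φ l t) := by
  refine (P.finFam_comp_apply (π := FinSurj.toOne n) (X := E) (X' := fun _ => E) (Y := fun _ => F)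
    (hX := fun _ _ => rfl) (q := fun _ => b) (by simpa)
    (P.finFamData.one (X := fun _ => F) f) (fun _ => φ) k t).trans ?_
  rw [sum_piFinset_one]
  refine Finset.sum_congr rfl fun l _ => ?_
  rw [sgnC_toOne, Int.negOnePow_zero, one_smul]
  have e : ∀ {d d' e e' : ℤ} (hd : d = d') (h : d' + ∑ _i : Fin 1, e = e') (h' : d + e = e')
      (x : (C.hom (FinFam.E F l) (FinFam.E G k)).X d)
      (y : (P.P n (fun i => FinFam.E (E i) (t i)) (FinFam.E F l)).X e),
      P.comp (FinSurj.toOne n) (X := fun i => FinFam.E (E i) (t i))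
        (X' := fun _ i => FinFam.E (E i) (t i)) (Y := fun _ => FinFam.E F l) (fun _ _ => rfl)
        (q := fun _ => e) h (P.one (X := fun _ => FinFam.E F l) ((C.hom _ _).cast hd x))
        (fun _ => y) = P.act h' x y := by
    rintro d _ e e' rfl h h' x y
    rfl
  exact e (by simp) _ _ (f k l) (φ l t)

lemma finFam_rhoAt_apply {n : ℕ} (E : Fin (n + 1) → PreTr C) (F : PreTr C)
    {a b : ℤ} (h : a + 1 = b) (φ : P.TFam E F a) (i : Fin (n + 1))
    (k : ℤ) (t : Fin (n + 1) → ℤ) :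
    P.finFam.rhoAt E h i φ k t = ∑ l ∈ PreTr.rng (E i),
      (sgnD t i l).negOnePow • P.subst h φ k t i l := by
  by_cases ht : ∀ b, b ≠ i → t b ∈ PreTr.rng (E b)
  swap
  · push Not at ht
    obtain ⟨b, _, hb⟩ := ht
    rw [P.eq_zero_of_source b (FinFam.id_eq_zero_of_notMem (E b).obj hb) (P.finFam.rhoAt E h i φ k t)]
    refine (Finset.sum_eq_zero fun l _ => ?_).symm
    rw [P.eq_zero_of_source b (FinFam.id_eq_zero_of_notMem (E b).obj hb) (P.subst h φ k t i l),
      smul_zero]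
  refine (P.finFam_comp_apply (π := FinSurj.refl n) (X := fun i => (E i).obj)
    (X' := fun i _ => (E i).obj) (Y := fun i => (E i).obj) (Z := F.obj)
    (hX := fun _ _ => rfl) (q := fun b => if b = i then 1 else 0) (by simpa using h)
    φ (fun b => P.finFamData.one (X := fun _ => (E b).obj)
      ((FinFam.cat C).iteEnd (b = i) (E b).e)) k t).trans ?_
  rw [sum_piFinset_update _ t i ht]
  · refine Finset.sum_congr rfl fun l _ => ?_
    rw [sgnC_refl_update]
    refine congrArg _ ?_
    refine PTData.comp_congr _ _ _ _ _ _ _ _ fun b => ⟨by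
      by_cases hb : b = i
      · subst hb; simp; ring
      · simp [hb], ?_⟩
    refine (P.one_cast (X := fun _ => FinFam.E (E b).obj (t b)) _ _).symm.trans ?_
    unfold slot
    split_ifs with hb
    · refine congrArg (P.one (X := fun _ => FinFam.E (E b).obj (t b))) ?_
      refine (PreCx.cast_cast _ _ _ _).trans ?_
      have e1 : ∀ {d : ℤ} (hd : 1 = d) (x : ((FinFam.cat C).hom (E b).obj (E b).obj).X 1) (r s : ℤ),
          ((FinFam.cat C).hom (E b).obj (E b).obj).cast hd x r s = (C.hom _ _).cast (by omega) (x r s) := by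
        rintro d rfl x r s; rfl
      rw [PreDG.iteEnd_true hb]
      refine (congrArg _ (e1 _ _ _ _)).trans ?_
      exact PreCx.cast_cast _ _ _ _
    · refine congrArg (P.one (X := fun _ => FinFam.E (E b).obj (t b))) ?_
      refine (PreCx.cast_cast _ _ _ _).trans ?_
      have e1 : ∀ {d : ℤ} (hd : 0 = d) (x : ((FinFam.cat C).hom (E b).obj (E b).obj).X 0) (r s : ℤ),
          ((FinFam.cat C).hom (E b).obj (E b).obj).cast hd x r s = (C.hom _ _).cast (by omega) (x r s) := by
        rintro d rfl x r s; rfl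
      rw [PreDG.iteEnd_false hb]
      refine (congrArg _ (e1 _ _ _ _)).trans ?_
      exact PreCx.cast_cast _ _ _ _
  · intro j b hb hj
    refine (congrArg _ (P.comp_zero_right _ _ _ _ _ b ?_)).trans (smul_zero _)
    rw [PreDG.iteEnd_false hb]
    have e1 : ∀ {d : ℤ} (hd : 0 = d),
        ((FinFam.cat C).hom (E b).obj (E b).obj).cast hd ((FinFam.cat C).id (E b).obj) (j b) (t b) = 0 := by
      rintro d rfl; exact FinFam.id_ne (E b).obj hj
    exact (congrArg (P.one (X := fun _ => FinFam.E (E b).obj (t b)))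
      ((congrArg _ (e1 _)).trans (map_zero _))).trans (map_zero _)

lemma tDel_apply {n : ℕ} (E : Fin (n + 1) → PreTr C) (F : PreTr C) (a b : ℤ) (h : a + 1 = b)
    (φ : P.TFam E F a) :
    P.tDel E F a b h φ = (P.finFam.P n (fun i => (E i).obj) F.obj).d a b h φ +
      P.finFam.act ((add_comm 1 a).trans h) F.e φ - a.negOnePow • P.finFam.rho E h φ := by
  funext k t
  have e1 := P.finFam_act_apply ((add_comm 1 a).trans h) F.e φ k t
  have e2 : P.finFam.rho E h φ k t = ∑ i, P.finFam.rhoAt E h i φ k t := by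
    refine (congrFun (congrFun (P.finFam.rho_apply E h φ) k) t).trans ?_
    exact (congrFun (Finset.sum_apply k Finset.univ _) t).trans (Finset.sum_apply t Finset.univ _)
  have e3 : P.finFam.rho E h φ k t = ∑ i, ∑ l ∈ PreTr.rng (E i),
      (sgnD t i l).negOnePow • P.subst h φ k t i l :=
    e2.trans (Finset.sum_congr rfl fun i _ => P.finFam_rhoAt_apply E F h φ i k t)
  change _ = k.negOnePow • (P.P n _ _).d _ _ _ (φ k t) + P.finFam.act _ F.e φ k t -
    a.negOnePow • P.finFam.rho E h φ k t
  rw [e1, e3]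
  rfl

lemma preTr_lawful : P.preTrData.Lawful :=
  MC.ptData_lawful P.finFam P.tDel_apply

end PT

lemma PTData.full_lawful {C : PreDG.{u, v}} {D : PTData C} (h : D.Lawful) (p : C.Obj → Prop) :
    (D.full p).Lawful where
  d_d := h.d_d
  one_bijective {X _ _} := h.one_bijective (X := fun i => (X i).1)
  one_d {X _ _ _} := h.one_d (X := fun i => (X i).1)
  one_comp {X Y _ _ _ _} := h.one_comp (X := fun i => (X i).1) (Y := fun i => (Y i).1)
  comp_add_left π _ _ hX _ _ _ _ _ := h.comp_add_left π fun i a => congrArg Subtype.val (hX i a)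
  comp_add_right π _ _ hX _ _ _ _ _ := h.comp_add_right π fun i a => congrArg Subtype.val (hX i a)
  leibniz π _ _ hX _ _ _ _ _ _ _ := h.leibniz π fun i a => congrArg Subtype.val (hX i a)
  assoc {_ _ _ _ _ _} π ρ σ τ hτ {W X Y Z _ _ _ _ _ _} := h.assoc π ρ σ τ hτ (W := fun i => (W i).1)
    (X := fun i => (X i).1) (Y := fun i => (Y i).1) (Z := Z.1)
  id_comp {_ X Y _} := h.id_comp (X := fun i => (X i).1) (Y := Y.1)
  comp_id {_ X Y _} := h.comp_id (X := fun i => (X i).1) (Y := Y.1)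

lemma DGCat.pretrData_lawful (C : DGCat.{u, v}) (P : PT C.toPreDG) : (C.pretrData P).Lawful :=
  PTData.full_lawful P.preTr_lawful _

/-- The pseudo-tensor structure on `C^pretr` induced by a pseudo-tensor structure on `C`. -/
noncomputable def DGCat.pretrPT (C : DGCat.{u, v}) (P : PT C.toPreDG) : PT C.pretr :=
  ⟨C.pretrData P, C.pretrData_lawful P⟩

/-! ### Quasi-isomorphisms of complexes -/

/-- A map of complexes is a quasi-isomorphism. -/
def CxHom.QI {K L : Cx.{v}} (f : CxHom K L) : Prop := ∀ n, Function.Bijective (f.H n)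

lemma Cx.exists_cls (K : Cx.{v}) {n : ℤ} (c : K.H n) :
    ∃ (x : K.X n) (hx : K.d n (n + 1) rfl x = 0), K.cls x hx = c :=
  ⟨K.rep c, K.d_rep rfl c, K.cls_rep c⟩

lemma CxHom.qi_iff {K L : Cx.{v}} (f : CxHom K L) :
    f.QI ↔ ∀ (a b c : ℤ) (h : a + 1 = b) (h' : b + 1 = c) (x : K.X b) (y : L.X a),
      K.d b c h' x = 0 → f.f b x = L.d a b h y →
      ∃ (x' : K.X a) (y' : L.X (a - 1)), K.d a b h x' = x ∧
        y = f.f a x' + L.d (a - 1) a (by omega) y' := by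
  constructor
  · rintro hf a b _ rfl rfl x y hx hxy
    obtain ⟨z, hz⟩ : ∃ z : K.X a, K.d a (a + 1) rfl z = x := by
      have h1 : f.H _ (K.cls x hx) = f.H _ 0 := by
        rw [map_zero]
        exact L.cls_eq (f.f _ x) 0 (by rw [← f.comm, hx, map_zero]) (map_zero _) rfl y
          (by rw [hxy, sub_zero])
      obtain ⟨z, hz⟩ := K.exists_of_cls_eq (hy := map_zero _) (m := a) rfl
        (show K.cls x hx = K.cls 0 _ from (hf _).1 h1)
      exact ⟨z, by rw [hz, sub_zero]⟩
    have hy : L.d a (a + 1) rfl (y - f.f a z) = 0 := by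
      rw [map_sub, ← f.comm, hz, hxy, sub_self]
    obtain ⟨c, hc⟩ := (hf a).2 (L.cls _ hy)
    obtain ⟨c, hc', rfl⟩ := K.exists_cls c
    obtain ⟨w, hw⟩ := L.exists_of_cls_eq (m := a - 1) (by omega)
      ((CxHom.H_cls f c hc').symm.trans hc)
    refine ⟨z + c, -w, ?_, ?_⟩
    · rw [map_add, hz, hc', add_zero]
    · rw [map_neg, hw, map_add]
      abel
  · intro hf n
    constructor
    · rw [injective_iff_map_eq_zero]
      rintro ⟨x, hx⟩ hx'
      obtain ⟨z, hz⟩ := L.exists_of_cls_eq (hx := by rw [← f.comm, hx, map_zero])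
        (hy := map_zero _) (m := n - 1) (by omega) (show L.cls (f.f n x) _ = L.cls 0 _ from hx')
      obtain ⟨x', -, h1, -⟩ := hf (n - 1) n (n + 1) (by omega) rfl x z hx (by rw [hz, sub_zero])
      exact K.cls_eq x 0 hx (map_zero _) (m := n - 1) (by omega) x' (by rw [h1, sub_zero])
    · rintro ⟨y, hy⟩
      obtain ⟨x', y', h1, h2⟩ := hf n (n + 1) _ rfl rfl 0 y (map_zero _)
        (by rw [map_zero]; exact Eq.symm hy)
      refine ⟨K.cls x' h1, L.cls_eq _ _ _ _ (m := n - 1) (by omega) (-y') ?_⟩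
      change _ = f.f n x' - y
      rw [map_neg, h2]
      abel

lemma CxHom.qi_of_ses {K₁ K₂ K₃ L₁ L₂ L₃ : Cx.{v}} {i : CxHom K₁ K₂} {p : CxHom K₂ K₃}
    {j : CxHom L₁ L₂} {q : CxHom L₂ L₃} {f₁ : CxHom K₁ L₁} {f₂ : CxHom K₂ L₂} {f₃ : CxHom K₃ L₃}
    (hi : ∀ n, Function.Injective (i.f n))
    (hp : ∀ n, Function.Surjective (p.f n)) (hip : ∀ n x, p.f n x = 0 → ∃ y, i.f n y = x)
    (hj : ∀ n, Function.Injective (j.f n)) (hq : ∀ n, Function.Surjective (q.f n))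
    (hjq : ∀ n x, q.f n x = 0 → ∃ y, j.f n y = x)
    (h₁ : ∀ n x, f₂.f n (i.f n x) = j.f n (f₁.f n x))
    (h₂ : ∀ n x, f₃.f n (p.f n x) = q.f n (f₂.f n x)) (hf₁ : f₁.QI) (hf₃ : f₃.QI) : f₂.QI := by
  rw [CxHom.qi_iff] at hf₁ hf₃ ⊢
  intro a b c h h' x y hx hxy
  obtain ⟨x₃, y₃, e1, e2⟩ := hf₃ a b c h h' (p.f b x) (q.f a y) (by rw [← p.comm, hx, map_zero])
    (by rw [h₂, hxy, q.comm])
  obtain ⟨u, rfl⟩ := hp _ x₃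
  obtain ⟨w, rfl⟩ := hq _ y₃
  obtain ⟨s, hs⟩ := hip b (x - K₂.d a b h u) (by rw [map_sub, p.comm, e1, sub_self])
  obtain ⟨t, ht⟩ := hjq a (y - f₂.f a u - L₂.d _ a (by omega) w)
    (by rw [map_sub, map_sub, ← h₂, q.comm, e2]; abel)
  obtain ⟨s', t', e3, e4⟩ := hf₁ a b c h h' s t
    (hi _ (by rw [i.comm, hs, map_sub, hx, K₂.d_d, map_zero, sub_zero]))
    (hj _ (by
      rw [← h₁, hs, j.comm, ht, map_sub, hxy, f₂.comm, map_sub, map_sub, L₂.d_d, sub_zero]))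
  refine ⟨u + i.f a s', w + j.f _ t', ?_, ?_⟩
  · rw [map_add, ← i.comm, e3, hs]; abel
  · rw [map_add, map_add, h₁, ← j.comm, add_add_add_comm, ← map_add, ← e4, add_comm, ht]
    abel

lemma CxHom.qi_of_iso {K L K' L' : Cx.{v}} {n : ℤ} (f : CxHom K L) (f' : CxHom K' L')
    (α : ∀ a b : ℤ, n + a = b → K.X a →+ K'.X b) (β : ∀ a b : ℤ, n + a = b → L.X a →+ L'.X b)
    (hα : ∀ a b h, Function.Bijective (α a b h)) (hβ : ∀ a b h, Function.Bijective (β a b h))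
    (dα : ∀ a b c d h h' (k : a + 1 = b) (k' : c + 1 = d) x,
      K'.d c d k' (α a c h x) = n.negOnePow • α b d h' (K.d a b k x))
    (dβ : ∀ a b c d h h' (k : a + 1 = b) (k' : c + 1 = d) x,
      L'.d c d k' (β a c h x) = n.negOnePow • β b d h' (L.d a b k x))
    (h : ∀ a b h x, f'.f b (α a b h x) = β a b h (f.f a x)) (hf : f.QI) : f'.QI := by
  rw [CxHom.qi_iff] at hf ⊢
  intro a b c ha hb x y hx hxy
  obtain ⟨x, rfl⟩ := (hα (b - n) b (by omega)).2 x
  obtain ⟨y, rfl⟩ := (hβ (a - n) a (by omega)).2 y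
  have e1 := dα (b - n) (c - n) b c (by omega) (by omega) (by omega) hb x
  rw [hx] at e1
  have e2 : K.d (b - n) (c - n) (by omega) x = 0 := by
    refine (hα (c - n) c (by omega)).1 ?_
    rw [map_zero]
    have := congrArg (n.negOnePow • ·) e1
    simpa [smul_smul] using this.symm
  rw [h, dβ (a - n) (b - n) a b (by omega) (by omega) (by omega) ha y, ← map_negOnePow,
    ← map_negOnePow] at hxy
  obtain ⟨x', y', e3, e4⟩ := hf (a - n) (b - n) (c - n) (by omega) (by omega) x (n.negOnePow • y) e2
    ((hβ _ _ _).1 hxy)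
  refine ⟨n.negOnePow • α (a - n) a (by omega) x', β (a - n - 1) (a - 1) (by omega) y', ?_, ?_⟩
  · rw [map_negOnePow, dα (a - n) (b - n) a b (by omega) (by omega) (by omega) ha, smul_smul,
      Int.units_mul_self, one_smul, e3]
  · rw [map_negOnePow, h, dβ (a - n - 1) (a - n) (a - 1) a (by omega) (by omega) (by omega) (by omega),
      ← smul_add, ← map_add, ← e4, map_negOnePow, smul_smul, Int.units_mul_self, one_smul]

lemma CxHom.qi_of_homotopic {K L : Cx.{v}} (f g : CxHom K L)
    (h : ∀ (a b : ℤ) (h : a + 1 = b) (x : K.X b), K.d b (b + 1) rfl x = 0 →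
      ∃ y : L.X a, L.d a b h y = f.f b x - g.f b x) (hg : g.QI) : f.QI := by
  have e : ∀ n, f.H n = g.H n := by
    intro n
    ext ⟨x, hx⟩
    obtain ⟨y, hy⟩ := h (n - 1) n (by omega) x hx
    exact L.cls_eq _ _ _ _ (m := n - 1) (by omega) y hy
  intro n
  rw [e]
  exact hg n

/-! ### Extensions and shifts in a pre-DG category -/

/-- An object `K` which is the direct sum of `A` and `B` as far as the graded category is concerned,
with differential twisted by a closed morphism `x : B → A` of degree one. -/
structure PreDG.Ext (C : PreDG.{u, v}) (A B K : C.Obj) where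
  x : (C.hom B A).X 1
  i : (C.hom A K).X 0
  p : (C.hom K B).X 0
  s : (C.hom B K).X 0
  q : (C.hom K A).X 0
  d_x : (C.hom B A).d 1 2 rfl x = 0
  d_i : (C.hom A K).d 0 1 rfl i = 0
  d_p : (C.hom K B).d 0 1 rfl p = 0
  d_s : (C.hom B K).d 0 1 rfl s = C.comp (zero_add 1) i x
  d_q : (C.hom K A).d 0 1 rfl q = - C.comp (add_zero 1) x p
  q_i : C.comp (add_zero 0) q i = C.id A
  p_s : C.comp (add_zero 0) p s = C.id B
  p_i : C.comp (add_zero 0) p i = 0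
  q_s : C.comp (add_zero 0) q s = 0
  total : C.comp (add_zero 0) i q + C.comp (add_zero 0) s p = C.id K

/-- A closed isomorphism `V' → V` of degree `n`. -/
structure PreDG.Shift (C : PreDG.{u, v}) (n : ℤ) (V V' : C.Obj) where
  v : (C.hom V' V).X n
  w : (C.hom V V').X (-n)
  d_v : (C.hom V' V).d n (n + 1) rfl v = 0
  d_w : (C.hom V V').d (-n) (-n + 1) rfl w = 0
  v_w : C.comp (add_neg_cancel n) v w = C.id V
  w_v : C.comp (neg_add_cancel n) w v = C.id V'

namespace DGMod

variable {C : PreDG.{u, v}} (M : DGMod C)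

/-- The map of complexes given by the action of a closed morphism of degree zero. -/
def actHom {X Y : C.Obj} (f : (C.hom X Y).X 0) (hf : (C.hom X Y).d 0 1 rfl f = 0) :
    CxHom (M.obj X) (M.obj Y) where
  f n := M.act (zero_add n) f
  comm a b h x := by rw [M.leibniz _ (a' := 1) rfl h h, hf]; simp

lemma act_zero_left {X Y : C.Obj} {a b c : ℤ} (h : a + b = c) (x : (M.obj X).X b) :
    M.act h (0 : (C.hom X Y).X a) x = 0 := by
  rw [map_zero, AddMonoidHom.zero_apply]

variable {M} {N : DGMod C}

lemma qi_ext {A B K : C.Obj} (e : C.Ext A B K) (φ : M ⟶ N) (hA : (DGMod.Hom.app φ A).QI)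
    (hB : (DGMod.Hom.app φ B).QI) : (DGMod.Hom.app φ K).QI := by
  have key : ∀ (M : DGMod C) (n : ℤ), Function.Injective ((M.actHom e.i e.d_i).f n) ∧
      Function.Surjective ((M.actHom e.p e.d_p).f n) ∧
      ∀ x, (M.actHom e.p e.d_p).f n x = 0 → ∃ y, (M.actHom e.i e.d_i).f n y = x := by
    intro M n
    refine ⟨?_, ?_, ?_⟩
    · rw [injective_iff_map_eq_zero]
      intro x (hx : M.act _ _ _ = 0)
      have := M.comp_act (add_zero 0) (zero_add n) (zero_add n) (zero_add n) e.q e.i x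
      rwa [e.q_i, M.id_act, hx, map_zero] at this
    · intro x
      have := M.comp_act (add_zero 0) (zero_add n) (zero_add n) (zero_add n) e.p e.s x
      rw [e.p_s, M.id_act] at this
      exact ⟨_, this.symm⟩
    · intro x (hx : M.act _ _ _ = 0)
      refine ⟨M.act (zero_add n) e.q x, ?_⟩
      have h1 := M.comp_act (add_zero 0) (zero_add n) (zero_add n) (zero_add n) e.i e.q x
      have h2 := M.comp_act (add_zero 0) (zero_add n) (zero_add n) (zero_add n) e.s e.p x
      have h3 := congrArg (fun f => M.act (zero_add n) f x) e.total
      simp only [map_add, AddMonoidHom.add_apply] at h3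
      rw [h1, h2, hx, map_zero, add_zero, M.id_act] at h3
      exact h3
  exact CxHom.qi_of_ses (i := M.actHom e.i e.d_i) (p := M.actHom e.p e.d_p)
    (j := N.actHom e.i e.d_i) (q := N.actHom e.p e.d_p) (fun n => (key M n).1)
    (fun n => (key M n).2.1) (fun n => (key M n).2.2)
    (fun n => (key N n).1) (fun n => (key N n).2.1) (fun n => (key N n).2.2)
    (fun n x => DGMod.Hom.natural φ _ _ _) (fun n x => DGMod.Hom.natural φ _ _ _) hA hB

lemma qi_shift {n : ℤ} {V V' : C.Obj} (e : C.Shift n V V') (φ : M ⟶ N)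
    (hV : (DGMod.Hom.app φ V).QI) : (DGMod.Hom.app φ V').QI := by
  have key : ∀ (M : DGMod C) (a b : ℤ) (h : -n + a = b), Function.Bijective (M.act h e.w) := by
    intro M a b h
    refine Function.bijective_iff_has_inverse.2 ⟨M.act (by omega) e.v, fun x => ?_, fun x => ?_⟩
    · have := M.comp_act (add_neg_cancel n) (zero_add a) h (by omega) e.v e.w x
      rw [e.v_w, M.id_act] at this
      exact this.symm
    · have := M.comp_act (neg_add_cancel n) (zero_add b) (by omega) h e.w e.v x
      rw [e.w_v, M.id_act] at this
      exact this.symm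
  have dkey : ∀ (M : DGMod C) (a b c d : ℤ) (h : -n + a = c) (h' : -n + b = d) (k : a + 1 = b)
      (k' : c + 1 = d) x, (M.obj V').d c d k' (M.act h e.w x) =
        (-n).negOnePow • M.act h' e.w ((M.obj V).d a b k x) := by
    intro M a b c d h h' k k' x
    rw [M.leibniz h rfl k k', e.d_w, M.act_zero_left, zero_add]
  exact CxHom.qi_of_iso (n := -n) _ _ (fun a b h => M.act h e.w) (fun a b h => N.act h e.w)
    (key M) (key N) (dkey M) (dkey N) (fun a b h x => DGMod.Hom.natural φ _ _ _) hV

end DGMod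

/-! ### Contravariant modules, bimodules and pairings -/

/-- A contravariant DG module. -/
structure RMod (C : PreDG.{u, v}) where
  obj : C.Obj → Cx.{v}
  act : ∀ {X Y : C.Obj} {a b c : ℤ}, a + b = c → (obj Y).X a →+ (C.hom X Y).X b →+ (obj X).X c
  leibniz : ∀ {X Y : C.Obj} {a b c a' b' c' : ℤ} (h : a + b = c) (ha : a + 1 = a')
    (hb : b + 1 = b') (hc : c + 1 = c') (x : (obj Y).X a) (f : (C.hom X Y).X b),
    (obj X).d c c' hc (act h x f) =
      act (by omega) ((obj Y).d a a' ha x) f +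
        a.negOnePow • act (by omega) x ((C.hom X Y).d b b' hb f)
  act_comp : ∀ {X Y Z : C.Obj} {a b c ab bc abc : ℤ} (h₁ : a + b = ab) (h₂ : ab + c = abc)
    (h₃ : b + c = bc) (h₄ : a + bc = abc)
    (x : (obj Z).X a) (f : (C.hom Y Z).X b) (g : (C.hom X Y).X c),
    act h₂ (act h₁ x f) g = act h₄ x (C.comp h₃ f g)
  act_id : ∀ {X : C.Obj} {a : ℤ} (h : a + 0 = a) (x : (obj X).X a), act h x (C.id X) = x

/-- The contravariant module `Hom(_, Z)`. -/
def RMod.rep {C : PreDG.{u, v}} (Z : C.Obj) : RMod C where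
  obj Y := C.hom Y Z
  act h := C.comp h
  leibniz := C.leibniz
  act_comp := C.assoc
  act_id := C.comp_id

/-- A DG bimodule: contravariant in the first and covariant in the second variable. -/
structure Bimod (C : PreDG.{u, v}) where
  R : C.Obj → RMod C
  lact : ∀ {V X Y : C.Obj} {a b c : ℤ}, a + b = c →
    (C.hom X Y).X a →+ ((R X).obj V).X b →+ ((R Y).obj V).X c
  leibniz : ∀ {V X Y : C.Obj} {a b c a' b' c' : ℤ} (h : a + b = c) (ha : a + 1 = a')
    (hb : b + 1 = b') (hc : c + 1 = c') (f : (C.hom X Y).X a) (x : ((R X).obj V).X b),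
    ((R Y).obj V).d c c' hc (lact h f x) =
      lact (by omega) ((C.hom X Y).d a a' ha f) x +
        a.negOnePow • lact (by omega) f (((R X).obj V).d b b' hb x)
  comp_act : ∀ {V X Y Z : C.Obj} {a b c ab bc abc : ℤ} (h₁ : a + b = ab) (h₂ : ab + c = abc)
    (h₃ : b + c = bc) (h₄ : a + bc = abc)
    (f : (C.hom Y Z).X a) (g : (C.hom X Y).X b) (x : ((R X).obj V).X c),
    lact h₂ (C.comp h₁ f g) x = lact h₄ f (lact h₃ g x)
  id_act : ∀ {V X : C.Obj} {a : ℤ} (h : 0 + a = a) (x : ((R X).obj V).X a), lact h (C.id X) x = x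
  act_act : ∀ {V W X Y : C.Obj} {a b c ab bc abc : ℤ} (h₁ : a + b = ab) (h₂ : ab + c = abc)
    (h₃ : b + c = bc) (h₄ : a + bc = abc)
    (f : (C.hom X Y).X a) (x : ((R X).obj W).X b) (g : (C.hom V W).X c),
    (R Y).act h₂ (lact h₁ f x) g = lact h₄ f ((R X).act h₃ x g)

/-- A balanced pairing `N(W) ⊗ L(V, W) → M(V)`. -/
structure Pairing {C : PreDG.{u, v}} (N : RMod C) (L : Bimod C) (M : RMod C) where
  c : ∀ {V W : C.Obj} {a b c : ℤ}, a + b = c →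
    (N.obj W).X a →+ ((L.R W).obj V).X b →+ (M.obj V).X c
  leibniz : ∀ {V W : C.Obj} {a b d a' b' d' : ℤ} (h : a + b = d) (ha : a + 1 = a')
    (hb : b + 1 = b') (hd : d + 1 = d') (f : (N.obj W).X a) (x : ((L.R W).obj V).X b),
    (M.obj V).d d d' hd (c h f x) =
      c (by omega) ((N.obj W).d a a' ha f) x +
        a.negOnePow • c (by omega) f (((L.R W).obj V).d b b' hb x)
  balanced : ∀ {V W W' : C.Obj} {a b d ab bd abd : ℤ} (h₁ : a + b = ab) (h₂ : ab + d = abd)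
    (h₃ : b + d = bd) (h₄ : a + bd = abd)
    (f : (N.obj W).X a) (g : (C.hom W' W).X b) (x : ((L.R W').obj V).X d),
    c h₂ (N.act h₁ f g) x = c h₄ f (L.lact h₃ g x)
  act : ∀ {V V' W : C.Obj} {a b d ab bd abd : ℤ} (h₁ : a + b = ab) (h₂ : ab + d = abd)
    (h₃ : b + d = bd) (h₄ : a + bd = abd)
    (f : (N.obj W).X a) (x : ((L.R W).obj V).X b) (g : (C.hom V' V).X d),
    M.act h₂ (c h₁ f x) g = c h₄ f ((L.R W).act h₃ x g)

/-- The pairing given by the left action on a bimodule. -/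
def Bimod.pairing {C : PreDG.{u, v}} (L : Bimod C) (Z : C.Obj) : Pairing (RMod.rep Z) L (L.R Z) where
  c h := L.lact h
  leibniz := L.leibniz
  balanced := L.comp_act
  act := L.act_act

namespace RMod

variable {C : PreDG.{u, v}} (M : RMod C)

/-- The map of complexes given by the action of a closed morphism of degree zero. -/
def actHom {X Y : C.Obj} (f : (C.hom X Y).X 0) (hf : (C.hom X Y).d 0 1 rfl f = 0) :
    CxHom (M.obj Y) (M.obj X) where
  f n := (M.act (add_zero n)).flip f
  comm a b h x := by
    change M.act _ _ f = (M.obj X).d _ _ _ (M.act _ _ f)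
    rw [M.leibniz _ h (b' := 1) rfl h, hf]; simp

lemma ext_exact {A B K : C.Obj} (e : C.Ext A B K) (n : ℤ) :
    Function.Injective ((M.actHom e.p e.d_p).f n) ∧
      Function.Surjective ((M.actHom e.i e.d_i).f n) ∧
      ∀ x, (M.actHom e.i e.d_i).f n x = 0 → ∃ y, (M.actHom e.p e.d_p).f n y = x := by
  refine ⟨?_, ?_, ?_⟩
  · rw [injective_iff_map_eq_zero]
    intro x (hx : M.act _ _ _ = 0)
    have := M.act_comp (add_zero n) (add_zero n) (add_zero 0) (add_zero n) x e.p e.s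
    rw [e.p_s, M.act_id, hx, map_zero] at this
    exact this.symm
  · intro x
    have := M.act_comp (add_zero n) (add_zero n) (add_zero 0) (add_zero n) x e.q e.i
    rw [e.q_i, M.act_id] at this
    exact ⟨_, this⟩
  · intro x (hx : M.act _ _ _ = 0)
    refine ⟨M.act (add_zero n) x e.s, ?_⟩
    have h1 := M.act_comp (add_zero n) (add_zero n) (add_zero 0) (add_zero n) x e.i e.q
    have h2 := M.act_comp (add_zero n) (add_zero n) (add_zero 0) (add_zero n) x e.s e.p
    have h3 := congrArg (M.act (add_zero n) x) e.total
    rw [map_add, ← h1, ← h2, hx, map_zero, AddMonoidHom.zero_apply, zero_add, M.act_id] at h3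
    exact h3

end RMod

namespace Pairing

variable {C : PreDG.{u, v}} {N : RMod C} {L : Bimod C} {M : RMod C} (c : Pairing N L M)

/-- The map of complexes given by pairing with a closed element of degree zero. -/
def hom {V W : C.Obj} (u : ((L.R W).obj V).X 0) (hu : ((L.R W).obj V).d 0 1 rfl u = 0) :
    CxHom (N.obj W) (M.obj V) where
  f n := (c.c (add_zero n)).flip u
  comm a b h x := by
    change c.c _ _ u = (M.obj V).d _ _ _ (c.c _ _ u)
    rw [c.leibniz _ h (b' := 1) rfl h, hu]; simp

lemma qi_congr {V W : C.Obj} (u u' : ((L.R W).obj V).X 0) (hu : ((L.R W).obj V).d 0 1 rfl u = 0)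
    (hu' : ((L.R W).obj V).d 0 1 rfl u' = 0) (z : ((L.R W).obj V).X (-1))
    (hz : ((L.R W).obj V).d (-1) 0 rfl z = u - u') (h : (c.hom u' hu').QI) : (c.hom u hu).QI := by
  refine CxHom.qi_of_homotopic _ _ (fun a b h x hx => ?_) h
  refine ⟨b.negOnePow • c.c (by omega) x z, ?_⟩
  change (M.obj V).d _ _ _ _ = c.c _ x u - c.c _ x u'
  rw [← map_sub, ← hz, map_negOnePow, c.leibniz _ rfl (b' := 0) rfl h, hx, map_zero,
    AddMonoidHom.zero_apply, zero_add, smul_smul, Int.units_mul_self, one_smul]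

end Pairing

namespace Bimod

variable {C : PreDG.{u, v}} (L : Bimod C)

/-- An element `u ∈ L(V, T)` is universal if it is closed of degree zero and `f ↦ f u` is a
quasi-isomorphism `Hom(T, Z) → L(V, Z)` for all `Z`. -/
def IsUniv {V T : C.Obj} (u : ((L.R T).obj V).X 0) : Prop :=
  ∃ hu : ((L.R T).obj V).d 0 1 rfl u = 0, ∀ Z, ((L.pairing Z).hom u hu).QI

section ext

variable {A B K TA TB TK : C.Obj} (e : C.Ext A B K) (t : C.Ext TA TB TK)
  (uA : ((L.R TA).obj A).X 0) (uB : ((L.R TB).obj B).X 0) (w : ((L.R TA).obj B).X 0)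

/-- The universal element for an extension, constructed from universal elements for the two ends. -/
def extElt : ((L.R TK).obj K).X 0 :=
  L.lact (add_zero 0) t.i ((L.R TA).act (add_zero 0) uA e.q) +
    L.lact (add_zero 0) t.s ((L.R TB).act (add_zero 0) uB e.p) +
    L.lact (add_zero 0) t.i ((L.R TA).act (add_zero 0) w e.p)

lemma d_extElt (hA : ((L.R TA).obj A).d 0 1 rfl uA = 0) (hB : ((L.R TB).obj B).d 0 1 rfl uB = 0)
    (hw : ((L.R TA).obj B).d 0 1 rfl w =
      (L.R TA).act (zero_add 1) uA e.x - L.lact (add_zero 1) t.x uB) :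
    ((L.R TK).obj K).d 0 1 rfl (L.extElt e t uA uB w) = 0 := by
  unfold extElt
  rw [map_add, map_add, L.leibniz _ (a' := 1) (b' := 1) rfl rfl, L.leibniz _ (a' := 1) (b' := 1) rfl rfl,
    L.leibniz _ (a' := 1) (b' := 1) rfl rfl, (L.R TA).leibniz _ (a' := 1) (b' := 1) rfl rfl,
    (L.R TB).leibniz _ (a' := 1) (b' := 1) rfl rfl, (L.R TA).leibniz _ (a' := 1) (b' := 1) rfl rfl,
    t.d_i, t.d_s, e.d_p, e.d_q, hA, hB, hw]
  simp only [map_zero, AddMonoidHom.zero_apply, zero_add, Int.negOnePow_zero, one_smul, map_sub,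
    AddMonoidHom.sub_apply, map_neg, add_zero]
  rw [L.comp_act (bc := 1) (abc := 1) _ _ (by omega) (by omega),
    (L.R TA).act_comp (bc := 1) (abc := 1) _ _ (by omega) (by omega),
    L.act_act (bc := 0) (abc := 1) _ _ (by omega) (by omega)]
  abel

lemma extElt_i : (L.R TK).act (add_zero 0) (L.extElt e t uA uB w) e.i =
    L.lact (add_zero 0) t.i uA := by
  unfold extElt
  simp only [map_add, AddMonoidHom.add_apply]
  rw [L.act_act (bc := 0) (abc := 0) _ _ (by omega) (by omega),
    L.act_act (bc := 0) (abc := 0) _ _ (by omega) (by omega),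
    L.act_act (bc := 0) (abc := 0) _ _ (by omega) (by omega),
    (L.R TA).act_comp (bc := 0) (abc := 0) _ _ (by omega) (by omega),
    (L.R TB).act_comp (bc := 0) (abc := 0) _ _ (by omega) (by omega),
    (L.R TA).act_comp (bc := 0) (abc := 0) _ _ (by omega) (by omega), e.q_i, e.p_i,
    (L.R TA).act_id]
  simp

lemma p_extElt : L.lact (add_zero 0) t.p (L.extElt e t uA uB w) =
    (L.R TB).act (add_zero 0) uB e.p := by
  unfold extElt
  simp only [map_add]
  rw [← L.comp_act (ab := 0) (abc := 0) (by omega) (by omega),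
    ← L.comp_act (ab := 0) (abc := 0) (by omega) (by omega),
    ← L.comp_act (ab := 0) (abc := 0) (by omega) (by omega), t.p_i, t.p_s, L.id_act]
  simp

end ext

end Bimod

namespace Pairing

variable {C : PreDG.{u, v}} {N : RMod C} {L : Bimod C} {M : RMod C} (c : Pairing N L M)

lemma qi_ext {A B K TA TB TK : C.Obj} (e : C.Ext A B K) (t : C.Ext TA TB TK)
    (uA : ((L.R TA).obj A).X 0) (uB : ((L.R TB).obj B).X 0) (w : ((L.R TA).obj B).X 0)
    (hA : ((L.R TA).obj A).d 0 1 rfl uA = 0) (hB : ((L.R TB).obj B).d 0 1 rfl uB = 0)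
    (hK : ((L.R TK).obj K).d 0 1 rfl (L.extElt e t uA uB w) = 0)
    (cA : (c.hom uA hA).QI) (cB : (c.hom uB hB).QI) :
    (c.hom (L.extElt e t uA uB w) hK).QI := by
  refine CxHom.qi_of_ses (i := N.actHom t.p t.d_p) (p := N.actHom t.i t.d_i)
    (j := M.actHom e.p e.d_p) (q := M.actHom e.i e.d_i) (fun n => (N.ext_exact t n).1)
    (fun n => (N.ext_exact t n).2.1) (fun n => (N.ext_exact t n).2.2)
    (fun n => (M.ext_exact e n).1) (fun n => (M.ext_exact e n).2.1)
    (fun n => (M.ext_exact e n).2.2) (fun n x => ?_) (fun n x => ?_) cB cA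
  · refine (c.balanced (add_zero n) (add_zero n) (add_zero 0) (add_zero n) x t.p _).trans ?_
    rw [L.p_extElt]
    exact (c.act (add_zero n) (add_zero n) (add_zero 0) (add_zero n) x uB e.p).symm
  · refine (c.balanced (add_zero n) (add_zero n) (add_zero 0) (add_zero n) x t.i _).trans ?_
    rw [← L.extElt_i e t uA uB w]
    exact (c.act (add_zero n) (add_zero n) (add_zero 0) (add_zero n) x _ e.i).symm

lemma qi_shift {n : ℤ} {V V' T T' : C.Obj} (e : C.Shift n V V') (t : C.Shift n T T')
    (u : ((L.R T).obj V).X 0) (hu : ((L.R T).obj V).d 0 1 rfl u = 0)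
    (u' : ((L.R T').obj V').X 0) (hu' : ((L.R T').obj V').d 0 1 rfl u' = 0)
    (huv : L.lact (add_zero n) t.v u' = (L.R T).act (zero_add n) u e.v)
    (cu : (c.hom u hu).QI) : (c.hom u' hu').QI := by
  have key : ∀ (M : RMod C) {V V' : C.Obj} (e : C.Shift n V V') (a b : ℤ) (h : n + a = b),
      Function.Bijective ((M.act ((add_comm a n).trans h)).flip e.v) := by
    intro M V V' e a b h
    refine Function.bijective_iff_has_inverse.2
      ⟨(M.act (show b + -n = a by omega)).flip e.w, fun x => ?_, fun x => ?_⟩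
    · have := M.act_comp ((add_comm a n).trans h) (show b + -n = a by omega) (add_neg_cancel n)
        (add_zero a) x e.v e.w
      rw [e.v_w, M.act_id] at this
      exact this
    · have := M.act_comp (show b + -n = a by omega) ((add_comm a n).trans h) (neg_add_cancel n)
        (add_zero b) x e.w e.v
      rw [e.w_v, M.act_id] at this
      exact this
  have dkey : ∀ (M : RMod C) {V V' : C.Obj} (e : C.Shift n V V') (a b c d : ℤ) (h : n + a = c)
      (h' : n + b = d) (k : a + 1 = b) (k' : c + 1 = d) (x : (M.obj V).X a),
      (M.obj V').d c d k' (M.act ((add_comm a n).trans h) x e.v) =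
        M.act ((add_comm b n).trans h') ((M.obj V).d a b k x) e.v := by
    intro M V V' e a b c d h h' k k' x
    rw [M.leibniz _ k rfl k', e.d_v]
    simp
  have e1 : ∀ {a b : ℤ} (h : n + a = b), n.negOnePow * (n * a).negOnePow = (n * (a + 1)).negOnePow := by
    intro a b h
    rw [← Int.negOnePow_add]; congr 1; ring
  refine CxHom.qi_of_iso (n := n) (c.hom u hu) (c.hom u' hu')
    (fun a b h => (n * a).negOnePow • (N.act ((add_comm a n).trans h)).flip t.v)
    (fun a b h => (n * a).negOnePow • (M.act ((add_comm a n).trans h)).flip e.v)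
    (fun a b h => ?_) (fun a b h => ?_) (fun a b c d h h' k k' x => ?_)
    (fun a b c d h h' k k' x => ?_) (fun a b h x => ?_) cu
  · exact (MulAction.bijective (α := ℤˣ) (β := (N.obj T').X b) _).comp (key N t a b h)
  · exact (MulAction.bijective (α := ℤˣ) (β := (M.obj V').X b) _).comp (key M e a b h)
  · change (N.obj T').d c d k' ((n * a).negOnePow • N.act _ x t.v) =
      n.negOnePow • (n * b).negOnePow • N.act _ _ t.v
    rw [map_negOnePow, dkey N t a b c d h h' k k' x, smul_smul]
    subst k
    rw [← e1 h, ← mul_assoc, Int.units_mul_self, one_mul]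
  · change (M.obj V').d c d k' ((n * a).negOnePow • M.act _ x e.v) =
      n.negOnePow • (n * b).negOnePow • M.act _ _ e.v
    rw [map_negOnePow, dkey M e a b c d h h' k k' x, smul_smul]
    subst k
    rw [← e1 h, ← mul_assoc, Int.units_mul_self, one_mul]
  · refine (map_negOnePow _ _ _).trans (congrArg _ ?_)
    refine (c.balanced ((add_comm a n).trans h) (add_zero b) (add_zero n)
      ((add_comm a n).trans h) x t.v u').trans ?_
    refine (congrArg (c.c _ x) huv).trans ?_
    exact (c.act (add_zero a) ((add_comm a n).trans h) (zero_add n) ((add_comm a n).trans h)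
      x u e.v).symm

end Pairing

/-- Composition of maps of complexes. -/
def CxHom.comp {K L M : Cx.{v}} (g : CxHom L M) (f : CxHom K L) : CxHom K M where
  f n := (g.f n).comp (f.f n)
  comm a b h x := by simp only [AddMonoidHom.comp_apply, CxHom.comm]

lemma CxHom.QI.comp {K L M : Cx.{v}} {g : CxHom L M} {f : CxHom K L} (hg : g.QI) (hf : f.QI) :
    (g.comp f).QI := by
  intro n
  have : ⇑((g.comp f).H n) = g.H n ∘ f.H n := by
    funext x
    obtain ⟨x, hx, rfl⟩ := K.exists_cls x
    rfl
  rw [this]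
  exact (hg n).comp (hf n)

lemma CxHom.qi_of_comp_homotopic {K L : Cx.{v}} (f : CxHom K L) (g : CxHom L K)
    (h₁ : ∀ n, ∀ x : K.X n, K.d n (n + 1) rfl x = 0 →
      ∃ y : K.X (n - 1), K.d (n - 1) n (by omega) y = g.f n (f.f n x) - x)
    (h₂ : ∀ n, ∀ x : L.X n, L.d n (n + 1) rfl x = 0 →
      ∃ y : L.X (n - 1), L.d (n - 1) n (by omega) y = f.f n (g.f n x) - x) : f.QI := by
  intro n
  refine Function.bijective_iff_has_inverse.2 ⟨g.H n, fun x => ?_, fun x => ?_⟩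
  · obtain ⟨x, hx, rfl⟩ := K.exists_cls x
    obtain ⟨y, hy⟩ := h₁ n x hx
    exact K.cls_eq _ _ _ _ (m := n - 1) (by omega) y hy
  · obtain ⟨x, hx, rfl⟩ := L.exists_cls x
    obtain ⟨y, hy⟩ := h₂ n x hx
    exact L.cls_eq _ _ _ _ (m := n - 1) (by omega) y hy

/-- Two objects are homotopy equivalent, by means of `φ : T → T'`. -/
def PreDG.IsHoEquiv (C : PreDG.{u, v}) {T T' : C.Obj} (φ : (C.hom T T').X 0) : Prop :=
  (C.hom T T').d 0 1 rfl φ = 0 ∧ ∃ ψ : (C.hom T' T).X 0, (C.hom T' T).d 0 1 rfl ψ = 0 ∧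
    (∃ h : (C.hom T T).X (-1), (C.hom T T).d (-1) 0 rfl h = C.comp (add_zero 0) ψ φ - C.id T) ∧
    ∃ h : (C.hom T' T').X (-1), (C.hom T' T').d (-1) 0 rfl h = C.comp (add_zero 0) φ ψ - C.id T'

/-- Every closed morphism of degree one defines an extension, and translations exist. -/
structure PreDG.Pretriangulated (C : PreDG.{u, v}) : Prop where
  ext : ∀ {A B : C.Obj} (y : (C.hom B A).X 1), (C.hom B A).d 1 2 rfl y = 0 →
    ∃ (K : C.Obj) (e : C.Ext A B K), e.x = y
  shift : ∀ (n : ℤ) (T : C.Obj), ∃ T', Nonempty (C.Shift n T T')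

lemma RMod.qi_actHom {C : PreDG.{u, v}} (M : RMod C) {T T' : C.Obj} {φ : (C.hom T T').X 0}
    (hφ : C.IsHoEquiv φ) : (M.actHom φ hφ.1).QI := by
  obtain ⟨h0, ψ, hψ, ⟨h, hh⟩, h', hh'⟩ := hφ
  have key : ∀ {T : C.Obj} (k : (C.hom T T).X (-1)) (f : (C.hom T T).X 0)
      (_ : (C.hom T T).d (-1) 0 rfl k = f - C.id T) (n : ℤ) (x : (M.obj T).X n),
      (M.obj T).d n (n + 1) rfl x = 0 →
      ∃ y : (M.obj T).X (n - 1), (M.obj T).d (n - 1) n (by omega) y =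
        M.act (add_zero n) x f - x := by
    intro T k f hk n x hx
    refine ⟨n.negOnePow • M.act (by omega) x k, ?_⟩
    rw [map_negOnePow, M.leibniz _ rfl (b' := 0) rfl _, hx, hk, map_zero, AddMonoidHom.zero_apply,
      zero_add, smul_smul, Int.units_mul_self, one_smul, map_sub, M.act_id]
  refine CxHom.qi_of_comp_homotopic (M.actHom φ h0) (M.actHom ψ hψ) (fun n x hx => ?_)
    (fun n x hx => ?_)
  · obtain ⟨y, hy⟩ := key h' _ hh' n x hx
    exact ⟨y, hy.trans (congrArg (· - x)
      (M.act_comp (add_zero n) (add_zero n) (add_zero 0) (add_zero n) x φ ψ).symm)⟩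
  · obtain ⟨y, hy⟩ := key h _ hh n x hx
    exact ⟨y, hy.trans (congrArg (· - x)
      (M.act_comp (add_zero n) (add_zero n) (add_zero 0) (add_zero n) x ψ φ).symm)⟩

namespace Bimod

variable {C : PreDG.{u, v}} {L : Bimod C}

lemma IsUniv.exists_ext (hC : C.Pretriangulated) {A B K TA TB : C.Obj} (e : C.Ext A B K)
    {uA : ((L.R TA).obj A).X 0} {uB : ((L.R TB).obj B).X 0} (hA : L.IsUniv uA)
    (hB : L.IsUniv uB) : ∃ (TK : C.Obj) (t : C.Ext TA TB TK) (w : ((L.R TA).obj B).X 0)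
      (_ : ((L.R TK).obj K).d 0 1 rfl (L.extElt e t uA uB w) = 0),
      L.IsUniv (L.extElt e t uA uB w) := by
  obtain ⟨y, w, hy, hw⟩ := (CxHom.qi_iff _).1 (hB.2 TA) 1 2 3 rfl rfl 0
    ((L.R TA).act (zero_add 1) uA e.x) (map_zero _) (by
      rw [map_zero, (L.R TA).leibniz _ (a' := 1) rfl (b' := 2) rfl, hA.1, e.d_x]; simp)
  obtain ⟨TK, t, rfl⟩ := hC.ext y hy
  have hw' : ((L.R TA).obj B).d 0 1 rfl w =
      (L.R TA).act (zero_add 1) uA e.x - L.lact (add_zero 1) t.x uB := by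
    refine eq_sub_of_add_eq ?_
    rw [add_comm]
    exact hw.symm
  have hK := L.d_extElt e t uA uB w hA.1 hB.1 hw'
  exact ⟨TK, t, w, hK, hK, fun Z => (L.pairing Z).qi_ext e t uA uB w hA.1 hB.1 hK
    (hA.2 Z) (hB.2 Z)⟩

lemma IsUniv.exists_shift (hC : C.Pretriangulated) {n : ℤ} {V V' T : C.Obj} (e : C.Shift n V V')
    {u : ((L.R T).obj V).X 0} (hu : L.IsUniv u) : ∃ (T' : C.Obj) (t : C.Shift n T T')
      (u' : ((L.R T').obj V').X 0),
      L.lact (add_zero n) t.v u' = (L.R T).act (zero_add n) u e.v ∧ L.IsUniv u' := by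
  obtain ⟨T', ⟨t⟩⟩ := hC.shift n T
  have h1 : L.lact (add_zero n) t.v (L.lact (neg_add_cancel n) t.w
      ((L.R T).act (zero_add n) u e.v)) = (L.R T).act (zero_add n) u e.v := by
    rw [← L.comp_act (add_neg_cancel n) (zero_add n), t.v_w, L.id_act]
  have h2 : ((L.R T').obj V').d 0 1 rfl (L.lact (neg_add_cancel n) t.w
      ((L.R T).act (zero_add n) u e.v)) = 0 := by
    rw [L.leibniz _ rfl rfl, t.d_w, (L.R T).leibniz _ (a' := 1) rfl rfl, hu.1, e.d_v]
    simp
  exact ⟨T', t, _, h1, h2, fun Z =>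
    (L.pairing Z).qi_shift e t u hu.1 _ h2 h1 (hu.2 Z)⟩

lemma IsUniv.exists_hom {V T T' : C.Obj} {u : ((L.R T).obj V).X 0} (hu : L.IsUniv u)
    {u' : ((L.R T').obj V).X 0} (hu' : ((L.R T').obj V).d 0 1 rfl u' = 0) :
    ∃ (φ : (C.hom T T').X 0) (z : ((L.R T').obj V).X (-1)), (C.hom T T').d 0 1 rfl φ = 0 ∧
      ((L.R T').obj V).d (-1) 0 rfl z = u' - L.lact (add_zero 0) φ u := by
  obtain ⟨φ, z, h1, h2⟩ := (CxHom.qi_iff _).1 (hu.2 T') 0 1 2 rfl rfl 0 u' (map_zero _) (by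
    rw [map_zero, hu'])
  refine ⟨φ, z, h1, ?_⟩
  rw [eq_sub_iff_add_eq, add_comm]
  exact h2.symm

lemma IsUniv.exists_homotopy {V T T' : C.Obj} {u : ((L.R T).obj V).X 0} (hu : L.IsUniv u)
    {φ : (C.hom T T').X 0} (hφ : (C.hom T T').d 0 1 rfl φ = 0) (z : ((L.R T').obj V).X (-1))
    (hz : ((L.R T').obj V).d (-1) 0 rfl z = L.lact (add_zero 0) φ u) :
    ∃ h : (C.hom T T').X (-1), (C.hom T T').d (-1) 0 rfl h = φ := by
  obtain ⟨h, -, h1, -⟩ := (CxHom.qi_iff _).1 (hu.2 T') (-1) 0 1 rfl rfl φ z hφ hz.symm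
  exact ⟨h, h1⟩

lemma IsUniv.exists_hoEquiv {V T T' : C.Obj} {u : ((L.R T).obj V).X 0} (hu : L.IsUniv u)
    {u' : ((L.R T').obj V).X 0} (hu' : L.IsUniv u') :
    ∃ (φ : (C.hom T T').X 0) (z : ((L.R T').obj V).X (-1)), C.IsHoEquiv φ ∧
      ((L.R T').obj V).d (-1) 0 rfl z = u' - L.lact (add_zero 0) φ u := by
  obtain ⟨φ, z, hφ, hz⟩ := hu.exists_hom hu'.1
  obtain ⟨ψ, z', hψ, hz'⟩ := hu'.exists_hom hu.1
  have key : ∀ {T T' : C.Obj} {u : ((L.R T).obj V).X 0} {u' : ((L.R T').obj V).X 0}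
      (_ : L.IsUniv u) (φ : (C.hom T T').X 0) (ψ : (C.hom T' T).X 0)
      (_ : (C.hom T T').d 0 1 rfl φ = 0) (_ : (C.hom T' T).d 0 1 rfl ψ = 0)
      (z : ((L.R T').obj V).X (-1)) (z' : ((L.R T).obj V).X (-1))
      (_ : ((L.R T').obj V).d (-1) 0 rfl z = u' - L.lact (add_zero 0) φ u)
      (_ : ((L.R T).obj V).d (-1) 0 rfl z' = u - L.lact (add_zero 0) ψ u'),
      ∃ h : (C.hom T T).X (-1), (C.hom T T).d (-1) 0 rfl h = C.comp (add_zero 0) ψ φ - C.id T := by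
    intro T T' u u' hu φ ψ hφ hψ z z' hz hz'
    refine hu.exists_homotopy ?_ (-(z' + L.lact (zero_add _) ψ z)) ?_
    · rw [map_sub, C.leibniz _ (a' := 1) rfl (b' := 1) rfl, hφ, hψ, C.d_id]; simp
    · rw [map_neg, map_add, L.leibniz _ (a' := 1) rfl (b' := 0) rfl, hψ, hz, hz', map_sub,
        map_sub, AddMonoidHom.sub_apply, L.id_act,
        L.comp_act (add_zero 0) (add_zero 0) (add_zero 0) (add_zero 0)]
      simp
  exact ⟨φ, z, ⟨hφ, ψ, hψ, key hu φ ψ hφ hψ z z' hz hz', key hu' ψ φ hψ hφ z' z hz' hz⟩, hz⟩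

end Bimod

namespace Pairing

variable {C : PreDG.{u, v}} {N : RMod C} {L : Bimod C} {M : RMod C} (c : Pairing N L M)

lemma qi_of_univ {V T T' : C.Obj} {u : ((L.R T).obj V).X 0} (hu : L.IsUniv u)
    {u' : ((L.R T').obj V).X 0} (hu' : L.IsUniv u') (h : (c.hom u hu.1).QI) :
    (c.hom u' hu'.1).QI := by
  obtain ⟨φ, z, hφ, hz⟩ := hu.exists_hoEquiv hu'
  have h2 : ((L.R T').obj V).d 0 1 rfl (L.lact (add_zero 0) φ u) = 0 := by
    rw [L.leibniz _ (a' := 1) rfl (b' := 1) rfl, hφ.1, hu.1]; simp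
  refine c.qi_congr u' (L.lact (add_zero 0) φ u) hu'.1 h2 z hz ?_
  have e : c.hom (L.lact (add_zero 0) φ u) h2 = (c.hom u hu.1).comp (N.actHom φ hφ.1) := by
    ext n x
    exact (c.balanced (add_zero n) (add_zero n) (add_zero 0) (add_zero n) x φ u).symm
  rw [e]
  exact h.comp (N.qi_actHom hφ)

/-- All universal elements of `L(V, T)` induce quasi-isomorphisms. -/
def Good (V : C.Obj) : Prop := ∀ (T : C.Obj) (u : ((L.R T).obj V).X 0) (hu : L.IsUniv u),
  (c.hom u hu.1).QI

variable {c}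

lemma Good.ext (hC : C.Pretriangulated) {A B K TA TB : C.Obj} (e : C.Ext A B K)
    {uA : ((L.R TA).obj A).X 0} {uB : ((L.R TB).obj B).X 0} (hA : L.IsUniv uA)
    (hB : L.IsUniv uB) (cA : c.Good A) (cB : c.Good B) : c.Good K := by
  obtain ⟨TK, t, w, h, hK⟩ := hA.exists_ext hC e hB
  intro T u hu
  exact c.qi_of_univ hK hu (c.qi_ext e t uA uB w hA.1 hB.1 h (cA _ _ hA) (cB _ _ hB))

lemma Good.shift (hC : C.Pretriangulated) {n : ℤ} {V V' T : C.Obj} (e : C.Shift n V V')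
    {u : ((L.R T).obj V).X 0} (hu : L.IsUniv u) (cV : c.Good V) : c.Good V' := by
  obtain ⟨T', t, u', h, hu'⟩ := hu.exists_shift hC e
  intro T u₁ hu₁
  exact c.qi_of_univ hu' hu₁ (c.qi_shift e t u hu.1 u' hu'.1 h (cV _ _ hu))

end Pairing

/-- A family of objects depending functorially on an object in one place. -/
structure Slot (C : PreDG.{u, v}) (n : ℕ) where
  F : C.Obj → Fin (n + 1) → C.Obj
  p : Fin (n + 1) → Prop
  [dec : DecidablePred p]
  base : Fin (n + 1)
  p_iff : ∀ b, p b ↔ b = base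
  map : ∀ {V W : C.Obj} {a : ℤ}, (C.hom V W).X a → ∀ b, (C.hom (F V b) (F W b)).X (if p b then a else 0)
  map_id : ∀ V b, (C.hom (F V b) (F V b)).cast (by simp) (map (C.id V) b) = C.id (F V b)
  map_comp : ∀ {U V W : C.Obj} {a b c : ℤ} (h : a + b = c) (f : (C.hom V W).X a)
    (g : (C.hom U V).X b) (x : Fin (n + 1)),
    C.comp (by split_ifs; exacts [h, rfl]) (map f x) (map g x) = map (C.comp h f g) x
  map_add : ∀ {V W : C.Obj} {a : ℤ} (f g : (C.hom V W).X a) (b : Fin (n + 1)), p b →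
    map (f + g) b = map f b + map g b
  map_not : ∀ {V W : C.Obj} {a a' : ℤ} (f : (C.hom V W).X a) (g : (C.hom V W).X a') (b : Fin (n + 1))
    (hb : ¬ p b), map f b = (C.hom (F V b) (F W b)).cast (by simp [hb]) (map g b)
  d_map : ∀ {V W : C.Obj} {a a' : ℤ} (ha : a + 1 = a') (f : (C.hom V W).X a) (b : Fin (n + 1))
    (hb : p b), (C.hom (F V b) (F W b)).d _ _ (by simp [hb, ha]) (map f b) =
      map ((C.hom V W).d a a' ha f) b
  d_map_not : ∀ {V W : C.Obj} {a c : ℤ} (f : (C.hom V W).X a) (b : Fin (n + 1)) (_ : ¬ p b)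
    (h : (if p b then a else 0) + 1 = c), (C.hom (F V b) (F W b)).d _ c h (map f b) = 0

attribute [instance] Slot.dec

namespace Slot

variable {C : PreDG.{u, v}} {n : ℕ} (S : Slot C n)

lemma sum_ite (a : ℤ) : ∑ b, (if S.p b then a else 0) = a := by
  simp only [S.p_iff]; simp

lemma sum_lt (a : ℤ) : ∑ b with b < S.base, (if S.p b then a else 0) = 0 :=
  Finset.sum_eq_zero fun b hb => by
    rw [if_neg]
    rw [S.p_iff]
    rintro rfl
    simp at hb

lemma mul_ite_eq_zero {a a' : ℤ} {i j : Fin (n + 1)} (h : j ≠ i) :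
    (if S.p j then a else 0) * (if S.p i then a' else 0) = 0 := by
  by_cases hi : S.p i
  · rw [if_neg, zero_mul]
    rw [S.p_iff] at hi ⊢
    rwa [hi] at h
  · rw [if_neg hi, mul_zero]

/-- The restriction of a family to a subset of the index set. -/
def restrict {m : ℕ} (e : Fin (m + 1) → Fin (n + 1)) (he : Function.Injective e) (b : Fin (m + 1))
    (hb : e b = S.base) : Slot C m where
  F V a := S.F V (e a)
  p a := S.p (e a)
  base := b
  p_iff a := by rw [S.p_iff, ← hb, he.eq_iff]
  map f a := S.map f (e a)
  map_id V a := S.map_id V (e a)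
  map_comp h f g a := S.map_comp h f g (e a)
  map_add f g a := S.map_add f g (e a)
  map_not f g a := S.map_not f g (e a)
  d_map h f a := S.d_map h f (e a)
  d_map_not f a := S.d_map_not f (e a)

end Slot

/-! ### The standard slot -/

/-- The morphism `f` if the condition holds, and the identity otherwise. -/
def PreDG.iteHom {C : PreDG.{u, v}} (c : Prop) [inst : Decidable c] {V V' W : C.Obj} {a : ℤ}
    (f : (C.hom V V').X a) :
    (C.hom (if c then V else W) (if c then V' else W)).X (if c then a else 0) :=
  match inst with
  | isTrue _ => f
  | isFalse _ => C.id W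

/-- The family with the member `V` in the places satisfying `p`, and the members `X b` in the
other places. -/
def PreDG.slot (C : PreDG.{u, v}) {n : ℕ} (X : Fin (n + 1) → C.Obj) (i : Fin (n + 1)) :
    Slot C n where
  F V b := if b = i then V else X b
  p b := b = i
  base := i
  p_iff _ := Iff.rfl
  map f b := PreDG.iteHom (b = i) f
  map_id V b := by
    have : ∀ (c : Prop) [inst : Decidable c] (V W : C.Obj), (C.hom _ _).cast (by simp)
        (PreDG.iteHom (W := W) c (C.id V)) = C.id (if c then V else W) := by
      rintro c (h | h) V W <;> rfl
    exact this _ _ _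
  map_comp := by
    have : ∀ (c : Prop) [inst : Decidable c] (U V W X : C.Obj) (a b d : ℤ) (h : a + b = d)
        (f : (C.hom V W).X a) (g : (C.hom U V).X b),
        C.comp (by split_ifs; exacts [h, rfl]) (PreDG.iteHom (W := X) c f)
          (PreDG.iteHom (W := X) c g) = PreDG.iteHom (W := X) c (C.comp h f g) := by
      rintro c (h | h) U V W X a b d e f g
      · exact C.id_comp _ _
      · rfl
    intro U V W a b d h f g x
    exact this _ _ _ _ _ _ _ _ h f g
  map_add := by
    have : ∀ (c : Prop) [inst : Decidable c] (V W X : C.Obj) (a : ℤ) (f g : (C.hom V W).X a), c →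
        PreDG.iteHom (W := X) c (f + g) = PreDG.iteHom c f + PreDG.iteHom c g := by
      rintro c (h | h) V W X a f g hc
      · exact absurd hc h
      · rfl
    intro V W a f g b hb
    exact this _ _ _ _ _ _ _ hb
  map_not := by
    have : ∀ (c : Prop) [inst : Decidable c] (V W X : C.Obj) (a a' : ℤ) (f : (C.hom V W).X a)
        (g : (C.hom V W).X a') (hc : ¬ c), PreDG.iteHom (W := X) c f =
          (C.hom _ _).cast (by simp [hc]) (PreDG.iteHom (W := X) c g) := by
      rintro c (h | h) V W X a a' f g hc
      · rfl
      · exact absurd h hc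
    intro V W a a' f g b hb
    exact this _ _ _ _ _ _ f g hb
  d_map := by
    have : ∀ (c : Prop) [inst : Decidable c] (V W X : C.Obj) (a a' : ℤ) (ha : a + 1 = a')
        (f : (C.hom V W).X a) (hc : c), (C.hom _ _).d _ _ (by simp [hc, ha])
          (PreDG.iteHom (W := X) c f) = PreDG.iteHom (W := X) c ((C.hom V W).d a a' ha f) := by
      rintro c (h | h) V W X a a' ha f hc
      · exact absurd hc h
      · rfl
    intro V W a a' ha f b hb
    exact this _ _ _ _ _ _ ha f hb
  d_map_not := by
    have : ∀ (c : Prop) [inst : Decidable c] (V W X : C.Obj) (a d : ℤ)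
        (f : (C.hom V W).X a) (hc : ¬ c) (h : (if c then a else 0) + 1 = d), (C.hom _ _).d _ d h
          (PreDG.iteHom (W := X) c f) = 0 := by
      rintro c (h | h) V W X a d f hc hd
      · subst hd
        exact C.d_id X
      · exact absurd h hc
    intro V W a d f b hb h
    exact this _ _ _ _ _ _ f hb h

lemma PreDG.slot_self (C : PreDG.{u, v}) {n : ℕ} (X : Fin (n + 1) → C.Obj) (i : Fin (n + 1)) :
    (C.slot X i).F (X i) = X := by
  funext b
  by_cases h : b = i
  · subst h; exact if_pos rfl
  · exact if_neg h

/-! ### The bimodule of a slot -/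

namespace PT

variable {C : PreDG.{u, v}} (D : PT C)

/-- The map of complexes `f ↦ f u`. -/
def actCx {n : ℕ} {X : Fin (n + 1) → C.Obj} {T : C.Obj} (u : (D.P n X T).X 0)
    (hu : (D.P n X T).d 0 1 rfl u = 0) (Z : C.Obj) : CxHom (C.hom T Z) (D.cx n X Z) where
  f a := AddMonoidHom.mk' (fun f => D.act (add_zero a) f u) (fun f f' => D.act_add_left _ f f' u)
  comm a b h x := by
    change D.act (add_zero b) _ u = (D.P n X Z).d _ _ _ (D.act (add_zero a) _ u)
    rw [D.d_act _ h (b' := 1) rfl h, hu]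
    have : D.act h x (0 : (D.P n X T).X 1) = 0 := map_zero (AddMonoidHom.mk' _ (D.act_add_right h x))
    rw [this, smul_zero, add_zero]

/-- A universal element of `P(X, T)`: a closed element `u` of degree zero such that `f ↦ f u` is a
quasi-isomorphism `Hom(T, Z) → P(X, Z)` for all `Z`. -/
def IsUniv {n : ℕ} {X : Fin (n + 1) → C.Obj} {T : C.Obj} (u : (D.P n X T).X 0) : Prop :=
  ∃ hu : (D.P n X T).d 0 1 rfl u = 0, ∀ Z, (D.actCx u hu Z).QI

variable {n : ℕ} (S : Slot C n)

/-- Substitution of a morphism into the distinguished place. -/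
def slotAct {V W Z : C.Obj} {a b c : ℤ} (h : a + b = c) (x : (D.P n (S.F W) Z).X a)
    (f : (C.hom V W).X b) : (D.P n (S.F V) Z).X c :=
  D.pull (by rw [S.sum_ite]; exact h) (S.map f) x

variable {S} in
lemma slotAct_add_left {V W Z : C.Obj} {a b c : ℤ} (h : a + b = c) (x y : (D.P n (S.F W) Z).X a)
    (f : (C.hom V W).X b) : D.slotAct S h (x + y) f = D.slotAct S h x f + D.slotAct S h y f :=
  map_add (D.pull _ _) x y

variable {S} in
lemma slotAct_add_right {V W Z : C.Obj} {a b c : ℤ} (h : a + b = c) (x : (D.P n (S.F W) Z).X a)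
    (f g : (C.hom V W).X b) : D.slotAct S h x (f + g) = D.slotAct S h x f + D.slotAct S h x g :=
  D.pull_add_of _ S.base (S.map_add f g _ ((S.p_iff _).2 rfl))
    (fun b hb => S.map_not f (f + g) b (by rwa [S.p_iff]))
    (fun b hb => S.map_not g (f + g) b (by rwa [S.p_iff])) x

lemma d_slotAct {X Y Z : C.Obj} {a b c a' b' c' : ℤ} (h : a + b = c) (ha : a + 1 = a')
    (hb : b + 1 = b') (hc : c + 1 = c') (x : (D.P n (S.F Y) Z).X a) (f : (C.hom X Y).X b) :
    (D.P n (S.F X) Z).d c c' hc (D.slotAct S h x f) =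
      D.slotAct S (by omega) ((D.P n _ Z).d a a' ha x) f +
        a.negOnePow • D.slotAct S (by omega) x ((C.hom X Y).d b b' hb f) := by
  unfold slotAct
  rw [D.d_pull_of_ne _ ha hc _ S.base (fun j hj => S.d_map_not f j (by rwa [S.p_iff]) rfl), S.sum_lt,
    add_zero]
  congr 2
  refine D.pull_congr _ _ _ _ (fun i => ?_) x
  by_cases hi : S.p i
  · have hi' := (S.p_iff i).1 hi
    refine ⟨by rw [if_pos hi, if_pos hi', if_pos hi, hb], ?_⟩
    rw [PreDG.dAtHom, dif_pos hi', PreCx.cast_d]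
    exact S.d_map hb f i hi
  · have hi' : i ≠ S.base := fun e => hi ((S.p_iff i).2 e)
    refine ⟨by simp [hi, hi'], ?_⟩
    rw [PreDG.dAtHom, dif_neg hi', PreCx.cast_cast]
    exact (S.map_not _ _ i hi).symm

/-- The contravariant module `V ↦ P(S(V), Z)`. -/
def slotMod (Z : C.Obj) : RMod C where
  obj V := D.cx n (S.F V) Z
  act h := AddMonoidHom.mk' (fun x => AddMonoidHom.mk' (fun f => D.slotAct S h x f)
      (D.slotAct_add_right h x)) (fun x y => by ext f; exact D.slotAct_add_left h x y f)
  leibniz := D.d_slotAct S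
  act_comp := by
    intro X Y Z' a b c ab bc abc h₁ h₂ h₃ h₄ x f g
    refine (D.pull_pull_of_zero _ _ _ _ (δ'' := fun i => if S.p i then bc else 0)
      (fun i => by split_ifs; exacts [h₃, rfl]) (by rw [S.sum_ite]; exact h₄)
      (fun i j hj => S.mul_ite_eq_zero hj.ne) x).trans ?_
    exact D.pull_congr _ _ _ _ (fun i => ⟨rfl, S.map_comp h₃ f g i⟩) x
  act_id := by
    intro X a h x
    refine (D.pull_congr _ _ (by simp) _ (fun i => ⟨by simp, S.map_id X i⟩) x).trans ?_
    exact D.pull_id _ rfl x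

/-- The bimodule `V, W ↦ P(S(V), W)`. -/
def slotBimod : Bimod C where
  R W := D.slotMod S W
  lact h := AddMonoidHom.mk' (fun f => AddMonoidHom.mk' (fun x => D.act h f x)
    (D.act_add_right h f)) (fun f f' => by ext x; exact D.act_add_left h f f' x)
  leibniz := D.d_act
  comp_act := D.comp_act
  id_act := fun h x => D.lawful.id_comp x
  act_act h₁ h₂ h₃ h₄ f x g :=
    (D.act_pull (by rw [S.sum_ite]; exact h₃) h₄ h₁ (by rw [S.sum_ite]; exact h₂) f _ x).symm

lemma slotBimod_isUniv {V T : C.Obj} {u : (D.P n (S.F V) T).X 0} :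
    (D.slotBimod S).IsUniv (V := V) u ↔ D.IsUniv u := Iff.rfl

end PT

namespace PT

variable {C : PreDG.{u, v}} (D : PT C)

/-- The element `x` if the condition holds, and the element `g` otherwise. -/
def ite {k : ℕ} {X : Fin (k + 1) → C.Obj} {W T : C.Obj} {b : ℤ} (c : Prop) [inst : Decidable c]
    (x : c → (D.P k X W).X b) (g : ¬ c → (D.P k X T).X 0) :
    (D.P k X (if c then W else T)).X (if c then b else 0) :=
  match inst with
  | isTrue h => x h
  | isFalse h => g h

section ite

variable {k : ℕ} {X : Fin (k + 1) → C.Obj} {W T : C.Obj} {b : ℤ} (c : Prop) [inst : Decidable c]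

lemma ite_pos (hc : c) (x y : c → (D.P k X W).X b) (g : ¬ c → (D.P k X T).X 0) :
    D.ite c (fun hc => x hc + y hc) g = D.ite c x g + D.ite c y g := by
  obtain rfl : inst = isTrue hc := Subsingleton.elim _ _
  rfl

lemma ite_neg (hc : ¬ c) {b' : ℤ} (x : c → (D.P k X W).X b) (y : c → (D.P k X W).X b')
    (g : ¬ c → (D.P k X T).X 0) :
    D.ite c x g = (D.P k X _).cast (by simp [hc]) (D.ite c y g) := by
  obtain rfl : inst = isFalse hc := Subsingleton.elim _ _
  rfl

lemma d_ite_pos (hc : c) {b' : ℤ} (h : b + 1 = b') (x : c → (D.P k X W).X b)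
    (g : ¬ c → (D.P k X T).X 0) :
    (D.P k X _).d _ _ (by simp [hc, h]) (D.ite c x g) =
      D.ite c (fun hc => (D.P k X W).d b b' h (x hc)) g := by
  obtain rfl : inst = isTrue hc := Subsingleton.elim _ _
  rfl

lemma d_ite_neg (hc : ¬ c) {d : ℤ} (h : (if c then b else 0) + 1 = d) (x : c → (D.P k X W).X b)
    (g : ¬ c → (D.P k X T).X 0) (hg : ∀ hc, (D.P k X T).d 0 1 rfl (g hc) = 0) :
    (D.P k X _).d _ d h (D.ite c x g) = 0 := by
  obtain rfl : inst = isFalse hc := Subsingleton.elim _ _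
  subst h
  exact hg hc

lemma act_ite {W' : C.Obj} {a d : ℤ} (h : a + b = d) (f : (C.hom W W').X a) (x : c → (D.P k X W).X b)
    (g : ¬ c → (D.P k X T).X 0) :
    D.act (by split_ifs; exacts [h, rfl]) (PreDG.iteHom (W := T) c f) (D.ite c x g) =
      D.ite c (fun hc => D.act h f (x hc)) g := by
  cases inst with
  | isFalse h => exact D.lawful.id_comp _
  | isTrue h => rfl

lemma pull_ite {X' : Fin (k + 1) → C.Obj} {d : ℤ} {t : Fin (k + 1) → ℤ}
    (ht : c → b + ∑ a, t a = d) (ht' : ¬ c → 0 + ∑ a, t a = 0) (f : ∀ a, (C.hom (X' a) (X a)).X (t a))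
    (x : c → (D.P k X W).X b) (g : ¬ c → (D.P k X T).X 0) :
    D.pull (by split_ifs with h; exacts [ht h, ht' h]) f (D.ite c x g) =
      D.ite c (fun hc => D.pull (ht hc) f (x hc)) (fun hc => D.pull (ht' hc) f (g hc)) := by
  cases inst with
  | isFalse h => rfl
  | isTrue h => rfl

end ite

section fam

variable {n : ℕ} {k : Fin (n + 1) → ℕ} {X : ∀ i, Fin (k i + 1) → C.Obj} {T : Fin (n + 1) → C.Obj}

/-- The family with the member `x` in the `i`-th place and the members `g i'` in the other
places. -/
def fam (i : Fin (n + 1)) {W : C.Obj} {b : ℤ} (x : (D.P (k i) (X i) W).X b)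
    (g : ∀ i', i' ≠ i → (D.P (k i') (X i') (T i')).X 0) (i' : Fin (n + 1)) :
    (D.P (k i') (X i') ((C.slot T i).F W i')).X (if i' = i then b else 0) :=
  D.ite (i' = i) (fun h => Eq.rec (motive := fun i' _ => (D.P (k i') (X i') W).X b) x h.symm)
    (g i')

variable {m : ℕ} (π : FinSurj m n k) (S : Slot C m) (T)

/-- The base of the restriction of a family to the fibre containing its distinguished place. -/
noncomputable def _root_.DGTensor.Slot.fibreBase : Fin (k (π.map S.base) + 1) :=
  (π.exists_emb_map S.base).choose

lemma _root_.DGTensor.Slot.emb_fibreBase : π.emb (π.map S.base) (S.fibreBase π) = S.base :=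
  (π.exists_emb_map S.base).choose_spec

/-- The restriction to the fibre containing the distinguished place. -/
noncomputable abbrev _root_.DGTensor.Slot.fibre : Slot C (k (π.map S.base)) :=
  S.restrict (π.emb (π.map S.base)) (π.emb_injective _) (S.fibreBase π) (S.emb_fibreBase π)

lemma _root_.DGTensor.Slot.sum_fibre (i : Fin (n + 1)) (a : ℤ) :
    ∑ c, (if S.p (π.emb i c) then a else 0) = if i = π.map S.base then a else 0 := by
  split_ifs with h
  · subst h
    exact (S.fibre π).sum_ite a
  · refine Finset.sum_eq_zero fun c _ => if_neg fun hc => h ?_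
    rw [S.p_iff] at hc
    rw [← hc, π.map_emb]

/-- Elements of `P` for the other fibres, compatible with substitution of morphisms. -/
structure Frame where
  g : ∀ (V : C.Obj) (i : Fin (n + 1)), i ≠ π.map S.base →
    (D.P (k i) (fun a => S.F V (π.emb i a)) (T i)).X 0
  d_g : ∀ V i hi, (D.P _ _ _).d 0 1 rfl (g V i hi) = 0
  pull_g : ∀ {V W : C.Obj} {a : ℤ} (f : (C.hom V W).X a) (i : Fin (n + 1)) (hi : i ≠ π.map S.base),
    D.pull (by rw [S.sum_fibre, if_neg hi, add_zero]) (fun c => S.map f (π.emb i c)) (g W i hi) =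
      g V i hi

variable {π S T} (G : D.Frame T π S) {D}

namespace Frame

/-- The composition `f(x, g_i)`. -/
def comp {V W Z : C.Obj} {a b c : ℤ} (h : a + b = c)
    (f : (D.P n ((C.slot T (π.map S.base)).F W) Z).X a)
    (x : (D.P (k (π.map S.base)) (fun a => S.F V (π.emb _ a)) W).X b) : (D.P m (S.F V) Z).X c :=
  D.comp π (X := S.F V) (X' := fun i a => S.F V (π.emb i a)) (fun _ _ => rfl)
    (Y := (C.slot T (π.map S.base)).F W) (q := fun i => if i = π.map S.base then b else 0)
    (by simpa using h) f (D.fam _ x (G.g V))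

lemma comp_add_left {V W Z : C.Obj} {a b c : ℤ} (h : a + b = c)
    (f f' : (D.P n ((C.slot T (π.map S.base)).F W) Z).X a)
    (x : (D.P (k (π.map S.base)) (fun a => S.F V (π.emb _ a)) W).X b) :
    G.comp h (f + f') x = G.comp h f x + G.comp h f' x :=
  D.lawful.comp_add_left _ _ _ _ _ _

lemma comp_add_right {V W Z : C.Obj} {a b c : ℤ} (h : a + b = c)
    (f : (D.P n ((C.slot T (π.map S.base)).F W) Z).X a)
    (x y : (D.P (k (π.map S.base)) (fun a => S.F V (π.emb _ a)) W).X b) :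
    G.comp h f (x + y) = G.comp h f x + G.comp h f y :=
  D.comp_add_of _ _ (π.map S.base) (D.ite_pos _ rfl _ _ _)
    (fun i hi => D.ite_neg (i = π.map S.base) hi (b' := b) _ _ (G.g V i))
    (fun i hi => D.ite_neg (i = π.map S.base) hi (b' := b) _ _ (G.g V i))

lemma d_comp {V W Z : C.Obj} {a b c a' b' c' : ℤ} (h : a + b = c) (ha : a + 1 = a')
    (hb : b + 1 = b') (hc : c + 1 = c') (f : (D.P n ((C.slot T (π.map S.base)).F W) Z).X a)
    (x : (D.P (k (π.map S.base)) (fun a => S.F V (π.emb _ a)) W).X b) :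
    (D.P m (S.F V) Z).d c c' hc (G.comp h f x) =
      G.comp (by omega) ((D.P n ((C.slot T (π.map S.base)).F W) Z).d a a' ha f) x +
        a.negOnePow • G.comp (by omega) f ((D.P _ _ W).d b b' hb x) := by
  unfold comp
  rw [D.lawful.leibniz _ _ _ ha hc]
  congr 1
  rw [Finset.sum_eq_single (π.map S.base)]
  · rw [Finset.sum_eq_zero (s := Finset.univ.filter _), add_zero]
    · congr 1
      refine D.comp_congr _ _ _ _ _ _ _ fun i => ?_
      by_cases hi : i = π.map S.base
      · refine ⟨by simp [hi, hb], ?_⟩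
        rw [PTData.dAt, dif_pos hi, PreCx.cast_d]
        refine (D.d_ite_pos _ hi hb _ _).trans ?_
        subst hi
        rfl
      · refine ⟨by simp [hi], ?_⟩
        rw [PTData.dAt, dif_neg hi, PreCx.cast_cast]
        exact (D.ite_neg _ hi _ _ _).symm
    · intro j hj
      simp only [Finset.mem_filter, Finset.mem_univ, true_and] at hj
      exact if_neg hj.ne
  · intro i _ hi
    refine (congrArg _ (D.comp_zero_right _ _ _ _ _ i ?_)).trans (smul_zero _)
    rw [PTData.dAt, dif_pos rfl]
    exact D.d_ite_neg _ hi _ _ _ fun hc => G.d_g _ _ _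
  · simp

lemma balanced {V W W' Z : C.Obj} {a b d ab bd abd : ℤ} (h₁ : a + b = ab) (h₂ : ab + d = abd)
    (h₃ : b + d = bd) (h₄ : a + bd = abd) (f : (D.P n ((C.slot T (π.map S.base)).F W) Z).X a)
    (g : (C.hom W' W).X b)
    (x : (D.P (k (π.map S.base)) (fun a => S.F V (π.emb _ a)) W').X d) :
    G.comp h₂ (D.slotAct (C.slot T (π.map S.base)) h₁ f g) x = G.comp h₄ f (D.act h₃ g x) := by
  have := D.comp_pull π (X := S.F V) (Y := (C.slot T (π.map S.base)).F W')
    (Y' := (C.slot T (π.map S.base)).F W) (p := a) (r := ab) (N := abd) (Z := Z)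
    (δ := fun i => if i = π.map S.base then b else 0)
    (q := fun i => if i = π.map S.base then d else 0)
    (u := fun i => if i = π.map S.base then bd else 0)
    (by simpa using h₁) (by simpa using h₂) (fun i => by split_ifs; exacts [h₃, rfl])
    (by simpa using h₄) ((C.slot T (π.map S.base)).map g) f (D.fam _ x (G.g V))
  have hs : (∑ i, ∑ j with j < i,
      (if j = π.map S.base then d else 0) * if i = π.map S.base then b else 0) = 0 := by
    refine Finset.sum_eq_zero fun i _ => Finset.sum_eq_zero fun j hj => ?_
    simp only [Finset.mem_filter, Finset.mem_univ, true_and] at hj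
    exact (C.slot T (π.map S.base)).mul_ite_eq_zero hj.ne
  rw [hs, Int.negOnePow_zero, one_smul] at this
  refine this.symm.trans ?_
  refine congrArg _ (funext fun i => ?_)
  refine (D.act_ite (i = π.map S.base) h₃ g _ _).trans ?_
  refine congrArg (fun x => D.ite _ x _) (funext fun hi => ?_)
  subst hi
  rfl

lemma act_comp {V V' W Z : C.Obj} {a b d ab bd abd : ℤ} (h₁ : a + b = ab) (h₂ : ab + d = abd)
    (h₃ : b + d = bd) (h₄ : a + bd = abd) (f : (D.P n ((C.slot T (π.map S.base)).F W) Z).X a)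
    (x : (D.P (k (π.map S.base)) (fun a => S.F V (π.emb _ a)) W).X b) (g : (C.hom V' V).X d) :
    D.slotAct S h₂ (G.comp h₁ f x) g = G.comp h₄ f (D.slotAct (S.fibre π) h₃ x g) := by
  have h₃' : ∀ i, (if i = π.map S.base then b else 0) + ∑ c, (if S.p (π.emb i c) then d else 0) =
      if i = π.map S.base then bd else 0 := fun i => by
    rw [S.sum_fibre]; split_ifs; exacts [h₃, rfl]
  have := D.pull_comp π (X := S.F V) (X' := S.F V') (p := a) (r := ab) (N := abd) (Z := Z)
    (q := fun i => if i = π.map S.base then b else 0)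
    (t := fun c => if S.p c then d else 0)
    (u := fun i => if i = π.map S.base then bd else 0)
    (by simpa using h₁) (by rw [S.sum_ite]; exact h₂) h₃' (by simpa using h₄) (S.map g) f
    (D.fam _ x (G.g V))
  have hs : koszul π.map (fun i => if i = π.map S.base then b else 0)
      (fun c => if S.p c then d else 0) = 0 := by
    unfold koszul
    rw [Finset.sum_eq_zero, Finset.sum_eq_zero, add_zero]
    · intro c _
      refine Finset.sum_eq_zero fun c' hc => ?_
      simp only [Finset.mem_filter, Finset.mem_univ, true_and] at hc
      exact S.mul_ite_eq_zero hc.1.ne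
    · intro i _
      refine Finset.sum_eq_zero fun c hc => ?_
      simp only [Finset.mem_filter, Finset.mem_univ, true_and] at hc
      change (if S.p c then d else 0) * (if i = π.map S.base then b else 0) = 0
      by_cases hi : i = π.map S.base
      · rw [if_neg, zero_mul]
        rw [S.p_iff]
        rintro rfl
        exact hc.ne hi.symm
      · rw [if_neg hi, mul_zero]
  rw [hs, Int.negOnePow_zero, one_smul] at this
  refine this.symm.trans ?_
  refine congrArg _ (funext fun i => ?_)
  refine (D.pull_ite (i = π.map S.base) (fun hi => by
      have := h₃' i; rwa [if_pos hi, if_pos hi] at this)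
    (fun hi => by have := h₃' i; rwa [if_neg hi, if_neg hi] at this) _ _ _).trans ?_
  refine (congrArg (fun x => D.ite _ x _) (funext fun hi => ?_)).trans
    (congrArg (fun g => D.ite _ _ g) (funext fun hi => G.pull_g g i hi))
  subst hi
  rfl

/-- The pairing given by composition along `π`, with the elements `g_i` in the places of the fibres
not containing the distinguished place. -/
noncomputable def pairing (Z : C.Obj) :
    Pairing (D.slotMod (C.slot T (π.map S.base)) Z) (D.slotBimod (S.fibre π)) (D.slotMod S Z) where
  c h := AddMonoidHom.mk' (fun f => AddMonoidHom.mk' (fun x => G.comp h f x)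
    (G.comp_add_right h f)) (fun f f' => by ext x; exact G.comp_add_left h f f' x)
  leibniz := G.d_comp
  balanced := G.balanced
  act := G.act_comp

end Frame

end fam

end PT

lemma CxHom.qi_of_bijective {K L : Cx.{v}} (f : CxHom K L) (h : ∀ n, Function.Bijective (f.f n)) :
    f.QI :=
  f.H_bijective h

/-- The morphism from `V` (if the condition holds) or `W` (otherwise) to `V`. -/
def PreDG.iteFst {C : PreDG.{u, v}} (c : Prop) [inst : Decidable c] {V W : C.Obj} :
    (C.hom (if c then V else W) V).X 0 :=
  match inst with
  | isTrue _ => C.id V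
  | isFalse _ => 0

/-- The morphism from `V` (if the condition holds) or `W` (otherwise) to `W`. -/
def PreDG.iteSnd {C : PreDG.{u, v}} (c : Prop) [inst : Decidable c] {V W : C.Obj} :
    (C.hom (if c then V else W) W).X 0 :=
  match inst with
  | isTrue _ => 0
  | isFalse _ => C.id W

namespace PT

variable {C : PreDG.{u, v}} (D : PT C)

section univ

variable {k : ℕ} {X : Fin (k + 1) → C.Obj} {W T : C.Obj} (c : Prop) [inst : Decidable c]

lemma ite_act (y : (D.P k X (if c then W else T)).X 0) :
    D.ite c (fun _ => D.act (add_zero 0) (PreDG.iteFst c) y)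
      (fun _ => D.act (add_zero 0) (PreDG.iteSnd c) y) = (D.P k X _).cast (by simp) y := by
  cases inst with
  | isFalse h => exact D.lawful.id_comp _
  | isTrue h => exact D.lawful.id_comp _

variable {D}

lemma IsUniv.iteFst (hc : c) {y : (D.P k X (if c then W else T)).X 0} (hy : D.IsUniv y) :
    D.IsUniv (D.act (add_zero 0) (PreDG.iteFst c) y) := by
  obtain rfl : inst = isTrue hc := Subsingleton.elim _ _
  have : D.act (add_zero 0) (C.id W) (y : (D.P k X W).X 0) = y := D.lawful.id_comp _
  change D.IsUniv (D.act (add_zero 0) (C.id W) (y : (D.P k X W).X 0))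
  rw [this]
  exact hy

lemma IsUniv.iteSnd (hc : ¬ c) {y : (D.P k X (if c then W else T)).X 0} (hy : D.IsUniv y) :
    D.IsUniv (D.act (add_zero 0) (PreDG.iteSnd c) y) := by
  obtain rfl : inst = isFalse hc := Subsingleton.elim _ _
  have : D.act (add_zero 0) (C.id T) (y : (D.P k X T).X 0) = y := D.lawful.id_comp _
  change D.IsUniv (D.act (add_zero 0) (C.id T) (y : (D.P k X T).X 0))
  rw [this]
  exact hy

lemma isUniv_ite (x : c → (D.P k X W).X 0) (g : ¬ c → (D.P k X T).X 0)
    (hx : ∀ h, D.IsUniv (x h)) (hg : ∀ h, D.IsUniv (g h)) :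
    D.IsUniv ((D.P k X _).cast (by simp) (D.ite c x g)) := by
  cases inst with
  | isFalse h => exact hg h
  | isTrue h => exact hx h

/-- Substitution of isomorphisms preserves universal elements. -/
lemma IsUniv.pull {X' : Fin (k + 1) → C.Obj} {δ δ' : Fin (k + 1) → ℤ} (hδ : ∀ b, δ b = 0)
    (hδ' : ∀ b, δ' b = 0) (f : ∀ b, (C.hom (X' b) (X b)).X (δ b))
    (g : ∀ b, (C.hom (X b) (X' b)).X (δ' b))
    (hf : ∀ b, (C.hom _ _).d (δ b) (δ b + 1) rfl (f b) = 0)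
    (hfg : ∀ b, C.comp (by rw [hδ, hδ']; rfl) (f b) (g b) = C.id (X b))
    (hgf : ∀ b, C.comp (by rw [hδ, hδ']; rfl) (g b) (f b) = C.id (X' b))
    {y : (D.P k X T).X 0} (hy : D.IsUniv y) (h : 0 + ∑ b, δ b = 0) :
    D.IsUniv (D.pull h f y) := by
  have hs : ∀ {a : ℤ}, a + ∑ b, δ b = a := fun {a} => by simp [hδ]
  have hs' : ∀ {a : ℤ}, a + ∑ b, δ' b = a := fun {a} => by simp [hδ']
  have hd : (D.P k X' T).d 0 1 rfl (D.pull h f y) = 0 := by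
    rw [D.d_pull_of_closed h (p' := 1) (r' := 1) rfl rfl f hf, hy.1, map_zero]
  refine ⟨hd, fun Z => ?_⟩
  let φ : CxHom (D.cx k X Z) (D.cx k X' Z) :=
    { f := fun a => D.pull hs f
      comm := fun a b h x => (D.d_pull_of_closed hs h h f hf x).symm }
  have hφ : φ.QI := by
    refine φ.qi_of_bijective fun a => Function.bijective_iff_has_inverse.2
      ⟨D.pull hs' g, fun x => ?_, fun x => ?_⟩
    · refine (D.pull_pull_of_zero hs hs' f g (δ'' := fun _ => 0) (fun b => by rw [hδ, hδ']; rfl)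
        (by simp) (fun i j _ => by rw [hδ, mul_zero]) x).trans ?_
      refine (D.pull_congr _ _ (by simp) _ (fun b => ⟨rfl, hfg b⟩) x).trans ?_
      exact D.pull_id _ rfl x
    · refine (D.pull_pull_of_zero hs' hs g f (δ'' := fun _ => 0) (fun b => by rw [hδ, hδ']; rfl)
        (by simp) (fun i j _ => by rw [hδ, zero_mul]) x).trans ?_
      refine (D.pull_congr _ _ (by simp) _ (fun b => ⟨rfl, hgf b⟩) x).trans ?_
      exact D.pull_id _ rfl x
  have e : D.actCx _ hd Z = φ.comp (D.actCx y hy.1 Z) := by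
    ext a x
    exact D.act_pull h (add_zero a) (add_zero a) hs x f y
  rw [e]
  exact hφ.comp (hy.2 Z)

end univ

section slot

variable {n : ℕ} (S : Slot C n)

/-- Representability of the module `P(X, _)`, in terms of a universal element. -/
def IsRep (X : Fin (n + 1) → C.Obj) : Prop := ∃ (T : C.Obj) (u : (D.P n X T).X 0), D.IsUniv u

variable {D S}

lemma IsRep.ext (hC : C.Pretriangulated) {A B K : C.Obj} (e : C.Ext A B K)
    (hA : D.IsRep (S.F A)) (hB : D.IsRep (S.F B)) : D.IsRep (S.F K) := by
  obtain ⟨TA, uA, hA⟩ := hA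
  obtain ⟨TB, uB, hB⟩ := hB
  obtain ⟨T, t, w, -, hu⟩ := Bimod.IsUniv.exists_ext (L := D.slotBimod S) hC e hA hB
  exact ⟨T, _, hu⟩

lemma IsRep.shift (hC : C.Pretriangulated) {k : ℤ} {V V' : C.Obj} (e : C.Shift k V V')
    (hV : D.IsRep (S.F V)) : D.IsRep (S.F V') := by
  obtain ⟨T, u, hu⟩ := hV
  obtain ⟨T', -, u', -, hu'⟩ := Bimod.IsUniv.exists_shift (L := D.slotBimod S) hC e hu
  exact ⟨T', _, hu'⟩

end slot

section comp

variable {m n : ℕ} {k : Fin (n + 1) → ℕ} (π : FinSurj m n k) {X : Fin (m + 1) → C.Obj}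
  {T : Fin (n + 1) → C.Obj}

lemma d_comp_of_closed (u : ∀ i, (D.P (k i) (fun a => X (π.emb i a)) (T i)).X 0)
    (hu : ∀ i, (D.P (k i) _ (T i)).d 0 1 rfl (u i) = 0) {Z : C.Obj} {a b : ℤ} (h : a + 1 = b)
    (x : (D.P n T Z).X a) :
    D.comp π (X := X) (fun _ _ => rfl) (by simp) ((D.P n T Z).d a b h x) u =
      (D.P m X Z).d a b h (D.comp π (X := X) (fun _ _ => rfl) (by simp) x u) := by
  rw [D.lawful.leibniz _ _ _ h h]
  refine Eq.symm ((congrArg _ (Finset.sum_eq_zero fun i _ => ?_)).trans (add_zero _))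
  refine (congrArg _ (D.comp_zero_right _ _ _ _ _ i ?_)).trans (smul_zero _)
  rw [PTData.dAt_self]
  have := congrArg ((D.P (k i) _ (T i)).cast (show (1 : ℤ) = 0 + if i = i then 1 else 0 by simp))
    (hu i)
  rw [PreCx.cast_d, map_zero] at this
  exact (PreCx.cast_d _ _ _ _).trans this

/-- The map of complexes `f ↦ f(u_i)`. -/
def compCx (u : ∀ i, (D.P (k i) (fun a => X (π.emb i a)) (T i)).X 0)
    (hu : ∀ i, (D.P (k i) _ (T i)).d 0 1 rfl (u i) = 0) (Z : C.Obj) :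
    CxHom (D.cx n T Z) (D.cx m X Z) where
  f a := D.compL π (fun _ _ => rfl) (by simp) u
  comm _ _ h x := D.d_comp_of_closed π u hu h x

/-- Composition with universal elements along `π` is a quasi-isomorphism. -/
def Good (X : Fin (m + 1) → C.Obj) : Prop := ∀ (T : Fin (n + 1) → C.Obj)
  (u : ∀ i, (D.P (k i) (fun a => X (π.emb i a)) (T i)).X 0) (hu : ∀ i, D.IsUniv (u i)) (Z : C.Obj),
  (D.compCx π u (fun i => (hu i).1) Z).QI

variable {π} {S : Slot C m} {D}

/-- The frame determined by its members for one object. -/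
def Frame.mk' {V₀ : C.Obj} (g : ∀ i, i ≠ π.map S.base →
      (D.P (k i) (fun a => S.F V₀ (π.emb i a)) (T i)).X 0)
    (hg : ∀ i hi, (D.P (k i) _ (T i)).d 0 1 rfl (g i hi) = 0) : D.Frame T π S where
  g V i hi := D.pull (by rw [S.sum_fibre, if_neg hi, add_zero])
    (fun c => S.map (0 : (C.hom V V₀).X 0) (π.emb i c)) (g i hi)
  d_g V i hi := by
    have hp : ∀ c, ¬ S.p (π.emb i c) := fun c hc => hi (by
      rw [S.p_iff] at hc; rw [← hc, π.map_emb])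
    rw [D.d_pull_of_closed (p' := 1) (r' := 1) _ rfl rfl _ (fun c => S.d_map_not _ _ (hp c) rfl),
      hg, map_zero]
  pull_g := by
    intro V W a f i hi
    have hp : ∀ c, ¬ S.p (π.emb i c) := fun c hc => hi (by
      rw [S.p_iff] at hc; rw [← hc, π.map_emb])
    refine (D.pull_pull_of_zero _ _ _ _ (δ'' := fun _ => 0) (fun c => by simp [hp]) (by simp)
      (fun c c' _ => by simp [hp]) (g i hi)).trans ?_
    refine D.pull_congr _ _ _ _ (fun c => ⟨by simp, ?_⟩) _
    have h1 := S.map_comp (zero_add a) (0 : (C.hom W V₀).X 0) f (π.emb i c)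
    have h2 := S.map_not (C.comp (zero_add a) (0 : (C.hom W V₀).X 0) f) (0 : (C.hom V V₀).X 0)
      (π.emb i c) (hp c)
    have h3 := congrArg ((C.hom (S.F V (π.emb i c)) (S.F V₀ (π.emb i c))).cast
      (show (if S.p (π.emb i c) then a else 0) = if S.p (π.emb i c) then 0 else 0 by simp [hp]))
      (h1.trans h2)
    rw [PreCx.cast_cast, PreCx.cast_rfl, PreDG.cast_comp] at h3
    rw [PreDG.cast_comp]
    exact h3

lemma Frame.mk'_self {V₀ : C.Obj} (g : ∀ i, i ≠ π.map S.base →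
      (D.P (k i) (fun a => S.F V₀ (π.emb i a)) (T i)).X 0)
    (hg : ∀ i hi, (D.P (k i) _ (T i)).d 0 1 rfl (g i hi) = 0) (i : Fin (n + 1))
    (hi : i ≠ π.map S.base) : (Frame.mk' g hg).g V₀ i hi = g i hi := by
  have hp : ∀ c, ¬ S.p (π.emb i c) := fun c hc => hi (by
    rw [S.p_iff] at hc; rw [← hc, π.map_emb])
  refine (D.pull_congr _ _ (by simp) _ (fun c => ⟨by simp, ?_⟩) (g i hi)).trans
    (D.pull_id (by simp) rfl _)
  rw [S.map_not _ (C.id V₀) _ (hp c), PreCx.cast_cast]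
  exact S.map_id _ _

lemma Frame.isUniv (G : D.Frame T π S) {V V₀ : C.Obj} (i : Fin (n + 1)) (hi : i ≠ π.map S.base)
    (h : D.IsUniv (G.g V₀ i hi)) : D.IsUniv (G.g V i hi) := by
  have hp : ∀ c, ¬ S.p (π.emb i c) := fun c hc => hi (by
    rw [S.p_iff] at hc; rw [← hc, π.map_emb])
  have key : ∀ (V V' : C.Obj) (c : Fin (k i + 1)), C.comp (by simp)
      (S.map (0 : (C.hom V V').X 0) (π.emb i c)) (S.map (0 : (C.hom V' V).X 0) (π.emb i c)) =
      C.id (S.F V' (π.emb i c)) := by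
    intro V V' c
    have h1 := S.map_comp (zero_add 0) (0 : (C.hom V V').X 0) (0 : (C.hom V' V).X 0) (π.emb i c)
    rw [S.map_not _ (C.id V') _ (hp c)] at h1
    have h3 := congrArg ((C.hom _ _).cast (show _ = (0 : ℤ) by simp)) h1
    rw [PreCx.cast_cast, S.map_id, PreDG.cast_comp] at h3
    exact h3
  rw [← G.pull_g (0 : (C.hom V V₀).X 0)]
  refine h.pull (by simp) (by simp) _ (fun c => S.map (0 : (C.hom V₀ V).X 0) (π.emb i c))
    (fun c => S.d_map_not _ _ (hp c) rfl) (fun c => key _ _ c) (fun c => key _ _ c) _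

lemma good_iff {K : C.Obj} : D.Good π (S.F K) ↔ ∀ (T : Fin (n + 1) → C.Obj) (G : D.Frame T π S)
    (_ : ∀ i hi, D.IsUniv (G.g K i hi)) (Z : C.Obj), (G.pairing Z).Good K := by
  constructor
  · intro h T G hG Z W u hu
    have h1 := h ((C.slot T (π.map S.base)).F W)
      (fun i => (D.P _ _ _).cast (by simp) (D.fam (X := fun i a => S.F K (π.emb i a)) (π.map S.base) (W := W) (b := 0) u (G.g K) i))
      (fun i => D.isUniv_ite (i = π.map S.base) _ _ (fun hi => by subst hi; exact hu) (hG i)) Z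
    refine (congrArg CxHom.QI ?_).mpr h1
    ext a x
    exact D.comp_congr _ _ _ (by simp) _ _ _ (fun i => ⟨by simp, rfl⟩)
  · intro h T u hu Z
    obtain ⟨T', W, rfl⟩ : ∃ T' W, T = (C.slot T' (π.map S.base)).F W :=
      ⟨T, _, (C.slot_self T (π.map S.base)).symm⟩
    have hg : ∀ i, i ≠ π.map S.base → D.IsUniv (D.act (add_zero 0)
        (PreDG.iteSnd (V := W) (W := T' i) (i = π.map S.base)) (u i)) :=
      fun i hi => (hu i).iteSnd _ hi
    have hx : D.IsUniv (D.act (add_zero 0) (PreDG.iteFst (V := W) (W := T' (π.map S.base))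
      (π.map S.base = π.map S.base)) (u (π.map S.base))) := (hu _).iteFst _ rfl
    have h1 := h T' (Frame.mk' _ (fun i hi => (hg i hi).1))
      (fun i hi => by rw [Frame.mk'_self]; exact hg i hi) Z W _ hx
    have e : D.compCx π u (fun i => (hu i).1) Z =
        ((Frame.mk' _ (fun i hi => (hg i hi).1)).pairing Z).hom (V := K) (W := W) _ hx.1 := by
      ext a x
      refine D.comp_congr _ _ _ _ _ _ _ (fun i => ⟨by simp, ?_⟩)
      refine (D.ite_act (i = π.map S.base) (u i)).symm.trans ?_
      refine (congrArg (fun x => D.ite _ x _) (funext fun hi => ?_)).trans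
        (congrArg (fun g => D.ite _ _ g) (funext fun hi => (Frame.mk'_self
          (fun i hi => D.act (add_zero 0) (PreDG.iteSnd (i = π.map S.base)) (u i))
          (fun i hi => (hg i hi).1) i hi).symm))
      subst hi
      rfl
    rw [e]
    exact h1

lemma Good.ext (hC : C.Pretriangulated) {A B K : C.Obj} (e : C.Ext A B K)
    (rA : D.IsRep fun a => S.F A (π.emb (π.map S.base) a))
    (rB : D.IsRep fun a => S.F B (π.emb (π.map S.base) a))
    (hA : D.Good π (S.F A)) (hB : D.Good π (S.F B)) : D.Good π (S.F K) := by
  obtain ⟨TA, uA, uA'⟩ := rA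
  obtain ⟨TB, uB, uB'⟩ := rB
  rw [good_iff] at hA hB ⊢
  intro T G hG Z
  exact Pairing.Good.ext hC e (L := D.slotBimod (S.fibre π)) uA' uB'
    (hA T G (fun i hi => G.isUniv i hi (hG i hi)) Z)
    (hB T G (fun i hi => G.isUniv i hi (hG i hi)) Z)

lemma Good.shift (hC : C.Pretriangulated) {d : ℤ} {V V' : C.Obj} (e : C.Shift d V V')
    (rV : D.IsRep fun a => S.F V (π.emb (π.map S.base) a))
    (hV : D.Good π (S.F V)) : D.Good π (S.F V') := by
  obtain ⟨T, u, hu⟩ := rV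
  rw [good_iff] at hV ⊢
  intro T G hG Z
  exact Pairing.Good.shift hC e (L := D.slotBimod (S.fibre π)) hu
    (hV T G (fun i hi => G.isUniv i hi (hG i hi)) Z)

end comp

end PT

/-! ### Extensions and shifts in `Pre-Tr(C)` -/

namespace MC

variable {A : PreDG.{u, v}}

/-- An extension of Maurer-Cartan elements is an extension in the DG category of Maurer-Cartan
elements. -/
def extendExt (X Y : MC A) (S : A.Biprod X.obj Y.obj) (x : (A.hom Y.obj X.obj).X 1) (hx)
    (hS : A.comp (add_zero 0) S.inl S.fst + A.comp (add_zero 0) S.inr S.snd = A.id S.sum) :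
    (MC.cat A).Ext X Y (MC.extend X Y S x hx) where
  x := x
  i := S.inl
  p := S.snd
  s := S.inr
  q := S.fst
  d_x := by
    refine Eq.trans ?_ hx
    refine (MC.del_apply _ _ _ _ _ _).trans ?_
    rw [Int.negOnePow_one, Units.neg_smul, one_smul, sub_neg_eq_add]
  d_i := MC.extend_inl _ _ _ _ _
  d_p := MC.extend_snd _ _ _ _ _
  d_s := by
    have : (A.hom Y.obj S.sum).d 0 1 rfl S.inr +
        A.comp (by rfl) (A.sand S.inl S.fst 1 X.e + A.sand S.inl S.snd 1 x +
          A.sand S.inr S.snd 1 Y.e) S.inr -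
        Int.negOnePow 0 • A.comp (c := 1) (by rfl) S.inr Y.e = A.comp (zero_add 1) S.inl x := by
      simp only [S.d_inr, map_add, AddMonoidHom.add_apply]
      rw [PreDG.sand_comp _ _ rfl, PreDG.sand_comp _ _ rfl, PreDG.sand_comp _ _ rfl, S.fst_inr,
        S.snd_inr, A.comp_id, A.comp_id]
      simp
    exact this
  d_q := by
    have : (A.hom S.sum X.obj).d 0 1 rfl S.fst + A.comp (by rfl) X.e S.fst -
        Int.negOnePow 0 • A.comp (by rfl) S.fst (A.sand S.inl S.fst 1 X.e + A.sand S.inl S.snd 1 x +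
          A.sand S.inr S.snd 1 Y.e) = - A.comp (add_zero 1) x S.snd := by
      simp only [S.d_fst, map_add]
      rw [PreDG.comp_sand _ _ rfl, PreDG.comp_sand _ _ rfl,
        PreDG.comp_sand _ _ rfl, S.fst_inr, S.fst_inl, A.id_comp, A.id_comp]
      simp
    exact this
  q_i := S.fst_inl
  p_s := S.snd_inr
  p_i := S.snd_inl
  q_s := S.fst_inr
  total := hS

end MC

namespace FinFam

lemma diag_add {C : PreDG.{u, v}} {E F : FinFam C} (m m' : ∀ i, (C.hom (E.E i) (F.E i)).X 0) :
    diag m + diag m' = diag (m + m') := by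
  funext i j
  rw [Pi.add_apply, Pi.add_apply]
  by_cases h : i = j
  · subst h
    rw [diag_self, diag_self, diag_self, ← map_add]
    rfl
  · rw [diag_ne _ h, diag_ne _ h, diag_ne _ h, add_zero]

lemma diag_total {C : DGCat.{u, v}} (E F : FinFam C.toPreDG) :
    diag (E := sum E F) (F := sum E F)
        (fun i => C.comp (add_zero 0) (C.inl (E.E i) (F.E i)) (C.fst (E.E i) (F.E i))) +
      diag (E := sum E F) (F := sum E F)
        (fun i => C.comp (add_zero 0) (C.inr (E.E i) (F.E i)) (C.snd (E.E i) (F.E i))) =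
      diag (E := sum E F) (F := sum E F) (fun i => C.id (C.sum (E.E i) (F.E i))) :=
  (diag_add _ _).trans (congrArg _ (funext fun _ => C.total _ _))

lemma biprod_total {C : DGCat.{u, v}} (E F : (cat C.toPreDG).Obj) :
    (cat C.toPreDG).comp (add_zero 0) (biprod E F).inl (biprod E F).fst +
      (cat C.toPreDG).comp (add_zero 0) (biprod E F).inr (biprod E F).snd =
      (cat C.toPreDG).id (biprod E F).sum :=
  (congrArg₂ (· + ·) (diag_diag (E := sum E F) (F := E) (G := sum E F) _ _)
    (diag_diag (E := sum E F) (F := F) (G := sum E F) _ _)).trans (diag_total E F)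

variable {C : PreDG.{u, v}}

/-- The family `φ_{i,n+j}`. -/
noncomputable def rbar (n : ℤ) {E F : (cat C).Obj} (a b : ℤ) (h : a + n = b) :
    ((cat C).hom E F).X a →+ ((cat C).hom (cshift n E) F).X b :=
  AddMonoidHom.mk' (fun (φ : Fam E F a) i j => (C.hom (FinFam.E E (n + j)) (FinFam.E F i)).cast
    (by omega) (φ i (n + j))) (fun φ ψ => by funext i j; exact map_add _ _ _)

/-- The family `φ_{n+i,j}`. -/
noncomputable def lbar (n : ℤ) {E F : (cat C).Obj} (a b : ℤ) (h : a - n = b) :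
    ((cat C).hom E F).X a →+ ((cat C).hom E (cshift n F)).X b :=
  AddMonoidHom.mk' (fun (φ : Fam E F a) i j => (C.hom (FinFam.E E j) (FinFam.E F (n + i))).cast
    (by omega) (φ (n + i) j)) (fun φ ψ => by funext i j; exact map_add _ _ _)

variable {E F G : (cat C).Obj} {a b c : ℤ} (n : ℤ)

lemma comp_rbar {b' c' : ℤ} (h : a + b = c) (hb : b + n = b') (hc : c + n = c')
    (ψ : ((cat C).hom F G).X a) (φ : ((cat C).hom E F).X b) :
    (cat C).comp (by omega) ψ (rbar n b b' hb φ) = rbar n c c' hc ((cat C).comp h ψ φ) := by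
  funext i j
  change ∑ k ∈ FinFam.rng F, C.comp _ ((ψ : Fam F G a) i k)
      ((C.hom _ _).cast _ ((φ : Fam E F b) k (n + j))) =
    (C.hom _ _).cast _ (∑ k ∈ FinFam.rng F, C.comp _ ((ψ : Fam F G a) i k)
      ((φ : Fam E F b) k (n + j)))
  simp only [PreDG.comp_cast_right, map_sum, PreDG.cast_comp]

lemma lbar_comp {a' c' : ℤ} (h : a + b = c) (ha : a - n = a') (hc : c - n = c')
    (ψ : ((cat C).hom F G).X a) (φ : ((cat C).hom E F).X b) :
    (cat C).comp (by omega) (lbar n a a' ha ψ) φ = lbar n c c' hc ((cat C).comp h ψ φ) := by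
  funext i j
  change ∑ k ∈ FinFam.rng F, C.comp _ ((C.hom _ _).cast _ ((ψ : Fam F G a) (n + i) k))
      ((φ : Fam E F b) k j) =
    (C.hom _ _).cast _ (∑ k ∈ FinFam.rng F, C.comp _ ((ψ : Fam F G a) (n + i) k)
      ((φ : Fam E F b) k j))
  simp only [PreDG.comp_cast_left, map_sum, PreDG.cast_comp]

lemma rbar_comp_lbar {a' b' : ℤ} (h : a + b = c) (ha : a + n = a') (hb : b - n = b')
    (ψ : ((cat C).hom F G).X a) (φ : ((cat C).hom E F).X b) :
    (cat C).comp (by omega) (rbar n a a' ha ψ) (lbar n b b' hb φ) = (cat C).comp h ψ φ := by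
  funext i j
  change ∑ k ∈ (FinFam.shift n F).rng, C.comp _
      ((C.hom _ _).cast _ ((ψ : Fam F G a) i (n + k)))
      ((C.hom _ _).cast _ ((φ : Fam E F b) (n + k) j)) =
    ∑ k ∈ FinFam.rng F, C.comp _ ((ψ : Fam F G a) i k) ((φ : Fam E F b) k j)
  simp only [PreDG.comp_cast_right, PreDG.comp_cast_left]
  exact sum_shift n F (fun k => C.comp (c := c + j - i) (by omega) ((ψ : Fam F G a) i k)
    ((φ : Fam E F b) k j))

lemma d_rbar {b' : ℤ} (h : a + 1 = b) (ha : a + n = c) (hc : c + 1 = b')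
    (φ : ((cat C).hom E F).X a) :
    ((cat C).hom _ _).d c b' hc (rbar n a c ha φ) =
      rbar n b b' (by omega) (((cat C).hom _ _).d a b h φ) := by
  funext i j
  change i.negOnePow • (C.hom _ _).d _ _ _ ((C.hom _ _).cast _ ((φ : Fam E F a) i (n + j))) =
    (C.hom _ _).cast _ (i.negOnePow • (C.hom _ _).d _ _ _ ((φ : Fam E F a) i (n + j)))
  rw [PreCx.d_cast, map_negOnePow, PreCx.cast_d]

lemma d_lbar {b' : ℤ} (h : a + 1 = b) (ha : a - n = c) (hc : c + 1 = b')
    (φ : ((cat C).hom E F).X a) :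
    ((cat C).hom _ _).d c b' hc (lbar n a c ha φ) =
      n.negOnePow • lbar n b b' (by omega) (((cat C).hom _ _).d a b h φ) := by
  funext i j
  change i.negOnePow • (C.hom _ _).d _ _ _ ((C.hom _ _).cast _ ((φ : Fam E F a) (n + i) j)) =
    n.negOnePow • (C.hom _ _).cast _ ((n + i).negOnePow •
      (C.hom _ _).d _ _ _ ((φ : Fam E F a) (n + i) j))
  rw [PreCx.d_cast, map_negOnePow, PreCx.cast_d, smul_smul, Int.negOnePow_add, ← mul_assoc,
    Int.units_mul_self, one_mul]

lemma lbar_rbar (h : a + n = b) (h' : b - n = a) (φ : ((cat C).hom E F).X a) :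
    lbar n b a h' (rbar n a b h φ) = cmap n a φ := by
  funext i j
  exact PreCx.cast_cast _ _ _ _

lemma rbar_comp_cmap {a' c' : ℤ} (h : a + b = c) (ha : a + n = a') (hc : c + n = c')
    (ψ : ((cat C).hom F G).X a) (φ : ((cat C).hom E F).X b) :
    (cat C).comp (by omega) (rbar n a a' ha ψ) (cmap n b φ) =
      rbar n c c' hc ((cat C).comp h ψ φ) := by
  rw [← lbar_rbar n (b := b + n) rfl (by omega), rbar_comp_lbar n (c := c') (by omega),
    comp_rbar n h]

lemma cmap_comp_lbar {b' c' : ℤ} (h : a + b = c) (hb : b - n = b') (hc : c - n = c')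
    (ψ : ((cat C).hom F G).X a) (φ : ((cat C).hom E F).X b) :
    (cat C).comp (by omega) (cmap n a ψ) (lbar n b b' hb φ) =
      lbar n c c' hc ((cat C).comp h ψ φ) := by
  rw [← lbar_rbar n (b := a + n) rfl (by omega), lbar_comp n (c := c) (by omega) _ hc,
    rbar_comp_lbar n h]

lemma del_rbar_id (X : (cat C).Obj) (e : ((cat C).hom X X).X 1) :
    ((cat C).hom _ _).d n (n + 1) rfl (rbar n 0 n (zero_add n) ((cat C).id X)) +
      (cat C).comp (by omega) e (rbar n 0 n (zero_add n) ((cat C).id X)) -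
      n.negOnePow • (cat C).comp rfl (rbar n 0 n (zero_add n) ((cat C).id X))
        (n.negOnePow • cmap n 1 e) = 0 := by
  rw [d_rbar n (b := 1) rfl, (cat C).d_id, map_zero, zero_add, map_negOnePow, smul_smul,
    Int.units_mul_self, one_smul, comp_rbar n (c := 1) (c' := n + 1) rfl _ (by omega),
    rbar_comp_cmap n (c := 1) (c' := n + 1) rfl _ (by omega), (cat C).id_comp, (cat C).comp_id,
    sub_self]

lemma del_lbar_id (X : (cat C).Obj) (e : ((cat C).hom X X).X 1) :
    ((cat C).hom _ _).d (-n) (-n + 1) rfl (lbar n 0 (-n) (zero_sub n) ((cat C).id X)) +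
      (cat C).comp (by omega) (n.negOnePow • cmap n 1 e) (lbar n 0 (-n) (zero_sub n) ((cat C).id X)) -
      (-n).negOnePow • (cat C).comp rfl (lbar n 0 (-n) (zero_sub n) ((cat C).id X)) e = 0 := by
  rw [d_lbar n (b := 1) rfl, (cat C).d_id, map_zero, smul_zero, zero_add, comp_negOnePow,
    Int.negOnePow_neg, ← smul_sub, cmap_comp_lbar n (c := 1) (c' := -n + 1) rfl _ (by omega),
    lbar_comp n (c := 1) (c' := -n + 1) rfl _ (by omega), (cat C).id_comp, (cat C).comp_id,
    sub_self, smul_zero]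

lemma lbar_id_comp_rbar_id (X : (cat C).Obj) :
    (cat C).comp (neg_add_cancel n) (lbar n 0 (-n) (zero_sub n) ((cat C).id X))
      (rbar n 0 n (zero_add n) ((cat C).id X)) = (cat C).id (cshift n X) := by
  rw [lbar_comp n (zero_add n) _ (sub_self n), (cat C).id_comp, lbar_rbar, cmap_id]

lemma rbar_id_comp_lbar_id (X : (cat C).Obj) :
    (cat C).comp (add_neg_cancel n) (rbar n 0 n (zero_add n) ((cat C).id X))
      (lbar n 0 (-n) (zero_sub n) ((cat C).id X)) = (cat C).id X := by
  rw [rbar_comp_lbar n (add_zero 0), (cat C).id_comp]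

end FinFam

namespace PreTr

/-- The translation `E[n]` as a shift of `E`. -/
noncomputable def shiftData {C : PreDG.{u, v}} (n : ℤ) (E : PreTr C) :
    (PreTr.cat C).Shift n E (E.shift n) where
  v := FinFam.rbar n 0 n (zero_add n) ((FinFam.cat C).id E.obj)
  w := FinFam.lbar n 0 (-n) (zero_sub n) ((FinFam.cat C).id E.obj)
  d_v := FinFam.del_rbar_id n E.obj E.e
  d_w := FinFam.del_lbar_id n E.obj E.e
  v_w := FinFam.rbar_id_comp_lbar_id n E.obj
  w_v := FinFam.lbar_id_comp_rbar_id n E.obj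

end PreTr

/-! ### The category `C^pretr` -/

section full

variable {C : PreDG.{u, v}} {p : C.Obj → Prop}

/-- Extensions in a full subcategory. -/
def PreDG.Ext.full {A B K : (C.full p).Obj} (e : C.Ext A.1 B.1 K.1) : (C.full p).Ext A B K :=
  ⟨e.x, e.i, e.p, e.s, e.q, e.d_x, e.d_i, e.d_p, e.d_s, e.d_q, e.q_i, e.p_s, e.p_i, e.q_s, e.total⟩

/-- Shifts in a full subcategory. -/
def PreDG.Shift.full {n : ℤ} {A B : (C.full p).Obj} (e : C.Shift n A.1 B.1) :
    (C.full p).Shift n A B :=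
  ⟨e.v, e.w, e.d_v, e.d_w, e.v_w, e.w_v⟩

/-- An extension with one of the ends replaced by an isomorphic object. -/
def PreDG.Ext.congr {A B B' K : C.Obj} (e : C.Ext A B' K) (f : (C.hom B B').X 0)
    (g : (C.hom B' B).X 0) (hf : (C.hom B B').d 0 1 rfl f = 0) (hg : (C.hom B' B).d 0 1 rfl g = 0)
    (hfg : C.comp (add_zero 0) f g = C.id B') (hgf : C.comp (add_zero 0) g f = C.id B) :
    C.Ext A B K where
  x := C.comp (add_zero 1) e.x f
  i := e.i
  p := C.comp (add_zero 0) g e.p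
  s := C.comp (add_zero 0) e.s f
  q := e.q
  d_x := by rw [C.leibniz _ (a' := 2) rfl (b' := 1) rfl, e.d_x, hf]; simp
  d_i := e.d_i
  d_p := by rw [C.leibniz _ (a' := 1) rfl (b' := 1) rfl, e.d_p, hg]; simp
  d_s := by
    rw [C.leibniz _ (a' := 1) rfl (b' := 1) rfl, e.d_s, hf, map_zero, smul_zero, add_zero,
      C.assoc (bc := 1) (abc := 1) _ _ (by omega) (by omega)]
  d_q := by
    rw [e.d_q, C.assoc (a := 1) (b := 0) (c := 0) (bc := 0) (abc := 1) _ _ (by omega) (by omega),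
      ← C.assoc (a := 0) (b := 0) (c := 0) (ab := 0) (abc := 0) (by omega) (by omega), hfg, C.id_comp]
  q_i := e.q_i
  p_s := by
    rw [C.assoc (bc := 0) (abc := 0) _ _ (add_zero 0) (by omega) g e.p,
      ← C.assoc (add_zero 0) (add_zero 0) (add_zero 0) (add_zero 0) e.p e.s f, e.p_s,
      C.id_comp, hgf]
  p_i := by rw [C.assoc (bc := 0) (abc := 0) _ _ (by omega) (by omega), e.p_i, map_zero]
  q_s := by
    rw [← C.assoc (ab := 0) (abc := 0) (by omega) (by omega), e.q_s, map_zero,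
      AddMonoidHom.zero_apply]
  total := by
    rw [C.assoc (bc := 0) (abc := 0) _ _ (add_zero 0) (by omega) e.s f,
      ← C.assoc (add_zero 0) (add_zero 0) (add_zero 0) (add_zero 0) f g e.p, hfg,
      C.id_comp, e.total]

end full

namespace DGCat

variable {C : DGCat.{u, v}}

/-- The translation of an object of `C^pretr`, as a shift. -/
noncomputable def pretrShiftData (n : ℤ) (E : C.pretr.Obj) :
    C.pretr.Shift n E ((C.pretrShift n).obj E) :=
  PreDG.Shift.full (PreTr.shiftData n E.1)

/-- The cone of a closed morphism of `C^pretr`, as an extension. -/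
noncomputable def pretrConeExt {E F : C.pretr.Obj} (ψ : (C.pretr.hom E F).X 0)
    (hψ : (C.pretr.hom E F).d 0 1 rfl ψ = 0) :
    C.pretr.Ext F ((C.pretrShift 1).obj E) (pretrCone ψ hψ) :=
  PreDG.Ext.full (MC.extendExt F.1 (PreTr.shift 1 E.1) (FinFam.biprod _ _) (FinFam.cbar 0 1 rfl ψ)
    (PreTr.cone_aux ψ E.1.e F.1.e hψ) (FinFam.biprod_total _ _))

lemma pretrConeExt_x {E F : C.pretr.Obj} (ψ : (C.pretr.hom E F).X 0)
    (hψ : (C.pretr.hom E F).d 0 1 rfl ψ = 0) :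
    (pretrConeExt ψ hψ).x = C.pretr.comp (zero_add 1) ψ (pretrShiftData 1 E).v := by
  refine ((FinFam.comp_rbar (E := MC.obj E.1) (F := MC.obj E.1) (G := MC.obj F.1) 1 (add_zero 0)
    (zero_add 1) (zero_add 1) ψ ((FinFam.cat C.toPreDG).id _)).trans ?_).symm
  exact congrArg (FinFam.rbar 1 0 1 (zero_add 1)) ((FinFam.cat C.toPreDG).comp_id _ _)

lemma pretriangulated (C : DGCat.{u, v}) : C.pretr.Pretriangulated where
  shift n T := ⟨_, ⟨pretrShiftData n T⟩⟩
  ext := by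
    intro A B y hy
    let s := pretrShiftData (-1) B
    let t := pretrShiftData 1 ((C.pretrShift (-1)).obj B)
    have hψ := C.pretr.d_comp_zero (show 1 + -1 = (0 : ℤ) from rfl) y s.v hy s.d_v
    let f := C.pretr.comp (show -1 + 1 = (0 : ℤ) from rfl) t.w s.w
    let g := C.pretr.comp (show -1 + 1 = (0 : ℤ) from rfl) s.v t.v
    have hf : (C.pretr.hom _ _).d 0 1 rfl f = 0 := C.pretr.d_comp_zero _ _ _ t.d_w s.d_w
    have hg : (C.pretr.hom _ _).d 0 1 rfl g = 0 := C.pretr.d_comp_zero _ _ _ s.d_v t.d_v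
    have hfg : C.pretr.comp (add_zero 0) f g = C.pretr.id _ := by
      refine (C.pretr.assoc _ _ (show (1 : ℤ) + 0 = 1 from rfl) (show (-1 : ℤ) + 1 = 0 from rfl)
        t.w s.w g).trans ?_
      refine (congrArg _ ((C.pretr.assoc (show (1 : ℤ) + -1 = 0 from rfl) (zero_add 1) _ _ s.w s.v
        t.v).symm.trans ?_)).trans t.w_v
      refine (congrArg (fun x => C.pretr.comp (zero_add 1) x t.v) s.w_v).trans ?_
      exact C.pretr.id_comp _ _
    have hgf : C.pretr.comp (add_zero 0) g f = C.pretr.id _ := by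
      refine (C.pretr.assoc _ _ (show (1 : ℤ) + 0 = 1 from rfl) (show (-1 : ℤ) + 1 = 0 from rfl)
        s.v t.v f).trans ?_
      refine (congrArg _ ((C.pretr.assoc (show (1 : ℤ) + -1 = 0 from rfl) (zero_add 1) _ _ t.v t.w
        s.w).symm.trans ?_)).trans s.v_w
      refine (congrArg (fun x => C.pretr.comp (zero_add 1) x s.w) t.v_w).trans ?_
      exact C.pretr.id_comp _ _
    refine ⟨_, (pretrConeExt _ hψ).congr f g hf hg hfg hgf, ?_⟩
    change C.pretr.comp _ (pretrConeExt _ hψ).x f = y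
    rw [pretrConeExt_x]
    refine (C.pretr.assoc (zero_add 1) (add_zero 1) (show (1 : ℤ) + 0 = 1 from rfl) (zero_add 1)
      _ t.v f).trans ?_
    have h1 : C.pretr.comp (show (1 : ℤ) + 0 = 1 from rfl) t.v f = s.w := by
      refine (C.pretr.assoc (show (1 : ℤ) + -1 = 0 from rfl) (zero_add 1) _ _ t.v t.w s.w).symm.trans ?_
      exact (congrArg (fun x => C.pretr.comp (zero_add 1) x s.w) t.v_w).trans (C.pretr.id_comp _ _)
    rw [h1]
    refine (C.pretr.assoc _ _ (show (-1 : ℤ) + 1 = 0 from rfl) (add_zero 1) y s.v s.w).trans ?_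
    exact (congrArg (C.pretr.comp (add_zero 1) y) s.v_w).trans (C.pretr.comp_id _ _)

end DGCat

/-! ### Cohomology of modules on the derived category -/

section

variable {C : PreDG.{u, v}}

/-- The functor `M ↦ Hᵐ(M(Y))` on `C`-modules. -/
def DGMod.Hn (C : PreDG.{u, v}) (Y : C.Obj) (m : ℤ) : DGMod C ⥤ AddCommGrpCat.{v} where
  obj M := AddCommGrpCat.of ((M.obj Y).H m)
  map φ := AddCommGrpCat.ofHom ((φ.app Y).H m)
  map_id M := by
    ext ⟨x⟩; rfl
  map_comp φ ψ := by
    ext ⟨x⟩; rfl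

/-- The functor `M ↦ Hᵐ(M(Y))` on the derived category. -/
noncomputable def DerCat.Hn (C : PreDG.{u, v}) (Y : C.Obj) (m : ℤ) :
    DerCat C ⥤ AddCommGrpCat.{v} :=
  Localization.Construction.lift (DGMod.Hn C Y m) (fun _ _ φ hφ => by
    rw [ConcreteCategory.isIso_iff_bijective]
    exact hφ Y m)

lemma DerCat.Hn_map_Q (Y : C.Obj) (m : ℤ) {M N : DGMod C} (φ : M ⟶ N) :
    (DerCat.Hn C Y m).map ((DGMod.quasiIso C).Q.map φ) = (DGMod.Hn C Y m).map φ := by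
  refine (Functor.congr_hom (Localization.Construction.fac (DGMod.Hn C Y m) (fun _ _ φ hφ => by
    rw [ConcreteCategory.isIso_iff_bijective]
    exact hφ Y m) (W := DGMod.quasiIso C)) φ).trans ?_
  exact (Category.id_comp _).trans (Category.comp_id _)

lemma DGMod.d_act_of_closed (M : DGMod C) {Y Z : C.Obj} {m : ℤ} {f : (C.hom Y Z).X m}
    (hf : (C.hom Y Z).d m (m + 1) rfl f = 0) {a b a' b' : ℤ} (h : m + a = b) (ha : a + 1 = a')
    (hb : b + 1 = b') (x : (M.obj Y).X a) : (M.obj Z).d b b' hb (M.act h f x) =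
      m.negOnePow • M.act (by omega) f ((M.obj Y).d a a' ha x) := by
  rw [M.leibniz h rfl ha, hf, M.act_zero_left, zero_add]

/-- The action of a closed morphism on cohomology. -/
def DGMod.actH (M : DGMod C) {Y Z : C.Obj} {m : ℤ} (f : (C.hom Y Z).X m)
    (hf : (C.hom Y Z).d m (m + 1) rfl f = 0) : (M.obj Y).H 0 →+ (M.obj Z).H m :=
  QuotientAddGroup.map _ _
    (((M.act (add_zero m) f).comp ((M.obj Y).Z 0).subtype).codRestrict ((M.obj Z).Z m) fun x => by
      change (M.obj Z).d m (m + 1) rfl (M.act _ f x.1) = 0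
      have hx : (M.obj Y).d 0 1 rfl x.1 = 0 := x.2
      rw [M.d_act_of_closed hf _ (a' := 1) rfl]
      exact (congrArg _ ((congrArg _ hx).trans (map_zero _))).trans (smul_zero _))
    (by
      rintro x ⟨y, hy⟩
      refine ⟨m.negOnePow • M.act (by omega) f y, ?_⟩
      have hy' : (M.obj Y).d (-1) 0 rfl y = x.1 := hy
      rw [map_negOnePow, M.d_act_of_closed hf (a := -1) (a' := 0) _ rfl, smul_smul,
        Int.units_mul_self, one_smul, hy']
      rfl)

/-- The action of a closed morphism as a natural transformation. -/
def DGMod.actNat {Y Z : C.Obj} {m : ℤ} (f : (C.hom Y Z).X m)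
    (hf : (C.hom Y Z).d m (m + 1) rfl f = 0) : DGMod.Hn C Y 0 ⟶ DGMod.Hn C Z m where
  app M := AddCommGrpCat.ofHom (M.actH f hf)
  naturality M N φ := by
    ext ⟨x⟩
    exact congrArg _ (Subtype.ext (φ.natural (add_zero m) f x.1).symm)

lemma DerCat.map_actH {M N : DGMod C}
    (φ : (DGMod.quasiIso C).Q.obj M ⟶ (DGMod.quasiIso C).Q.obj N) {Y Z : C.Obj} {m : ℤ}
    (f : (C.hom Y Z).X m) (hf : (C.hom Y Z).d m (m + 1) rfl f = 0) (x : (M.obj Y).H 0) :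
    (DerCat.Hn C Z m).map φ (M.actH f hf x) = N.actH f hf ((DerCat.Hn C Y 0).map φ x) := by
  let τ : (DGMod.quasiIso C).Q ⋙ DerCat.Hn C Y 0 ⟶ (DGMod.quasiIso C).Q ⋙ DerCat.Hn C Z m :=
    { app := fun M => (DGMod.actNat f hf).app M
      naturality := fun M N φ => (congrArg (· ≫ (DGMod.actNat f hf).app N)
        (DerCat.Hn_map_Q Y 0 φ)).trans (((DGMod.actNat f hf).naturality φ).trans
          (congrArg ((DGMod.actNat f hf).app M ≫ ·) (DerCat.Hn_map_Q Z m φ).symm)) }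
  have := (Localization.Construction.natTransExtension τ).naturality φ
  exact (ConcreteCategory.congr_hom this x).symm

end

namespace PT

variable {C : PreDG.{u, v}} {D : PT C}

namespace Rep

variable (R : D.Rep)

lemma isUniv_rep_univ (n : ℕ) (X : Fin (n + 1) → C.Obj) :
    D.IsUniv ((D.cx n X (R.T n X)).rep (R.univ n X)) := by
  refine ⟨(D.cx n X (R.T n X)).d_rep _ _, fun Z m => ?_⟩
  have h1 : Function.Bijective ((DerCat.Hn C Z m).map (R.lambda n X).inv) :=
    (ConcreteCategory.isIso_iff_bijective _).1 inferInstance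
  refine (congrArg Function.Bijective (funext fun c => ?_)).mpr h1
  obtain ⟨f, hf, rfl⟩ := Cx.exists_cls _ c
  have h2 := DerCat.map_actH (R.lambda n X).inv f hf
    (Cx.cls (C.hom (R.T n X) (R.T n X)) (C.id (R.T n X)) (C.d_id _))
  have h3 : (DGMod.corep (R.T n X)).actH f hf
      (Cx.cls (C.hom (R.T n X) (R.T n X)) (C.id (R.T n X)) (C.d_id _)) =
        (C.hom (R.T n X) Z).cls f hf :=
    congrArg _ (Subtype.ext (C.comp_id _ _))
  rw [h3] at h2
  refine Eq.trans ?_ h2.symm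
  have h4 : (DerCat.Hn C (R.T n X) 0).map (R.lambda n X).inv
      (Cx.cls (C.hom (R.T n X) (R.T n X)) (C.id (R.T n X)) (C.d_id _)) = R.univ n X := rfl
  rw [h4]
  conv_rhs => rw [← Cx.cls_rep _ (R.univ n X)]
  rfl

lemma lambdaH0_symm_cls (n : ℕ) (X : Fin (n + 1) → C.Obj) {Z : C.Obj}
    (f : (C.hom (R.T n X) Z).X 0) (hf : (C.hom (R.T n X) Z).d 0 1 rfl f = 0) :
    (R.lambdaH0 n X Z).symm ((C.hom (R.T n X) Z).cls f hf) =
      (D.mod n X).actH f hf (R.univ n X) := by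
  have h2 := DerCat.map_actH (R.lambda n X).inv f hf
    (Cx.cls (C.hom (R.T n X) (R.T n X)) (C.id (R.T n X)) (C.d_id _))
  have h3 : (DGMod.corep (R.T n X)).actH f hf
      (Cx.cls (C.hom (R.T n X) (R.T n X)) (C.id (R.T n X)) (C.d_id _)) =
        (C.hom (R.T n X) Z).cls f hf :=
    congrArg _ (Subtype.ext (C.comp_id _ _))
  rw [h3] at h2
  exact h2

lemma univ_zero (X : Fin 1 → C.Obj) :
    R.univ 0 X = D.oneH0 X (X 0) ((C.hom (X 0) (X 0)).cls (C.id (X 0)) (C.d_id _)) := by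
  have h : (DerCat.Hn C (R.T 0 X) 0).map (R.lambda 0 X).inv
      (Cx.cls (C.hom (R.T 0 X) (R.T 0 X)) (C.id (R.T 0 X)) (C.d_id _)) = R.univ 0 X := rfl
  have h' : (R.lambda 0 X).inv = (DGMod.quasiIso C).Q.map (D.oneHom X) := rfl
  rw [← h, h']
  exact ConcreteCategory.congr_hom (DerCat.Hn_map_Q (X 0) 0 (D.oneHom X))
    (Cx.cls (C.hom (X 0) (X 0)) (C.id (X 0)) (C.d_id _))

end Rep

/-- The map of modules `f ↦ f u`. -/
def actHom {n : ℕ} {X : Fin (n + 1) → C.Obj} {T : C.Obj} (u : (D.P n X T).X 0)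
    (hu : (D.P n X T).d 0 1 rfl u = 0) : DGMod.corep T ⟶ D.mod n X :=
  DGMod.Hom.mk (fun Z => D.actCx u hu Z)
    (fun h f x => D.comp_act h (add_zero _) (add_zero _) h f x u)

lemma exists_rep (h : ∀ n (X : Fin (n + 1) → C.Obj), D.IsRep X) : Nonempty D.Rep := by
  choose T u hu using h
  exact ⟨{
    obj := fun n X => T (n + 1) X
    iso := fun n X => (Localization.Construction.wIso (W := DGMod.quasiIso C)
      (actHom (u (n + 1) X) (hu (n + 1) X).1) (hu (n + 1) X).2).symm }⟩

/-! ### Dependence of compositions on cohomology classes -/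

variable (D)

lemma exists_d_eq_comp_update {m n : ℕ} {k : Fin (n + 1) → ℕ} (π : FinSurj m n k)
    {X : Fin (m + 1) → C.Obj} {X' : ∀ i, Fin (k i + 1) → C.Obj}
    (hX : ∀ i a, X' i a = X (π.emb i a)) {Y : Fin (n + 1) → C.Obj} {Z : C.Obj} {p r s : ℤ}
    (h : p + ∑ _i : Fin (n + 1), 0 = r) (hs : s + 1 = r)
    (f : (D.P n Y Z).X p) (hf : (D.P n Y Z).d p (p + 1) rfl f = 0)
    (g : ∀ i, (D.P (k i) (X' i) (Y i)).X 0) (hg : ∀ i, (D.P (k i) (X' i) (Y i)).d 0 1 rfl (g i) = 0)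
    (i : Fin (n + 1)) (y : (D.P (k i) (X' i) (Y i)).X 0) (z : (D.P (k i) (X' i) (Y i)).X (-1))
    (hz : (D.P (k i) (X' i) (Y i)).d (-1) 0 rfl z = y) :
    ∃ w, (D.P m X Z).d s r hs w = D.comp π hX h f (Function.update g i y) := by
  let q : Fin (n + 1) → ℤ := fun j => if j = i then -1 else 0
  let g' : ∀ j, (D.P (k j) (X' j) (Y j)).X (q j) := fun j =>
    if hj : j = i then (D.P (k j) (X' j) (Y j)).cast (by simp [q, hj])
      (Eq.rec (motive := fun j _ => (D.P (k j) (X' j) (Y j)).X (-1)) z hj.symm)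
    else (D.P (k j) (X' j) (Y j)).cast (by simp [q, hj]) (g j)
  have hq : ∑ j, q j = -1 := by simp [q]
  have hdg : ∀ j, j ≠ i → D.dAt g' j j = 0 := fun j hj => by
    rw [PTData.dAt_self]
    have e : g' j = (D.P (k j) (X' j) (Y j)).cast (by simp [q, hj]) (g j) := dif_neg hj
    rw [e, PreCx.d_cast]
    have := congrArg ((D.P (k j) (X' j) (Y j)).cast (show (1 : ℤ) = q j + if j = j then 1 else 0 by
      simp [q, hj])) (hg j)
    rw [PreCx.cast_d, map_zero] at this
    exact (PreCx.cast_d _ _ _ _).trans this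
  have hs' : p + ∑ j, q j = s := by rw [hq]; simp at h; omega
  have key := D.lawful.leibniz π hX (p := p) (r := s) (q := q) hs'
    (p' := p + 1) rfl hs f g'
  rw [hf, D.comp_zero_left, zero_add, Finset.sum_eq_single i (fun j _ hj => by
    rw [D.comp_zero_right _ _ _ _ _ j (hdg j hj), smul_zero]) (by simp)] at key
  refine ⟨(p + ∑ j with j < i, q j).negOnePow • D.comp π hX hs' f g', ?_⟩
  rw [map_negOnePow, key, smul_smul, Int.units_mul_self, one_smul]
  refine D.comp_congr _ _ _ _ _ _ _ (fun j => ⟨?_, ?_⟩)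
  · by_cases hj : j = i <;> simp [q, hj]
  · by_cases hj : j = i
    · subst hj
      have e : g' j = (D.P (k j) (X' j) (Y j)).cast (by simp [q]) z := dif_pos rfl
      rw [PTData.dAt_self, e, PreCx.d_cast, Function.update_self, ← hz, PreCx.cast_d]
      exact PreCx.cast_d _ _ _ _
    · have e : g' j = (D.P (k j) (X' j) (Y j)).cast (by simp [q, hj]) (g j) := dif_neg hj
      have e' : D.dAt g' i j = (D.P (k j) (X' j) (Y j)).cast (by simp [hj]) (g' j) := dif_neg hj
      rw [e', e, Function.update_of_ne hj, PreCx.cast_cast, PreCx.cast_cast]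
      rfl

lemma exists_d_eq_comp_sub {m n : ℕ} {k : Fin (n + 1) → ℕ} (π : FinSurj m n k)
    {X : Fin (m + 1) → C.Obj} {X' : ∀ i, Fin (k i + 1) → C.Obj}
    (hX : ∀ i a, X' i a = X (π.emb i a)) {Y : Fin (n + 1) → C.Obj} {Z : C.Obj} {p r s : ℤ}
    (h : p + ∑ _i : Fin (n + 1), 0 = r) (hs : s + 1 = r)
    (f : (D.P n Y Z).X p) (hf : (D.P n Y Z).d p (p + 1) rfl f = 0)
    (g g' : ∀ i, (D.P (k i) (X' i) (Y i)).X 0)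
    (hg : ∀ i, (D.P (k i) (X' i) (Y i)).d 0 1 rfl (g i) = 0)
    (hg' : ∀ i, (D.P (k i) (X' i) (Y i)).d 0 1 rfl (g' i) = 0)
    (hz : ∀ i, ∃ z, (D.P (k i) (X' i) (Y i)).d (-1) 0 rfl z = g i - g' i) :
    ∃ w, (D.P m X Z).d s r hs w = D.comp π hX h f g - D.comp π hX h f g' := by
  have : ∀ t : Finset (Fin (n + 1)), ∃ w, (D.P m X Z).d s r hs w =
      D.comp π hX h f g - D.comp π hX h f (t.piecewise g' g) := by
    intro t
    induction t using Finset.induction_on with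
    | empty => exact ⟨0, by rw [map_zero, Finset.piecewise_empty, sub_self]⟩
    | insert j t hj ih =>
      obtain ⟨w, hw⟩ := ih
      obtain ⟨z, hz⟩ := hz j
      obtain ⟨w', hw'⟩ := D.exists_d_eq_comp_update π hX h hs f hf (t.piecewise g' g)
        (fun i => by by_cases hi : i ∈ t <;> simp [hi, hg, hg']) j _ z hz
      refine ⟨w + w', ?_⟩
      rw [map_add, hw, hw', Finset.piecewise_insert]
      have e := D.lawful.comp_add_right π hX h f (t.piecewise g' g) j (g j - g' j) (g' j)
      rw [sub_add_cancel] at e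
      have e' : Function.update (t.piecewise g' g) j (g j) = t.piecewise g' g := by
        conv_rhs => rw [← Function.update_eq_self j (t.piecewise g' g)]
        rw [Finset.piecewise_eq_of_notMem _ _ _ hj]
      rw [e'] at e
      rw [e]
      abel
  obtain ⟨w, hw⟩ := this Finset.univ
  exact ⟨w, by rw [hw, Finset.piecewise_univ]⟩

lemma compH0_cls {m n : ℕ} {k : Fin (n + 1) → ℕ} (π : FinSurj m n k)
    {X : Fin (m + 1) → C.Obj} {X' : ∀ i, Fin (k i + 1) → C.Obj}
    (hX : ∀ i a, X' i a = X (π.emb i a)) {Y : Fin (n + 1) → C.Obj} {Z : C.Obj}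
    (f : (D.P n Y Z).X 0) (hf : (D.P n Y Z).d 0 1 rfl f = 0)
    (g : ∀ i, (D.P (k i) (X' i) (Y i)).X 0)
    (hg : ∀ i, (D.P (k i) (X' i) (Y i)).d 0 1 rfl (g i) = 0) :
    D.compH0 π hX ((D.cx n Y Z).cls f hf) (fun i => (D.cx (k i) (X' i) (Y i)).cls (g i) (hg i)) =
      (D.cx m X Z).cls (D.comp π hX (q := fun _ => 0) (by simp) f g)
        (D.d_comp_zero π hX _ _ _ hf hg) := by
  let f' : (D.P n Y Z).X 0 := (D.cx n Y Z).rep ((D.cx n Y Z).cls f hf)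
  let g' : ∀ i, (D.P (k i) (X' i) (Y i)).X 0 :=
    fun i => (D.cx (k i) (X' i) (Y i)).rep ((D.cx (k i) (X' i) (Y i)).cls (g i) (hg i))
  have hg' : ∀ i, (D.P (k i) (X' i) (Y i)).d 0 1 rfl (g' i) = 0 := fun i =>
    Cx.d_rep (D.cx (k i) (X' i) (Y i)) rfl _
  obtain ⟨w, hw⟩ := D.exists_d_eq_comp_sub π hX (r := 0) (s := -1) (by simp) rfl f hf g' g hg' hg
    (fun i => Cx.exists_of_cls_eq (D.cx (k i) (X' i) (Y i)) rfl (Cx.cls_rep _ _))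
  obtain ⟨z, hz⟩ : ∃ z, (D.P n Y Z).d (-1) 0 rfl z = f' - f :=
    Cx.exists_of_cls_eq (D.cx n Y Z) (m := -1) rfl (Cx.cls_rep _ ((D.cx n Y Z).cls f hf))
  have e := D.lawful.leibniz π hX (p := -1) (r := -1) (q := fun _ => 0) (by simp) (p' := 0)
    (r' := 0) rfl rfl z g'
  have e' := e.trans ((congrArg _ (Finset.sum_eq_zero fun i _ => ?_)).trans (add_zero _))
  · refine Cx.cls_eq _ _ _ _ _ (m := -1) rfl (D.comp π hX (by simp) z g' + w) ?_
    refine (map_add _ _ _).trans ?_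
    refine (congrArg₂ _ e' hw).trans ?_
    rw [hz, D.comp_sub_left]
    exact sub_add_sub_cancel _ _ _
  · refine (congrArg _ (D.comp_zero_right _ _ _ _ _ i ?_)).trans (smul_zero _)
    rw [PTData.dAt_self]
    have := congrArg ((D.P (k i) (X' i) (Y i)).cast
      (show (1 : ℤ) = 0 + if i = i then 1 else 0 by simp)) (hg' i)
    rw [map_zero] at this
    exact this

end PT

lemma CxHom.QI.of_comp {K L M : Cx.{v}} {g : CxHom L M} {f : CxHom K L} (h : (g.comp f).QI)
    (hf : f.QI) : g.QI := by
  intro n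
  have : ⇑((g.comp f).H n) = g.H n ∘ f.H n := by
    funext x
    obtain ⟨x, hx, rfl⟩ := K.exists_cls x
    rfl
  exact (Function.Bijective.of_comp_iff _ (hf n)).1 (this ▸ h n)

/-- A closed morphism of degree zero is a homotopy equivalence if and only if it is an isomorphism
in `H⁰ C`. -/
lemma PreDG.isHoEquiv_iff {C : PreDG.{u, v}} {X Y : C.Obj} (f : (C.hom X Y).X 0)
    (hf : (C.hom X Y).d 0 1 rfl f = 0) : C.IsHoEquiv f ↔ IsIso (Ho.ofClosed f hf) := by
  constructor
  · rintro ⟨-, g, hg, ⟨h, hh⟩, h', hh'⟩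
    exact ⟨Ho.ofClosed g hg, Cx.cls_eq _ _ _ _ _ (m := -1) rfl h hh,
      Cx.cls_eq _ _ _ _ _ (m := -1) rfl h' hh'⟩
  · rintro ⟨g, h₁, h₂⟩
    obtain ⟨g, hg, rfl⟩ := Cx.exists_cls _ g
    exact ⟨hf, g, hg, Cx.exists_of_cls_eq (C.hom X X) (m := -1) rfl h₁,
      Cx.exists_of_cls_eq (C.hom Y Y) (m := -1) rfl h₂⟩

namespace PT

variable {C : PreDG.{u, v}} {D : PT C}

section univ

variable {n : ℕ} {X : Fin (n + 1) → C.Obj} {T T' : C.Obj}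

lemma act_zero_right {Y Z : C.Obj} {a b c : ℤ} (h : a + b = c) (f : (C.hom Y Z).X a) :
    D.act h f (0 : (D.P n X Y).X b) = 0 :=
  map_zero (AddMonoidHom.mk' _ (D.act_add_right h f))

lemma act_sub_right {Y Z : C.Obj} {a b c : ℤ} (h : a + b = c) (f : (C.hom Y Z).X a)
    (x y : (D.P n X Y).X b) : D.act h f (x - y) = D.act h f x - D.act h f y :=
  map_sub (AddMonoidHom.mk' _ (D.act_add_right h f)) x y

lemma IsUniv.of_homologous {u u' : (D.P n X T).X 0} (hu : D.IsUniv u)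
    (hu' : (D.P n X T).d 0 1 rfl u' = 0) (z : (D.P n X T).X (-1))
    (hz : (D.P n X T).d (-1) 0 rfl z = u' - u) : D.IsUniv u' := by
  refine ⟨hu', fun Z => CxHom.qi_of_homotopic _ _ (fun a b h x hx => ?_) (hu.2 Z)⟩
  refine ⟨b.negOnePow • D.act (by omega) x z, ?_⟩
  change (D.P n X Z).d _ _ _ _ = D.act (add_zero b) x u' - D.act (add_zero b) x u
  rw [← D.act_sub_right, ← hz, map_negOnePow, D.d_act _ rfl (b' := 0) rfl h, hx]
  have : D.act (by omega) (0 : (C.hom T Z).X (b + 1)) z = (0 : (D.P n X Z).X b) := 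
    map_zero (AddMonoidHom.mk' (fun f : (C.hom T Z).X (b + 1) => D.act (c := b) (by omega) f z)
      (fun f f' => D.act_add_left _ f f' z))
  rw [this, zero_add, smul_smul, Int.units_mul_self, one_smul]

lemma IsUniv.act {u : (D.P n X T).X 0} (hu : D.IsUniv u) {φ : (C.hom T T').X 0}
    (hφ : C.IsHoEquiv φ) : D.IsUniv (D.act (add_zero 0) φ u) := by
  have h : (D.P n X T').d 0 1 rfl (D.act (add_zero 0) φ u) = 0 := by
    rw [D.d_act _ (a' := 1) rfl (b' := 1) rfl, hu.1, D.act_zero_right, hφ.1, smul_zero, add_zero]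
    exact map_zero (AddMonoidHom.mk' (fun f : (C.hom T T').X 1 => D.act (c := 1) (by omega) f u)
      (fun f f' => D.act_add_left _ f f' u))
  refine ⟨h, fun Z => ?_⟩
  have e : D.actCx _ h Z = (D.actCx u hu.1 Z).comp ((RMod.rep Z).actHom φ hφ.1) := by
    ext a x
    exact (D.comp_act (add_zero a) (add_zero a) (add_zero 0) (add_zero a) x φ u).symm
  rw [e]
  exact (hu.2 Z).comp ((RMod.rep Z).qi_actHom hφ)

lemma IsUniv.exists_hoEquiv {u : (D.P n X T).X 0} (hu : D.IsUniv u)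
    {u' : (D.P n X T').X 0} (hu' : D.IsUniv u') :
    ∃ (φ : (C.hom T T').X 0) (z : (D.P n X T').X (-1)), C.IsHoEquiv φ ∧
      (D.P n X T').d (-1) 0 rfl z = u' - D.act (add_zero 0) φ u := by
  obtain ⟨S, V, rfl⟩ : ∃ (S : Slot C n) (V : C.Obj), X = S.F V :=
    ⟨C.slot X 0, X 0, (C.slot_self X 0).symm⟩
  exact Bimod.IsUniv.exists_hoEquiv (L := D.slotBimod S) (V := V) hu hu'

end univ

section pull

variable {n : ℕ} {X X' : Fin (n + 1) → C.Obj}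

variable (D) in
/-- The map of complexes given by substitution of closed morphisms of degree zero. -/
def pullCx (f : ∀ b, (C.hom (X' b) (X b)).X 0)
    (hf : ∀ b, (C.hom (X' b) (X b)).d 0 1 rfl (f b) = 0) (Z : C.Obj) :
    CxHom (D.cx n X Z) (D.cx n X' Z) where
  f a := D.pull (by simp) f
  comm a b h x := (D.d_pull_of_closed (δ := fun _ => 0) (by simp) h h f hf x).symm

lemma qi_pullCx (f : ∀ b, (C.hom (X' b) (X b)).X 0) (hf : ∀ b, C.IsHoEquiv (f b)) (Z : C.Obj) :
    (D.pullCx f (fun b => (hf b).1) Z).QI := by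
  have hf' := fun b => (hf b).1
  choose g hg h₁ h₂ using fun b => (hf b).2
  have key : ∀ {X X' : Fin (n + 1) → C.Obj} (f : ∀ b, (C.hom (X' b) (X b)).X 0)
      (g : ∀ b, (C.hom (X b) (X' b)).X 0) (_ : ∀ b, (C.hom _ _).d 0 1 rfl (f b) = 0)
      (_ : ∀ b, (C.hom _ _).d 0 1 rfl (g b) = 0)
      (_ : ∀ b, ∃ z, (C.hom _ _).d (-1) 0 rfl z = C.comp (add_zero 0) (f b) (g b) - C.id (X b))
      (a : ℤ) (x : (D.P n X Z).X a), (D.P n X Z).d a (a + 1) rfl x = 0 →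
      ∃ y, (D.P n X Z).d (a - 1) a (by omega) y =
        D.pull (δ := fun _ => 0) (by simp) g (D.pull (δ := fun _ => 0) (r := a) (by simp) f x) - x := by
    intro X X' f g hf hg hz a x hx
    obtain ⟨w, hw⟩ := D.exists_d_eq_comp_sub (FinSurj.refl n) (X' := fun i _ => X i)
      (fun _ _ => rfl) (p := a) (r := a) (s := a - 1) (by simp) (by omega) x hx
      (fun b => D.one (X := fun _ => X b) (C.comp (add_zero 0) (f b) (g b)))
      (fun b => D.one (X := fun _ => X b) (C.id (X b)))
      (fun b => by rw [← D.lawful.one_d, C.leibniz _ (a' := 1) rfl (b' := 1) rfl, hf, hg]; simp)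
      (fun b => by rw [← D.lawful.one_d, C.d_id, map_zero])
      (fun b => by
        obtain ⟨z, hz⟩ := hz b
        exact ⟨D.one (X := fun _ => X b) z, by
          rw [← map_sub, ← hz]; exact (D.lawful.one_d _ _).symm⟩)
    refine ⟨w, hw.trans (congrArg₂ _ ?_ ?_)⟩
    · exact (D.pull_pull_of_zero (r := a) (δ := fun _ => 0) (δ' := fun _ => 0) (δ'' := fun _ => 0)
        (by simp) (by simp) f g (fun _ => rfl) (by simp) (fun _ _ _ => rfl) x).symm
    · exact D.pull_id (by simp) rfl x
  exact CxHom.qi_of_comp_homotopic _ (D.pullCx g hg Z)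
    (fun a x hx => key f g hf' hg h₂ a x hx)
    (fun a x hx => key g f hg hf' h₁ a x hx)

end pull

section comp

variable {m n : ℕ} {k : Fin (n + 1) → ℕ} {π : FinSurj m n k} {X : Fin (m + 1) → C.Obj}
  {T : Fin (n + 1) → C.Obj}

lemma actCx_comp (u : ∀ i, (D.P (k i) (fun a => X (π.emb i a)) (T i)).X 0)
    (hu : ∀ i, (D.P (k i) _ (T i)).d 0 1 rfl (u i) = 0) {V : C.Obj} (w : (D.P n T V).X 0)
    (hw : (D.P n T V).d 0 1 rfl w = 0)
    (h : (D.P m X V).d 0 1 rfl (D.comp π (X := X) (fun _ _ => rfl) (q := fun _ => 0)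
      (r := 0) (by simp) w u) = 0) (Z : C.Obj) :
    D.actCx _ h Z = (D.compCx π u hu Z).comp (D.actCx w hw Z) := by
  ext a x
  exact D.act_comp π (q := fun _ => 0) (by simp) (add_zero a) (add_zero a) (by simp) x w u

/-- Compositions of universal elements along a good surjection are universal. -/
lemma Good.isUniv_comp (h : D.Good π X)
    {u : ∀ i, (D.P (k i) (fun a => X (π.emb i a)) (T i)).X 0} (hu : ∀ i, D.IsUniv (u i))
    {V : C.Obj} {w : (D.P n T V).X 0} (hw : D.IsUniv w) :
    D.IsUniv (D.comp π (X := X) (fun _ _ => rfl) (q := fun _ => 0) (r := 0) (by simp) w u) := by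
  refine ⟨D.d_comp_zero π _ _ _ _ hw.1 fun i => (hu i).1, fun Z => ?_⟩
  rw [D.actCx_comp u (fun i => (hu i).1) w hw.1]
  exact (h T u hu Z).comp (hw.2 Z)

/-- A surjection is good if some composition of universal elements is universal. -/
lemma good_of_isUniv_comp {u : ∀ i, (D.P (k i) (fun a => X (π.emb i a)) (T i)).X 0}
    (hu : ∀ i, D.IsUniv (u i)) {V : C.Obj} {w : (D.P n T V).X 0} (hw : D.IsUniv w)
    (h : D.IsUniv (D.comp π (X := X) (fun _ _ => rfl) (q := fun _ => 0) (r := 0) (by simp) w u)) :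
    D.Good π X := by
  intro T' u' hu' Z
  have h1 : (D.compCx π u (fun i => (hu i).1) Z).QI := by
    refine CxHom.QI.of_comp (f := D.actCx w hw.1 Z) ?_ (hw.2 Z)
    rw [← D.actCx_comp u (fun i => (hu i).1) w hw.1 h.1]
    exact h.2 Z
  have h2 : ∀ i, ∃ (φ : (C.hom (T i) (T' i)).X 0) (z : _), C.IsHoEquiv φ ∧
      (D.P (k i) _ (T' i)).d (-1) 0 rfl z = u' i - D.act (add_zero 0) φ (u i) :=
    fun i => (hu i).exists_hoEquiv (hu' i)
  choose φ z hφ hz using h2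
  refine CxHom.qi_of_homotopic _ ((D.compCx π u (fun i => (hu i).1) Z).comp
    (D.pullCx φ (fun i => (hφ i).1) Z)) (fun a b h x hx => ?_) (h1.comp (qi_pullCx φ hφ Z))
  obtain ⟨w, hw⟩ := D.exists_d_eq_comp_sub π (fun _ _ => rfl) (X := X) (p := b) (r := b) (s := a)
    (by simp) h x hx u' (fun i => D.act (add_zero 0) (φ i) (u i)) (fun i => (hu' i).1)
    (fun i => ((hu i).act (hφ i)).1) (fun i => ⟨z i, hz i⟩)
  refine ⟨w, hw.trans (congrArg _ ?_)⟩
  refine (D.comp_pull π (δ := fun _ => 0) (q := fun _ => 0) (r := b) (by simp) (by simp) (fun _ => rfl)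
    (by simp) φ x u).trans ?_
  simp only [mul_zero, Finset.sum_const_zero, Int.negOnePow_zero, one_smul]
  rfl

end comp

end PT

namespace PT

variable {C : PreDG.{u, v}} (D : PT C)

/-! ### The pseudo-tensor structure on the homotopy category -/

/-- The composition of a morphism of `H⁰ C` with an element of `H⁰ P(X, Y)`. -/
noncomputable def smul {n : ℕ} {X : Fin (n + 1) → C.Obj} {Y Z : C.Obj}
    (f : (⟨Y⟩ : Ho C) ⟶ ⟨Z⟩) (x : (D.cx n X Y).H 0) : (D.cx n X Z).H 0 :=
  D.compH0 (FinSurj.toOne n) (X' := fun _ => X) (Y := fun _ => Y) (fun _ _ => rfl)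
    (D.oneH0 (fun _ => Y) Z f) (fun _ => x)

variable {D}

lemma d_act_zero {n : ℕ} {X : Fin (n + 1) → C.Obj} {Y Z : C.Obj} {f : (C.hom Y Z).X 0}
    {x : (D.P n X Y).X 0} (hf : (C.hom Y Z).d 0 1 rfl f = 0) (hx : (D.P n X Y).d 0 1 rfl x = 0) :
    (D.P n X Z).d 0 1 rfl (D.act (add_zero 0) f x) = 0 := by
  rw [D.d_act _ (a' := 1) rfl (b' := 1) rfl, hx, D.act_zero_right, hf, smul_zero, add_zero]
  exact map_zero (AddMonoidHom.mk' (fun f : (C.hom Y Z).X 1 => D.act (c := 1) (by omega) f x)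
    (fun f f' => D.act_add_left _ f f' x))

lemma smul_cls {n : ℕ} {X : Fin (n + 1) → C.Obj} {Y Z : C.Obj} (f : (C.hom Y Z).X 0)
    (x : (D.P n X Y).X 0) (hf : (C.hom Y Z).d 0 1 rfl f = 0)
    (hx : (D.P n X Y).d 0 1 rfl x = 0) :
    D.smul (Ho.ofClosed f hf) ((D.cx n X Y).cls x hx) =
      (D.cx n X Z).cls (D.act (add_zero 0) f x) (d_act_zero hf hx) :=
  D.compH0_cls (FinSurj.toOne n) (X' := fun _ => X) (Y := fun _ => Y) (fun _ _ => rfl) (D.one f)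
    (by rw [← D.lawful.one_d, hf, map_zero]) (fun _ => x) (fun _ => hx)

/-- A representing cocycle. -/
lemma exists_cls {n : ℕ} {X : Fin (n + 1) → C.Obj} {Y : C.Obj} (x : (D.cx n X Y).H 0) :
    ∃ (y : (D.P n X Y).X 0) (hy : (D.P n X Y).d 0 1 rfl y = 0), (D.cx n X Y).cls y hy = x :=
  Cx.exists_cls _ x

lemma _root_.DGTensor.Ho.exists_ofClosed {X Y : C.Obj} (f : (⟨X⟩ : Ho C) ⟶ ⟨Y⟩) :
    ∃ (g : (C.hom X Y).X 0) (hg : (C.hom X Y).d 0 1 rfl g = 0), Ho.ofClosed g hg = f :=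
  Cx.exists_cls _ f

lemma comp_smul {n : ℕ} {X : Fin (n + 1) → C.Obj} {Y Z W : C.Obj}
    (f : (⟨Y⟩ : Ho C) ⟶ ⟨Z⟩) (g : (⟨Z⟩ : Ho C) ⟶ ⟨W⟩) (x : (D.cx n X Y).H 0) :
    D.smul (f ≫ g) x = D.smul g (D.smul f x) := by
  obtain ⟨x, hx, rfl⟩ := exists_cls x
  obtain ⟨f, hf, rfl⟩ := Ho.exists_ofClosed f
  obtain ⟨g, hg, rfl⟩ := Ho.exists_ofClosed g
  rw [smul_cls, smul_cls]
  refine (smul_cls _ x (C.d_comp_zero _ _ _ hg hf) hx).trans (congrArg _ (Subtype.ext ?_))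
  exact D.comp_act (add_zero 0) (add_zero 0) (add_zero 0) (add_zero 0) g f x

lemma id_smul {n : ℕ} {X : Fin (n + 1) → C.Obj} {Y : C.Obj} (x : (D.cx n X Y).H 0) :
    D.smul (𝟙 (⟨Y⟩ : Ho C)) x = x := by
  obtain ⟨x, hx, rfl⟩ := exists_cls x
  exact (smul_cls _ x (C.d_id _) hx).trans (congrArg _ (Subtype.ext (D.lawful.id_comp x)))

section comp

variable {m n : ℕ} {k : Fin (n + 1) → ℕ} {π : FinSurj m n k} {X : Fin (m + 1) → C.Obj}
  {X' : ∀ i, Fin (k i + 1) → C.Obj} {hX : ∀ i a, X' i a = X (π.emb i a)} {Y : Fin (n + 1) → C.Obj}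
  {Z : C.Obj}

lemma exists_cls_family (g : ∀ i, (D.cx (k i) (X' i) (Y i)).H 0) :
    ∃ (y : ∀ i, (D.P (k i) (X' i) (Y i)).X 0) (hy : ∀ i, (D.P (k i) (X' i) (Y i)).d 0 1 rfl (y i) = 0),
      (fun i => (D.cx (k i) (X' i) (Y i)).cls (y i) (hy i)) = g := by
  choose y hy h using fun i => exists_cls (g i)
  exact ⟨y, hy, funext h⟩

lemma smul_compH0 {W : C.Obj} (f : (⟨Z⟩ : Ho C) ⟶ ⟨W⟩) (x : (D.cx n Y Z).H 0)
    (g : ∀ i, (D.cx (k i) (X' i) (Y i)).H 0) :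
    D.smul f (D.compH0 π hX x g) = D.compH0 π hX (D.smul f x) g := by
  obtain rfl : X' = fun i a => X (π.emb i a) := funext₂ hX
  obtain ⟨x, hx, rfl⟩ := exists_cls x
  obtain ⟨f, hf, rfl⟩ := Ho.exists_ofClosed f
  obtain ⟨g, hg, rfl⟩ := exists_cls_family g
  rw [compH0_cls D π _ x hx, smul_cls, smul_cls, compH0_cls]
  refine congrArg _ (Subtype.ext ?_)
  exact D.act_comp π (q := fun _ => 0) (by simp) (add_zero 0) (add_zero 0) (by simp) f x g

lemma closed_update {y : ∀ i, (D.P (k i) (X' i) (Y i)).X 0}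
    (hy : ∀ i, (D.P (k i) (X' i) (Y i)).d 0 1 rfl (y i) = 0) (i : Fin (n + 1))
    {z : (D.P (k i) (X' i) (Y i)).X 0} (hz : (D.P (k i) (X' i) (Y i)).d 0 1 rfl z = 0)
    (j : Fin (n + 1)) :
    (D.P (k j) (X' j) (Y j)).d 0 1 rfl (Function.update y i z j) = 0 := by
  by_cases hj : j = i
  · subst hj; simpa using hz
  · simp [hj, hy]

lemma compH0_add_of (x : (D.cx n Y Z).H 0) {g g' g'' : ∀ i, (D.cx (k i) (X' i) (Y i)).H 0}
    (i : Fin (n + 1)) (hi : g'' i = g i + g' i) (h₁ : ∀ j, j ≠ i → g j = g'' j)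
    (h₂ : ∀ j, j ≠ i → g' j = g'' j) :
    D.compH0 π hX x g'' = D.compH0 π hX x g + D.compH0 π hX x g' := by
  obtain ⟨x, hx, rfl⟩ := exists_cls x
  obtain ⟨y, hy, rfl⟩ := exists_cls_family g
  obtain ⟨z, hz, hz'⟩ := exists_cls (g' i)
  have e' : g' = fun j => (D.cx (k j) (X' j) (Y j)).cls (Function.update y i z j) (closed_update hy i hz j) := by
    funext j
    by_cases hj : j = i
    · subst hj
      simp [hz']
    · rw [h₂ j hj, ← h₁ j hj]
      simp [hj]
  have e'' : g'' = fun j => (D.cx (k j) (X' j) (Y j)).cls (Function.update y i (y i + z) j)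
      (closed_update hy i (by rw [map_add, hy, hz, add_zero]) j) := by
    funext j
    by_cases hj : j = i
    · subst hj
      rw [hi, ← hz']
      exact congrArg _ (Subtype.ext (Function.update_self j (y j + z) y).symm)
    · rw [← h₁ j hj]
      simp [hj]
  rw [e', e'', compH0_cls D π _ x hx, compH0_cls D π _ x hx, compH0_cls D π _ x hx]
  refine congrArg _ (Subtype.ext ?_)
  exact D.comp_add_of _ x i (by simp) (fun j hj => by simp [hj]) (fun j hj => by simp [hj])

end comp

lemma compH0_assoc {l m n : ℕ} {k : Fin (n + 1) → ℕ} {k' : Fin (m + 1) → ℕ} {s : Fin (n + 1) → ℕ}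
    (π : FinSurj m n k) (ρ : FinSurj l m k') (σ : FinSurj l n s)
    (τ : ∀ i, FinSurj (s i) (k i) (fun a => k' (π.emb i a)))
    (hτ : ∀ i a b, σ.emb i ((τ i).emb a b) = ρ.emb (π.emb i a) b)
    {W : Fin (l + 1) → C.Obj} {X : Fin (m + 1) → C.Obj} {Y : Fin (n + 1) → C.Obj} {Z : C.Obj}
    (f : (D.cx n Y Z).H 0) (g : ∀ i, (D.cx (k i) (fun a => X (π.emb i a)) (Y i)).H 0)
    (h : ∀ j, (D.cx (k' j) (fun b => W (ρ.emb j b)) (X j)).H 0) :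
    D.compH0 ρ (fun _ _ => rfl) (D.compH0 π (fun _ _ => rfl) f g) h =
      D.compH0 σ (X := W) (X' := fun i c => W (σ.emb i c)) (fun _ _ => rfl) f
        (fun i => D.compH0 (τ i) (fun a b => by rw [hτ]) (g i) (fun a => h (π.emb i a))) := by
  obtain ⟨f, hf, rfl⟩ := exists_cls f
  obtain ⟨g, hg, rfl⟩ := exists_cls_family g
  obtain ⟨h, hh, rfl⟩ := exists_cls_family h
  have e : ∀ i, D.compH0 (τ i) (X := fun c => W (σ.emb i c)) (fun a b => by rw [hτ])
      ((D.cx (k i) (fun a => X (π.emb i a)) (Y i)).cls (g i) (hg i))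
      (fun a => (D.cx (k' (π.emb i a)) (fun b => W (ρ.emb (π.emb i a) b)) (X (π.emb i a))).cls
        (h (π.emb i a)) (hh (π.emb i a))) = _ :=
    fun i => D.compH0_cls (τ i) _ (g i) (hg i) (fun a => h (π.emb i a)) (fun a => hh (π.emb i a))
  rw [compH0_cls D π _ f hf, compH0_cls]
  refine Eq.trans ?_ (congrArg _ (funext e)).symm
  rw [compH0_cls]
  refine congrArg _ (Subtype.ext ?_)
  have key := D.lawful.assoc π ρ σ τ hτ (q := fun _ => 0) (t := fun _ => 0) (u := fun _ => 0)
    (p := 0) (r := 0) (N := 0) (by simp) (by simp) (by simp) (by simp) f g h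
  rw [koszul_of_right_eq_zero _ _ (fun _ => rfl), Int.negOnePow_zero, one_smul] at key
  exact key.symm

namespace Rep

variable (R : D.Rep)

lemma lambdaH0_symm (n : ℕ) (X : Fin (n + 1) → C.Obj) {Z : C.Obj} (f : (⟨R.T n X⟩ : Ho C) ⟶ ⟨Z⟩) :
    (R.lambdaH0 n X Z).symm f = D.smul f (R.univ n X) := by
  obtain ⟨f, hf, rfl⟩ := Ho.exists_ofClosed f
  refine (R.lambdaH0_symm_cls n X f hf).trans ?_
  obtain ⟨u, hu, e⟩ := exists_cls (R.univ n X)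
  rw [← e, smul_cls]
  rfl

lemma smul_lambdaH0 (n : ℕ) (X : Fin (n + 1) → C.Obj) {Z : C.Obj} (x : (D.cx n X Z).H 0) :
    D.smul (R.lambdaH0 n X Z x) (R.univ n X) = x := by
  rw [← lambdaH0_symm, AddEquiv.symm_apply_apply]

lemma hom_ext {n : ℕ} {X : Fin (n + 1) → C.Obj} {Z : C.Obj} {f g : (⟨R.T n X⟩ : Ho C) ⟶ ⟨Z⟩}
    (h : D.smul f (R.univ n X) = D.smul g (R.univ n X)) : f = g := by
  rw [← lambdaH0_symm, ← lambdaH0_symm] at h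
  exact (R.lambdaH0 n X Z).symm.injective h

section lift

variable {m n : ℕ} {k : Fin (n + 1) → ℕ} (π : FinSurj m n k) {X : Fin (m + 1) → C.Obj}
  {X' : ∀ i, Fin (k i + 1) → C.Obj} (hX : ∀ i a, X' i a = X (π.emb i a)) {Y : Fin (n + 1) → C.Obj}

lemma smul_lift (g : ∀ i, (D.cx (k i) (X' i) (Y i)).H 0) :
    D.smul (R.lift π hX g) (R.univ m X) = D.compH0 π hX (R.univ n Y) g :=
  R.smul_lambdaH0 _ _ _

lemma lift_add_of {g g' g'' : ∀ i, (D.cx (k i) (X' i) (Y i)).H 0}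
    (i : Fin (n + 1)) (hi : g'' i = g i + g' i) (h₁ : ∀ j, j ≠ i → g j = g'' j)
    (h₂ : ∀ j, j ≠ i → g' j = g'' j) :
    R.lift π hX g'' = R.lift π hX g + R.lift π hX g' := by
  unfold lift
  rw [compH0_add_of _ i hi h₁ h₂, map_add]

end lift

lemma good_of_isIso_eps {m n : ℕ} {k : Fin (n + 1) → ℕ} (π : FinSurj m n k)
    (X : Fin (m + 1) → C.Obj) (h : IsIso (R.eps π X)) : D.Good π X := by
  let T : Fin (n + 1) → C.Obj := fun i => R.T (k i) fun a => X (π.emb i a)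
  let u : ∀ i, (D.P (k i) (fun a => X (π.emb i a)) (T i)).X 0 :=
    fun i => (D.cx _ _ _).rep (R.univ (k i) fun a => X (π.emb i a))
  have hu : ∀ i, D.IsUniv (u i) := fun i => R.isUniv_rep_univ _ _
  let w : (D.P n T (R.T n T)).X 0 := (D.cx _ _ _).rep (R.univ n T)
  have hw : D.IsUniv w := R.isUniv_rep_univ _ _
  let U : (D.P m X (R.T m X)).X 0 := (D.cx _ _ _).rep (R.univ m X)
  have hU : D.IsUniv U := R.isUniv_rep_univ _ _
  have e := R.smul_lift π (fun _ _ => rfl) (X := X) (fun i => R.univ (k i) fun a => X (π.emb i a))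
  obtain ⟨φ, hφ, hφ'⟩ := Ho.exists_ofClosed (R.eps π X)
  rw [← hφ', ← PreDG.isHoEquiv_iff] at h
  have e' : (D.cx m X (R.T n T)).cls (D.act (add_zero 0) φ U) (d_act_zero hφ hU.1) =
      D.compH0 π (fun _ _ => rfl) (R.univ n T) (fun i => R.univ (k i) fun a => X (π.emb i a)) := by
    rw [← e, ← smul_cls φ U hφ hU.1, hφ']
    exact congrArg _ (Cx.cls_rep _ _)
  obtain ⟨z, hz⟩ := Cx.exists_of_cls_eq (D.cx m X (R.T n T)) (m := -1)
    (x := D.comp π (X := X) (fun _ _ => rfl) (q := fun _ => 0) (r := 0) (by simp) w u)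
    (y := D.act (add_zero 0) φ U) (hy := d_act_zero hφ hU.1)
    (hx := D.d_comp_zero π _ _ _ _ hw.1 fun i => (hu i).1) rfl e'.symm
  exact good_of_isUniv_comp hu hw ((hU.act h).of_homologous
    (D.d_comp_zero π _ _ _ _ hw.1 fun i => (hu i).1) z hz)

lemma isIso_eps_of_good {m n : ℕ} {k : Fin (n + 1) → ℕ} (π : FinSurj m n k)
    (X : Fin (m + 1) → C.Obj) (h : D.Good π X) : IsIso (R.eps π X) := by
  let T : Fin (n + 1) → C.Obj := fun i => R.T (k i) fun a => X (π.emb i a)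
  let u : ∀ i, (D.P (k i) (fun a => X (π.emb i a)) (T i)).X 0 :=
    fun i => (D.cx _ _ _).rep (R.univ (k i) fun a => X (π.emb i a))
  have hu : ∀ i, D.IsUniv (u i) := fun i => R.isUniv_rep_univ _ _
  let w : (D.P n T (R.T n T)).X 0 := (D.cx _ _ _).rep (R.univ n T)
  have hw : D.IsUniv w := R.isUniv_rep_univ _ _
  let U : (D.P m X (R.T m X)).X 0 := (D.cx _ _ _).rep (R.univ m X)
  have hU : D.IsUniv U := R.isUniv_rep_univ _ _
  have e := R.smul_lift π (fun _ _ => rfl) (X := X) (fun i => R.univ (k i) fun a => X (π.emb i a))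
  obtain ⟨φ, z, hφ, hz⟩ := hU.exists_hoEquiv (h.isUniv_comp hu hw)
  have e' : R.eps π X = Ho.ofClosed φ hφ.1 := by
    refine R.hom_ext (e.trans ?_)
    have : R.univ m X = (D.cx m X (R.T m X)).cls U hU.1 := (Cx.cls_rep _ _).symm
    rw [this, smul_cls]
    exact Cx.cls_eq _ _ _ _ _ (m := -1) rfl z hz
  rw [e', ← PreDG.isHoEquiv_iff]
  exact hφ

end Rep

end PT

lemma CxHom.qi_of_conj {K L K' L' : Cx.{v}} (f : CxHom K L) (f' : CxHom K' L') (α : CxHom K' K)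
    (β : CxHom L' L) (hα : ∀ n, Function.Bijective (α.f n)) (hβ : ∀ n, Function.Bijective (β.f n))
    (h : ∀ n x, β.f n (f'.f n x) = f.f n (α.f n x)) (hf : f.QI) : f'.QI := by
  have h1 : (β.comp f').QI := by
    have : β.comp f' = f.comp α := by ext n x; exact h n x
    rw [this]
    exact hf.comp (α.qi_of_bijective hα)
  intro n
  have : ⇑((β.comp f').H n) = β.H n ∘ f'.H n := by
    funext x
    obtain ⟨x, hx, rfl⟩ := K'.exists_cls x
    rfl
  exact (Function.Bijective.of_comp_iff' ((β.qi_of_bijective hβ) n) _).1 (this ▸ h1 n)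

lemma PreCx.cast_injective (K : PreCx.{v}) {a b : ℤ} (h : a = b) : Function.Injective (K.cast h) := by
  subst h
  exact fun _ _ h => h

lemma MC.del_of_zero {A : PreDG.{u, v}} (E F : MC A) (hE : E.e = 0) (hF : F.e = 0) {a b : ℤ}
    (h : a + 1 = b) (φ : (A.hom E.obj F.obj).X a) :
    MC.del E F a b h φ = (A.hom E.obj F.obj).d a b h φ := by
  rw [MC.del_apply, hE, hF, map_zero, map_zero, AddMonoidHom.zero_apply, add_zero, smul_zero,
    sub_zero]

lemma PT.act_zero_left {C : PreDG.{u, v}} {D : PT C} {n : ℕ} {X : Fin (n + 1) → C.Obj} {Y Z : C.Obj}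
    {a b c : ℤ} (h : a + b = c) (x : (D.P n X Y).X b) : D.act h (0 : (C.hom Y Z).X a) x = 0 :=
  map_zero (AddMonoidHom.mk' (fun f => D.act h f x) (fun f f' => D.act_add_left h f f' x))

lemma PT.rho_of_zero {A : PreDG.{u, v}} {D : PT A} {n : ℕ} (E : Fin (n + 1) → MC A) {Z : A.Obj}
    (hE : ∀ i, (E i).e = 0) {a b : ℤ} (h : a + 1 = b)
    (φ : (D.P n (fun i => (E i).obj) Z).X a) : D.rho E h φ = 0 := by
  rw [PT.rho_apply]
  refine Finset.sum_eq_zero fun i _ => D.pull_eq_zero _ _ i ?_ φ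
  rw [PreDG.iteEnd_true rfl, hE, map_zero]

lemma PT.tDel_of_zero {C : PreDG.{u, v}} (P : PT C) {n : ℕ} (E : Fin (n + 1) → PreTr C) (F : PreTr C)
    (hE : ∀ i, (E i).e = 0) (hF : F.e = 0) {a b : ℤ} (h : a + 1 = b) (φ : P.TFam E F a) :
    P.tDel E F a b h φ = (P.finFam.P n (fun i => (E i).obj) F.obj).d a b h φ := by
  refine (P.tDel_apply E F a b h φ).trans ?_
  have h₁ : P.finFam.act (show 1 + a = b by omega) F.e φ = 0 := by
    rw [hF]
    exact PT.act_zero_left (D := P.finFam) (X := fun i => (E i).obj) _ φ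
  have key : ∀ {A : Type v} [AddCommGroup A] (x : A) {y z : A} (e : ℤˣ), y = 0 → z = 0 →
      x + y - e • z = x := by
    rintro A _ x _ _ e rfl rfl
    rw [smul_zero, sub_zero, add_zero]
  exact key _ _ h₁ (PT.rho_of_zero (A := FinFam.cat C) (D := P.finFam) E hE h φ)

lemma PTData.cast_act {C : PreDG.{u, v}} (D : PTData C) {n : ℕ} {X : Fin (n + 1) → C.Obj}
    {Y Z : C.Obj} {a b c a' b' c' : ℤ} (ha : a = a') (hb : b = b') (hc : c = c') (h : a + b = c)
    (h' : a' + b' = c') (f : (C.hom Y Z).X a) (x : (D.P n X Y).X b) :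
    (D.P n X Z).cast hc (D.act h f x) = D.act h' ((C.hom Y Z).cast ha f) ((D.P n X Y).cast hb x) := by
  subst ha hb hc
  rfl

lemma PTData.cast_comp {C : PreDG.{u, v}} (D : PTData C) {m n : ℕ} {k : Fin (n + 1) → ℕ}
    (π : FinSurj m n k) {X : Fin (m + 1) → C.Obj} {X' : ∀ i, Fin (k i + 1) → C.Obj}
    (hX : ∀ i a, X' i a = X (π.emb i a)) {Y : Fin (n + 1) → C.Obj} {Z : C.Obj} {p r p' r' : ℤ}
    {q q' : Fin (n + 1) → ℤ} (hp : p = p') (hq : ∀ i, q i = q' i) (hr : r = r')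
    (h : p + ∑ i, q i = r) (h' : p' + ∑ i, q' i = r') (f : (D.P n Y Z).X p)
    (g : ∀ i, (D.P (k i) (X' i) (Y i)).X (q i)) :
    (D.P m X Z).cast hr (D.comp π hX h f g) =
      D.comp π hX h' ((D.P n Y Z).cast hp f) (fun i => (D.P _ _ _).cast (hq i) (g i)) := by
  obtain rfl : q = q' := funext hq
  subst hp hr
  rfl

namespace DGCat

variable {C : DGCat.{u, v}}

/-- An object of `C` as an object of `C^pretr`. -/
noncomputable def inclObj (X : C.Obj) : C.pretr.Obj := ⟨PreTr.incl X, .incl X⟩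

lemma pretr_induction {Q : C.pretr.Obj → Prop} (h₀ : ∀ X, Q (inclObj X))
    (hext : ∀ {A B K} (_ : C.pretr.Ext A B K), Q A → Q B → Q K)
    (hshift : ∀ {n V V'} (_ : C.pretr.Shift n V V'), Q V → Q V') (E : C.pretr.Obj) : Q E := by
  obtain ⟨E, hE⟩ := E
  induction hE with
  | incl X => exact h₀ X
  | shift n hE ih => exact hshift (pretrShiftData n ⟨_, hE⟩) ih
  | cone ψ hψ hE hF ihE ihF =>
    exact hext (pretrConeExt (E := ⟨_, hE⟩) (F := ⟨_, hF⟩) ψ hψ) ihF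
      (hshift (pretrShiftData 1 ⟨_, hE⟩) ihE)

lemma pretr_family_induction {n : ℕ} {Q : (Fin (n + 1) → C.pretr.Obj) → Prop}
    (h₀ : ∀ X : Fin (n + 1) → C.Obj, Q (fun i => inclObj (X i)))
    (hext : ∀ (S : Slot C.pretr n) {A B K} (_ : C.pretr.Ext A B K), Q (S.F A) → Q (S.F B) →
      Q (S.F K))
    (hshift : ∀ (S : Slot C.pretr n) {d V V'} (_ : C.pretr.Shift d V V'), Q (S.F V) → Q (S.F V'))
    (X : Fin (n + 1) → C.pretr.Obj) : Q X := by
  have key : ∀ (s : Finset (Fin (n + 1))) (X : Fin (n + 1) → C.pretr.Obj),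
      (∀ b, b ∉ s → ∃ Y, X b = inclObj Y) → Q X := by
    intro s
    induction s using Finset.induction_on with
    | empty =>
      intro X hX
      choose Y hY using fun b => hX b (Finset.notMem_empty b)
      obtain rfl : X = fun b => inclObj (Y b) := funext hY
      exact h₀ Y
    | insert b s hb ih =>
      intro X hX
      rw [← C.pretr.slot_self X b]
      refine pretr_induction (Q := fun V => Q ((C.pretr.slot X b).F V)) (fun V => ih _ fun c hc => ?_)
        (fun e hA hB => hext _ e hA hB) (fun e hV => hshift _ e hV) (X b)
      by_cases h : c = b
      · exact ⟨V, if_pos h⟩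
      · obtain ⟨Y, hY⟩ := hX c (by simp [h, hc])
        exact ⟨Y, (if_neg h).trans hY⟩
  exact key Finset.univ X fun b hb => absurd (Finset.mem_univ b) hb

/-! ### Morphisms between objects of `C` -/

variable (P : PT C.toPreDG)

lemma id_incl {X : C.Obj} {i : ℤ} (h : i ≠ 0) : C.id (PreTr.ob (PreTr.incl X) i) = 0 :=
  (PreTr.incl X).obj.id_eq_zero i (by
    change i < 0 ∨ 0 < i
    omega)

/-- The entry of a morphism between objects of `C`. -/
noncomputable def evHom (X Y : C.Obj) (a : ℤ) :
    (C.pretr.hom (inclObj X) (inclObj Y)).X a →+ (C.hom X Y).X a :=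
  AddMonoidHom.mk' (fun (φ : FinFam.Fam (PreTr.incl X).obj (PreTr.incl Y).obj a) =>
    (C.hom X Y).cast (by omega) (φ 0 0)) (fun φ ψ => map_add ((C.hom X Y).cast _) (φ 0 0) (ψ 0 0))

section

variable {n : ℕ} (X : Fin (n + 1) → C.Obj) (Y : C.Obj)

/-- The entry of an element of `P^pretr` for objects of `C`. -/
noncomputable def evP (a : ℤ) :
    ((C.pretrPT P).P n (fun i => inclObj (X i)) (inclObj Y)).X a →+ (P.P n X Y).X a :=
  AddMonoidHom.mk' (fun (φ : P.TFam (fun i => PreTr.incl (X i)) (PreTr.incl Y) a) =>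
    (P.P n X Y).cast (by simp) (φ 0 (fun _ => 0)))
    (fun φ ψ => map_add ((P.P n X Y).cast _) (φ 0 fun _ => 0) (ψ 0 fun _ => 0))

variable {X Y}

lemma evHom_bijective {X : C.Obj} (a : ℤ) : Function.Bijective (evHom X Y a) := by
  constructor
  · intro φ ψ h
    funext i j
    by_cases hi : i = 0
    · by_cases hj : j = 0
      · subst hi hj
        exact PreCx.cast_injective (C.hom X Y).toPreCx (a := a + 0 - 0) (b := a) (by omega) h
      · exact (PreDG.eq_zero_of_source (id_incl hj) _).trans
          (PreDG.eq_zero_of_source (id_incl hj) _).symm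
    · exact (PreDG.eq_zero_of_target (id_incl hi) _).trans
        (PreDG.eq_zero_of_target (id_incl hi) _).symm
  · intro x
    let φ : FinFam.Fam (PreTr.incl X).obj (PreTr.incl Y).obj a := Function.update 0 0
      (Function.update 0 0 ((C.hom X Y).cast (show a = a + 0 - 0 by omega) x))
    refine ⟨φ, ?_⟩
    have : φ 0 0 = (C.hom X Y).cast (show a = a + 0 - 0 by omega) x :=
      (congrFun (Function.update_self _ _ _) _).trans (Function.update_self _ _ _)
    exact (congrArg ((C.hom X Y).cast _) this).trans (PreCx.cast_cast _ _ _ _)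

lemma evP_bijective (a : ℤ) : Function.Bijective (evP P X Y a) := by
  constructor
  · intro φ ψ h
    funext k j
    by_cases hk : k = 0
    · by_cases hj : ∃ i, j i ≠ 0
      · obtain ⟨i, hi⟩ := hj
        exact (P.eq_zero_of_source i (id_incl hi) _).trans
          (P.eq_zero_of_source i (id_incl hi) _).symm
      · push Not at hj
        obtain rfl : j = fun _ => 0 := funext hj
        subst hk
        exact PreCx.cast_injective (P.P n X Y) (by simp) h
    · exact (P.eq_zero_of_target (id_incl hk) _).trans
        (P.eq_zero_of_target (id_incl hk) _).symm
  · intro x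
    let φ : P.TFam (fun i => PreTr.incl (X i)) (PreTr.incl Y) a := Function.update 0 0
      (Function.update 0 (fun _ => 0) ((P.P n X Y).cast
        (show a = a + ∑ i : Fin (n + 1), (fun _ => (0 : ℤ)) i - 0 by simp) x))
    refine ⟨φ, ?_⟩
    have : φ 0 (fun _ => 0) = (P.P n X Y).cast
        (show a = a + ∑ i : Fin (n + 1), (fun _ => (0 : ℤ)) i - 0 by simp) x :=
      (congrFun (Function.update_self _ _ _) _).trans (Function.update_self _ _ _)
    exact (congrArg ((P.P n X Y).cast _) this).trans (PreCx.cast_cast _ _ _ _)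

lemma evHom_d {X : C.Obj} {a b : ℤ} (h : a + 1 = b)
    (φ : (C.pretr.hom (inclObj X) (inclObj Y)).X a) :
    evHom X Y b ((C.pretr.hom (inclObj X) (inclObj Y)).d a b h φ) =
      (C.hom X Y).d a b h (evHom X Y a φ) := by
  have e : (C.pretr.hom (inclObj X) (inclObj Y)).d a b h φ =
      ((FinFam.cat C.toPreDG).hom (PreTr.incl X).obj (PreTr.incl Y).obj).d a b h φ :=
    MC.del_of_zero (PreTr.incl X) (PreTr.incl Y) rfl rfl h φ
  rw [e]
  refine (congrArg ((C.hom X Y).cast _) (one_smul _ _)).trans ?_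
  exact (PreCx.cast_d _ _ _ _).trans (PreCx.d_cast _ _ _ _).symm

lemma evP_d {a b : ℤ} (h : a + 1 = b)
    (φ : ((C.pretrPT P).P n (fun i => inclObj (X i)) (inclObj Y)).X a) :
    evP P X Y b (((C.pretrPT P).P n (fun i => inclObj (X i)) (inclObj Y)).d a b h φ) =
      (P.P n X Y).d a b h (evP P X Y a φ) := by
  have e : ((C.pretrPT P).P n (fun i => inclObj (X i)) (inclObj Y)).d a b h φ =
      (P.finFam.P n (fun i => (PreTr.incl (X i)).obj) (PreTr.incl Y).obj).d a b h φ :=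
    P.tDel_of_zero (fun i => PreTr.incl (X i)) (PreTr.incl Y) (fun _ => rfl) rfl h φ
  rw [e]
  refine (congrArg ((P.P n X Y).cast _) (one_smul _ _)).trans ?_
  exact (PreCx.cast_d _ _ _ _).trans (PreCx.d_cast _ _ _ _).symm

lemma evP_act {Z : C.Obj} {a b c : ℤ} (h : a + b = c) (f : (C.pretr.hom (inclObj Y) (inclObj Z)).X a)
    (φ : ((C.pretrPT P).P n (fun i => inclObj (X i)) (inclObj Y)).X b) :
    evP P X Z c ((C.pretrPT P).act h f φ) = P.act h (evHom Y Z a f) (evP P X Y b φ) := by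
  have e : ((C.pretrPT P).act h f φ : P.TFam (fun i => PreTr.incl (X i)) (PreTr.incl Z) c)
      0 (fun _ => 0) = P.act (by simp; omega) ((f : FinFam.Fam _ _ a) 0 0)
        ((φ : P.TFam (fun i => PreTr.incl (X i)) (PreTr.incl Y) b) 0 (fun _ => 0)) := by
    refine (P.finFam_act_apply (E := fun i => (PreTr.incl (X i)).obj) (F := (PreTr.incl Y).obj)
      (G := (PreTr.incl Z).obj) h f φ 0 (fun _ => 0)).trans ?_
    exact (Finset.sum_congr (Finset.Icc_self (0 : ℤ)) fun _ _ => rfl).trans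
      (Finset.sum_singleton _ _)
  refine (congrArg ((P.P n X Z).cast _) e).trans ?_
  exact P.cast_act _ _ _ _ _ _ _

lemma evP_comp {m : ℕ} {k : Fin (n + 1) → ℕ} (π : FinSurj m n k) {W : Fin (m + 1) → C.Obj}
    {p r : ℤ} (h : p + ∑ _i : Fin (n + 1), 0 = r)
    (φ : ((C.pretrPT P).P n (fun i => inclObj (X i)) (inclObj Y)).X p)
    (ψ : ∀ i, ((C.pretrPT P).P (k i) (fun a => inclObj (W (π.emb i a))) (inclObj (X i))).X 0) :
    evP P W Y r ((C.pretrPT P).comp π (X := fun b => inclObj (W b)) (fun _ _ => rfl) h φ ψ) =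
      P.comp π (X := W) (fun _ _ => rfl) h (evP P X Y p φ)
        (fun i => evP P (fun a => W (π.emb i a)) (X i) 0 (ψ i)) := by
  have e : ((C.pretrPT P).comp π (X := fun b => inclObj (W b)) (fun _ _ => rfl) h φ ψ :
      P.TFam (fun i => PreTr.incl (W i)) (PreTr.incl Y) r) 0 (fun _ => 0) =
      P.comp π (X := W) (X' := fun i a => W (π.emb i a)) (Y := X) (Z := Y) (fun _ _ => rfl)
        (q := fun i => 0 + ∑ _a : Fin (k i + 1), (0 : ℤ) - 0)
        (by simp at h ⊢; omega)
        ((φ : P.TFam (fun i => PreTr.incl (X i)) (PreTr.incl Y) p) 0 (fun _ => 0))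
        (fun i => (ψ i : P.TFam (fun a => PreTr.incl (W (π.emb i a))) (PreTr.incl (X i)) 0)
          0 (fun _ => 0)) := by
    refine (P.finFam_comp_apply (π := π) (hX := fun _ _ => rfl) (X := fun i => (PreTr.incl (W i)).obj)
      (Y := fun i => (PreTr.incl (X i)).obj)
      (Z := (PreTr.incl Y).obj) h φ ψ 0 (fun _ => 0)).trans ?_
    refine (Finset.sum_eq_single (fun _ => 0) (fun j hj hj' => absurd (funext fun i => ?_) hj')
      (fun hj => absurd ?_ hj)).trans ?_
    · have := Fintype.mem_piFinset.1 hj i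
      have := Finset.mem_Icc.1 this
      exact le_antisymm this.2 this.1
    · exact Fintype.mem_piFinset.2 fun i => Finset.mem_Icc.2 ⟨le_rfl, le_rfl⟩
    · have hs : PT.sgnC π (fun _ => 0) (fun _ => 0) (fun _ => 0) = 0 := by simp [PT.sgnC]
      rw [hs, Int.negOnePow_zero, one_smul]
      rfl
  refine (congrArg ((P.P m W Y).cast _) e).trans ?_
  exact P.cast_comp π _ _ _ _ _ _ _ _

end

end DGCat

namespace DGCat

variable {C : DGCat.{u, v}} {P : PT C.toPreDG}

section

variable {n : ℕ} {X : Fin (n + 1) → C.Obj} {Y : C.Obj}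

lemma evP_closed {φ : ((C.pretrPT P).P n (fun i => inclObj (X i)) (inclObj Y)).X 0}
    (h : (P.P n X Y).d 0 1 rfl (evP P X Y 0 φ) = 0) :
    ((C.pretrPT P).P n (fun i => inclObj (X i)) (inclObj Y)).d 0 1 rfl φ = 0 := by
  refine (evP_bijective P 1).1 ?_
  rw [evP_d, h, map_zero]

lemma isUniv_of_evP {φ : ((C.pretrPT P).P n (fun i => inclObj (X i)) (inclObj Y)).X 0}
    (h : P.IsUniv (evP P X Y 0 φ)) : (C.pretrPT P).IsUniv φ := by
  have hφ := evP_closed h.1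
  refine ⟨hφ, fun Z => ?_⟩
  refine pretr_induction (Q := fun Z => ((C.pretrPT P).actCx φ hφ Z).QI) (fun Z => ?_)
    (fun e hA hB => ?_) (fun e hV => ?_) Z
  · refine CxHom.qi_of_conj (P.actCx _ h.1 Z) _
      ⟨evHom Y Z, fun a b h x => evHom_d h x⟩ ⟨evP P X Z, fun a b h x => evP_d P h x⟩
      (fun n => evHom_bijective n) (fun n => evP_bijective P n) (fun a x => ?_) (h.2 Z)
    exact evP_act P (add_zero a) _ _
  · exact DGMod.qi_ext e (PT.actHom φ hφ) hA hB
  · exact DGMod.qi_shift e (PT.actHom φ hφ) hV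

end

lemma isRep_incl (R : P.Rep) {n : ℕ} (X : Fin (n + 1) → C.Obj) :
    (C.pretrPT P).IsRep (fun i => inclObj (X i)) := by
  obtain ⟨φ, hφ⟩ := (evP_bijective P (X := X) (Y := R.T n X) 0).2
    ((P.cx n X (R.T n X)).rep (R.univ n X))
  exact ⟨_, φ, isUniv_of_evP (by rw [hφ]; exact R.isUniv_rep_univ n X)⟩

lemma isRep_pretr (R : P.Rep) {n : ℕ} (X : Fin (n + 1) → C.pretr.Obj) : (C.pretrPT P).IsRep X :=
  pretr_family_induction (isRep_incl R) (fun _ _ _ _ e hA hB => hA.ext (pretriangulated C) e hB)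
    (fun _ _ _ _ e hV => hV.shift (pretriangulated C) e) X

theorem exists_rep_pretr (R : P.Rep) : Nonempty (C.pretrPT P).Rep :=
  PT.exists_rep fun _ X => isRep_pretr R X

lemma good_incl (R : P.Rep) (hR : R.IsTensor) {m n : ℕ} {k : Fin (n + 1) → ℕ} (π : FinSurj m n k)
    (X : Fin (m + 1) → C.Obj) : (C.pretrPT P).Good π (fun b => inclObj (X b)) := by
  let T : Fin (n + 1) → C.Obj := fun i => R.T (k i) (fun a => X (π.emb i a))
  let u₀ : ∀ i, (P.P (k i) (fun a => X (π.emb i a)) (T i)).X 0 := fun i =>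
    (P.cx (k i) _ (T i)).rep (R.univ (k i) _)
  have hu₀ : ∀ i, P.IsUniv (u₀ i) := fun i => R.isUniv_rep_univ (k i) _
  let w₀ : (P.P n T (R.T n T)).X 0 := (P.cx n T _).rep (R.univ n T)
  have hw₀ : P.IsUniv w₀ := R.isUniv_rep_univ n T
  have h₀ := (R.good_of_isIso_eps π X (hR π X)).isUniv_comp hu₀ hw₀
  have hu : ∀ i, ∃ φ, evP P (fun a => X (π.emb i a)) (T i) 0 φ = u₀ i := fun i =>
    (evP_bijective P 0).2 (u₀ i)
  choose u hu using hu
  obtain ⟨w, hw⟩ := (evP_bijective P (X := T) (Y := R.T n T) 0).2 w₀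
  refine PT.good_of_isUniv_comp (T := fun i => inclObj (T i)) (u := u) (w := w)
    (fun i => isUniv_of_evP (by rw [hu]; exact hu₀ i)) (isUniv_of_evP (by rw [hw]; exact hw₀))
    (isUniv_of_evP ?_)
  have e := evP_comp P π (W := X) (X := T) (Y := R.T n T) (p := 0) (r := 0) (by simp) w u
  rw [hw, funext hu] at e
  rw [← e] at h₀
  exact h₀

lemma good_pretr (R : P.Rep) (hR : R.IsTensor) {m n : ℕ} {k : Fin (n + 1) → ℕ} (π : FinSurj m n k)
    (X : Fin (m + 1) → C.pretr.Obj) : (C.pretrPT P).Good π X :=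
  pretr_family_induction (good_incl R hR π)
    (fun _ _ _ _ e hA hB => PT.Good.ext (pretriangulated C) e (isRep_pretr R _) (isRep_pretr R _) hA hB)
    (fun _ _ _ _ e hV => PT.Good.shift (pretriangulated C) e (isRep_pretr R _) hV) X

theorem isTensor_pretr (R : P.Rep) (hR : R.IsTensor) (R' : (C.pretrPT P).Rep) : R'.IsTensor :=
  fun π X => R'.isIso_eps_of_good π X (good_pretr R hR π X)

end DGCat

namespace PT

variable {C : PreDG.{u, v}} {D : PT C}

/-! ### Units of `H⁰ P` -/

lemma d_one_zero {X : Fin 1 → C.Obj} {Y : C.Obj} {f : (C.hom (X 0) Y).X 0}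
    (hf : (C.hom (X 0) Y).d 0 1 rfl f = 0) : (D.P 0 X Y).d 0 1 rfl (D.one f) = 0 :=
  (D.lawful.one_d rfl f).symm.trans ((congrArg D.one hf).trans (map_zero _))

lemma oneH0_ofClosed {X : Fin 1 → C.Obj} {Y : C.Obj} (f : (C.hom (X 0) Y).X 0)
    (hf : (C.hom (X 0) Y).d 0 1 rfl f = 0) :
    D.oneH0 X Y (Ho.ofClosed f hf) = (D.cx 0 X Y).cls (D.one f) (d_one_zero hf) := rfl

lemma compH0_oneH0 {s : ℕ} {W : Fin (s + 1) → C.Obj} {X : Fin 1 → C.Obj} {Y : C.Obj}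
    (f : (⟨X 0⟩ : Ho C) ⟶ ⟨Y⟩) (x : ∀ i, (D.cx s W (X i)).H 0) :
    D.compH0 (FinSurj.toOne s) (X' := fun _ => W) (fun _ _ => rfl) (D.oneH0 X Y f) x =
      D.smul f (x 0) := by
  obtain ⟨f, hf, rfl⟩ := Ho.exists_ofClosed f
  obtain ⟨Y', rfl⟩ : ∃ Y' : C.Obj, X = fun _ => Y' :=
    ⟨X 0, funext fun i => by rw [Subsingleton.elim i 0]⟩
  obtain ⟨y, hy, hx⟩ := exists_cls (x 0)
  have e : x = fun _ => (D.cx s W _).cls y hy := funext fun i => by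
    obtain rfl : i = 0 := Subsingleton.elim _ _
    exact hx.symm
  subst e
  rw [oneH0_ofClosed]
  exact (D.compH0_cls (FinSurj.toOne s) (X' := fun _ => W) (fun _ _ => rfl) (Y := fun _ => Y')
    (Z := Y) (D.one f) (d_one_zero hf) (fun _ => y) (fun _ => hy)).trans
    (smul_cls f y hf hy).symm

lemma compH0_refl {n : ℕ} {X : Fin (n + 1) → C.Obj} {Y : C.Obj} (x : (D.cx n X Y).H 0) :
    D.compH0 (FinSurj.refl n) (X' := fun i _ => X i) (fun _ _ => rfl) x
      (fun i => D.oneH0 (fun _ => X i) (X i) (𝟙 _)) = x := by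
  obtain ⟨x, hx, rfl⟩ := exists_cls x
  refine (D.compH0_cls (FinSurj.refl n) (X' := fun i _ => X i) (fun _ _ => rfl) x hx
    (fun i => D.one (C.id (X i))) fun i => d_one_zero (X := fun _ => X i) (C.d_id _)).trans ?_
  congr 1
  exact D.lawful.comp_id x

lemma smul_oneH0 {X : Fin 1 → C.Obj} {Y Z : C.Obj} (g : (⟨Y⟩ : Ho C) ⟶ ⟨Z⟩)
    (f : (⟨X 0⟩ : Ho C) ⟶ ⟨Y⟩) : D.smul g (D.oneH0 X Y f) = D.oneH0 X Z (f ≫ g) := by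
  obtain ⟨f, hf, rfl⟩ := Ho.exists_ofClosed f
  obtain ⟨g, hg, rfl⟩ := Ho.exists_ofClosed g
  refine (smul_cls g (D.one f) hg (d_one_zero hf)).trans ?_
  refine congrArg (QuotientAddGroup.mk (s := _)) (Subtype.ext ?_)
  exact (D.lawful.one_comp (Y := fun _ => Y) (add_zero 0) g (fun _ => f)).symm

/-- `x` is the composition of `g` with the `h a`, for the embeddings `e a` of the index sets of the
`h a` and `e'` of the index set of `x` in a common set. -/
def IsSubst {k s l : ℕ} {X : Fin (k + 1) → C.Obj} {Y : C.Obj} (g : (D.cx k X Y).H 0)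
    {kk : Fin (k + 1) → ℕ} {A : ∀ a, Fin (kk a + 1) → C.Obj} {B : Fin (k + 1) → C.Obj}
    (h : ∀ a, (D.cx (kk a) (A a) (B a)).H 0) (e : ∀ a, Fin (kk a + 1) → Fin (l + 1))
    (e' : Fin (s + 1) → Fin (l + 1)) {W : Fin (s + 1) → C.Obj} (x : (D.cx s W Y).H 0) : Prop :=
  ∃ (κ : Fin (k + 1) → ℕ) (τ : FinSurj s k κ) (V : ∀ a, Fin (κ a + 1) → C.Obj)
    (hV : ∀ a b, V a b = W (τ.emb a b)) (h' : ∀ a, (D.cx (κ a) (V a) (X a)).H 0),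
    (∀ a, κ a = kk a ∧ HEq (fun b => e' (τ.emb a b)) (e a) ∧ HEq (h' a) (h a)) ∧
      x = D.compH0 τ hV g h'

lemma IsSubst.left {s l : ℕ} {X : Fin 1 → C.Obj} {Y : C.Obj} (f : (⟨X 0⟩ : Ho C) ⟶ ⟨Y⟩)
    {kk : Fin 1 → ℕ} {A : ∀ a, Fin (kk a + 1) → C.Obj} {B : Fin 1 → C.Obj}
    {h : ∀ a, (D.cx (kk a) (A a) (B a)).H 0} {e : ∀ a, Fin (kk a + 1) → Fin (l + 1)}
    {e' : Fin (s + 1) → Fin (l + 1)} {W : Fin (s + 1) → C.Obj} (x : (D.cx s W (X 0)).H 0)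
    (h₁ : s = kk 0) (h₂ : HEq e' (e 0)) (h₃ : HEq x (h 0)) {y : (D.cx s W Y).H 0}
    (hy : y = D.smul f x) : IsSubst (k := 0) (D.oneH0 X Y f) h e e' y := by
  subst hy
  obtain ⟨X₀, rfl⟩ : ∃ X₀ : C.Obj, X = fun _ => X₀ :=
    ⟨X 0, funext fun i => congrArg X (Fin.ext (by omega))⟩
  refine ⟨fun _ => s, FinSurj.toOne s, fun _ => W, fun _ _ => rfl, fun _ => x, fun a => ?_,
    (compH0_oneH0 f (fun _ => x)).symm⟩
  obtain rfl : a = 0 := Fin.ext (by omega)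
  exact ⟨h₁, h₂, h₃⟩

lemma IsSubst.right {k l : ℕ} {X : Fin (k + 1) → C.Obj} {Y : C.Obj} (g : (D.cx k X Y).H 0)
    {kk : Fin (k + 1) → ℕ} {A : ∀ a, Fin (kk a + 1) → C.Obj} {B : Fin (k + 1) → C.Obj}
    {h : ∀ a, (D.cx (kk a) (A a) (B a)).H 0} {e : ∀ a, Fin (kk a + 1) → Fin (l + 1)}
    {e' : Fin (k + 1) → Fin (l + 1)}
    (H : ∀ a, 0 = kk a ∧ HEq (fun _ : Fin 1 => e' a) (e a) ∧
      HEq (D.oneH0 (fun _ => X a) (X a) (𝟙 _)) (h a)) :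
    IsSubst g h e e' g :=
  ⟨fun _ => 0, FinSurj.refl k, fun a _ => X a, fun _ _ => rfl, _, H, (compH0_refl g).symm⟩

namespace Rep

variable (R : D.Rep)

/-! ### Compositions of induced morphisms -/

lemma lift_comp_lift {l m n : ℕ} {k : Fin (n + 1) → ℕ} {k' : Fin (m + 1) → ℕ} {s : Fin (n + 1) → ℕ}
    {π : FinSurj m n k} {ρ : FinSurj l m k'} {σ : FinSurj l n s}
    {W : Fin (l + 1) → C.Obj} {X : Fin (m + 1) → C.Obj} {Y : Fin (n + 1) → C.Obj}
    {X₁ : ∀ i, Fin (k i + 1) → C.Obj} {h₁ : ∀ i a, X₁ i a = X (π.emb i a)}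
    {X₂ : ∀ i, Fin (k' i + 1) → C.Obj} {h₂ : ∀ i a, X₂ i a = W (ρ.emb i a)}
    {X₃ : ∀ i, Fin (s i + 1) → C.Obj} {h₃ : ∀ i a, X₃ i a = W (σ.emb i a)}
    {g : ∀ i, (D.cx (k i) (X₁ i) (Y i)).H 0} {h : ∀ j, (D.cx (k' j) (X₂ j) (X j)).H 0}
    {x : ∀ i, (D.cx (s i) (X₃ i) (Y i)).H 0}
    (H : ∀ i, IsSubst (g i) (fun a => h (π.emb i a)) (fun a => ρ.emb (π.emb i a)) (σ.emb i) (x i)) :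
    R.lift ρ h₂ h ≫ R.lift π h₁ g = R.lift σ h₃ x := by
  obtain rfl : X₁ = fun i a => X (π.emb i a) := funext₂ h₁
  obtain rfl : X₂ = fun i a => W (ρ.emb i a) := funext₂ h₂
  obtain rfl : X₃ = fun i a => W (σ.emb i a) := funext₂ h₃
  choose κ τ V hV h' H H' using H
  obtain rfl : κ = fun i a => k' (π.emb i a) := funext₂ fun i a => (H i a).1
  have hτ : ∀ i a b, σ.emb i ((τ i).emb a b) = ρ.emb (π.emb i a) b := fun i a b =>
    congrFun (eq_of_heq (H i a).2.1) b
  obtain rfl : V = fun i a b => W (ρ.emb (π.emb i a) b) :=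
    funext₃ fun i a b => (hV i a b).trans (congrArg W (hτ i a b))
  obtain rfl : h' = fun i a => h (π.emb i a) := funext₂ fun i a => eq_of_heq (H i a).2.2
  obtain rfl : x = _ := funext H'
  refine R.hom_ext ?_
  rw [comp_smul, smul_lift, smul_lift, smul_compH0, smul_lift]
  exact compH0_assoc π ρ σ τ hτ _ g h

variable {R}

lemma isIso_lift (hR : R.IsTensor) {m n : ℕ} {k : Fin (n + 1) → ℕ} {π : FinSurj m n k}
    {X : Fin (m + 1) → C.Obj} {Y : Fin (n + 1) → C.Obj} {X' : ∀ i, Fin (k i + 1) → C.Obj}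
    {hX : ∀ i a, X' i a = X (π.emb i a)} {g : ∀ i, (D.cx (k i) (X' i) (Y i)).H 0}
    (hY : ∀ i, Y i = R.T (k i) (X' i)) (hg : ∀ i, HEq (g i) (R.univ (k i) (X' i))) :
    IsIso (R.lift π hX g) := by
  obtain rfl : Y = fun i => R.T (k i) (X' i) := funext hY
  obtain rfl : g = fun i => R.univ (k i) (X' i) := funext fun i => eq_of_heq (hg i)
  obtain rfl : X' = fun i a => X (π.emb i a) := funext₂ hX
  exact hR π X

variable (R)

/-- The morphism `⨂ X_i ⟶ ⨂ Y_i` induced by morphisms `X_i ⟶ Y_i`. -/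
noncomputable def map {n : ℕ} {X Y : Fin (n + 1) → C.Obj} (f : ∀ i, (⟨X i⟩ : Ho C) ⟶ ⟨Y i⟩) :
    (⟨R.T n X⟩ : Ho C) ⟶ ⟨R.T n Y⟩ :=
  R.lift (FinSurj.refl n) (X' := fun i _ => X i) (fun _ _ => rfl)
    (fun i => D.oneH0 (fun _ => X i) (Y i) (f i))

lemma lift_map {m n : ℕ} {k : Fin (n + 1) → ℕ} {π : FinSurj m n k} {X : Fin (m + 1) → C.Obj}
    {X' : ∀ i, Fin (k i + 1) → C.Obj} {hX : ∀ i a, X' i a = X (π.emb i a)}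
    {Y Z : Fin (n + 1) → C.Obj} (g : ∀ i, (D.cx (k i) (X' i) (Y i)).H 0)
    (f : ∀ i, (⟨Y i⟩ : Ho C) ⟶ ⟨Z i⟩) :
    R.lift π hX g ≫ R.map f = R.lift π hX (fun i => D.smul (f i) (g i)) :=
  R.lift_comp_lift fun i => .left (X := fun _ => Y i) (f i) (g i) rfl HEq.rfl HEq.rfl rfl

lemma map_id {n : ℕ} (X : Fin (n + 1) → C.Obj) : R.map (fun i => 𝟙 (⟨X i⟩ : Ho C)) = 𝟙 _ := by
  refine R.hom_ext ?_
  rw [id_smul]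
  exact (R.smul_lift _ _ _).trans (compH0_refl _)

lemma map_comp {n : ℕ} {X Y Z : Fin (n + 1) → C.Obj} (f : ∀ i, (⟨X i⟩ : Ho C) ⟶ ⟨Y i⟩)
    (g : ∀ i, (⟨Y i⟩ : Ho C) ⟶ ⟨Z i⟩) : R.map f ≫ R.map g = R.map (fun i => f i ≫ g i) := by
  refine (R.lift_map _ g).trans ?_
  simp only [smul_oneH0]
  rfl

end Rep

end PT

/-- A surjection given by explicit maps. -/
abbrev FinSurj.of {m n : ℕ} {k : Fin (n + 1) → ℕ} (map : Fin (m + 1) → Fin (n + 1))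
    (emb : ∀ i, Fin (k i + 1) → Fin (m + 1)) (h₁ : ∀ i a b, a < b → emb i a < emb i b)
    (h₂ : ∀ i x, (∃ a, emb i a = x) ↔ map x = i) : FinSurj m n k where
  map := map
  emb := emb
  strictMono i _ _ h := h₁ i _ _ h
  range_emb i := Set.ext (h₂ i)

namespace FinSurj

abbrev surj₁₁₀ : FinSurj 2 1 ![0, 1] := .of ![1, 1, 0]
  (fun
    | 0 => fun _ => 2
    | 1 => ![0, 1]) (by decide) (by decide)

abbrev surj₀₁₁₁ : FinSurj 3 1 ![0, 2] := .of ![0, 1, 1, 1]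
  (fun
    | 0 => fun _ => 0
    | 1 => ![1, 2, 3]) (by decide) (by decide)

abbrev surj₀₀₀₁ : FinSurj 3 1 ![2, 0] := .of ![0, 0, 0, 1]
  (fun
    | 0 => ![0, 1, 2]
    | 1 => fun _ => 3) (by decide) (by decide)

abbrev surj₀₀₁₁ : FinSurj 3 1 ![1, 1] := .of ![0, 0, 1, 1]
  (fun
    | 0 => ![0, 1]
    | 1 => ![2, 3]) (by decide) (by decide)

abbrev surj₀₁₂₂ : FinSurj 3 2 ![0, 0, 1] := .of ![0, 1, 2, 2]
  (fun
    | 0 => fun _ => 0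
    | 1 => fun _ => 1
    | 2 => ![2, 3]) (by decide) (by decide)

abbrev surj₀₁₁₂ : FinSurj 3 2 ![0, 1, 0] := .of ![0, 1, 1, 2]
  (fun
    | 0 => fun _ => 0
    | 1 => ![1, 2]
    | 2 => fun _ => 3) (by decide) (by decide)

abbrev surj₀₀₁₂ : FinSurj 3 2 ![1, 0, 0] := .of ![0, 0, 1, 2]
  (fun
    | 0 => ![0, 1]
    | 1 => fun _ => 2
    | 2 => fun _ => 3) (by decide) (by decide)

abbrev perm₁₂₀ : FinSurj 2 2 (fun _ => 0) := .of ![1, 2, 0] (fun i _ => ![2, 0, 1] i)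
  (by decide) (by decide)

abbrev perm₀₂₁ : FinSurj 2 2 (fun _ => 0) := .of ![0, 2, 1] (fun i _ => ![0, 2, 1] i)
  (by decide) (by decide)

abbrev perm₁₀₂ : FinSurj 2 2 (fun _ => 0) := .of ![1, 0, 2] (fun i _ => ![1, 0, 2] i)
  (by decide) (by decide)

end FinSurj

namespace PT

variable {C : PreDG.{u, v}} {D : PT C} (R : D.Rep)

lemma IsSubst.univ_left {s l : ℕ} {X : Fin 1 → C.Obj}
    {kk : Fin 1 → ℕ} {A : ∀ a, Fin (kk a + 1) → C.Obj} {B : Fin 1 → C.Obj}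
    {h : ∀ a, (D.cx (kk a) (A a) (B a)).H 0} {e : ∀ a, Fin (kk a + 1) → Fin (l + 1)}
    {e' : Fin (s + 1) → Fin (l + 1)} {W : Fin (s + 1) → C.Obj} (x : (D.cx s W (X 0)).H 0)
    (h₁ : s = kk 0) (h₂ : HEq e' (e 0)) (h₃ : HEq x (h 0)) :
    IsSubst (k := 0) (R.univ 0 X) h e e' x := by
  have := IsSubst.left (X := X) (𝟙 _) x h₁ h₂ h₃ (id_smul x).symm
  exact (R.univ_zero X) ▸ this

lemma IsSubst.univ_right {k l : ℕ} {X : Fin (k + 1) → C.Obj} {Y : C.Obj} (g : (D.cx k X Y).H 0)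
    {kk : Fin (k + 1) → ℕ} {A : ∀ a, Fin (kk a + 1) → C.Obj} {B : Fin (k + 1) → C.Obj}
    {h : ∀ a, (D.cx (kk a) (A a) (B a)).H 0} {e : ∀ a, Fin (kk a + 1) → Fin (l + 1)}
    {e' : Fin (k + 1) → Fin (l + 1)}
    (H : ∀ a, 0 = kk a ∧ HEq (fun _ : Fin 1 => e' a) (e a) ∧
      HEq (R.univ 0 (fun _ => X a)) (h a)) :
    IsSubst g h e e' g :=
  .right g fun a => ⟨(H a).1, (H a).2.1, (heq_of_eq (R.univ_zero (fun _ => X a)).symm).trans (H a).2.2⟩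

namespace Rep

lemma tensorHom_eq_map {X Y X' Y' : Ho C} (f : X ⟶ Y) (f' : X' ⟶ Y') :
    R.tensorHom f f' = R.map (X := ![X.as, X'.as]) (Y := ![Y.as, Y'.as])
      (fun
        | 0 => f
        | 1 => f') :=
  congrArg (R.lift (FinSurj.refl 1) _) (funext fun
    | 0 => rfl
    | 1 => rfl)

lemma lift_tensorHom {m : ℕ} {k : Fin 2 → ℕ} {π : FinSurj m 1 k} {X : Fin (m + 1) → C.Obj}
    {X' : ∀ i, Fin (k i + 1) → C.Obj} {hX : ∀ i a, X' i a = X (π.emb i a)}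
    {U V U' V' : Ho C} (g : ∀ i, (D.cx (k i) (X' i) ((![U.as, U'.as] : Fin 2 → C.Obj) i)).H 0)
    (f : U ⟶ V) (f' : U' ⟶ V') :
    R.lift π hX g ≫ R.tensorHom f f' = R.lift π hX (Y := ![V.as, V'.as])
      (fun
        | 0 => D.smul f (g 0)
        | 1 => D.smul f' (g 1)) := by
  rw [tensorHom_eq_map]
  refine (R.lift_map g _).trans (congrArg (R.lift π hX) (funext fun
    | 0 => rfl
    | 1 => rfl))

lemma tensorHom_id (X Y : Ho C) : R.tensorHom (𝟙 X) (𝟙 Y) = 𝟙 (R.tensor X Y) := by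
  rw [tensorHom_eq_map]
  refine Eq.trans (congrArg (R.map) (funext fun
    | 0 => rfl
    | 1 => rfl)) (R.map_id ![X.as, Y.as])

lemma tensorHom_comp {X Y Z X' Y' Z' : Ho C} (f : X ⟶ Y) (g : Y ⟶ Z) (f' : X' ⟶ Y')
    (g' : Y' ⟶ Z') : R.tensorHom (f ≫ g) (f' ≫ g') = R.tensorHom f f' ≫ R.tensorHom g g' := by
  simp only [tensorHom_eq_map]
  refine Eq.trans (congrArg (R.map) (funext fun
    | 0 => rfl
    | 1 => rfl)) (R.map_comp _ _).symm

lemma add_tensorHom {X Y X' Y' : Ho C} (f g : X ⟶ Y) (f' : X' ⟶ Y') :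
    R.tensorHom (f + g) f' = R.tensorHom f f' + R.tensorHom g f' :=
  R.lift_add_of (FinSurj.refl 1) (Y := ![Y.as, Y'.as]) _ 0 (map_add (D.oneH0 (fun _ => X.as) Y.as) f g)
    (fun
      | 0 => fun h => absurd rfl h
      | 1 => fun _ => rfl)
    (fun
      | 0 => fun h => absurd rfl h
      | 1 => fun _ => rfl)

lemma tensorHom_add {X Y X' Y' : Ho C} (f : X ⟶ Y) (f' g' : X' ⟶ Y') :
    R.tensorHom f (f' + g') = R.tensorHom f f' + R.tensorHom f g' :=
  R.lift_add_of (FinSurj.refl 1) (Y := ![Y.as, Y'.as]) _ 1 (map_add (D.oneH0 (fun _ => X'.as) Y'.as) f' g')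
    (fun
      | 0 => fun _ => rfl
      | 1 => fun h => absurd rfl h)
    (fun
      | 0 => fun _ => rfl
      | 1 => fun h => absurd rfl h)

/-! ### The commutativity constraint -/

lemma tensorHom_tau {X Y X' Y' : Ho C} (f : X ⟶ X') (g : Y ⟶ Y') :
    R.tensorHom f g ≫ R.tau X' Y' = R.tau X Y ≫ R.tensorHom g f := by
  refine Eq.trans (R.lift_comp_lift (fun
    | 0 => .left (X := fun _ => Y'.as) (𝟙 _) (D.oneH0 (fun _ => Y.as) Y'.as g) rfl
        (heq_of_eq (by decide)) HEq.rfl ?_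
    | 1 => .left (X := fun _ => X'.as) (𝟙 _) (D.oneH0 (fun _ => X.as) X'.as f) rfl
        (heq_of_eq (by decide)) HEq.rfl ?_)) (R.lift_tensorHom _ _ _).symm
  · exact (smul_oneH0 _ _).trans ((smul_oneH0 _ _).trans (by simp)).symm
  · exact (smul_oneH0 _ _).trans ((smul_oneH0 _ _).trans (by simp)).symm

lemma tau_tau (X Y : Ho C) : R.tau X Y ≫ R.tau Y X = 𝟙 _ := by
  rw [← tensorHom_id]
  refine R.lift_comp_lift (fun
    | 0 => .left (X := fun _ => X.as) (𝟙 _) (D.oneH0 (fun _ => X.as) X.as (𝟙 _)) rfl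
        (heq_of_eq (by decide)) HEq.rfl (id_smul _).symm
    | 1 => .left (X := fun _ => Y.as) (𝟙 _) (D.oneH0 (fun _ => Y.as) Y.as (𝟙 _)) rfl
        (heq_of_eq (by decide)) HEq.rfl (id_smul _).symm)

end Rep

end PT

lemma heq_fin_one {A : Type*} {f g : Fin 1 → A} (h : f 0 = g 0) : HEq f g :=
  heq_of_eq (funext fun a => by rwa [Subsingleton.elim a 0])

lemma heq_fin_two {A : Type*} {f g : Fin 2 → A} (h₀ : f 0 = g 0) (h₁ : f 1 = g 1) : HEq f g :=
  heq_of_eq (funext fun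
    | 0 => h₀
    | 1 => h₁)

namespace PT

variable {C : PreDG.{u, v}} {D : PT C} (R : D.Rep)

namespace Rep

/-! ### The associativity constraint -/

lemma smul_univ_zero {X Y : C.Obj} (f : (⟨X⟩ : Ho C) ⟶ ⟨Y⟩) :
    D.smul f (R.univ 0 (fun _ => X)) = D.oneH0 (fun _ => X) Y f := by
  rw [univ_zero]
  exact (smul_oneH0 (X := fun _ => X) f (𝟙 _)).trans (congrArg _ (Category.id_comp f))

/-- The morphism `X ⊗ Y ⊗ Z ⟶ X' ⊗ Y' ⊗ Z'` induced by three morphisms. -/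
noncomputable def map₃ {X Y Z X' Y' Z' : Ho C} (f : X ⟶ X') (g : Y ⟶ Y') (h : Z ⟶ Z') :
    (⟨R.T 2 ![X.as, Y.as, Z.as]⟩ : Ho C) ⟶ ⟨R.T 2 ![X'.as, Y'.as, Z'.as]⟩ :=
  R.lift (FinSurj.refl 2) (X := ![X.as, Y.as, Z.as]) (X' := fun i _ => ![X.as, Y.as, Z.as] i)
    (Y := ![X'.as, Y'.as, Z'.as]) (fun _ _ => rfl) (fun
      | 0 => D.oneH0 (fun _ => X.as) X'.as f
      | 1 => D.oneH0 (fun _ => Y.as) Y'.as g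
      | 2 => D.oneH0 (fun _ => Z.as) Z'.as h)

lemma map₃_eps₀₁₁ {X Y Z X' Y' Z' : Ho C} (f : X ⟶ X') (g : Y ⟶ Y') (h : Z ⟶ Z') :
    R.map₃ f g h ≫ R.eps₀₁₁ X' Y' Z' = R.eps₀₁₁ X Y Z ≫ R.tensorHom f (R.tensorHom g h) := by
  refine Eq.trans (R.lift_comp_lift (fun
    | 0 => .univ_left (X := fun _ => X'.as) R _ rfl (heq_fin_one rfl)
        (heq_of_eq (R.smul_univ_zero f))
    | 1 => ⟨_, FinSurj.refl 1, fun i _ => ![Y.as, Z.as] i, fun _ _ => rfl, fun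
        | 0 => D.oneH0 (fun _ => Y.as) Y'.as g
        | 1 => D.oneH0 (fun _ => Z.as) Z'.as h, fun
        | 0 => ⟨rfl, heq_fin_one rfl, HEq.rfl⟩
        | 1 => ⟨rfl, heq_fin_one rfl, HEq.rfl⟩, R.smul_lift _ _ _⟩))
    (R.lift_tensorHom _ _ _).symm

lemma map₃_eps₀₀₁ {X Y Z X' Y' Z' : Ho C} (f : X ⟶ X') (g : Y ⟶ Y') (h : Z ⟶ Z') :
    R.map₃ f g h ≫ R.eps₀₀₁ X' Y' Z' = R.eps₀₀₁ X Y Z ≫ R.tensorHom (R.tensorHom f g) h := by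
  refine Eq.trans (R.lift_comp_lift (fun
    | 0 => ⟨_, FinSurj.refl 1, fun i _ => ![X.as, Y.as] i, fun _ _ => rfl, fun
        | 0 => D.oneH0 (fun _ => X.as) X'.as f
        | 1 => D.oneH0 (fun _ => Y.as) Y'.as g, fun
        | 0 => ⟨rfl, heq_fin_one rfl, HEq.rfl⟩
        | 1 => ⟨rfl, heq_fin_one rfl, HEq.rfl⟩, R.smul_lift _ _ _⟩
    | 1 => .univ_left (X := fun _ => Z'.as) R _ rfl (heq_fin_one rfl)
        (heq_of_eq (R.smul_univ_zero h))))
    (R.lift_tensorHom _ _ _).symm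

section pentagon

variable (X Y Z W : Ho C)

/-- The morphism `X ⊗ Y ⊗ Z ⊗ W ⟶ X ⊗ Y ⊗ (Z ⊗ W)`. -/
noncomputable def eps₀₁₂₂ : (⟨R.T 3 ![X.as, Y.as, Z.as, W.as]⟩ : Ho C) ⟶
    ⟨R.T 2 ![X.as, Y.as, (R.tensor Z W).as]⟩ :=
  R.lift FinSurj.surj₀₁₂₂ (X := ![X.as, Y.as, Z.as, W.as]) (Y := ![X.as, Y.as, (R.tensor Z W).as])
    (X' := fun
      | 0 => fun (_ : Fin 1) => X.as
      | 1 => fun (_ : Fin 1) => Y.as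
      | 2 => (![Z.as, W.as] : Fin 2 → C.Obj))
    (fun
      | 0 => fun (_ : Fin 1) => rfl
      | 1 => fun (_ : Fin 1) => rfl
      | 2 => fun (a : Fin 2) => by fin_cases a <;> rfl)
    (fun
      | 0 => R.univ 0 (fun _ => X.as)
      | 1 => R.univ 0 (fun _ => Y.as)
      | 2 => R.univ 1 ![Z.as, W.as])

/-- The morphism `X ⊗ Y ⊗ Z ⊗ W ⟶ X ⊗ (Y ⊗ Z) ⊗ W`. -/
noncomputable def eps₀₁₁₂ : (⟨R.T 3 ![X.as, Y.as, Z.as, W.as]⟩ : Ho C) ⟶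
    ⟨R.T 2 ![X.as, (R.tensor Y Z).as, W.as]⟩ :=
  R.lift FinSurj.surj₀₁₁₂ (X := ![X.as, Y.as, Z.as, W.as]) (Y := ![X.as, (R.tensor Y Z).as, W.as])
    (X' := fun
      | 0 => fun (_ : Fin 1) => X.as
      | 1 => (![Y.as, Z.as] : Fin 2 → C.Obj)
      | 2 => fun (_ : Fin 1) => W.as)
    (fun
      | 0 => fun (_ : Fin 1) => rfl
      | 1 => fun (a : Fin 2) => by fin_cases a <;> rfl
      | 2 => fun (_ : Fin 1) => rfl)
    (fun
      | 0 => R.univ 0 (fun _ => X.as)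
      | 1 => R.univ 1 ![Y.as, Z.as]
      | 2 => R.univ 0 (fun _ => W.as))

/-- The morphism `X ⊗ Y ⊗ Z ⊗ W ⟶ (X ⊗ Y) ⊗ Z ⊗ W`. -/
noncomputable def eps₀₀₁₂ : (⟨R.T 3 ![X.as, Y.as, Z.as, W.as]⟩ : Ho C) ⟶
    ⟨R.T 2 ![(R.tensor X Y).as, Z.as, W.as]⟩ :=
  R.lift FinSurj.surj₀₀₁₂ (X := ![X.as, Y.as, Z.as, W.as]) (Y := ![(R.tensor X Y).as, Z.as, W.as])
    (X' := fun
      | 0 => (![X.as, Y.as] : Fin 2 → C.Obj)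
      | 1 => fun (_ : Fin 1) => Z.as
      | 2 => fun (_ : Fin 1) => W.as)
    (fun
      | 0 => fun (a : Fin 2) => by fin_cases a <;> rfl
      | 1 => fun (_ : Fin 1) => rfl
      | 2 => fun (_ : Fin 1) => rfl)
    (fun
      | 0 => R.univ 1 ![X.as, Y.as]
      | 1 => R.univ 0 (fun _ => Z.as)
      | 2 => R.univ 0 (fun _ => W.as))

/-- The morphism `X ⊗ Y ⊗ Z ⊗ W ⟶ X ⊗ (Y ⊗ Z ⊗ W)`. -/
noncomputable def eps₀₁₁₁ : (⟨R.T 3 ![X.as, Y.as, Z.as, W.as]⟩ : Ho C) ⟶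
    R.tensor X ⟨R.T 2 ![Y.as, Z.as, W.as]⟩ :=
  R.lift FinSurj.surj₀₁₁₁ (X := ![X.as, Y.as, Z.as, W.as])
    (Y := ![X.as, R.T 2 ![Y.as, Z.as, W.as]])
    (X' := fun
      | 0 => fun (_ : Fin 1) => X.as
      | 1 => (![Y.as, Z.as, W.as] : Fin 3 → C.Obj))
    (fun
      | 0 => fun (_ : Fin 1) => rfl
      | 1 => fun (a : Fin 3) => by fin_cases a <;> rfl)
    (fun
      | 0 => R.univ 0 (fun _ => X.as)
      | 1 => R.univ 2 ![Y.as, Z.as, W.as])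

/-- The morphism `X ⊗ Y ⊗ Z ⊗ W ⟶ (X ⊗ Y ⊗ Z) ⊗ W`. -/
noncomputable def eps₀₀₀₁ : (⟨R.T 3 ![X.as, Y.as, Z.as, W.as]⟩ : Ho C) ⟶
    R.tensor ⟨R.T 2 ![X.as, Y.as, Z.as]⟩ W :=
  R.lift FinSurj.surj₀₀₀₁ (X := ![X.as, Y.as, Z.as, W.as])
    (Y := ![R.T 2 ![X.as, Y.as, Z.as], W.as])
    (X' := fun
      | 0 => (![X.as, Y.as, Z.as] : Fin 3 → C.Obj)
      | 1 => fun (_ : Fin 1) => W.as)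
    (fun
      | 0 => fun (a : Fin 3) => by fin_cases a <;> rfl
      | 1 => fun (_ : Fin 1) => rfl)
    (fun
      | 0 => R.univ 2 ![X.as, Y.as, Z.as]
      | 1 => R.univ 0 (fun _ => W.as))

lemma eps₀₁₂₂_eps₀₁₁ : R.eps₀₁₂₂ X Y Z W ≫ R.eps₀₁₁ X Y (R.tensor Z W) =
    R.eps₀₁₁₁ X Y Z W ≫ R.tensorHom (𝟙 X) (R.eps₀₁₁ Y Z W) := by
  refine Eq.trans (R.lift_comp_lift (fun
    | 0 => .univ_left (X := fun _ => X.as) R _ rfl (heq_fin_one rfl)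
        (heq_of_eq (id_smul _))
    | 1 => ⟨_, surj₀₁₁, fun
        | 0 => fun (_ : Fin 1) => Y.as
        | 1 => (![Z.as, W.as] : Fin 2 → C.Obj), fun
        | 0 => fun (_ : Fin 1) => rfl
        | 1 => fun (a : Fin 2) => by fin_cases a <;> rfl, fun
        | 0 => R.univ 0 (fun _ => Y.as)
        | 1 => R.univ 1 ![Z.as, W.as], fun
        | 0 => ⟨rfl, heq_fin_one rfl, HEq.rfl⟩
        | 1 => ⟨rfl, heq_fin_two (by rfl) (by rfl), HEq.rfl⟩, R.smul_lift _ _ _⟩))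
    (R.lift_tensorHom _ _ _).symm

lemma eps₀₁₁₂_eps₀₁₁ : R.eps₀₁₁₂ X Y Z W ≫ R.eps₀₁₁ X (R.tensor Y Z) W =
    R.eps₀₁₁₁ X Y Z W ≫ R.tensorHom (𝟙 X) (R.eps₀₀₁ Y Z W) := by
  refine Eq.trans (R.lift_comp_lift (fun
    | 0 => .univ_left (X := fun _ => X.as) R _ rfl (heq_fin_one rfl)
        (heq_of_eq (id_smul _))
    | 1 => ⟨_, surj₀₀₁, fun
        | 0 => (![Y.as, Z.as] : Fin 2 → C.Obj)
        | 1 => fun (_ : Fin 1) => W.as, fun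
        | 0 => fun (a : Fin 2) => by fin_cases a <;> rfl
        | 1 => fun (_ : Fin 1) => rfl, fun
        | 0 => R.univ 1 ![Y.as, Z.as]
        | 1 => R.univ 0 (fun _ => W.as), fun
        | 0 => ⟨rfl, heq_fin_two (by rfl) (by rfl), HEq.rfl⟩
        | 1 => ⟨rfl, heq_fin_one rfl, HEq.rfl⟩, R.smul_lift _ _ _⟩))
    (R.lift_tensorHom _ _ _).symm

lemma eps₀₁₁₂_eps₀₀₁ : R.eps₀₁₁₂ X Y Z W ≫ R.eps₀₀₁ X (R.tensor Y Z) W =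
    R.eps₀₀₀₁ X Y Z W ≫ R.tensorHom (R.eps₀₁₁ X Y Z) (𝟙 W) := by
  refine Eq.trans (R.lift_comp_lift (fun
    | 0 => ⟨_, surj₀₁₁, fun
        | 0 => fun (_ : Fin 1) => X.as
        | 1 => (![Y.as, Z.as] : Fin 2 → C.Obj), fun
        | 0 => fun (_ : Fin 1) => rfl
        | 1 => fun (a : Fin 2) => by fin_cases a <;> rfl, fun
        | 0 => R.univ 0 (fun _ => X.as)
        | 1 => R.univ 1 ![Y.as, Z.as], fun
        | 0 => ⟨rfl, heq_fin_one rfl, HEq.rfl⟩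
        | 1 => ⟨rfl, heq_fin_two (by rfl) (by rfl), HEq.rfl⟩, R.smul_lift _ _ _⟩
    | 1 => .univ_left (X := fun _ => W.as) R _ rfl (heq_fin_one rfl)
        (heq_of_eq (id_smul _))))
    (R.lift_tensorHom _ _ _).symm

lemma eps₀₀₁₂_eps₀₀₁ : R.eps₀₀₁₂ X Y Z W ≫ R.eps₀₀₁ (R.tensor X Y) Z W =
    R.eps₀₀₀₁ X Y Z W ≫ R.tensorHom (R.eps₀₀₁ X Y Z) (𝟙 W) := by
  refine Eq.trans (R.lift_comp_lift (fun
    | 0 => ⟨_, surj₀₀₁, fun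
        | 0 => (![X.as, Y.as] : Fin 2 → C.Obj)
        | 1 => fun (_ : Fin 1) => Z.as, fun
        | 0 => fun (a : Fin 2) => by fin_cases a <;> rfl
        | 1 => fun (_ : Fin 1) => rfl, fun
        | 0 => R.univ 1 ![X.as, Y.as]
        | 1 => R.univ 0 (fun _ => Z.as), fun
        | 0 => ⟨rfl, heq_fin_two (by rfl) (by rfl), HEq.rfl⟩
        | 1 => ⟨rfl, heq_fin_one rfl, HEq.rfl⟩, R.smul_lift _ _ _⟩
    | 1 => .univ_left (X := fun _ => W.as) R _ rfl (heq_fin_one rfl)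
        (heq_of_eq (id_smul _))))
    (R.lift_tensorHom _ _ _).symm

/-- The morphism `X ⊗ Y ⊗ Z ⊗ W ⟶ (X ⊗ Y) ⊗ (Z ⊗ W)`. -/
noncomputable def eps₀₀₁₁ : (⟨R.T 3 ![X.as, Y.as, Z.as, W.as]⟩ : Ho C) ⟶
    R.tensor (R.tensor X Y) (R.tensor Z W) :=
  R.lift FinSurj.surj₀₀₁₁ (X := ![X.as, Y.as, Z.as, W.as])
    (Y := ![(R.tensor X Y).as, (R.tensor Z W).as])
    (X' := fun
      | 0 => (![X.as, Y.as] : Fin 2 → C.Obj)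
      | 1 => (![Z.as, W.as] : Fin 2 → C.Obj))
    (fun
      | 0 => fun (a : Fin 2) => by fin_cases a <;> rfl
      | 1 => fun (a : Fin 2) => by fin_cases a <;> rfl)
    (fun
      | 0 => R.univ 1 ![X.as, Y.as]
      | 1 => R.univ 1 ![Z.as, W.as])

lemma eps₀₁₂₂_eps₀₀₁ :
    R.eps₀₁₂₂ X Y Z W ≫ R.eps₀₀₁ X Y (R.tensor Z W) = R.eps₀₀₁₁ X Y Z W :=
  R.lift_comp_lift (fun
    | 0 => .univ_right R _ fun
        | 0 => ⟨rfl, heq_fin_one rfl, HEq.rfl⟩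
        | 1 => ⟨rfl, heq_fin_one rfl, HEq.rfl⟩
    | 1 => .univ_left (X := fun _ => (R.tensor Z W).as) R _ rfl (heq_fin_two (by rfl) (by rfl)) HEq.rfl)

lemma eps₀₀₁₂_eps₀₁₁ :
    R.eps₀₀₁₂ X Y Z W ≫ R.eps₀₁₁ (R.tensor X Y) Z W = R.eps₀₀₁₁ X Y Z W :=
  R.lift_comp_lift (fun
    | 0 => .univ_left (X := fun _ => (R.tensor X Y).as) R _ rfl (heq_fin_two (by rfl) (by rfl)) HEq.rfl
    | 1 => .univ_right R _ fun
        | 0 => ⟨rfl, heq_fin_one rfl, HEq.rfl⟩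
        | 1 => ⟨rfl, heq_fin_one rfl, HEq.rfl⟩)

end pentagon

section hexagon

variable (X Y Z : Ho C)

/-- The morphism `X ⊗ Y ⊗ Z ⟶ Z ⊗ X ⊗ Y`. -/
noncomputable def cyc : (⟨R.T 2 ![X.as, Y.as, Z.as]⟩ : Ho C) ⟶ ⟨R.T 2 ![Z.as, X.as, Y.as]⟩ :=
  R.lift FinSurj.perm₁₂₀ (X := ![X.as, Y.as, Z.as]) (Y := ![Z.as, X.as, Y.as])
    (X' := fun i (_ : Fin 1) => ![Z.as, X.as, Y.as] i) (fun i _ => by fin_cases i <;> rfl)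
    (fun
      | 0 => R.univ 0 (fun _ => Z.as)
      | 1 => R.univ 0 (fun _ => X.as)
      | 2 => R.univ 0 (fun _ => Y.as))

/-- The morphism `X ⊗ Y ⊗ Z ⟶ X ⊗ Z ⊗ Y`. -/
noncomputable def swapRight :
    (⟨R.T 2 ![X.as, Y.as, Z.as]⟩ : Ho C) ⟶ ⟨R.T 2 ![X.as, Z.as, Y.as]⟩ :=
  R.lift FinSurj.perm₀₂₁ (X := ![X.as, Y.as, Z.as]) (Y := ![X.as, Z.as, Y.as])
    (X' := fun i (_ : Fin 1) => ![X.as, Z.as, Y.as] i) (fun i _ => by fin_cases i <;> rfl)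
    (fun
      | 0 => R.univ 0 (fun _ => X.as)
      | 1 => R.univ 0 (fun _ => Z.as)
      | 2 => R.univ 0 (fun _ => Y.as))

/-- The morphism `X ⊗ Y ⊗ Z ⟶ Y ⊗ X ⊗ Z`. -/
noncomputable def swapLeft :
    (⟨R.T 2 ![X.as, Y.as, Z.as]⟩ : Ho C) ⟶ ⟨R.T 2 ![Y.as, X.as, Z.as]⟩ :=
  R.lift FinSurj.perm₁₀₂ (X := ![X.as, Y.as, Z.as]) (Y := ![Y.as, X.as, Z.as])
    (X' := fun i (_ : Fin 1) => ![Y.as, X.as, Z.as] i) (fun i _ => by fin_cases i <;> rfl)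
    (fun
      | 0 => R.univ 0 (fun _ => Y.as)
      | 1 => R.univ 0 (fun _ => X.as)
      | 2 => R.univ 0 (fun _ => Z.as))

lemma swapRight_swapLeft : R.swapRight X Y Z ≫ R.swapLeft X Z Y = R.cyc X Y Z :=
  R.lift_comp_lift (fun
    | 0 => .univ_left (X := fun _ => Z.as) R _ rfl (heq_fin_one rfl) HEq.rfl
    | 1 => .univ_left (X := fun _ => X.as) R _ rfl (heq_fin_one rfl) HEq.rfl
    | 2 => .univ_left (X := fun _ => Y.as) R _ rfl (heq_fin_one rfl) HEq.rfl)

lemma eps₀₀₁_tau :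
    R.eps₀₀₁ X Y Z ≫ R.tau (R.tensor X Y) Z = R.cyc X Y Z ≫ R.eps₀₁₁ Z X Y := by
  refine Eq.trans (b := R.lift FinSurj.surj₁₁₀ (X := ![X.as, Y.as, Z.as])
    (Y := ![Z.as, (R.tensor X Y).as])
    (X' := fun
      | 0 => fun (_ : Fin 1) => Z.as
      | 1 => (![X.as, Y.as] : Fin 2 → C.Obj))
    (fun
      | 0 => fun (_ : Fin 1) => rfl
      | 1 => fun (a : Fin 2) => by fin_cases a <;> rfl)
    (fun
      | 0 => R.univ 0 (fun _ => Z.as)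
      | 1 => R.univ 1 ![X.as, Y.as]))
    (R.lift_comp_lift (fun
      | 0 => .left (X := fun _ => Z.as) (𝟙 _) (R.univ 0 (fun _ => Z.as)) rfl (heq_fin_one rfl)
          HEq.rfl (id_smul _).symm
      | 1 => .left (X := fun _ => (R.tensor X Y).as) (𝟙 _) (R.univ 1 ![X.as, Y.as]) rfl
          (heq_fin_two (by rfl) (by rfl)) HEq.rfl (id_smul _).symm))
    (R.lift_comp_lift (fun
      | 0 => .univ_left (X := fun _ => Z.as) R _ rfl (heq_fin_one rfl) HEq.rfl
      | 1 => .univ_right R _ fun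
        | 0 => ⟨rfl, heq_fin_one rfl, HEq.rfl⟩
        | 1 => ⟨rfl, heq_fin_one rfl, HEq.rfl⟩)).symm

lemma swapRight_eps₀₁₁ : R.swapRight X Y Z ≫ R.eps₀₁₁ X Z Y =
    R.eps₀₁₁ X Y Z ≫ R.tensorHom (𝟙 X) (R.tau Y Z) := by
  refine Eq.trans (R.lift_comp_lift (fun
    | 0 => .univ_left (X := fun _ => X.as) R _ rfl (heq_fin_one rfl)
        (heq_of_eq (id_smul _))
    | 1 => ⟨_, swap, fun i _ => ![Z.as, Y.as] i, fun i _ => by fin_cases i <;> rfl, fun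
        | 0 => D.oneH0 (fun _ => Z.as) Z.as (𝟙 Z)
        | 1 => D.oneH0 (fun _ => Y.as) Y.as (𝟙 Y), fun
        | 0 => ⟨rfl, heq_fin_one rfl, by exact heq_of_eq (R.univ_zero (fun _ => Z.as)).symm⟩
        | 1 => ⟨rfl, heq_fin_one rfl, by exact heq_of_eq (R.univ_zero (fun _ => Y.as)).symm⟩,
          R.smul_lift _ _ _⟩))
    (R.lift_tensorHom _ _ _).symm

lemma swapLeft_eps₀₀₁ : R.swapLeft X Y Z ≫ R.eps₀₀₁ Y X Z =
    R.eps₀₀₁ X Y Z ≫ R.tensorHom (R.tau X Y) (𝟙 Z) := by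
  refine Eq.trans (R.lift_comp_lift (fun
    | 0 => ⟨_, swap, fun i _ => ![Y.as, X.as] i, fun i _ => by fin_cases i <;> rfl, fun
        | 0 => D.oneH0 (fun _ => Y.as) Y.as (𝟙 Y)
        | 1 => D.oneH0 (fun _ => X.as) X.as (𝟙 X), fun
        | 0 => ⟨rfl, heq_fin_one rfl, by exact heq_of_eq (R.univ_zero (fun _ => Y.as)).symm⟩
        | 1 => ⟨rfl, heq_fin_one rfl, by exact heq_of_eq (R.univ_zero (fun _ => X.as)).symm⟩,
          R.smul_lift _ _ _⟩
    | 1 => .univ_left (X := fun _ => Z.as) R _ rfl (heq_fin_one rfl)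
        (heq_of_eq (id_smul _))))
    (R.lift_tensorHom _ _ _).symm

end hexagon

end Rep

end PT

namespace PT.Rep

variable {C : PreDG.{u, v}} {D : PT C} {R : D.Rep} (hR : R.IsTensor)

/-! ### The tensor structure -/

section

variable (X Y Z W : Ho C)

lemma isIso_eps₀₁₁ (hR : R.IsTensor) : IsIso (R.eps₀₁₁ X Y Z) :=
  isIso_lift hR
    (fun
      | 0 => rfl
      | 1 => rfl)
    (fun
      | 0 => HEq.rfl
      | 1 => HEq.rfl)

lemma isIso_eps₀₀₁ (hR : R.IsTensor) : IsIso (R.eps₀₀₁ X Y Z) :=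
  isIso_lift hR
    (fun
      | 0 => rfl
      | 1 => rfl)
    (fun
      | 0 => HEq.rfl
      | 1 => HEq.rfl)

lemma isIso_eps₀₁₂₂ (hR : R.IsTensor) : IsIso (R.eps₀₁₂₂ X Y Z W) :=
  isIso_lift hR
    (fun
      | 0 => rfl
      | 1 => rfl
      | 2 => rfl)
    (fun
      | 0 => HEq.rfl
      | 1 => HEq.rfl
      | 2 => HEq.rfl)

/-- The associativity constraint. -/
noncomputable def assoc : R.tensor X (R.tensor Y Z) ≅ R.tensor (R.tensor X Y) Z :=
  letI := isIso_eps₀₁₁ X Y Z hR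
  letI := isIso_eps₀₀₁ X Y Z hR
  (asIso (R.eps₀₁₁ X Y Z)).symm ≪≫ asIso (R.eps₀₀₁ X Y Z)

lemma eps_assoc : R.eps₀₁₁ X Y Z ≫ (assoc hR X Y Z).hom = R.eps₀₀₁ X Y Z := by
  have := isIso_eps₀₁₁ X Y Z hR
  exact IsIso.hom_inv_id_assoc _ _

lemma epi_eps₀₁₁ (hR : R.IsTensor) : Epi (R.eps₀₁₁ X Y Z) :=
  have := isIso_eps₀₁₁ X Y Z hR
  inferInstance

variable {X Y Z W}

lemma assoc_natural {X' Y' Z' : Ho C} (f : X ⟶ X') (g : Y ⟶ Y') (h : Z ⟶ Z') :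
    R.tensorHom f (R.tensorHom g h) ≫ (assoc hR X' Y' Z').hom =
      (assoc hR X Y Z).hom ≫ R.tensorHom (R.tensorHom f g) h := by
  have := epi_eps₀₁₁ X Y Z hR
  rw [← cancel_epi (R.eps₀₁₁ X Y Z), ← Category.assoc, ← map₃_eps₀₁₁, Category.assoc, eps_assoc,
    map₃_eps₀₀₁, ← Category.assoc, eps_assoc]

variable (X Y Z W)

lemma tensorHom_comp_id {X Y Z : Ho C} (f : X ⟶ Y) (g : Y ⟶ Z) (W : Ho C) :
    R.tensorHom f (𝟙 W) ≫ R.tensorHom g (𝟙 W) = R.tensorHom (f ≫ g) (𝟙 W) := by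
  rw [← tensorHom_comp, Category.comp_id]

lemma tensorHom_id_comp {X Y Z : Ho C} (f : X ⟶ Y) (g : Y ⟶ Z) (W : Ho C) :
    R.tensorHom (𝟙 W) f ≫ R.tensorHom (𝟙 W) g = R.tensorHom (𝟙 W) (f ≫ g) := by
  rw [← tensorHom_comp, Category.comp_id]

lemma pentagon : (assoc hR X Y (R.tensor Z W)).hom ≫ (assoc hR (R.tensor X Y) Z W).hom =
    R.tensorHom (𝟙 X) (assoc hR Y Z W).hom ≫ (assoc hR X (R.tensor Y Z) W).hom ≫
      R.tensorHom (assoc hR X Y Z).hom (𝟙 W) := by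
  have := isIso_eps₀₁₂₂ X Y Z W hR
  have := isIso_eps₀₁₁ X Y (R.tensor Z W) hR
  rw [← cancel_epi (R.eps₀₁₂₂ X Y Z W ≫ R.eps₀₁₁ X Y (R.tensor Z W))]
  have lhs : (R.eps₀₁₂₂ X Y Z W ≫ R.eps₀₁₁ X Y (R.tensor Z W)) ≫
      (assoc hR X Y (R.tensor Z W)).hom ≫ (assoc hR (R.tensor X Y) Z W).hom =
      R.eps₀₀₀₁ X Y Z W ≫ R.tensorHom (R.eps₀₀₁ X Y Z) (𝟙 W) := by
    rw [Category.assoc, ← Category.assoc (R.eps₀₁₁ _ _ _), eps_assoc, ← Category.assoc,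
      eps₀₁₂₂_eps₀₀₁, ← eps₀₀₁₂_eps₀₁₁, Category.assoc, eps_assoc, eps₀₀₁₂_eps₀₀₁]
  rw [lhs, eps₀₁₂₂_eps₀₁₁, Category.assoc, ← Category.assoc (R.tensorHom _ _), tensorHom_id_comp,
    eps_assoc, ← Category.assoc, ← eps₀₁₁₂_eps₀₁₁, Category.assoc, ← Category.assoc (R.eps₀₁₁ _ _ _),
    eps_assoc, ← Category.assoc, eps₀₁₁₂_eps₀₀₁, Category.assoc, tensorHom_comp_id, eps_assoc]

lemma hexagon : (assoc hR X Y Z).hom ≫ R.tau (R.tensor X Y) Z ≫ (assoc hR Z X Y).hom =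
    R.tensorHom (𝟙 X) (R.tau Y Z) ≫ (assoc hR X Z Y).hom ≫ R.tensorHom (R.tau X Z) (𝟙 Y) := by
  have := epi_eps₀₁₁ X Y Z hR
  rw [← cancel_epi (R.eps₀₁₁ X Y Z), ← Category.assoc, eps_assoc, ← Category.assoc, eps₀₀₁_tau,
    Category.assoc, eps_assoc, ← Category.assoc (R.eps₀₁₁ _ _ _), ← swapRight_eps₀₁₁,
    Category.assoc, ← Category.assoc (R.eps₀₁₁ _ _ _), eps_assoc, ← swapLeft_eps₀₀₁,
    ← Category.assoc, swapRight_swapLeft]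

end

/-- The tensor structure on `H⁰ C` given by a representable pseudo-tensor structure. -/
noncomputable def tensorStr : TensorStr (Ho C) R.tensor where
  hom := R.tensorHom
  hom_id := R.tensorHom_id
  hom_comp := R.tensorHom_comp
  add_hom := R.add_tensorHom
  hom_add := R.tensorHom_add
  assoc := assoc hR
  assoc_natural := assoc_natural hR
  symm X Y := ⟨R.tau X Y, R.tau Y X, R.tau_tau X Y, R.tau_tau Y X⟩
  symm_natural := R.tensorHom_tau
  symm_symm := R.tau_tau
  pentagon := pentagon hR
  hexagon := hexagon hR

lemma gives_tensorStr : R.Gives (tensorStr hR) where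
  hom_eq _ _ := rfl
  assoc_eq := eps_assoc hR
  symm_eq _ _ := rfl

end PT.Rep

namespace TensorStr

variable {A : Type*} [Category A] [Preadditive A] {t : A → A → A} (S : TensorStr A t)

/-- The isomorphism `f ⊗ Y`. -/
def whiskerIso {X X' : A} (f : X ≅ X') (Y : A) : t X Y ≅ t X' Y where
  hom := S.hom f.hom (𝟙 Y)
  inv := S.hom f.inv (𝟙 Y)
  hom_inv_id := by rw [← S.hom_comp, f.hom_inv_id, Category.comp_id, S.hom_id]
  inv_hom_id := by rw [← S.hom_comp, f.inv_hom_id, Category.comp_id, S.hom_id]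

lemma hom_comp_id {X Y Z : A} (f : X ⟶ Y) (g : Y ⟶ Z) (W : A) :
    S.hom f (𝟙 W) ≫ S.hom g (𝟙 W) = S.hom (f ≫ g) (𝟙 W) := by
  rw [← S.hom_comp, Category.comp_id]

/-- It suffices to treat translations in the left variable, and triangles tensored on the right. -/
lemma isTriangulated_of_left (T : A ⥤ A)
    (dist : ∀ {X Y Z : A}, (X ⟶ Y) → (Y ⟶ Z) → (Z ⟶ T.obj X) → Prop)
    (hdist : ∀ {X Y Z X' Y' Z' : A} {f : X ⟶ Y} {g : Y ⟶ Z} {h : Z ⟶ T.obj X} {f' : X' ⟶ Y'}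
      {g' : Y' ⟶ Z'} {h' : Z' ⟶ T.obj X'} (a : X ≅ X') (b : Y ≅ Y') (c : Z ≅ Z'),
      f ≫ b.hom = a.hom ≫ f' → g ≫ c.hom = b.hom ≫ g' → h ≫ T.map a.hom = c.hom ≫ h' →
      dist f' g' h' → dist f g h)
    (l : ∀ X Y : A, t (T.obj X) Y ≅ T.obj (t X Y))
    (hl : ∀ {X Y X' Y' : A} (f : X ⟶ X') (g : Y ⟶ Y'),
      S.hom (T.map f) g ≫ (l X' Y').hom = (l X Y).hom ≫ T.map (S.hom f g))
    (H : ∀ {X Y Z : A} (f : X ⟶ Y) (g : Y ⟶ Z) (h : Z ⟶ T.obj X), dist f g h →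
      ∃ (X' Y' Z' : A) (f' : X' ⟶ Y') (g' : Y' ⟶ Z') (h' : Z' ⟶ T.obj X') (a : X ≅ X')
        (b : Y ≅ Y') (c : Z ≅ Z'), f ≫ b.hom = a.hom ≫ f' ∧ g ≫ c.hom = b.hom ≫ g' ∧
        h ≫ T.map a.hom = c.hom ≫ h' ∧ ∀ W : A,
          dist (S.hom f' (𝟙 W)) (S.hom g' (𝟙 W)) (S.hom h' (𝟙 W) ≫ (l X' W).hom)) :
    S.IsTriangulated T dist := by
  have h : ∀ {X Y Z : A} (f : X ⟶ Y) (g : Y ⟶ Z) (h : Z ⟶ T.obj X), dist f g h → ∀ W : A,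
      dist (S.hom f (𝟙 W)) (S.hom g (𝟙 W)) (S.hom h (𝟙 W) ≫ (l X W).hom) := by
    intro X Y Z f g h hd W
    obtain ⟨X', Y', Z', f', g', h', a, b, c, h₁, h₂, h₃, h₄⟩ := H f g h hd
    refine hdist (S.whiskerIso a W) (S.whiskerIso b W) (S.whiskerIso c W) ?_ ?_ ?_ (h₄ W)
    · simp only [whiskerIso, hom_comp_id, h₁]
    · simp only [whiskerIso, hom_comp_id, h₂]
    · simp only [whiskerIso, Category.assoc, ← hl]
      rw [← Category.assoc, ← Category.assoc, hom_comp_id, hom_comp_id, h₃]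
  refine ⟨l, fun X Y => S.symm X (T.obj Y) ≪≫ l Y X ≪≫ T.mapIso (S.symm Y X), hl, ?_, ?_, ?_⟩
  · intro X Y X' Y' f g
    simp only [Iso.trans_hom, Functor.mapIso_hom, Category.assoc]
    rw [← T.map_comp, ← S.symm_natural, T.map_comp, ← reassoc_of% (hl g f),
      ← reassoc_of% (S.symm_natural f (T.map g))]
  · intro X Y
    simp only [Iso.trans_hom, Functor.mapIso_hom]
    rw [← Category.assoc, S.symm_symm, Category.id_comp]
  · intro X Y Z f g k hd W
    refine ⟨h f g k hd W, hdist (S.symm W X) (S.symm W Y) (S.symm W Z)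
      (S.symm_natural _ _) (S.symm_natural _ _) ?_ (h f g k hd W)⟩
    simp only [Iso.trans_hom, Functor.mapIso_hom, Category.assoc]
    rw [← T.map_comp, S.symm_symm, T.map_id, Category.comp_id,
      ← reassoc_of% (S.symm_natural (𝟙 W) k)]

end TensorStr

namespace DGCat

variable {C : DGCat.{u, v}}

lemma dist_of_iso {X Y Z X' Y' Z' : C.Kb} {f : X ⟶ Y} {g : Y ⟶ Z} {h : Z ⟶ C.translation.obj X}
    {f' : X' ⟶ Y'} {g' : Y' ⟶ Z'} {h' : Z' ⟶ C.translation.obj X'} (a : X ≅ X') (b : Y ≅ Y')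
    (c : Z ≅ Z') (hf : f ≫ b.hom = a.hom ≫ f') (hg : g ≫ c.hom = b.hom ≫ g')
    (hh : h ≫ C.translation.map a.hom = c.hom ≫ h') (H : dist f' g' h') : dist f g h := by
  obtain ⟨E, F, ψ, hψ, a', b', c', h1, h2, h3⟩ := H
  refine ⟨E, F, ψ, hψ, a ≪≫ a', b ≪≫ b', c ≪≫ c', ?_, ?_, ?_⟩
  · simp only [Iso.trans_hom, Category.assoc]
    rw [← h1, reassoc_of% hf]
  · simp only [Iso.trans_hom, Category.assoc]
    rw [← h2, reassoc_of% hg]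
  · simp only [Iso.trans_hom, Category.assoc]
    rw [← h3, Functor.map_comp, reassoc_of% hh]
    rfl

end DGCat

/-- A translation functor of degree one. -/
structure PreDG.Translation (A : PreDG.{u, v}) where
  fn : DGFun A A
  data : ∀ E, A.Shift 1 E (fn.obj E)
  natural : ∀ {E F : A.Obj} (f : (A.hom E F).X 0),
    A.comp (add_zero 1) (data F).v ((fn.map E F).f 0 f) = A.comp (zero_add 1) f (data E).v

lemma PreDG.Translation.natural_w {A : PreDG.{u, v}} (t : A.Translation) {E F : A.Obj}
    (f : (A.hom E F).X 0) : A.comp (add_zero (-1)) (t.data F).w f =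
      A.comp (zero_add (-1)) ((t.fn.map E F).f 0 f) (t.data E).w := by
  have h := congrArg (fun x => A.comp (add_zero (-1)) (t.data F).w
    (A.comp (add_neg_cancel 1) x (t.data E).w)) (t.natural f)
  rw [A.assoc (bc := -1) (abc := 0) _ _ (by omega) (by omega),
    A.assoc (bc := 0) (abc := 0) _ _ (by omega) (by omega), (t.data E).v_w, A.comp_id,
    ← A.assoc (ab := 0) (by omega) (by omega), (t.data F).w_v, A.id_comp] at h
  exact h.symm

namespace PT

variable {A : PreDG.{u, v}} (D : PT A)

/-- A pair of morphisms of degree zero. -/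
def pairHom {X Y X' Y' : A.Obj} (f : (A.hom X X').X 0) (g : (A.hom Y Y').X 0) :
    ∀ b : Fin 2, (A.hom ((![X, Y] : Fin 2 → A.Obj) b) ((![X', Y'] : Fin 2 → A.Obj) b)).X 0
  | 0 => f
  | 1 => g

lemma d_pairHom {X Y X' Y' : A.Obj} {f : (A.hom X X').X 0} {g : (A.hom Y Y').X 0}
    (hf : (A.hom X X').d 0 1 rfl f = 0) (hg : (A.hom Y Y').d 0 1 rfl g = 0) :
    ∀ b, (A.hom _ _).d 0 1 rfl (pairHom f g b) = 0
  | 0 => hf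
  | 1 => hg

/-- The operation of a pair of morphisms of degree zero on `P({X', Y'}, Z)`. -/
def pullPair {X Y X' Y' Z : A.Obj} {a : ℤ} (f : (A.hom X X').X 0) (g : (A.hom Y Y').X 0) :
    (D.P 1 ![X', Y'] Z).X a →+ (D.P 1 ![X, Y] Z).X a :=
  D.pull (by simp) (pairHom f g)

lemma d_pullPair {X Y X' Y' Z : A.Obj} {a b : ℤ} (h : a + 1 = b) {f : (A.hom X X').X 0}
    {g : (A.hom Y Y').X 0} (hf : (A.hom X X').d 0 1 rfl f = 0)
    (hg : (A.hom Y Y').d 0 1 rfl g = 0) (x : (D.P 1 ![X', Y'] Z).X a) :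
    (D.P 1 ![X, Y] Z).d a b h (D.pullPair f g x) = D.pullPair f g ((D.P 1 _ Z).d a b h x) :=
  D.d_pull_of_closed _ h h _ (d_pairHom hf hg) x

lemma d_pullPair_zero {X Y X' Y' Z : A.Obj} {f : (A.hom X X').X 0}
    {g : (A.hom Y Y').X 0} (hf : (A.hom X X').d 0 1 rfl f = 0)
    (hg : (A.hom Y Y').d 0 1 rfl g = 0) {x : (D.P 1 ![X', Y'] Z).X 0}
    (hx : (D.P 1 ![X', Y'] Z).d 0 1 rfl x = 0) :
    (D.P 1 ![X, Y] Z).d 0 1 rfl (D.pullPair f g x) = 0 := by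
  rw [D.d_pullPair (zero_add 1) hf hg x, hx, map_zero]

lemma compH0_pair {X Y X' Y' Z : A.Obj} {f : (A.hom X X').X 0} {g : (A.hom Y Y').X 0}
    (hf : (A.hom X X').d 0 1 rfl f = 0) (hg : (A.hom Y Y').d 0 1 rfl g = 0)
    (x : (D.P 1 ![X', Y'] Z).X 0) (hx : (D.P 1 ![X', Y'] Z).d 0 1 rfl x = 0) :
    D.compH0 (FinSurj.refl 1) (X := ![X, Y]) (X' := fun i _ => (![X, Y] : Fin 2 → A.Obj) i)
      (Y := ![X', Y']) (fun _ _ => rfl) ((D.cx 1 ![X', Y'] Z).cls x hx) (fun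
        | 0 => D.oneH0 (fun _ => X) X' (Ho.ofClosed f hf)
        | 1 => D.oneH0 (fun _ => Y) Y' (Ho.ofClosed g hg)) =
      (D.cx 1 ![X, Y] Z).cls (D.pullPair f g x)
        (D.d_pullPair_zero hf hg hx) := by
  refine (congrArg _ ?_).trans (D.compH0_cls (FinSurj.refl 1) (X := ![X, Y])
    (X' := fun i _ => (![X, Y] : Fin 2 → A.Obj) i) (Y := ![X', Y']) (fun _ _ => rfl) x hx
    (fun b => D.one (X := fun _ => (![X, Y] : Fin 2 → A.Obj) b) (pairHom f g b))
    (fun b => d_one_zero (X := fun _ => (![X, Y] : Fin 2 → A.Obj) b) (d_pairHom hf hg b)))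
  funext b
  match b with
  | 0 => exact oneH0_ofClosed (X := fun _ => X) f hf
  | 1 => exact oneH0_ofClosed (X := fun _ => Y) g hg

variable {D} in
lemma Rep.smul_tensorHom (R : D.Rep) {X Y X' Y' : A.Obj} {f : (A.hom X X').X 0}
    {g : (A.hom Y Y').X 0}
    (hf : (A.hom X X').d 0 1 rfl f = 0) (hg : (A.hom Y Y').d 0 1 rfl g = 0) {Z : A.Obj}
    (h : R.tensor ⟨X'⟩ ⟨Y'⟩ ⟶ ⟨Z⟩) (x : (D.P 1 ![X', Y'] Z).X 0)
    (hx : (D.P 1 ![X', Y'] Z).d 0 1 rfl x = 0)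
    (hh : D.smul h (R.univ 1 ![X', Y']) = (D.cx 1 ![X', Y'] Z).cls x hx) :
    D.smul (R.tensorHom (Ho.ofClosed f hf) (Ho.ofClosed g hg) ≫ h) (R.univ 1 ![X, Y]) =
      (D.cx 1 ![X, Y] Z).cls (D.pullPair f g x)
        (D.d_pullPair_zero hf hg hx) := by
  refine (comp_smul _ _ _).trans ?_
  refine (congrArg (D.smul h) (R.smul_lift _ _ _)).trans ?_
  refine (smul_compH0 _ _ _).trans ?_
  rw [hh]
  exact D.compH0_pair hf hg x hx

/-- The first variable of the families `{V, W}`. -/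
def slotPair (W : A.Obj) : Slot A 1 where
  F V := ![V, W]
  p b := b = 0
  base := 0
  p_iff _ := Iff.rfl
  map f
    | 0 => f
    | 1 => A.id W
  map_id V
    | 0 => rfl
    | 1 => rfl
  map_comp h f g
    | 0 => rfl
    | 1 => A.comp_id _ _
  map_add f g
    | 0 => fun _ => rfl
    | 1 => fun h => absurd h (by decide)
  map_not f g
    | 0 => fun h => absurd rfl h
    | 1 => fun _ => rfl
  d_map ha f
    | 0 => fun _ => rfl
    | 1 => fun h => absurd h (by decide)
  d_map_not f
    | 0 => fun h => absurd rfl h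
    | 1 => fun _ h => by
      obtain rfl := h
      exact A.d_id W

end PT

namespace PT

variable {A : PreDG.{u, v}} (D : PT A) (t : A.Translation)

/-- The map `P({X, Y}, Z) → P({X[1], Y}, Z[1])`. -/
def sig {X Y Z : A.Obj} {a : ℤ} :
    (D.P 1 ![X, Y] Z).X a →+ (D.P 1 ![t.fn.obj X, Y] (t.fn.obj Z)).X a :=
  (AddMonoidHom.mk' (fun x => D.act (a := -1) (b := a + 1) (by omega) (t.data Z).w x)
    (D.act_add_right (show -1 + (a + 1) = a by omega) _)).comp
    (AddMonoidHom.mk' (fun x : (D.P 1 ![X, Y] Z).X a =>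
      D.slotAct (slotPair Y) (V := t.fn.obj X) (W := X) rfl x (t.data X).v)
    (fun x y => D.slotAct_add_left (S := slotPair Y) (W := X) _ x y _))

lemma sig_eq {X Y Z : A.Obj} {a : ℤ} (x : (D.P 1 ![X, Y] Z).X a) :
    D.sig t x = D.act (by omega) (t.data Z).w
      (D.slotAct (slotPair Y) (V := t.fn.obj X) (W := X) rfl x (t.data X).v) := rfl

lemma slotPair_sub_left {V W Y Z : A.Obj} {a b c : ℤ} (h : a + b = c)
    (x y : (D.P 1 ![W, Y] Z).X a) (f : (A.hom V W).X b) :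
    D.slotAct (slotPair Y) (V := V) (W := W) h (x - y) f =
      D.slotAct (slotPair Y) (V := V) (W := W) h x f -
        D.slotAct (slotPair Y) (V := V) (W := W) h y f :=
  map_sub (D.pull _ _) x y

lemma slotPair_zero_right {V W Y Z : A.Obj} {a b c : ℤ} (h : a + b = c)
    (x : (D.P 1 ![W, Y] Z).X a) :
    D.slotAct (slotPair Y) (V := V) (W := W) h x (0 : (A.hom V W).X b) = 0 :=
  map_zero ((D.slotMod (slotPair Y) Z).act (X := V) (Y := W) h x)

lemma d_slotPair {V W Y Z : A.Obj} {a b c a' c' : ℤ} (h : a + b = c) (ha : a + 1 = a')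
    (hc : c + 1 = c') (x : (D.P 1 ![W, Y] Z).X a) (f : (A.hom V W).X b)
    (hf : (A.hom V W).d b (b + 1) rfl f = 0) :
    (D.P 1 ![V, Y] Z).d c c' hc (D.slotAct (slotPair Y) (V := V) (W := W) h x f) =
      D.slotAct (slotPair Y) (V := V) (W := W) (by omega) ((D.P 1 ![W, Y] Z).d a a' ha x) f := by
  refine (D.d_slotAct (slotPair Y) h ha rfl hc x f).trans ?_
  rw [hf, slotPair_zero_right]
  exact (congrArg _ (smul_zero _)).trans (add_zero _)

lemma d_sig {X Y Z : A.Obj} {a b : ℤ} (h : a + 1 = b) (x : (D.P 1 ![X, Y] Z).X a) :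
    (D.P 1 ![t.fn.obj X, Y] (t.fn.obj Z)).d a b h (D.sig t x) =
      - D.sig t ((D.P 1 ![X, Y] Z).d a b h x) := by
  subst h
  rw [sig_eq, sig_eq]
  refine (D.d_act _ rfl rfl _ _ _).trans ?_
  rw [(t.data Z).d_w, D.d_slotPair rfl rfl rfl x _ (t.data X).d_v]
  simp only [Int.negOnePow_neg, Int.negOnePow_one, Units.neg_smul, one_smul]
  exact (congrArg (· + _) (D.act_zero_left _ _)).trans (zero_add _)

lemma sig_act {X Y Z Z' : A.Obj} {a : ℤ} (f : (A.hom Z Z').X 0) (x : (D.P 1 ![X, Y] Z).X a) :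
    D.act (zero_add a) ((t.fn.map Z Z').f 0 f) (D.sig t x) = D.sig t (D.act (zero_add a) f x) := by
  rw [sig_eq, sig_eq]
  refine (D.comp_act (zero_add (-1)) (show -1 + (a + 1) = a by omega) _ _ _ _ _).symm.trans ?_
  rw [← t.natural_w]
  refine (D.comp_act (add_zero (-1)) (show -1 + (a + 1) = a by omega) (zero_add (a + 1))
    (show -1 + (a + 1) = a by omega) _ _ _).trans ?_
  exact congrArg (D.act _ _) (D.act_pull _ _ _ _ _ _ _)

lemma sig_pullPair {X Y X' Y' Z : A.Obj} {a : ℤ} (f : (A.hom X X').X 0) (g : (A.hom Y Y').X 0)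
    (x : (D.P 1 ![X', Y'] Z).X a) :
    D.pullPair ((t.fn.map X X').f 0 f) g (D.sig t x) = D.sig t (D.pullPair f g x) := by
  rw [sig_eq, sig_eq]
  refine (D.act_pull (b := a + 1) (by simp) (show -1 + (a + 1) = a by omega)
    (show -1 + (a + 1) = a by omega) _ _ _ _).symm.trans ?_
  refine congrArg (D.act _ _) ?_
  have hs : a + ∑ b : Fin 2, (if b = 0 then (1 : ℤ) else 0) = a + 1 := by simp
  refine (D.pull_pull_of_zero _ _ _ _ (δ'' := fun b => if b = 0 then 1 else 0)
    (fun b => add_zero _) hs (fun _ _ _ => zero_mul _) _).trans ?_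
  refine Eq.trans ?_ (D.pull_pull_of_zero _ _ _ _ (δ'' := fun b => if b = 0 then 1 else 0)
    (fun b => zero_add _) hs (fun _ _ _ => mul_zero _) _).symm
  refine D.pull_congr _ _ _ _ (fun b => ⟨rfl, ?_⟩) _
  match b with
  | 0 => exact t.natural f
  | 1 => exact (A.id_comp (zero_add 0) g).trans (A.comp_id (add_zero 0) g).symm

variable {D} {t}

lemma isUniv_sig {X Y T : A.Obj} {u : (D.P 1 ![X, Y] T).X 0} (hu : D.IsUniv u) :
    D.IsUniv (D.sig t u) := by
  have hd : (D.P 1 ![t.fn.obj X, Y] (t.fn.obj T)).d 0 1 rfl (D.sig t u) = 0 := by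
    rw [d_sig, hu.1]
    rw [map_zero, neg_zero]
  refine (D.slotBimod_isUniv (slotPair Y) (V := t.fn.obj X)).1 ⟨hd, fun Z =>
    ((D.slotBimod (slotPair Y)).pairing Z).qi_shift (t.data X) (t.data T) u hu.1 _ hd ?_ (hu.2 Z)⟩
  refine ((D.slotBimod (slotPair Y)).comp_act (V := t.fn.obj X) (add_neg_cancel 1) (zero_add 1)
    (neg_add_cancel 1) (add_zero 1)
    (t.data T).v (t.data T).w
    (D.slotAct (slotPair Y) (V := t.fn.obj X) (W := X) (zero_add 1) u (t.data X).v)).symm.trans ?_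
  rw [(t.data T).v_w]
  exact (D.slotBimod (slotPair Y)).id_act _ _

end PT

namespace PT

variable {A : PreDG.{u, v}} {D : PT A} (t : A.Translation)

lemma Rep.exists_iso_of_isUniv (R : D.Rep) {n : ℕ} {X : Fin (n + 1) → A.Obj} {Z : A.Obj}
    {u : (D.P n X Z).X 0} (hu : D.IsUniv u) :
    ∃ c : (⟨R.T n X⟩ : Ho A) ≅ ⟨Z⟩, D.smul c.hom (R.univ n X) = (D.cx n X Z).cls u hu.1 := by
  obtain ⟨φ, z, hφ, hz⟩ := (R.isUniv_rep_univ n X).exists_hoEquiv hu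
  have := (PreDG.isHoEquiv_iff φ hφ.1).1 hφ
  refine ⟨asIso (Ho.ofClosed φ hφ.1), ?_⟩
  have h := Cx.cls_rep _ (R.univ n X)
  rw [← h]
  refine (smul_cls φ _ hφ.1 ((D.cx n X (R.T n X)).d_rep (zero_add 1) _)).trans ?_
  exact ((D.cx n X Z).cls_eq _ _ _ _ (neg_add_cancel 1) z hz).symm

/-- The isomorphism `X[1] ⊗ Y ≅ (X ⊗ Y)[1]`. -/
noncomputable def Rep.shiftLeft (R : D.Rep) (X Y : Ho A) :
    R.tensor (t.fn.ho.obj X) Y ≅ t.fn.ho.obj (R.tensor X Y) :=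
  (R.exists_iso_of_isUniv (isUniv_sig (t := t) (R.isUniv_rep_univ 1 ![X.as, Y.as]))).choose

variable {t}

lemma d_sig_zero {X Y Z : A.Obj} {x : (D.P 1 ![X, Y] Z).X 0}
    (hx : (D.P 1 ![X, Y] Z).d 0 1 rfl x = 0) :
    (D.P 1 ![t.fn.obj X, Y] (t.fn.obj Z)).d 0 1 rfl (D.sig t x) = 0 := by
  rw [d_sig, hx, map_zero, neg_zero]

lemma cls_sig_congr {X Y Z : A.Obj} {x y : (D.P 1 ![X, Y] Z).X 0}
    {hx : (D.P 1 ![X, Y] Z).d 0 1 rfl x = 0} {hy : (D.P 1 ![X, Y] Z).d 0 1 rfl y = 0}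
    (h : (D.cx 1 ![X, Y] Z).cls x hx = (D.cx 1 ![X, Y] Z).cls y hy) :
    (D.cx 1 ![t.fn.obj X, Y] (t.fn.obj Z)).cls (D.sig t x) (d_sig_zero hx) =
      (D.cx 1 ![t.fn.obj X, Y] (t.fn.obj Z)).cls (D.sig t y) (d_sig_zero hy) := by
  obtain ⟨z, hz⟩ := Cx.exists_of_cls_eq _ (neg_add_cancel 1) h
  refine Cx.cls_eq _ _ _ _ _ (neg_add_cancel 1) (- D.sig t z) ?_
  refine (map_neg ((D.P 1 ![t.fn.obj X, Y] (t.fn.obj Z)).d (-1) 0 (neg_add_cancel 1)) _).trans ?_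
  refine (congrArg Neg.neg (D.d_sig t (neg_add_cancel 1) z)).trans ?_
  refine (neg_neg _).trans ?_
  exact (congrArg (D.sig t) hz).trans (D.sig t |>.map_sub x y)

lemma Rep.smul_shiftLeft (R : D.Rep) {X Y : A.Obj} {u : (D.P 1 ![X, Y] (R.T 1 ![X, Y])).X 0}
    (hu : (D.P 1 ![X, Y] (R.T 1 ![X, Y])).d 0 1 rfl u = 0)
    (h : R.univ 1 ![X, Y] = (D.cx 1 ![X, Y] (R.T 1 ![X, Y])).cls u hu) :
    D.smul (R.shiftLeft t ⟨X⟩ ⟨Y⟩).hom (R.univ 1 ![t.fn.obj X, Y]) =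
      (D.cx 1 ![t.fn.obj X, Y] (t.fn.obj (R.T 1 ![X, Y]))).cls (D.sig t u) (d_sig_zero hu) := by
  refine (R.exists_iso_of_isUniv
    (isUniv_sig (t := t) (R.isUniv_rep_univ 1 ![X, Y]))).choose_spec.trans ?_
  exact cls_sig_congr ((Cx.cls_rep _ _).trans h)

lemma Rep.cls_act_univ (R : D.Rep) {X Y X' Y' : A.Obj} {f : (A.hom X X').X 0}
    {g : (A.hom Y Y').X 0} (hf : (A.hom X X').d 0 1 rfl f = 0) (hg : (A.hom Y Y').d 0 1 rfl g = 0)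
    {θ : (A.hom (R.T 1 ![X, Y]) (R.T 1 ![X', Y'])).X 0} (hθ : (A.hom _ _).d 0 1 rfl θ = 0)
    (h : Ho.ofClosed θ hθ = R.tensorHom (Ho.ofClosed f hf) (Ho.ofClosed g hg))
    {u : (D.P 1 ![X, Y] (R.T 1 ![X, Y])).X 0}
    (hu : (D.P 1 ![X, Y] (R.T 1 ![X, Y])).d 0 1 rfl u = 0)
    (h₁ : R.univ 1 ![X, Y] = (D.cx 1 ![X, Y] (R.T 1 ![X, Y])).cls u hu)
    {u' : (D.P 1 ![X', Y'] (R.T 1 ![X', Y'])).X 0}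
    (hu' : (D.P 1 ![X', Y'] (R.T 1 ![X', Y'])).d 0 1 rfl u' = 0)
    (h₂ : R.univ 1 ![X', Y'] = (D.cx 1 ![X', Y'] (R.T 1 ![X', Y'])).cls u' hu') :
    (D.cx 1 ![X, Y] (R.T 1 ![X', Y'])).cls (D.act (add_zero 0) θ u) (d_act_zero hθ hu) =
      (D.cx 1 ![X, Y] (R.T 1 ![X', Y'])).cls (D.pullPair f g u') (D.d_pullPair_zero hf hg hu') := by
  rw [← smul_cls θ u hθ hu, h, ← h₁]
  refine (R.smul_lift _ _ _).trans ?_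
  rw [h₂]
  exact D.compH0_pair hf hg u' hu'

lemma Rep.shiftLeft_natural (R : D.Rep) {X Y X' Y' : Ho A} (f : X ⟶ X') (g : Y ⟶ Y') :
    R.tensorHom (t.fn.ho.map f) g ≫ (R.shiftLeft t X' Y').hom =
      (R.shiftLeft t X Y).hom ≫ t.fn.ho.map (R.tensorHom f g) := by
  obtain ⟨f, hf, rfl⟩ := Ho.exists_ofClosed f
  obtain ⟨g, hg, rfl⟩ := Ho.exists_ofClosed g
  obtain ⟨θ, hθ, h⟩ := Ho.exists_ofClosed (R.tensorHom (Ho.ofClosed f hf) (Ho.ofClosed g hg))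
  obtain ⟨u, hu, h₁⟩ := exists_cls (R.univ 1 ![X.as, Y.as])
  obtain ⟨u', hu', h₂⟩ := exists_cls (R.univ 1 ![X'.as, Y'.as])
  have e := R.cls_act_univ hf hg hθ h hu h₁.symm hu' h₂.symm
  have hTf : (A.hom _ _).d 0 1 rfl ((t.fn.map X.as X'.as).f 0 f) = 0 := by
    rw [← (t.fn.map X.as X'.as).comm, hf, map_zero]
  have hTθ : (A.hom _ _).d 0 1 rfl ((t.fn.map _ _).f 0 θ) = 0 := by
    rw [← (t.fn.map _ _).comm, hθ, map_zero]
  refine R.hom_ext ?_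
  refine (R.smul_tensorHom hTf hg _ _ (d_sig_zero hu') (R.smul_shiftLeft hu' h₂.symm)).trans ?_
  rw [← h]
  refine Eq.trans ?_ (comp_smul _ _ _).symm
  refine Eq.trans ?_ (congrArg (D.smul _) (R.smul_shiftLeft hu h₁.symm)).symm
  refine Eq.trans ?_ (smul_cls _ _ hTθ (d_sig_zero hu)).symm
  simp only [sig_pullPair, sig_act]
  exact (cls_sig_congr e).symm

end PT

namespace PT

variable {A : PreDG.{u, v}} {D : PT A} {t : A.Translation}

lemma slotAct_slotPair {V V' W Z : A.Obj} (f : (A.hom V V').X 0) (x : (D.P 1 ![V', W] Z).X 0) :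
    D.slotAct (slotPair W) (V := V) (W := V') (add_zero 0) x f = D.pullPair f (A.id W) x :=
  D.pull_congr _ _ _ _ (fun
    | 0 => ⟨rfl, rfl⟩
    | 1 => ⟨rfl, rfl⟩) x

lemma isUniv_extElt {E F K W T T' TK : A.Obj} {ψ : (A.hom E F).X 0} {θ : (A.hom T T').X 0}
    (e : A.Ext F (t.fn.obj E) K) (he : e.x = A.comp (zero_add 1) ψ (t.data E).v)
    (s : A.Ext T' (t.fn.obj T) TK) (hs : s.x = A.comp (zero_add 1) θ (t.data T).v)
    {u : (D.P 1 ![E, W] T).X 0} {u' : (D.P 1 ![F, W] T').X 0}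
    (hu : D.IsUniv u) (hu' : D.IsUniv u') {z : (D.P 1 ![E, W] T').X (-1)}
    (hz : (D.P 1 ![E, W] T').d (-1) 0 rfl z =
      D.pullPair ψ (A.id W) u' - D.act (add_zero 0) θ u) :
    D.IsUniv (n := 1) (X := ![K, W]) ((D.slotBimod (slotPair W)).extElt e s u' (D.sig t u)
      (D.slotAct (slotPair W) (V := t.fn.obj E) (W := E) (neg_add_cancel 1) z (t.data E).v)) := by
  have hB : D.IsUniv (D.sig t u) := isUniv_sig hu
  have hK := (D.slotBimod (slotPair W)).d_extElt e s u' (D.sig t u)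
    (D.slotAct (slotPair W) (V := t.fn.obj E) (W := E) (neg_add_cancel 1) z (t.data E).v)
    hu'.1 hB.1 (by
      refine (D.d_slotPair (neg_add_cancel 1) (neg_add_cancel 1) (zero_add 1) z _ (t.data E).d_v).trans ?_
      rw [hz, slotPair_sub_left]
      refine congrArg₂ _ ?_ ?_
      · rw [he]
        refine (congrArg (fun x => D.slotAct (slotPair W) (V := t.fn.obj E) (W := E) (zero_add 1) x
          (t.data E).v) (slotAct_slotPair ψ u').symm).trans ?_
        exact (D.slotMod (slotPair W) T').act_comp (X := t.fn.obj E) (Y := E) (Z := F) (add_zero 0)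
          (zero_add 1) (zero_add 1) (zero_add 1) u' ψ (t.data E).v
      · rw [hs]
        refine Eq.trans ?_ (D.comp_act (zero_add 1) (add_zero 1) (add_zero 1) (zero_add 1) _ _ _).symm
        refine Eq.trans ((D.slotBimod (slotPair W)).act_act (V := t.fn.obj E) (W := E) (add_zero 0)
          (zero_add 1) (zero_add 1) (zero_add 1) θ u (t.data E).v) (congrArg (D.act _ θ) ?_)
        refine Eq.trans ?_ (D.comp_act (add_neg_cancel 1) (zero_add 1) (neg_add_cancel 1)
          (add_zero 1) _ _ _)
        rw [(t.data T).v_w]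
        exact ((D.slotBimod (slotPair W)).id_act (zero_add 1) _).symm)
  refine (D.slotBimod_isUniv (slotPair W) (V := K)).1 ⟨hK, fun Z => ((D.slotBimod (slotPair W)).pairing Z).qi_ext e s u' (D.sig t u) _ hu'.1 hB.1
    hK (hu'.2 Z) (hB.2 Z)⟩

lemma Rep.exists_cone_iso (R : D.Rep) {E F K W TK : A.Obj} {ψ : (A.hom E F).X 0}
    (hψ : (A.hom E F).d 0 1 rfl ψ = 0) {θ : (A.hom (R.T 1 ![E, W]) (R.T 1 ![F, W])).X 0}
    (hθ : (A.hom _ _).d 0 1 rfl θ = 0)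
    (h : Ho.ofClosed θ hθ = R.tensorHom (Ho.ofClosed ψ hψ) (𝟙 (⟨W⟩ : Ho A)))
    (e : A.Ext F (t.fn.obj E) K) (he : e.x = A.comp (zero_add 1) ψ (t.data E).v)
    (s : A.Ext (R.T 1 ![F, W]) (t.fn.obj (R.T 1 ![E, W])) TK)
    (hs : s.x = A.comp (zero_add 1) θ (t.data (R.T 1 ![E, W])).v) :
    ∃ c : R.tensor ⟨K⟩ ⟨W⟩ ≅ (⟨TK⟩ : Ho A),
      R.tensorHom (Ho.ofClosed e.i e.d_i) (𝟙 (⟨W⟩ : Ho A)) ≫ c.hom = Ho.ofClosed s.i s.d_i ∧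
      R.tensorHom (Ho.ofClosed e.p e.d_p) (𝟙 (⟨W⟩ : Ho A)) ≫ (R.shiftLeft t ⟨E⟩ ⟨W⟩).hom =
        c.hom ≫ Ho.ofClosed s.p s.d_p := by
  let u := (D.cx 1 ![E, W] _).rep (R.univ 1 ![E, W])
  let u' := (D.cx 1 ![F, W] _).rep (R.univ 1 ![F, W])
  have hu : D.IsUniv u := R.isUniv_rep_univ 1 ![E, W]
  have hu' : D.IsUniv u' := R.isUniv_rep_univ 1 ![F, W]
  have h₁ : R.univ 1 ![E, W] = (D.cx 1 ![E, W] _).cls u hu.1 := (Cx.cls_rep _ _).symm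
  have h₂ : R.univ 1 ![F, W] = (D.cx 1 ![F, W] _).cls u' hu'.1 := (Cx.cls_rep _ _).symm
  obtain ⟨z, hz⟩ := Cx.exists_of_cls_eq _ (neg_add_cancel 1)
    (R.cls_act_univ hψ (A.d_id W) hθ h hu.1 h₁ hu'.1 h₂).symm
  have hK := isUniv_extElt e he s hs hu hu' hz
  obtain ⟨c, hc⟩ := R.exists_iso_of_isUniv hK
  refine ⟨c, ?_, ?_⟩
  · refine R.hom_ext ?_
    refine (R.smul_tensorHom e.d_i (A.d_id W) c.hom _ hK.1 hc).trans ?_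
    rw [h₂]
    refine Eq.trans ?_ (smul_cls s.i u' s.d_i hu'.1).symm
    congr 1
    exact (slotAct_slotPair e.i _).symm.trans ((D.slotBimod (slotPair W)).extElt_i e s u' _ _)
  · refine R.hom_ext ?_
    refine (R.smul_tensorHom e.d_p (A.d_id W) _ _ (d_sig_zero hu.1)
      (R.smul_shiftLeft hu.1 h₁)).trans ?_
    refine Eq.trans ?_ (comp_smul _ _ _).symm
    rw [hc]
    refine Eq.trans ?_ (smul_cls s.p _ s.d_p hK.1).symm
    congr 1
    exact (slotAct_slotPair e.p _).symm.trans ((D.slotBimod (slotPair W)).p_extElt e s u' _ _).symm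

end PT

namespace DGCat

variable {C : DGCat.{u, v}}

/-- The translation of `C^pretr`. -/
noncomputable def pretrTranslation (C : DGCat.{u, v}) : C.pretr.Translation where
  fn := C.pretrShift 1
  data := pretrShiftData 1
  natural {E F} f := by
    have h : ((C.pretrShift 1).map E F).f 0 f = FinFam.cmap 1 0 f := by
      change (1 * 0 : ℤ).negOnePow • FinFam.cmap 1 0 f = _
      rw [mul_zero, Int.negOnePow_zero, one_smul]
    refine (congrArg _ h).trans ?_
    refine (FinFam.rbar_comp_cmap (E := MC.obj E.1) (F := MC.obj F.1) (G := MC.obj F.1) 1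
      (zero_add 0) (zero_add 1) (zero_add 1) ((FinFam.cat C.toPreDG).id _) f).trans ?_
    refine Eq.trans ?_ (FinFam.comp_rbar (E := MC.obj E.1) (F := MC.obj E.1) (G := MC.obj F.1) 1
      (add_zero 0) (zero_add 1) (zero_add 1) f ((FinFam.cat C.toPreDG).id _)).symm
    exact congrArg (FinFam.rbar 1 0 1 (zero_add 1)) (((FinFam.cat C.toPreDG).id_comp _ _).trans
      ((FinFam.cat C.toPreDG).comp_id _ _).symm)

variable {D : PT C.pretr} {R : D.Rep}

lemma dist_tensorHom (R : D.Rep) {E F : C.pretr.Obj} (ψ : (C.pretr.hom E F).X 0)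
    (hψ : (C.pretr.hom E F).d 0 1 rfl ψ = 0) (W : C.Kb) :
    dist (R.tensorHom (Ho.ofClosed ψ hψ) (𝟙 W))
      (R.tensorHom (Ho.ofClosed (pretrConeExt ψ hψ).i (pretrConeExt ψ hψ).d_i) (𝟙 W))
      (R.tensorHom (Ho.ofClosed (pretrConeExt ψ hψ).p (pretrConeExt ψ hψ).d_p) (𝟙 W) ≫
        (R.shiftLeft C.pretrTranslation ⟨E⟩ W).hom) := by
  obtain ⟨θ, hθ, h⟩ := Ho.exists_ofClosed (R.tensorHom (Ho.ofClosed ψ hψ) (𝟙 W))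
  obtain ⟨k, hk₁, hk₂⟩ := R.exists_cone_iso (t := C.pretrTranslation) (W := W.as) hψ hθ h
    (pretrConeExt ψ hψ) (pretrConeExt_x ψ hψ) (pretrConeExt θ hθ) (pretrConeExt_x θ hθ)
  refine ⟨_, _, θ, hθ, Iso.refl _, Iso.refl _, k, ?_, ?_, ?_⟩
  · exact (Category.comp_id _).trans (h.symm.trans (Category.id_comp _).symm)
  · exact hk₁.trans (Category.id_comp _).symm
  · exact ((congrArg _ (C.translation.map_id _)).trans (Category.comp_id _)).trans hk₂

lemma isTriangulated_tensorStr (hR : R.IsTensor) :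
    (PT.Rep.tensorStr hR).IsTriangulated C.translation dist := by
  refine TensorStr.isTriangulated_of_left (PT.Rep.tensorStr hR) C.translation
    (fun f g h => dist f g h) ?_ (R.shiftLeft C.pretrTranslation) ?_ ?_
  · intro X Y Z X' Y' Z' f g h f' g' h' a b c hf hg hh H
    exact dist_of_iso a b c hf hg hh H
  · intro X Y X' Y' f g
    exact PT.Rep.shiftLeft_natural (t := C.pretrTranslation) R f g
  · rintro X Y Z f g h ⟨E, F, ψ, hψ, a, b, c, h₁, h₂, h₃⟩
    refine ⟨⟨E⟩, ⟨F⟩, ⟨pretrCone ψ hψ⟩, Ho.ofClosed ψ hψ,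
      Ho.ofClosed (pretrConeExt ψ hψ).i (pretrConeExt ψ hψ).d_i,
      Ho.ofClosed (pretrConeExt ψ hψ).p (pretrConeExt ψ hψ).d_p, a, b, c, h₁, ?_, ?_, ?_⟩
    · exact h₂
    · exact h₃
    · exact fun W => dist_tensorHom R ψ hψ W

end DGCat

end DGTensor

theorem mainTheorem3 (C : DGTensor.DGCat.{u, v}) (P : DGTensor.PT C.toPreDG) (R : P.Rep)
    (hR : R.IsTensor) :
    ∃ hQ : (C.pretrData P).Lawful,
      Nonempty (DGTensor.PT.Rep ⟨C.pretrData P, hQ⟩) ∧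
      ∀ R' : DGTensor.PT.Rep ⟨C.pretrData P, hQ⟩,
        R'.IsTensor ∧
        ∃ S : DGTensor.TensorStr C.Kb R'.tensor,
          R'.Gives S ∧ S.IsTriangulated C.translation DGTensor.DGCat.dist :=
  ⟨C.pretrData_lawful P, DGTensor.DGCat.exists_rep_pretr R, fun R' =>
    have h : R'.IsTensor := DGTensor.DGCat.isTensor_pretr R hR R'
    ⟨h, DGTensor.PT.Rep.tensorStr h, DGTensor.PT.Rep.gives_tensorStr h,
      DGTensor.DGCat.isTriangulated_tensorStr h⟩⟩
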